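/- **Setting.** Let $O=(W,A,Y)$ with covariates $W$, dose $A\in[0,1]$ and outcome $Y\in\{0,1\}$. The law $P_0$ of $O$ is given by a law $Q_{W,0}$ of $W$, a known conditional density $g_0(a|w)$ of $A$ given $W$ (positive a.e.), and $\bar Q_0(a,w)=E[Y|A=a,W=w]$. Fix $a_0\in[0,1]$ and a $C^2$ kernel $K$ with $\int K=1$, such that $u^jK^{(j)}(u)$ is bounded and integrable for $j=0,1,2$ and $\int_0^1K_\delta(a)\,da\to1$ as $\delta\downarrow0$, where $K_\delta(a)=\delta^{-1}K((a-a_0)/\delta)$ (the last condition is automatic if $0<a_0<1$). For $P$ with covariate law $Q_W$, regression function $\bar Q$ and the treatment mechanism $g_0$ let $\Psi_\delta(P)=E_{Q_W}\int_0^1K_\delta(a)\bar Q(a,W)\,da$, $$D^*_\delta(P)=\frac{K_\delta(A)}{g_0(A|W)}(Y-\bar Q(A,W))+\int_0^1K_\delta(a)\bar Q(a,W)\,da-\Psi_\delta(P),$$ $R_\delta(P,P_0)=\Psi_\delta(P)-\Psi_\delta(P_0)+P_0D^*_\delta(P)$, $H_\delta(P)=(D^*_\delta(P)-P_0D^*_\delta(P))^2$.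 The target is $\Psi(P_0)=E\,\bar Q_0(a_0,W)$, and $b_0(\delta)=\Psi_\delta(P_0)-\Psi(P_0)$. Let $O_1,O_2,\dots$ be i.i.d. from $P_0$, $0<p_1<p_2<1$, $l_{i,n}=\lfloor p_in\rfloor$ ($i=1,2$), $l_{3,n}=n$, $m_{2}=l_{2,n}-l_{1,n}$, $m_{3}=l_{3,n}-l_{2,n}$. A measurable algorithm maps a sample of size $n$ to an estimate $\hat{\bar Q}_n$ with values in $[0,1]$; $\bar Q_\infty$ is a measurable function with values in $[0,1]$ (its limit, possibly different from $\bar Q_0$). $\hat P_{i,n}$ is given by the empirical law of $W$ and by $\hat{\bar Q}$, both computed from the first $l_{i,n}$ observations; $P_\infty$ is given by $(Q_{W,0},\bar Q_\infty)$; $P_{2,n}$ and $P_{3,n}$ are the empirical laws of the observations $l_{1,n}<i\le l_{2,n}$ and $l_{2,n}<i\le n$. Put $\sigma_{i,n}^2(\delta)=\mathrm{Var}_{P_0}D^*_\delta(\hat P_{i,n})$ (with $\hat P_{i,n}$ held fixed) and $\sigma_\infty^2(\delta)=\mathrm{Var}_{P_0}D^*_\delta(P_\infty)$. **Assumptions.**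 "$\tilde\delta_n$ slower than $n^{-r}$" means: $\tilde\delta_n>0$, $\tilde\delta_n\to0$, $n^{-r}=o(\tilde\delta_n)$; $X_n\sim_P a_n$ means $X_n/a_n\to1$ in probability. * A1: as $\delta\downarrow0$, $\sigma_\infty(\delta)\sim C_\sigma\delta^{-\gamma}$, $\sigma_\infty'(\delta)\sim C_{\sigma'}\delta^{\nu}$, $b_0'(\delta)\sim C_{b'}\delta^{\beta-1}$, $\mathrm{Var}_{P_0}H_\delta(P_\infty)\sim C_H\delta^{-\eta}$ with non-zero constants, $\beta,\gamma\ge0$, $\eta>0$, $\nu\in\mathbb R$; and $b_0''(\delta)=O(\delta^{-k_0})$, $\sigma_\infty''(\delta)=O(\delta^{-k_1})$ for some $k_0,k_1>0$. * A2: there are positive $r,k,k',\kappa,\kappa'$ such that for every $\tilde\delta_n$ slower than $n^{-r}$, $\sigma_{1,n}(\tilde\delta_n)-\sigma_\infty(\tilde\delta_n)=O_P(\tilde\delta_n^{-k}m_2^{-\kappa})$, $\sigma_{1,n}'(\tilde\delta_n)-\sigma_\infty'(\tilde\delta_n)=O_P(\tilde\delta_n^{-k'}m_2^{-\kappa'})$,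 $\sigma_{1,n}''(\tilde\delta_n)\sim_P\sigma_\infty''(\tilde\delta_n)$. * A3: for some $r>0$ and all $\tilde\delta_n$ slower than $n^{-r}$, $R_{\tilde\delta_n}(\hat P_{1,n},P_0)=o_P(\sigma_\infty(\tilde\delta_n))$. * A4: for some $r>0$ and all $\tilde\delta_n$ slower than $n^{-r}$, $\mathrm{Var}_{P_0}H_{\tilde\delta_n}(\hat P_{1,n})\sim_P\mathrm{Var}_{P_0}H_{\tilde\delta_n}(P_\infty)$. * A5: for some $k,\kappa,r>0$ and all $\tilde\delta_n$ slower than $n^{-r}$, $\partial_\delta R_\delta(\hat P_{1,n},P_0)|_{\delta=\tilde\delta_n}=O_P(\tilde\delta_n^{-k}m_2^{-\kappa})$. * A6, A7, A8 (at a rate $r_0$): for all $r$ in a neighbourhood of $r_0$, with $\delta_n=m_3^{-r}$: $\sigma_{2,n}(\delta_n)\sim_P\sigma_\infty(\delta_n)$; $R_{\delta_n}(\hat P_{2,n},P_0)=o_P(m_3^{-1/2}\sigma_\infty(\delta_n)+b_0(\delta_n))$; $\partial_\delta R_\delta(\hat P_{2,n},P_0)|_{\delta=\delta_n}=o_P(m_3^{-1/2}\sigma_\infty'(\delta_n)+b_0'(\delta_n))$.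 **Estimators.** $\hat\Psi_{2,n}(\delta)=\Psi_\delta(\hat P_{1,n})+P_{2,n}D^*_\delta(\hat P_{1,n})$, $\hat\sigma_{2,n}^2(\delta)=P_{2,n}(D^*_\delta(\hat P_{1,n})-P_{2,n}D^*_\delta(\hat P_{1,n}))^2$, $\Delta_n=m_2^{-1/4}$, $\hat b'_n(\delta)=\{\hat\Psi_{2,n}(\delta+\Delta_n)-\hat\Psi_{2,n}(\delta)\}/\Delta_n$, $\hat\sigma'_n(\delta)=\{\hat\sigma_{2,n}(\delta+\Delta_n)-\hat\sigma_{2,n}(\delta)\}/\Delta_n$. For preliminary levels $\tilde\delta_{1,n},\tilde\delta_{2,n},\tilde\delta_{3,n}$ and $L_n[f]=\{\log|f(\tilde\delta_{2,n})|-\log|f(\tilde\delta_{1,n})|\}/\{\log\tilde\delta_{2,n}-\log\tilde\delta_{1,n}\}$, put $\hat\beta_n=1+L_n[\hat b'_n]$, $\hat\gamma_n=-L_n[\hat\sigma_{2,n}]$, $\hat\nu_n=L_n[\hat\sigma'_n]$, $\hat C_{b',n}=\hat b_n'(\tilde\delta_{3,n})\tilde\delta_{3,n}^{-(\hat\beta_n-1)}$,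 $\hat C_{\sigma,n}=\hat\sigma_{2,n}(\tilde\delta_{3,n})\tilde\delta_{3,n}^{\hat\gamma_n}$, $\hat C_{\sigma',n}=\hat\sigma_n'(\tilde\delta_{3,n})\tilde\delta_{3,n}^{-\hat\nu_n}$, $\hat r_n=(2\hat\beta_n-1+\hat\gamma_n-\hat\nu_n)^{-1}$, $\hat C_n=(|\hat C_{\sigma,n}\hat C_{\sigma',n}|\hat\beta_n/\hat C_{b',n}^2)^{\hat r_n}$, $\hat\delta_{\epsilon,n}=\hat C_nm_3^{-\hat r_n-\epsilon}$. Let $\hat\Psi_n(\delta)=\Psi_\delta(\hat P_{2,n})+P_{3,n}D^*_\delta(\hat P_{2,n})$ and $MSE_n(\delta)=E(\hat\Psi_n(\delta)-\Psi(P_0))^2$. **Statement.** (i) A3 and A5 hold, and A7, A8 hold at every $r_0>0$. (ii) Assume positivity $\|g_0^{-1}\|_{\infty}<\infty$; that for almost every $w$ the functions $g_0(\cdot|w)$, $\bar Q_0(\cdot,w)$, $\bar Q_\infty(\cdot,w)$ on $[0,1]$ are continuous at $a_0$; that $\bar Q_0(1-\bar Q_0)+(\bar Q_\infty-\bar Q_0)^2$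 at $(a_0,W)$ is not almost surely zero; that $\|\hat{\bar Q}_n-\bar Q_\infty\|_{L_\infty(P_0)}=O_P(n^{-r_Q})$ for some $r_Q>0$; and that $$\left\|\frac{(\hat{\bar Q}_n-\bar Q_\infty)^2}{\bar Q_0(1-\bar Q_0)+(\bar Q_\infty-\bar Q_0)^2}\right\|_{L_\infty(P_0)}=o_P(1).$$ Then A2 and A4 hold, and A6 holds at every $r_0>0$. (iii) If moreover A1 holds, there are $r>0$, $\epsilon_0>0$, $\delta_0>0$ such that for all $\tilde\delta_{1,n},\tilde\delta_{2,n},\tilde\delta_{3,n}$ slower than $n^{-r}$ with $|\log\tilde\delta_{2,n}-\log\tilde\delta_{1,n}|\ge c\log n$ for some $c>0$ and all large $n$: * for $0<\epsilon\le\epsilon_0$, $\ \hat C_{\sigma,n}^{-1}\hat\delta_{\epsilon,n}^{\hat\gamma_n}m_3^{1/2}(\hat\Psi_n(\hat\delta_{\epsilon,n})-\Psi(P_0))\to N(0,1)$ in distribution; * for $0<\delta_1\le\delta_0$ and all large $n$, $MSE_n$ has a minimizer over $(0,\delta_1]$, and for any sequence $\delta^*_{0,n}$ of such minimizers the (random)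 ratio $MSE_n(\hat\delta_{0,n})/MSE_n(\delta^*_{0,n})$ of values of the function $MSE_n$ converges in probability to $K(p_2)$, where $K(p_2)>0$ is a constant that depends on the sample split only through $p_2$ and is a non-increasing function of $p_2\in(0,1)$; * for all $\alpha\in(0,1)$ and $\epsilon>0$, with $q_{1-\alpha/2}$ the standard normal quantile, the probability that $\Psi(P_0)$ belongs to $$CI'_{\alpha,\epsilon,n}=\left[\hat\Psi_n(\hat\delta_{0,n})\mp q_{1-\alpha/2}\,\hat C_{\sigma,n}\,m_3^{-1/2+(\hat r_n+\epsilon)\hat\gamma_n}\right]$$ converges to one. -/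

import Mathlib

open MeasureTheory ProbabilityTheory Filter Topology Asymptotics
open scoped ENNReal

noncomputable section

namespace DoseResponse

/-! ### Stochastic order symbols -/

section Orders

variable {Ω : Type*} [MeasurableSpace Ω]

/-- `X n = O_P (a n)` for `[0, ∞]`-valued `X`. -/
def BigOPE (Pr : Measure Ω) (X : ℕ → Ω → ℝ≥0∞) (a : ℕ → ℝ) : Prop :=
  ∀ ε : ℝ, 0 < ε → ∃ M : ℝ, ∀ᶠ n in atTop,
    Pr {ω | ENNReal.ofReal (M * |a n|) < X n ω} ≤ ENNReal.ofReal ε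

/-- `X n = o_P (a n)` for `[0, ∞]`-valued `X`. -/
def LittleOPE (Pr : Measure Ω) (X : ℕ → Ω → ℝ≥0∞) (a : ℕ → ℝ) : Prop :=
  ∀ c : ℝ, 0 < c → Tendsto (fun n => Pr {ω | ENNReal.ofReal (c * |a n|) < X n ω}) atTop (𝓝 0)

/-- `X n = O_P (a n)` for real `X`. -/
def BigOP (Pr : Measure Ω) (X : ℕ → Ω → ℝ) (a : ℕ → ℝ) : Prop :=
  BigOPE Pr (fun n ω => ‖X n ω‖ₑ) a

/-- `X n = o_P (a n)` for real `X`. -/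
def LittleOP (Pr : Measure Ω) (X : ℕ → Ω → ℝ) (a : ℕ → ℝ) : Prop :=
  LittleOPE Pr (fun n ω => ‖X n ω‖ₑ) a

/-- `X n ∼_P a n`: the ratio tends to one in probability. -/
def EquivP (Pr : Measure Ω) (X : ℕ → Ω → ℝ) (a : ℕ → ℝ) : Prop :=
  TendstoInMeasure Pr (fun n ω => X n ω / a n) atTop (fun _ => (1 : ℝ))

end Orders

/-- A positive sequence that converges to zero slower than `n ^ (-r)`. -/
def SlowerThan (r : ℝ) (d : ℕ → ℝ) : Prop :=
  (∀ n, 0 < d n) ∧ Tendsto d atTop (𝓝 0) ∧ (fun n : ℕ => (n : ℝ) ^ (-r)) =o[atTop] d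

/-- The preliminary smoothing levels `δ̃_{1, n}, δ̃_{2, n}, δ̃_{3, n}`: each is positive and vanishes
slower than `n ^ (-r)`, and the first two are separated by a power of `n`. -/
def Admissible (r : ℝ) (d₁ d₂ d₃ : ℕ → ℝ) : Prop :=
  SlowerThan r d₁ ∧ SlowerThan r d₂ ∧ SlowerThan r d₃ ∧
    ∃ c : ℝ, 0 < c ∧ ∀ᶠ n : ℕ in atTop,
      c * Real.log n ≤ |Real.log (d₂ n) - Real.log (d₁ n)|

/-- The `p`-quantile of the standard normal distribution. -/
def normalQuantile (p : ℝ) : ℝ := sInf {x : ℝ | p ≤ cdf (gaussianReal 0 1) x}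

/-! ### The setting -/

/-- An observation `(W, A, Y)`: covariates, dose, binary outcome. -/
abbrev Obs (𝒲 : Type*) := 𝒲 × ℝ × Bool

/-- The numerical value of the binary outcome. -/
def yval (y : Bool) : ℝ := if y then 1 else 0

/-- `K` is a smoothing kernel, usable at the dose `a₀ ∈ [0, 1]`: it is `C²`, the functions
`u ^ j * K⁽ʲ⁾ u` (`j ≤ 2`) are bounded and integrable, `∫ K = 1`, and the mass of
`K_{δ, a₀}` concentrates in `[0, 1]` (which is automatic when `0 < a₀ < 1`). -/
structure IsKernel (K : ℝ → ℝ) (a₀ : ℝ) : Prop where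
  contDiff : ContDiff ℝ 2 K
  bounded : ∀ j ≤ 2, ∃ C : ℝ, ∀ u : ℝ, |u ^ j * iteratedDeriv j K u| ≤ C
  integrable : ∀ j ≤ 2, Integrable (fun u : ℝ => u ^ j * iteratedDeriv j K u)
  integral_eq_one : ∫ u, K u = 1
  mass : Tendsto (fun δ : ℝ => ∫ a in (0 : ℝ)..1, δ⁻¹ * K ((a - a₀) / δ)) (𝓝[>] 0) (𝓝 1)

/-- The dose-response problem with known treatment mechanism: the data-generating law
(law of `W`, conditional density `g₀(a | w)` of the dose, regression function `Q̄₀(a, w)`),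
the target dose, the kernel, the regression algorithm and its limit `Q̄_∞`.
Functions of `(a, w)` take the arguments in the order `w a`. -/
structure Setting (𝒲 : Type*) [MeasurableSpace 𝒲] where
  /-- the law of the covariates `W` -/
  covLaw : Measure 𝒲
  covLaw_prob : IsProbabilityMeasure covLaw
  /-- the known treatment mechanism -/
  g : 𝒲 → ℝ → ℝ
  g_meas : Measurable (Function.uncurry g)
  g_pos : ∀ᵐ p ∂(covLaw.prod (volume.restrict (Set.Icc (0 : ℝ) 1))), 0 < g p.1 p.2
  g_int : ∀ᵐ w ∂covLaw, ∫ a in (0 : ℝ)..1, g w a = 1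
  /-- the true regression function `E[Y | A = a, W = w]` -/
  Q₀ : 𝒲 → ℝ → ℝ
  Q₀_meas : Measurable (Function.uncurry Q₀)
  Q₀_mem : ∀ w a, Q₀ w a ∈ Set.Icc (0 : ℝ) 1
  /-- the dose of interest -/
  a₀ : ℝ
  a₀_mem : a₀ ∈ Set.Icc (0 : ℝ) 1
  /-- the kernel -/
  K : ℝ → ℝ
  K_kernel : IsKernel K a₀
  /-- the regression algorithm: a sample of size `m` is mapped to an estimate of `Q̄₀` -/
  Qhat : (m : ℕ) → (Fin m → Obs 𝒲) → 𝒲 → ℝ → ℝ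
  Qhat_meas : ∀ m, Measurable (fun p : (Fin m → Obs 𝒲) × 𝒲 × ℝ => Qhat m p.1 p.2.1 p.2.2)
  Qhat_mem : ∀ m s w a, Qhat m s w a ∈ Set.Icc (0 : ℝ) 1
  /-- the limit `Q̄_∞` of the regression estimates (it may differ from `Q̄₀`) -/
  Qinf : 𝒲 → ℝ → ℝ
  Qinf_meas : Measurable (Function.uncurry Qinf)
  Qinf_mem : ∀ w a, Qinf w a ∈ Set.Icc (0 : ℝ) 1

attribute [instance] Setting.covLaw_prob

namespace Setting

variable {𝒲 : Type*} [MeasurableSpace 𝒲] (S : Setting 𝒲)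

/-- The data-generating law, with density `q_Y g₀` with respect to
`(law of W) ⊗ (Lebesgue measure on [0, 1]) ⊗ (counting measure on {0, 1})`. -/
def P₀ : Measure (Obs 𝒲) :=
  (S.covLaw.prod ((volume.restrict (Set.Icc (0 : ℝ) 1)).prod Measure.count)).withDensity
    fun o => ENNReal.ofReal (S.g o.1 o.2.1) *
      ENNReal.ofReal (if o.2.2 then S.Q₀ o.1 o.2.1 else 1 - S.Q₀ o.1 o.2.1)

/-- `K_{δ, a₀}(a) = δ⁻¹ K((a - a₀) / δ)`. -/
def kern (δ a : ℝ) : ℝ := δ⁻¹ * S.K ((a - S.a₀) / δ)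

/-- `∫ K_{δ, a₀}(a) Q̄(a, w) da`. -/
def smooth (Q : 𝒲 → ℝ → ℝ) (δ : ℝ) (w : 𝒲) : ℝ := ∫ a in (0 : ℝ)..1, S.kern δ a * Q w a

/-- The smoothed parameter `Ψ_δ(P)` of a law `P` with covariate law `ν` and regression
function `Q`. -/
def Psi (ν : Measure 𝒲) (Q : 𝒲 → ℝ → ℝ) (δ : ℝ) : ℝ := ∫ w, S.smooth Q δ w ∂ν

/-- The canonical gradient `D*_δ(P)`, for `P` with covariate law `ν`, regression function `Q`
and the known treatment mechanism. -/
def grad (ν : Measure 𝒲) (Q : 𝒲 → ℝ → ℝ) (δ : ℝ) (o : Obs 𝒲) : ℝ :=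
  S.kern δ o.2.1 / S.g o.1 o.2.1 * (yval o.2.2 - Q o.1 o.2.1) + S.smooth Q δ o.1 - S.Psi ν Q δ

/-- The remainder `R_δ(P, P₀)` in `Ψ_δ(P) - Ψ_δ(P₀) = - P₀ D*_δ(P) + R_δ(P, P₀)`. -/
def rem (ν : Measure 𝒲) (Q : 𝒲 → ℝ → ℝ) (δ : ℝ) : ℝ :=
  S.Psi ν Q δ - S.Psi S.covLaw S.Q₀ δ + ∫ o, S.grad ν Q δ o ∂S.P₀

/-- The target `Ψ(P₀) = E E[Y | A = a₀, W]`. -/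
def target : ℝ := ∫ w, S.Q₀ w S.a₀ ∂S.covLaw

/-- `b₀(δ) = Ψ_δ(P₀) - Ψ(P₀)`. -/
def bias (δ : ℝ) : ℝ := S.Psi S.covLaw S.Q₀ δ - S.target

/-- `P₀ (f - P₀ f)²`. -/
def var (f : Obs 𝒲 → ℝ) : ℝ := ∫ o, (f o - ∫ o', f o' ∂S.P₀) ^ 2 ∂S.P₀

/-- The standard deviation under `P₀` of the canonical gradient at `P = (ν, Q)`. -/
def sd (ν : Measure 𝒲) (Q : 𝒲 → ℝ → ℝ) (δ : ℝ) : ℝ := √(S.var (S.grad ν Q δ))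

/-- `H_{0, δ}(P) = (D*_δ(P) - P₀ D*_δ(P))²`. -/
def H (ν : Measure 𝒲) (Q : 𝒲 → ℝ → ℝ) (δ : ℝ) (o : Obs 𝒲) : ℝ :=
  (S.grad ν Q δ o - ∫ o', S.grad ν Q δ o' ∂S.P₀) ^ 2

/-- `σ_∞(δ)`, the standard deviation of `D*_{δ, ∞} = D*_δ(P_∞)`. -/
def sdInf (δ : ℝ) : ℝ := S.sd S.covLaw S.Qinf δ

/-- `P₀ (H_{0, δ, ∞} - P₀ H_{0, δ, ∞})²`. -/
def varHInf (δ : ℝ) : ℝ := S.var (S.H S.covLaw S.Qinf δ)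

/-- Assumption **A1**, polynomial behaviour as `δ ↓ 0` of `σ_∞`, `σ_∞'`, `b₀'` and of the variance
of `H_{0, δ, ∞}`. -/
def A1 : Prop :=
  ∃ Cb Cσ Cσ' CH β γ ν η k₀ k₁ : ℝ,
    Cb ≠ 0 ∧ Cσ ≠ 0 ∧ Cσ' ≠ 0 ∧ CH ≠ 0 ∧ 0 ≤ β ∧ 0 ≤ γ ∧ 0 < η ∧ 0 < k₀ ∧ 0 < k₁ ∧
    S.sdInf ~[𝓝[>] 0] (fun δ => Cσ * δ ^ (-γ)) ∧
    deriv S.sdInf ~[𝓝[>] 0] (fun δ => Cσ' * δ ^ ν) ∧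
    deriv S.bias ~[𝓝[>] 0] (fun δ => Cb * δ ^ (β - 1)) ∧
    S.varHInf ~[𝓝[>] 0] (fun δ => CH * δ ^ (-η)) ∧
    iteratedDeriv 2 S.bias =O[𝓝[>] 0] (fun δ : ℝ => δ ^ (-k₀)) ∧
    iteratedDeriv 2 S.sdInf =O[𝓝[>] 0] (fun δ : ℝ => δ ^ (-k₁))

/-! ### Initial estimators and the first-order quantities built from them

A data sequence is `o : ℕ → Obs 𝒲`; the sample of size `n` is `o 0, …, o (n - 1)`. -/

/-- The regression estimate computed from the first `m` observations. -/
def fitQ (m : ℕ) (o : ℕ → Obs 𝒲) : 𝒲 → ℝ → ℝ := S.Qhat m (fun i => o i)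

/-- The empirical law of the covariates in the first `m` observations. -/
def empW (m : ℕ) (o : ℕ → Obs 𝒲) : Measure 𝒲 :=
  (m : ℝ≥0∞)⁻¹ • ∑ i ∈ Finset.range m, Measure.dirac (o i).1

/-- The empirical mean of `f` over the observations with index in `[k, l)`. -/
def empMean (k l : ℕ) (o : ℕ → Obs 𝒲) (f : Obs 𝒲 → ℝ) : ℝ :=
  (∑ i ∈ Finset.Ico k l, f (o i)) / ((l : ℝ) - k)

/-- `Ψ_δ(P̂)`, `P̂` fitted on the first `m` observations. -/
def fitPsi (m : ℕ) (o : ℕ → Obs 𝒲) (δ : ℝ) : ℝ := S.Psi (empW m o) (S.fitQ m o) δ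

/-- `D*_δ(P̂)`, `P̂` fitted on the first `m` observations. -/
def fitGrad (m : ℕ) (o : ℕ → Obs 𝒲) (δ : ℝ) : Obs 𝒲 → ℝ := S.grad (empW m o) (S.fitQ m o) δ

/-- `R_δ(P̂, P₀)`, `P̂` fitted on the first `m` observations. -/
def fitRem (m : ℕ) (o : ℕ → Obs 𝒲) (δ : ℝ) : ℝ := S.rem (empW m o) (S.fitQ m o) δ

/-- `{P₀ (D*_δ(P̂) - P₀ D*_δ(P̂))²}^{1/2}`, `P̂` fitted on the first `m` observations. -/
def fitSd (m : ℕ) (o : ℕ → Obs 𝒲) (δ : ℝ) : ℝ := S.sd (empW m o) (S.fitQ m o) δ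

/-- `P₀ (H_{0, δ}(P̂) - P₀ H_{0, δ}(P̂))²`, `P̂` fitted on the first `m` observations. -/
def fitVarH (m : ℕ) (o : ℕ → Obs 𝒲) (δ : ℝ) : ℝ := S.var (S.H (empW m o) (S.fitQ m o) δ)

end Setting

/-! ### Sample splitting: sizes `l_{i, n} = ⌊p_i n⌋` -/

/-- `l_{i, n}`. -/
def cut (p : ℝ) (n : ℕ) : ℕ := ⌊p * n⌋₊

/-- `l_{2, n} - l_{1, n}`. -/
def midSize (p₁ p₂ : ℝ) (n : ℕ) : ℝ := (cut p₂ n : ℝ) - cut p₁ n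

/-- `l_{3, n} - l_{2, n} = n - l_{2, n}`. -/
def lastSize (p₂ : ℝ) (n : ℕ) : ℝ := (n : ℝ) - cut p₂ n

/-! ### The assumptions A2 -- A8 -/

namespace Setting

section Assumptions

variable {𝒲 : Type*} [MeasurableSpace 𝒲] (S : Setting 𝒲)
  {Ω : Type*} [MeasurableSpace Ω] (Pr : Measure Ω) (O : ℕ → Ω → Obs 𝒲) (p₁ p₂ : ℝ)

/-- Assumption **A2**. -/
def A2 : Prop :=
  ∃ r k k' κ κ' : ℝ, 0 < r ∧ 0 < k ∧ 0 < k' ∧ 0 < κ ∧ 0 < κ' ∧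
    ∀ d : ℕ → ℝ, SlowerThan r d →
      BigOP Pr (fun n ω => S.fitSd (cut p₁ n) (O · ω) (d n) - S.sdInf (d n))
        (fun n => d n ^ (-k) * midSize p₁ p₂ n ^ (-κ)) ∧
      BigOP Pr (fun n ω => deriv (S.fitSd (cut p₁ n) (O · ω)) (d n) - deriv S.sdInf (d n))
        (fun n => d n ^ (-k') * midSize p₁ p₂ n ^ (-κ')) ∧
      EquivP Pr (fun n ω => iteratedDeriv 2 (S.fitSd (cut p₁ n) (O · ω)) (d n))
        (fun n => iteratedDeriv 2 S.sdInf (d n))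

/-- Assumption **A3**. -/
def A3 : Prop :=
  ∃ r : ℝ, 0 < r ∧ ∀ d : ℕ → ℝ, SlowerThan r d →
    LittleOP Pr (fun n ω => S.fitRem (cut p₁ n) (O · ω) (d n)) (fun n => S.sdInf (d n))

/-- Assumption **A4**. -/
def A4 : Prop :=
  ∃ r : ℝ, 0 < r ∧ ∀ d : ℕ → ℝ, SlowerThan r d →
    EquivP Pr (fun n ω => S.fitVarH (cut p₁ n) (O · ω) (d n)) (fun n => S.varHInf (d n))

/-- Assumption **A5**. -/
def A5 : Prop :=
  ∃ k κ r : ℝ, 0 < k ∧ 0 < κ ∧ 0 < r ∧ ∀ d : ℕ → ℝ, SlowerThan r d →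
    BigOP Pr (fun n ω => deriv (S.fitRem (cut p₁ n) (O · ω)) (d n))
      (fun n => d n ^ (-k) * midSize p₁ p₂ n ^ (-κ))

/-- Assumption **A6**, for the rate `r₀`. -/
def A6 (r₀ : ℝ) : Prop :=
  ∀ᶠ r in 𝓝 r₀,
    EquivP Pr (fun n ω => S.fitSd (cut p₂ n) (O · ω) (lastSize p₂ n ^ (-r)))
      (fun n => S.sdInf (lastSize p₂ n ^ (-r)))

/-- Assumption **A7**, for the rate `r₀`. -/
def A7 (r₀ : ℝ) : Prop :=
  ∀ᶠ r in 𝓝 r₀,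
    LittleOP Pr (fun n ω => S.fitRem (cut p₂ n) (O · ω) (lastSize p₂ n ^ (-r)))
      (fun n => lastSize p₂ n ^ (-(1 / 2 : ℝ)) * S.sdInf (lastSize p₂ n ^ (-r)) +
        S.bias (lastSize p₂ n ^ (-r)))

/-- Assumption **A8**, for the rate `r₀`. -/
def A8 (r₀ : ℝ) : Prop :=
  ∀ᶠ r in 𝓝 r₀,
    LittleOP Pr (fun n ω => deriv (S.fitRem (cut p₂ n) (O · ω)) (lastSize p₂ n ^ (-r)))
      (fun n => lastSize p₂ n ^ (-(1 / 2 : ℝ)) * deriv S.sdInf (lastSize p₂ n ^ (-r)) +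
        deriv S.bias (lastSize p₂ n ^ (-r)))

/-! ### Hypotheses on the law and on the regression estimator -/

/-- Positivity: `‖g₀⁻¹‖_∞ < ∞`. -/
def Positivity : Prop :=
  ∃ c : ℝ, 0 < c ∧
    ∀ᵐ p ∂(S.covLaw.prod (volume.restrict (Set.Icc (0 : ℝ) 1))), c ≤ S.g p.1 p.2

/-- Regularity at the dose `a₀`: `g₀`, `Q̄₀` and `Q̄_∞` are continuous in the dose at `a₀`
(within `[0, 1]`), for almost every value of the covariates. -/
def ContinuousAtDose : Prop :=
  ∀ᵐ w ∂S.covLaw,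
    ContinuousWithinAt (S.g w) (Set.Icc 0 1) S.a₀ ∧
    ContinuousWithinAt (S.Q₀ w) (Set.Icc 0 1) S.a₀ ∧
    ContinuousWithinAt (S.Qinf w) (Set.Icc 0 1) S.a₀

/-- `Q̄₀ (1 - Q̄₀) + (Q̄_∞ - Q̄₀)²`, the conditional second moment of `Y - Q̄_∞(A, W)`. -/
def residVar (w : 𝒲) (a : ℝ) : ℝ :=
  S.Q₀ w a * (1 - S.Q₀ w a) + (S.Qinf w a - S.Q₀ w a) ^ 2

/-- Non-degeneracy at the dose `a₀`. -/
def NonDegenerate : Prop := 0 < ∫ w, S.residVar w S.a₀ ∂S.covLaw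

/-- `‖Q̄̂_n - Q̄_∞‖_{L_∞(P₀)} = O_P (n ^ (-r))` for some `r > 0`. -/
def UniformRate : Prop :=
  ∃ r : ℝ, 0 < r ∧
    BigOPE Pr
      (fun n ω => essSup
        (fun x : Obs 𝒲 => ‖S.fitQ n (O · ω) x.1 x.2.1 - S.Qinf x.1 x.2.1‖ₑ) S.P₀)
      (fun n => (n : ℝ) ^ (-r))

/-- The ratio condition
`‖(Q̄̂_n - Q̄_∞)² / {Q̄₀ (1 - Q̄₀) + (Q̄_∞ - Q̄₀)²}‖_{L_∞(P₀)} = o_P (1)`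
(quotients in `[0, ∞]`, so that `x / 0 = ∞` for `x > 0`). -/
def RatioCondition : Prop :=
  LittleOPE Pr
    (fun n ω => essSup
      (fun x : Obs 𝒲 =>
        ENNReal.ofReal ((S.fitQ n (O · ω) x.1 x.2.1 - S.Qinf x.1 x.2.1) ^ 2) /
          ENNReal.ofReal (S.residVar x.1 x.2.1)) S.P₀)
    (fun _ => 1)

end Assumptions

/-! ### The estimators -/

section Estimators

variable {𝒲 : Type*} [MeasurableSpace 𝒲] (S : Setting 𝒲) (p₁ p₂ : ℝ)

/-- The one-step estimator `Ψ̂_{2, n}(δ)`: fit on `S₁`, average over `S₂`. -/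
def oneStep₂ (n : ℕ) (o : ℕ → Obs 𝒲) (δ : ℝ) : ℝ :=
  S.fitPsi (cut p₁ n) o δ + empMean (cut p₁ n) (cut p₂ n) o (S.fitGrad (cut p₁ n) o δ)

/-- `b̂'_{2, n}(δ, Δ)`. -/
def biasSlope (n : ℕ) (o : ℕ → Obs 𝒲) (δ Δ : ℝ) : ℝ :=
  (S.oneStep₂ p₁ p₂ n o (δ + Δ) - S.oneStep₂ p₁ p₂ n o δ) / Δ

/-- `σ̂_{2, n}(δ)`. -/
def sdHat (n : ℕ) (o : ℕ → Obs 𝒲) (δ : ℝ) : ℝ :=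
  √(empMean (cut p₁ n) (cut p₂ n) o fun x =>
    (S.fitGrad (cut p₁ n) o δ x -
      empMean (cut p₁ n) (cut p₂ n) o (S.fitGrad (cut p₁ n) o δ)) ^ 2)

/-- `σ̂'_{2, n}(δ, Δ)`. -/
def sdSlope (n : ℕ) (o : ℕ → Obs 𝒲) (δ Δ : ℝ) : ℝ :=
  (S.sdHat p₁ p₂ n o (δ + Δ) - S.sdHat p₁ p₂ n o δ) / Δ

/-- `Δ_n = (l_{2, n} - l_{1, n}) ^ (-1/4)`. -/
def stepSize (n : ℕ) : ℝ := midSize p₁ p₂ n ^ (-(1 / 4 : ℝ))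

variable (d₁ d₂ d₃ : ℕ → ℝ)

/-- `β̂_n`: one plus the log-log slope of `|b̂'|` between `δ̃_{1, n}` and `δ̃_{2, n}`
(`b₀'(δ)` behaves as `δ ^ (β₀ - 1)`). -/
def betaHat (n : ℕ) (o : ℕ → Obs 𝒲) : ℝ :=
  1 + (Real.log |S.biasSlope p₁ p₂ n o (d₂ n) (stepSize p₁ p₂ n)| -
    Real.log |S.biasSlope p₁ p₂ n o (d₁ n) (stepSize p₁ p₂ n)|) /
      (Real.log (d₂ n) - Real.log (d₁ n))

/-- `γ̂_n`: minus the log-log slope of `σ̂` (`σ_∞(δ)` behaves as `δ ^ (-γ)`). -/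
def gammaHat (n : ℕ) (o : ℕ → Obs 𝒲) : ℝ :=
  -((Real.log (S.sdHat p₁ p₂ n o (d₂ n)) - Real.log (S.sdHat p₁ p₂ n o (d₁ n))) /
      (Real.log (d₂ n) - Real.log (d₁ n)))

/-- `ν̂_n`: the log-log slope of `|σ̂'|` (`σ_∞'(δ)` behaves as `δ ^ ν`). -/
def nuHat (n : ℕ) (o : ℕ → Obs 𝒲) : ℝ :=
  (Real.log |S.sdSlope p₁ p₂ n o (d₂ n) (stepSize p₁ p₂ n)| -
    Real.log |S.sdSlope p₁ p₂ n o (d₁ n) (stepSize p₁ p₂ n)|) /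
      (Real.log (d₂ n) - Real.log (d₁ n))

/-- `Ĉ_{b', n}`. -/
def CbHat (n : ℕ) (o : ℕ → Obs 𝒲) : ℝ :=
  S.biasSlope p₁ p₂ n o (d₃ n) (stepSize p₁ p₂ n) * d₃ n ^ (-(S.betaHat p₁ p₂ d₁ d₂ n o - 1))

/-- `Ĉ_{σ, n}`. -/
def CsdHat (n : ℕ) (o : ℕ → Obs 𝒲) : ℝ :=
  S.sdHat p₁ p₂ n o (d₃ n) * d₃ n ^ S.gammaHat p₁ p₂ d₁ d₂ n o

/-- `Ĉ_{σ', n}`. -/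
def CsdSlopeHat (n : ℕ) (o : ℕ → Obs 𝒲) : ℝ :=
  S.sdSlope p₁ p₂ n o (d₃ n) (stepSize p₁ p₂ n) * d₃ n ^ (-S.nuHat p₁ p₂ d₁ d₂ n o)

/-- `r̂_n = 1 / (2 β̂_n - 1 + γ̂_n - ν̂_n)`. -/
def rHat (n : ℕ) (o : ℕ → Obs 𝒲) : ℝ :=
  1 / (2 * S.betaHat p₁ p₂ d₁ d₂ n o - 1 + S.gammaHat p₁ p₂ d₁ d₂ n o -
    S.nuHat p₁ p₂ d₁ d₂ n o)

/-- `Ĉ_n = (|Ĉ_{σ, n} Ĉ_{σ', n}| β̂_n / Ĉ_{b', n}²) ^ r̂_n`. -/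
def CHat (n : ℕ) (o : ℕ → Obs 𝒲) : ℝ :=
  (|S.CsdHat p₁ p₂ d₁ d₂ d₃ n o * S.CsdSlopeHat p₁ p₂ d₁ d₂ d₃ n o| *
    S.betaHat p₁ p₂ d₁ d₂ n o / S.CbHat p₁ p₂ d₁ d₂ d₃ n o ^ 2) ^ S.rHat p₁ p₂ d₁ d₂ n o

/-- `δ̂_{ε, n} = Ĉ_n (l_{3, n} - l_{2, n}) ^ (-r̂_n - ε)`. -/
def deltaHat (ε : ℝ) (n : ℕ) (o : ℕ → Obs 𝒲) : ℝ :=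
  S.CHat p₁ p₂ d₁ d₂ d₃ n o * lastSize p₂ n ^ (-S.rHat p₁ p₂ d₁ d₂ n o - ε)

/-- The final one-step estimator `Ψ̂_n(δ)`: fit on `S₁ ∪ S₂`, average over `S₃`. -/
def estimator (n : ℕ) (o : ℕ → Obs 𝒲) (δ : ℝ) : ℝ :=
  S.fitPsi (cut p₂ n) o δ + empMean (cut p₂ n) n o (S.fitGrad (cut p₂ n) o δ)

/-- The studentized estimator
`Ĉ_{σ, n}⁻¹ δ̂_{ε, n} ^ γ̂_n (l_{3, n} - l_{2, n}) ^ (1/2) (Ψ̂_n(δ̂_{ε, n}) - Ψ(P₀))`. -/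
def studentized (ε : ℝ) (n : ℕ) (o : ℕ → Obs 𝒲) : ℝ :=
  (S.CsdHat p₁ p₂ d₁ d₂ d₃ n o)⁻¹ *
    S.deltaHat p₁ p₂ d₁ d₂ d₃ ε n o ^ S.gammaHat p₁ p₂ d₁ d₂ n o *
    lastSize p₂ n ^ (1 / 2 : ℝ) *
    (S.estimator p₂ n o (S.deltaHat p₁ p₂ d₁ d₂ d₃ ε n o) - S.target)

/-- Half of the width of `CI'_{α, ε, n}`. -/
def halfWidth (α ε : ℝ) (n : ℕ) (o : ℕ → Obs 𝒲) : ℝ :=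
  normalQuantile (1 - α / 2) * (S.CsdHat p₁ p₂ d₁ d₂ d₃ n o /
    lastSize p₂ n ^ (1 / 2 - (S.rHat p₁ p₂ d₁ d₂ n o + ε) * S.gammaHat p₁ p₂ d₁ d₂ n o))

/-- The confidence interval `CI'_{α, ε, n}`, centred at `Ψ̂_n(δ̂_{0, n})`. -/
def CI' (α ε : ℝ) (n : ℕ) (o : ℕ → Obs 𝒲) : Set ℝ :=
  Set.Icc
    (S.estimator p₂ n o (S.deltaHat p₁ p₂ d₁ d₂ d₃ 0 n o) - S.halfWidth p₁ p₂ d₁ d₂ d₃ α ε n o)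
    (S.estimator p₂ n o (S.deltaHat p₁ p₂ d₁ d₂ d₃ 0 n o) + S.halfWidth p₁ p₂ d₁ d₂ d₃ α ε n o)

/-- `MSE_n(δ) = E (Ψ̂_n(δ) - Ψ(P₀))²`, a deterministic function of `δ`. -/
def MSE {Ω : Type*} [MeasurableSpace Ω] (Pr : Measure Ω) (O : ℕ → Ω → Obs 𝒲)
    (n : ℕ) (δ : ℝ) : ℝ :=
  ∫ ω, (S.estimator p₂ n (O · ω) δ - S.target) ^ 2 ∂Pr

end Estimators

end Setting

end DoseResponse

end

/-! Two structural facts make everything computable. Since the treatment mechanism is known, the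
weight `K_δ / g₀` cancels `g₀` under the integral, and the uncentred gradient has mean `Ψ_δ(P₀)`
whatever regression function is inserted (`integral_score`). Hence the remainder vanishes
identically (`rem_eq_zero`). Moreover a one-step estimator equals an average of centred gradients
plus `Ψ_δ(P₀)` (`oneStep_eq`), so given the fit it is unbiased for `Ψ_δ(P₀)`, and the empirical law
of the covariates drops out.

Second, the variance `V` of the gradient is dominated by the term with `K_δ ^ 2 / g₀`. Rescaling at
the dose and integrating by parts give `V ~ B / δ`, `V' ~ -B / δ ^ 2`, `V'' ~ 2 B / δ ^ 3` with `B =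
varLim`, uniformly over regression functions close to `Q̄_∞` in `L_∞` (`tendsto_varD_aux`). So `γ =
1/2` and `ν = -3/2` are forced, and A2, A4, A6 follow from this expansion and from perturbation
bounds that are linear in the `L_∞` distance. Assumption A1 is needed for the bias only: `b₀(δ) ~ (C
/ β) δ ^ β`, where `β > 0` is automatic (`A1.exists_biasRate`).

The difference quotients in `β̂_n` and `ν̂_n` follow the power laws of the derivatives by the mean
value theorem, up to noise controlled by Chebyshev's inequality conditionally on the fit. Log-log
slopes over polynomially separated levels then have errors `o(1 / log n)`, exactly what is needed
for a bandwidth raised to such an error to tend to one. Therefore `δ̂_{ε, n}` is equivalent to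
`optConst * m ^ (-1 / (2 β + 1) - ε)`, where `m` is the size of the last part of the sample
(`Tuned.tendsto_deltaHat`).

The mean squared error is exactly `E V / m + b₀ ^ 2`, with leading term `(C / β) ^ 2 δ ^ (2 β) + B /
(δ m)`. Its minimizer is `optConst * m ^ (-1 / (2 β + 1))`, so `δ̂_{0, n}` is optimal to first order
and the constant `K(p₂)` can be taken to be one (`RiskExpansion.tendsto_ratio`). For the limit law,
the fit and the bandwidth are frozen by conditioning on the first two parts; the rest is an average
of i.i.d. variables, handled by characteristic functions (`IsSample.tendstoInDistribution_fit`). The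
relative bias is of order `m ^ (-ε (2 β + 1) / 2)`. It vanishes for `ε > 0` and stays bounded for `ε
= 0`, where the widened interval absorbs it.

Convergence in probability is expressed as convergence along one filter, `whp`, so random bandwidths
and random regression functions can be substituted directly into deterministic limits. -/

namespace DoseResponse

/-! ### Convergence in probability as a filter limit -/

section WithHighProbability

variable {Ω : Type*} [MeasurableSpace Ω]

/-- The filter of events that hold with probability tending to one: limits along it are limits in
probability. -/
def whp (Pr : Measure Ω) : Filter (ℕ × Ω) where
  sets := {A | Tendsto (fun n => Pr {ω | (n, ω) ∉ A}) atTop (𝓝 0)}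
  univ_sets := by simp
  sets_of_superset := by
    intro A B hA hAB
    refine tendsto_of_tendsto_of_tendsto_of_le_of_le tendsto_const_nhds hA (fun n => zero_le) ?_
    intro n
    exact measure_mono fun ω hω h => hω (hAB h)
  inter_sets := by
    intro A B hA hB
    have h := Tendsto.add hA hB
    rw [add_zero] at h
    refine tendsto_of_tendsto_of_tendsto_of_le_of_le tendsto_const_nhds h (fun n => zero_le) ?_
    intro n
    refine (measure_mono ?_).trans (measure_union_le _ _)
    intro ω hω
    by_contra hc
    simp only [Set.mem_union, Set.mem_ofPred_eq, not_or, not_not] at hc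
    exact hω ⟨hc.1, hc.2⟩

variable {Pr : Measure Ω}

theorem eventually_whp {p : ℕ × Ω → Prop} :
    (∀ᶠ x in whp Pr, p x) ↔ Tendsto (fun n => Pr {ω | ¬ p (n, ω)}) atTop (𝓝 0) := Iff.rfl

theorem tendsto_fst_whp : Tendsto (Prod.fst : ℕ × Ω → ℕ) (whp Pr) atTop := by
  intro s hs
  change Tendsto (fun n => Pr {ω | ¬ (n ∈ s)}) atTop (𝓝 0)
  refine tendsto_const_nhds.congr' ?_
  filter_upwards [hs] with n hn
  simp [hn]

/-- Makes the calculus of limits along filters (algebra, squeezing, composition) available for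
convergence in probability to constants. -/
theorem tendstoInMeasure_const_iff {X : ℕ → Ω → ℝ} {c : ℝ} :
    TendstoInMeasure Pr X atTop (fun _ => c) ↔
      Tendsto (fun x : ℕ × Ω => X x.1 x.2) (whp Pr) (𝓝 c) := by
  rw [tendstoInMeasure_iff_dist, Metric.tendsto_nhds]
  refine forall₂_congr fun ε hε => ?_
  rw [eventually_whp]
  simp only [not_lt]

theorem equivP_iff {X : ℕ → Ω → ℝ} {a : ℕ → ℝ} :
    EquivP Pr X a ↔ Tendsto (fun x : ℕ × Ω => X x.1 x.2 / a x.1) (whp Pr) (𝓝 1) :=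
  tendstoInMeasure_const_iff

/-- The exceptional events have probability tending to zero, so a single constant serves every level
`ε`. -/
theorem bigOP_of_isBigO {X : ℕ → Ω → ℝ} {a : ℕ → ℝ}
    (h : (fun x : ℕ × Ω => X x.1 x.2) =O[whp Pr] fun x => a x.1) : BigOP Pr X a := by
  obtain ⟨C, hC⟩ := h.bound
  intro ε hε
  refine ⟨C, ?_⟩
  have h1 := (eventually_whp.1 hC).eventually (Iio_mem_nhds (ENNReal.ofReal_pos.2 hε))
  filter_upwards [h1] with n hn
  refine (measure_mono ?_).trans hn.le
  intro ω hω hle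
  simp only [Set.mem_ofPred_eq] at hω
  rw [← ofReal_norm] at hω
  exact absurd (ENNReal.ofReal_le_ofReal hle) (not_le.2 hω)

/-- A version of Chebyshev's inequality: convergence to zero in mean square implies convergence in
probability. -/
theorem tendsto_whp_of_lintegral_sq {X : ℕ → Ω → ℝ} (hX : ∀ n, AEMeasurable (X n) Pr)
    (h : Tendsto (fun n => ∫⁻ ω, ENNReal.ofReal (X n ω ^ 2) ∂Pr) atTop (𝓝 0)) :
    Tendsto (fun x : ℕ × Ω => X x.1 x.2) (whp Pr) (𝓝 0) := by
  rw [Metric.tendsto_nhds]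
  intro ε hε
  rw [eventually_whp]
  have hc : ENNReal.ofReal (ε ^ 2) ≠ 0 := by simpa using hε.ne'
  have h2 := ENNReal.Tendsto.div_const h (Or.inr hc)
  rw [ENNReal.zero_div] at h2
  refine tendsto_of_tendsto_of_tendsto_of_le_of_le tendsto_const_nhds h2 (fun n => zero_le) ?_
  intro n
  refine (measure_mono ?_).trans (meas_ge_le_lintegral_div (f := fun ω => ENNReal.ofReal (X n ω ^ 2))
    (((hX n).pow_const 2).ennreal_ofReal) hc ENNReal.ofReal_ne_top)
  intro ω hω
  simp only [Real.dist_eq, sub_zero, not_lt, Set.mem_ofPred_eq] at hω ⊢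
  apply ENNReal.ofReal_le_ofReal
  rw [← sq_abs (X n ω)]
  gcongr

/-- Bounded convergence in probability, uniformly over families. -/
theorem norm_integral_le_of_bounded [IsProbabilityMeasure Pr] {E : Type*} [NormedAddCommGroup E]
    [NormedSpace ℝ E] {X : Ω → E} {C ε p : ℝ} (hX : AEStronglyMeasurable X Pr)
    (hC : ∀ ω, ‖X ω‖ ≤ C) (hp0 : 0 ≤ p) (hε : 0 ≤ ε)
    (hp : Pr {ω | ¬ ‖X ω‖ ≤ ε} ≤ ENNReal.ofReal p) :
    ‖∫ ω, X ω ∂Pr‖ ≤ ε + C * p := by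
  obtain ⟨ω₀⟩ : Nonempty Ω := Pr.nonempty_of_neZero
  have hC0 : 0 ≤ C := (norm_nonneg _).trans (hC ω₀)
  have hXi : Integrable X Pr := Integrable.of_bound hX C (ae_of_all _ hC)
  refine (norm_integral_le_lintegral_norm X).trans ?_
  apply ENNReal.toReal_le_of_le_ofReal (by positivity)
  have hm : NullMeasurableSet {ω | ¬ ‖X ω‖ ≤ ε} Pr :=
    (nullMeasurableSet_le hX.norm.aemeasurable aemeasurable_const).compl
  calc ∫⁻ ω, ENNReal.ofReal ‖X ω‖ ∂Pr
      ≤ ∫⁻ ω, (ENNReal.ofReal ε +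
          {ω | ¬ ‖X ω‖ ≤ ε}.indicator (fun _ => ENNReal.ofReal C) ω) ∂Pr := by
        apply lintegral_mono
        intro ω
        by_cases h : ‖X ω‖ ≤ ε
        · exact (ENNReal.ofReal_le_ofReal h).trans le_self_add
        · simp only [Set.mem_ofPred_eq, h, not_false_eq_true, Set.indicator_of_mem]
          exact (ENNReal.ofReal_le_ofReal (hC ω)).trans le_add_self
    _ = ENNReal.ofReal ε + ENNReal.ofReal C * Pr {ω | ¬ ‖X ω‖ ≤ ε} := by
        rw [lintegral_add_left measurable_const, lintegral_const, measure_univ, mul_one,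
          lintegral_indicator_const₀ hm]
    _ ≤ ENNReal.ofReal ε + ENNReal.ofReal C * ENNReal.ofReal p := by gcongr
    _ = ENNReal.ofReal (ε + C * p) := by
        rw [← ENNReal.ofReal_mul hC0, ← ENNReal.ofReal_add hε (by positivity)]

theorem tendsto_integral_of_whp [IsProbabilityMeasure Pr] {E : Type*} [NormedAddCommGroup E]
    [NormedSpace ℝ E] {X : ℕ → Ω → E} {C : ℝ} (hX : ∀ n, AEStronglyMeasurable (X n) Pr)
    (hC : ∀ n ω, ‖X n ω‖ ≤ C) (h : Tendsto (fun x : ℕ × Ω => X x.1 x.2) (whp Pr) (𝓝 0)) :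
    Tendsto (fun n => ∫ ω, X n ω ∂Pr) atTop (𝓝 0) := by
  obtain ⟨ω₀⟩ : Nonempty Ω := Pr.nonempty_of_neZero
  have hC0 : 0 ≤ C := (norm_nonneg _).trans (hC 0 ω₀)
  rw [Metric.tendsto_nhds]
  intro ε hε
  have hev : ∀ᶠ x : ℕ × Ω in whp Pr, ‖X x.1 x.2‖ ≤ ε / 2 := by
    filter_upwards [Metric.tendsto_nhds.1 h (ε / 2) (by positivity)] with x hx
    simpa using hx.le
  -- The good event contributes at most `ε / 2` and the bad one at most `C` times this number, hence
  -- at most `ε / 4`.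
  have hp : 0 < ε / (4 * (C + 1)) := by positivity
  filter_upwards [(eventually_whp.1 hev).eventually (Iio_mem_nhds (ENNReal.ofReal_pos.2 hp))]
    with n hn
  rw [dist_zero_right]
  refine (norm_integral_le_of_bounded (hX n) (hC n) hp.le (by positivity) hn.le).trans_lt ?_
  have : C * (ε / (4 * (C + 1))) ≤ ε / 4 := by
    rw [mul_div_assoc', div_le_div_iff₀ (by positivity) (by positivity)]
    nlinarith
  linarith

/-- A random sequence bounded in probability by `a`, evaluated at a subsequence, is negligible
with respect to any deterministic sequence that dominates `a`. -/
theorem tendsto_whp_of_bigOPE {X : ℕ → Ω → ℝ≥0∞} {a b : ℕ → ℝ} {l : ℕ → ℕ}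
    (h : BigOPE Pr X a) (hl : Tendsto l atTop atTop) (hab : (fun n => a (l n)) =o[atTop] b) :
    ∀ ε : ℝ, 0 < ε → ∀ᶠ x : ℕ × Ω in whp Pr,
      X (l x.1) x.2 ≤ ENNReal.ofReal (ε * |b x.1|) := by
  intro ε hε
  rw [eventually_whp, ENNReal.tendsto_nhds_zero]
  intro e he
  by_cases hetop : e = ∞
  · simp [hetop]
  have he' : 0 < e.toReal := ENNReal.toReal_pos he.ne' hetop
  -- `M` depends on the level `e`, but the little-o domination of `a` by `b` absorbs any fixed
  -- constant.
  obtain ⟨M, hM⟩ := h e.toReal he'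
  have hb := (hab.const_mul_left M).bound hε
  filter_upwards [hl.eventually hM, hb] with n h1 h2
  rw [ENNReal.ofReal_toReal hetop] at h1
  refine (measure_mono ?_).trans h1
  intro ω hω
  simp only [not_le, Set.mem_ofPred_eq] at hω ⊢
  refine lt_of_le_of_lt (ENNReal.ofReal_le_ofReal ?_) hω
  simp only [Real.norm_eq_abs, abs_mul] at h2
  refine le_trans ?_ h2
  gcongr
  exact le_abs_self M

end WithHighProbability


/-! ### Localisation of rescaled kernels at the dose -/

section RealAnalysis

/-- If `f u = u * M u` with `M` and `f'` integrable at infinity, then `f` vanishes at infinity. -/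
theorem tendsto_zero_atTop_of_integrable_div {f f' M : ℝ → ℝ} (hf : ∀ u, HasDerivAt f (f' u) u)
    (hf' : Integrable f') (hM : Integrable M) (hfM : ∀ u, f u = u * M u) :
    Tendsto f atTop (𝓝 0) := by
  have h := tendsto_limUnder_of_hasDerivAt_of_integrableOn_Ioi (a := 0) (fun x _ => hf x)
    hf'.integrableOn
  set c := limUnder atTop f with hc
  by_cases h0 : c = 0
  · rwa [h0] at h
  exfalso
  have hev : ∀ᶠ u in atTop, |c| / 2 ≤ |f u| := by
    filter_upwards [(h.abs).eventually (lt_mem_nhds (half_lt_self (abs_pos.2 h0)))] with u hu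
    exact hu.le
  obtain ⟨N, hN⟩ := eventually_atTop.1 hev
  -- A nonzero limit `c` would give `|M u| ≥ |c| / (2 u)` near infinity, against the integrability
  -- of `M`.
  apply not_integrableOn_Ioi_inv (a := max N 1)
  have h1 : IntegrableOn (fun u => (|c| / 2)⁻¹ * |M u|) (Set.Ioi (max N 1)) :=
    (hM.abs.const_mul _).integrableOn
  refine Integrable.mono' h1 (by fun_prop) ?_
  refine (ae_restrict_mem measurableSet_Ioi).mono fun u hu => ?_
  have hu1 : (1 : ℝ) < u := (le_max_right _ _).trans_lt hu
  have huN : N ≤ u := (le_max_left _ _).trans (le_of_lt hu)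
  have hh := hN u huN
  rw [hfM, abs_mul, abs_of_pos (by linarith : 0 < u)] at hh
  rw [norm_inv, Real.norm_eq_abs, abs_of_pos (by linarith : 0 < u)]
  have : 0 < |c| / 2 := half_pos (abs_pos.2 h0)
  rw [inv_mul_eq_div, le_div_iff₀ this, inv_mul_eq_div, div_le_iff₀ (by linarith)]
  linarith

theorem tendsto_zero_atBot_of_integrable_div {f f' M : ℝ → ℝ} (hf : ∀ u, HasDerivAt f (f' u) u)
    (hf' : Integrable f') (hM : Integrable M) (hfM : ∀ u, f u = u * M u) :
    Tendsto f atBot (𝓝 0) := by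
  have h := tendsto_zero_atTop_of_integrable_div (f := fun u => f (-u)) (f' := fun u => - f' (-u))
    (M := fun u => - M (-u)) (fun u => by simpa [Function.comp_def] using HasDerivAt.scomp u (hf (-u)) (hasDerivAt_neg u))
    hf'.comp_neg.neg hM.comp_neg.neg (fun u => by rw [hfM]; ring)
  simpa [Function.comp_def] using h.comp tendsto_neg_atBot_atTop

/-- The half-line or line on which a kernel localised at `a₀ ∈ [0, 1]` lives. -/
def locDomain (a₀ : ℝ) : Set ℝ := {u | (a₀ = 0 → 0 < u) ∧ (a₀ = 1 → u ≤ 0)}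

theorem locDomain_cases {a₀ : ℝ} (h : a₀ ∈ Set.Icc (0 : ℝ) 1) :
    (locDomain a₀ = Set.univ ∧ a₀ ∈ Set.Ioo (0 : ℝ) 1) ∨ (locDomain a₀ = Set.Ioi 0 ∧ a₀ = 0) ∨
      (locDomain a₀ = Set.Iic 0 ∧ a₀ = 1) := by
  by_cases h0 : a₀ = 0
  · right; left
    subst h0
    simp [locDomain, Set.Ioi_def]
  by_cases h1 : a₀ = 1
  · right; right
    subst h1
    simp [locDomain, Set.Iic_def]
  · left
    refine ⟨by simp [locDomain, h0, h1], ?_, ?_⟩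
    · exact lt_of_le_of_ne h.1 (Ne.symm h0)
    · exact lt_of_le_of_ne h.2 h1

theorem measurableSet_locDomain {a₀ : ℝ} (h : a₀ ∈ Set.Icc (0 : ℝ) 1) :
    MeasurableSet (locDomain a₀) := by
  rcases locDomain_cases h with h | h | h <;> rw [h.1] <;> measurability

/-- No boundary term survives: `f` vanishes at infinity by integrability, and at `0` because of the
factor `u`. This treats interior doses and the two endpoints alike. -/
theorem setIntegral_locDomain_deriv_eq_zero {a₀ : ℝ} (h : a₀ ∈ Set.Icc (0 : ℝ) 1) {f f' M : ℝ → ℝ}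
    (hf : ∀ u, HasDerivAt f (f' u) u) (hf' : Integrable f') (hM : Integrable M)
    (hfM : ∀ u, f u = u * M u) : ∫ u in locDomain a₀, f' u = 0 := by
  have ht := tendsto_zero_atTop_of_integrable_div hf hf' hM hfM
  have hb := tendsto_zero_atBot_of_integrable_div hf hf' hM hfM
  have h0 : f 0 = 0 := by simp [hfM]
  rcases locDomain_cases h with h | h | h <;> rw [h.1]
  · rw [setIntegral_univ, integral_of_hasDerivAt_of_tendsto hf hf' hb ht, sub_zero]
  · rw [integral_Ioi_of_hasDerivAt_of_tendsto' (fun x _ => hf x) hf'.integrableOn ht, h0, sub_zero]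
  · rw [integral_Iic_of_hasDerivAt_of_tendsto' (fun x _ => hf x) hf'.integrableOn hb, h0, sub_zero]

/-- The rescaled interval `([0, 1] - a₀) / δ` grows to `locDomain a₀`. The point `u = 0` is excluded
because for `a₀ = 0` it lies in every rescaled interval but not in `locDomain`; it is a null set
anyway. -/
theorem eventually_mem_Icc_iff {a₀ : ℝ} (h : a₀ ∈ Set.Icc (0 : ℝ) 1) {u : ℝ} (hu : u ≠ 0) :
    ∀ᶠ δ : ℝ in 𝓝[>] 0, (a₀ + δ * u ∈ Set.Icc (0 : ℝ) 1 ↔ u ∈ locDomain a₀) := by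
  have hlim : Tendsto (fun δ : ℝ => δ * u) (𝓝[>] 0) (𝓝 0) := by
    have : Tendsto (fun δ : ℝ => δ * u) (𝓝 0) (𝓝 (0 * u)) := (continuous_mul_const u).tendsto 0
    rw [zero_mul] at this
    exact this.mono_left nhdsWithin_le_nhds
  rcases locDomain_cases h with h | h | h <;> rw [h.1]
  · have h2 : Tendsto (fun δ : ℝ => a₀ + δ * u) (𝓝[>] 0) (𝓝 a₀) := by
      simpa using hlim.const_add a₀
    filter_upwards [h2.eventually (Ioo_mem_nhds h.2.1 h.2.2)] with δ hδ
    simp only [Set.mem_univ, iff_true]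
    exact ⟨hδ.1.le, hδ.2.le⟩
  · filter_upwards [hlim.eventually (Iio_mem_nhds (by norm_num : (0 : ℝ) < 1)),
      self_mem_nhdsWithin] with δ hδ hδ0
    rw [h.2, zero_add, Set.mem_Ioi]
    constructor
    · intro hh
      exact lt_of_le_of_ne (nonneg_of_mul_nonneg_right hh.1 hδ0) (Ne.symm hu)
    · intro hh
      exact ⟨(mul_pos hδ0 hh).le, le_of_lt hδ⟩
  · filter_upwards [hlim.eventually (Ioi_mem_nhds (by norm_num : (-1 : ℝ) < 0)),
      self_mem_nhdsWithin] with δ hδ hδ0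
    rw [h.2, Set.mem_Iic]
    have hδ0' : (0 : ℝ) < δ := hδ0
    have hδ1 : -1 < δ * u := hδ
    constructor
    · intro hh
      have := hh.2
      nlinarith
    · intro hh
      constructor
      · linarith
      · nlinarith

theorem integral_comp_div_sub_eq {δ a₀ : ℝ} (hδ : 0 < δ) (M h : ℝ → ℝ) :
    ∫ a in Set.Icc (0 : ℝ) 1, δ⁻¹ * M ((a - a₀) / δ) * h a =
      ∫ u, M u * (Set.Icc (0 : ℝ) 1).indicator h (a₀ + δ * u) := by
  rw [← integral_indicator measurableSet_Icc]
  set g : ℝ → ℝ := fun u => M u * (Set.Icc (0 : ℝ) 1).indicator h (a₀ + δ * u) with hg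
  have h1 := Measure.integral_comp_div g δ
  have h2 := integral_sub_right_eq_self (μ := volume) (fun x => g (x / δ)) a₀
  rw [abs_of_pos hδ, smul_eq_mul] at h1
  have h3 : ∫ u, g u = δ⁻¹ * ∫ x, g ((x - a₀) / δ) := by
    rw [h2, h1, inv_mul_cancel_left₀ hδ.ne']
  rw [h3, ← integral_const_mul]
  congr 1
  ext a
  have h4 : a₀ + δ * ((a - a₀) / δ) = a := by field_simp; ring
  by_cases ha : a ∈ Set.Icc (0 : ℝ) 1
  · simp only [hg, h4, Set.indicator_of_mem ha]
    ring
  · simp only [hg, h4, Set.indicator_of_notMem ha]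
    ring

/-- Localisation: rescaled integrable kernels concentrate at `a₀`. -/
theorem tendsto_integral_rescaled {a₀ : ℝ} (ha₀ : a₀ ∈ Set.Icc (0 : ℝ) 1) {M h : ℝ → ℝ}
    (hM : Integrable M) (hh : Measurable h) {C : ℝ} (hC : ∀ a, |h a| ≤ C)
    (hcont : ContinuousWithinAt h (Set.Icc 0 1) a₀) :
    Tendsto (fun δ : ℝ => ∫ a in Set.Icc (0 : ℝ) 1, δ⁻¹ * M ((a - a₀) / δ) * h a) (𝓝[>] 0)
      (𝓝 (h a₀ * ∫ u in locDomain a₀, M u)) := by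
  have hC0 : 0 ≤ C := (abs_nonneg _).trans (hC 0)
  -- After the substitution `a = a₀ + δ u` the bandwidth only appears in a bounded factor, so `|M| *
  -- C` dominates for all `δ` at once.
  have hlim : Tendsto (fun δ : ℝ => ∫ u, M u * (Set.Icc (0 : ℝ) 1).indicator h (a₀ + δ * u))
      (𝓝[>] 0) (𝓝 (∫ u, M u * (locDomain a₀).indicator (fun _ => h a₀) u)) := by
    refine tendsto_integral_filter_of_dominated_convergence (fun u => |M u| * C) ?_ ?_
      (hM.abs.mul_const C) ?_
    · refine Eventually.of_forall fun δ => hM.aestronglyMeasurable.mul ?_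
      exact ((hh.indicator measurableSet_Icc).comp (by fun_prop)).aestronglyMeasurable
    · refine Eventually.of_forall fun δ => ae_of_all _ fun u => ?_
      rw [norm_mul, Real.norm_eq_abs]
      gcongr
      by_cases hu : a₀ + δ * u ∈ Set.Icc (0 : ℝ) 1
      · rw [Set.indicator_of_mem hu]; exact hC _
      · rw [Set.indicator_of_notMem hu]; simpa using hC0
    · have : ∀ᵐ u : ℝ, u ≠ 0 := by simp [ae_iff]
      filter_upwards [this] with u hu
      refine Tendsto.const_mul _ ?_
      have hev := eventually_mem_Icc_iff ha₀ hu
      by_cases hm : u ∈ locDomain a₀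
      · rw [Set.indicator_of_mem hm]
        have h1 : Tendsto (fun δ : ℝ => a₀ + δ * u) (𝓝[>] 0) (𝓝[Set.Icc 0 1] a₀) := by
          refine tendsto_nhdsWithin_iff.2 ⟨?_, by filter_upwards [hev] with δ hδ using hδ.2 hm⟩
          have : Tendsto (fun δ : ℝ => a₀ + δ * u) (𝓝 0) (𝓝 (a₀ + 0 * u)) :=
            (by fun_prop : Continuous fun δ : ℝ => a₀ + δ * u).tendsto 0
          simpa using this.mono_left nhdsWithin_le_nhds
        refine (hcont.tendsto.comp h1).congr' ?_
        filter_upwards [hev] with δ hδ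
        rw [Set.indicator_of_mem (hδ.2 hm), Function.comp_apply]
      · rw [Set.indicator_of_notMem hm]
        refine tendsto_const_nhds.congr' ?_
        filter_upwards [hev] with δ hδ
        rw [Set.indicator_of_notMem (fun hc => hm (hδ.1 hc))]
  have hval : ∫ u, M u * (locDomain a₀).indicator (fun _ => h a₀) u =
      h a₀ * ∫ u in locDomain a₀, M u := by
    rw [← integral_const_mul, ← integral_indicator (measurableSet_locDomain ha₀)]
    congr 1
    ext u
    by_cases hu : u ∈ locDomain a₀ <;> simp [hu, mul_comm]
  rw [hval] at hlim
  refine hlim.congr' ?_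
  filter_upwards [self_mem_nhdsWithin] with δ hδ
  exact (integral_comp_div_sub_eq hδ M h).symm

theorem integral_rescaled_abs_le {a₀ δ : ℝ} (hδ : 0 < δ) {M : ℝ → ℝ} (hM : Integrable M) :
    ∫ a in Set.Icc (0 : ℝ) 1, |δ⁻¹ * M ((a - a₀) / δ)| ≤ ∫ u, |M u| := by
  have h := integral_comp_div_sub_eq (a₀ := a₀) hδ (fun u => |M u|) (fun _ => 1)
  have h1 : ∫ a in Set.Icc (0 : ℝ) 1, |δ⁻¹ * M ((a - a₀) / δ)| =
      ∫ a in Set.Icc (0 : ℝ) 1, δ⁻¹ * |M ((a - a₀) / δ)| * 1 := by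
    congr 1
    ext a
    rw [abs_mul, abs_of_pos (inv_pos.2 hδ), mul_one]
  rw [h1, h]
  refine integral_mono_of_nonneg (ae_of_all _ fun u => ?_) hM.abs (ae_of_all _ fun u => ?_)
  · exact mul_nonneg (abs_nonneg _) (Set.indicator_nonneg (fun _ _ => zero_le_one) _)
  · refine mul_le_of_le_one_right (abs_nonneg _) ?_
    exact Set.indicator_le_self' (fun _ _ => zero_le_one) _

end RealAnalysis

/-! ### Derivatives of the kernel in the bandwidth -/

section KernelDerivatives

/-- `δ ^ (j + 1)` times the `j`-th derivative in `δ` of `δ⁻¹ * K (x / δ)`, as a function of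
`u = x / δ` (for `j ≤ 2`). -/
noncomputable def scaleDeriv (K : ℝ → ℝ) : ℕ → ℝ → ℝ
  | 0, u => K u
  | 1, u => -(K u + u * deriv K u)
  | _, u => 2 * K u + 4 * (u * deriv K u) + u ^ 2 * deriv (deriv K) u

/-- The analogue of `scaleDeriv` for `(δ⁻¹ * K (x / δ)) ^ 2`. -/
noncomputable def scaleDerivSq (K : ℝ → ℝ) : ℕ → ℝ → ℝ
  | 0, u => K u ^ 2
  | 1, u => 2 * K u * scaleDeriv K 1 u
  | _, u => 2 * scaleDeriv K 1 u ^ 2 + 2 * K u * scaleDeriv K 2 u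

variable {K : ℝ → ℝ} {a₀ : ℝ} (hK : IsKernel K a₀)
include hK

theorem IsKernel.differentiable : Differentiable ℝ K := hK.contDiff.differentiable (by norm_num)

theorem IsKernel.contDiff_deriv : ContDiff ℝ 1 (deriv K) := by
  have := hK.contDiff
  rw [show (2 : WithTop ℕ∞) = 1 + 1 by norm_num, contDiff_succ_iff_deriv] at this
  exact this.2.2

theorem IsKernel.hasDerivAt (u : ℝ) : HasDerivAt K (deriv K u) u :=
  (hK.differentiable u).hasDerivAt

theorem IsKernel.hasDerivAt_deriv (u : ℝ) : HasDerivAt (deriv K) (deriv (deriv K) u) u :=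
  ((hK.contDiff_deriv.differentiable (by norm_num)) u).hasDerivAt

theorem IsKernel.continuous_deriv : Continuous (deriv K) := hK.contDiff_deriv.continuous

theorem IsKernel.continuous_deriv2 : Continuous (deriv (deriv K)) :=
  hK.contDiff_deriv.continuous_deriv (by norm_num)

theorem IsKernel.continuous_scaleDeriv (j : ℕ) : Continuous (scaleDeriv K j) := by
  have h0 := hK.contDiff.continuous
  have h1 := hK.continuous_deriv
  have h2 := hK.continuous_deriv2
  rcases j with _ | _ | j
  · exact h0
  · change Continuous fun u => -(K u + u * deriv K u)
    fun_prop
  · change Continuous fun u => 2 * K u + 4 * (u * deriv K u) + u ^ 2 * deriv (deriv K) u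
    fun_prop

theorem IsKernel.continuous_scaleDerivSq (j : ℕ) : Continuous (scaleDerivSq K j) := by
  have h0 := hK.contDiff.continuous
  have h1 := hK.continuous_scaleDeriv
  have h2 := h1 1
  have h3 := h1 2
  rcases j with _ | _ | j
  · exact h0.pow 2
  · change Continuous fun u => 2 * K u * scaleDeriv K 1 u
    fun_prop
  · change Continuous fun u => 2 * scaleDeriv K 1 u ^ 2 + 2 * K u * scaleDeriv K 2 u
    fun_prop

theorem IsKernel.scaleDeriv_bounded (j : ℕ) : ∃ C : ℝ, 0 ≤ C ∧ ∀ u, |scaleDeriv K j u| ≤ C := by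
  obtain ⟨C0, h0⟩ := hK.bounded 0 (by norm_num)
  obtain ⟨C1, h1⟩ := hK.bounded 1 (by norm_num)
  obtain ⟨C2, h2⟩ := hK.bounded 2 (by norm_num)
  simp only [pow_zero, one_mul, iteratedDeriv_zero, pow_one,
    iteratedDeriv_succ] at h0 h1 h2
  have p0 := (abs_nonneg _).trans (h0 0)
  have p1 := (abs_nonneg _).trans (h1 0)
  have p2 := (abs_nonneg _).trans (h2 0)
  -- The coefficients of `scaleDeriv K 2`, which also dominate those of orders zero and one.
  refine ⟨2 * C0 + 4 * C1 + C2, by positivity, fun u => ?_⟩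
  have q0 := abs_le.1 (h0 u)
  have q1 := abs_le.1 (h1 u)
  have q2 := abs_le.1 (h2 u)
  rcases j with _ | _ | j <;> simp only [scaleDeriv] <;> rw [abs_le] <;> constructor <;> linarith

theorem IsKernel.scaleDeriv_integrable (j : ℕ) : Integrable (scaleDeriv K j) := by
  have h0 := hK.integrable 0 (by norm_num)
  have h1 := hK.integrable 1 (by norm_num)
  have h2 := hK.integrable 2 (by norm_num)
  simp only [pow_zero, one_mul, iteratedDeriv_zero, pow_one,
    iteratedDeriv_succ] at h0 h1 h2
  rcases j with _ | _ | j
  · exact h0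
  · exact (h0.add h1).neg
  · exact ((h0.const_mul 2).add (h1.const_mul 4)).add h2

theorem IsKernel.scaleDeriv_mul_integrable (i j : ℕ) :
    Integrable (fun u => scaleDeriv K i u * scaleDeriv K j u) := by
  obtain ⟨C, -, hC⟩ := hK.scaleDeriv_bounded i
  exact (hK.scaleDeriv_integrable j).bdd_mul (c := C)
    (hK.continuous_scaleDeriv i).aestronglyMeasurable (ae_of_all _ hC)

theorem IsKernel.scaleDerivSq_integrable (j : ℕ) : Integrable (scaleDerivSq K j) := by
  have h := hK.scaleDeriv_mul_integrable
  rcases j with _ | _ | j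
  · refine (h 0 0).congr (ae_of_all _ fun u => ?_)
    simp only [scaleDerivSq, scaleDeriv]; ring
  · refine ((h 0 1).const_mul 2).congr (ae_of_all _ fun u => ?_)
    simp only [scaleDerivSq, scaleDeriv]; ring
  · refine (((h 1 1).const_mul 2).add ((h 0 2).const_mul 2)).congr (ae_of_all _ fun u => ?_)
    simp only [scaleDerivSq, scaleDeriv, Pi.add_apply]; ring

theorem IsKernel.pow_integrable (j : ℕ) : Integrable (fun u => K u ^ (j + 1)) := by
  obtain ⟨C, -, hC⟩ := hK.scaleDeriv_bounded 0
  induction j with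
  | zero => exact (hK.scaleDeriv_integrable 0).congr (ae_of_all _ fun u => (pow_one _).symm)
  | succ j ih =>
    refine (ih.bdd_mul (c := C) (hK.continuous_scaleDeriv 0).aestronglyMeasurable
      (ae_of_all _ hC)).congr (ae_of_all _ fun u => ?_)
    simp only [scaleDeriv]; ring

/-- The derivative of `u K(u) ^ 2` is minus the sum of the two integrands, and its integral is zero.
This is the rescaled form of `(B / δ)' = -B / δ ^ 2`, and the reason why no further kernel constant
enters `σ'`. -/
theorem IsKernel.integral_scaleDerivSq_one (ha₀ : a₀ ∈ Set.Icc (0 : ℝ) 1) :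
    ∫ u in locDomain a₀, scaleDerivSq K 1 u = -∫ u in locDomain a₀, scaleDerivSq K 0 u := by
  have h0 := hK.scaleDerivSq_integrable 0
  have h1 := hK.scaleDerivSq_integrable 1
  have h := setIntegral_locDomain_deriv_eq_zero ha₀ (f := fun u => u * scaleDerivSq K 0 u)
    (f' := fun u => -(scaleDerivSq K 1 u + scaleDerivSq K 0 u)) (M := scaleDerivSq K 0)
    (fun u => ?_) (h1.add h0).neg h0 (fun u => rfl)
  · rw [integral_neg, integral_add h1.integrableOn h0.integrableOn] at h
    linarith
  · have := (hasDerivAt_id u).mul ((hK.hasDerivAt u).pow 2)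
    refine (this.congr_deriv ?_)
    simp only [scaleDerivSq, scaleDeriv, id, Pi.pow_apply]
    ring

theorem IsKernel.hasDerivAt_scaleDeriv_one (u : ℝ) :
    HasDerivAt (scaleDeriv K 1) (-(2 * deriv K u + u * deriv (deriv K) u)) u := by
  refine (((hK.hasDerivAt u).add ((hasDerivAt_id u).mul (hK.hasDerivAt_deriv u))).neg).congr_deriv ?_
  simp only [id]
  ring

/-- The same integration by parts once more, with `u * scaleDerivSq K 1 u` as primitive; it reflects
`(B / δ)'' = 2 B / δ ^ 3`. -/
theorem IsKernel.integral_scaleDerivSq_two (ha₀ : a₀ ∈ Set.Icc (0 : ℝ) 1) :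
    ∫ u in locDomain a₀, scaleDerivSq K 2 u = 2 * ∫ u in locDomain a₀, scaleDerivSq K 0 u := by
  have h1 := hK.scaleDerivSq_integrable 1
  have h2 := hK.scaleDerivSq_integrable 2
  have h := setIntegral_locDomain_deriv_eq_zero ha₀ (f := fun u => u * scaleDerivSq K 1 u)
    (f' := fun u => -(scaleDerivSq K 2 u + 2 * scaleDerivSq K 1 u)) (M := scaleDerivSq K 1)
    (fun u => ?_) (h2.add (h1.const_mul 2)).neg h1 (fun u => rfl)
  · rw [integral_neg, integral_add h2.integrableOn (h1.const_mul 2).integrableOn,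
      integral_const_mul, hK.integral_scaleDerivSq_one ha₀] at h
    linarith
  · have := (hasDerivAt_id u).mul
      (((hK.hasDerivAt u).const_mul 2).mul (hK.hasDerivAt_scaleDeriv_one u))
    refine (this.congr_deriv ?_)
    simp only [scaleDerivSq, scaleDeriv, id, Pi.mul_apply]
    ring

theorem IsKernel.hasDerivAt_rescaled_zero {x δ : ℝ} (hδ : 0 < δ) :
    HasDerivAt (fun δ : ℝ => δ⁻¹ ^ 1 * scaleDeriv K 0 (x / δ))
      (δ⁻¹ ^ 2 * scaleDeriv K 1 (x / δ)) δ := by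
  have hi := hasDerivAt_inv hδ.ne'
  have hx : HasDerivAt (fun δ : ℝ => x / δ) (-x / δ ^ 2) δ := by
    simpa [div_eq_mul_inv, mul_comm] using hi.const_mul x
  have hf := (hK.hasDerivAt (x / δ)).comp δ hx
  refine ((hi.pow 1).mul hf).congr_deriv ?_
  simp only [scaleDeriv, Function.comp_apply, Pi.pow_apply]
  norm_num
  field_simp
  ring

theorem IsKernel.hasDerivAt_rescaled_one {x δ : ℝ} (hδ : 0 < δ) :
    HasDerivAt (fun δ : ℝ => δ⁻¹ ^ 2 * scaleDeriv K 1 (x / δ))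
      (δ⁻¹ ^ 3 * scaleDeriv K 2 (x / δ)) δ := by
  have hi := hasDerivAt_inv hδ.ne'
  have hx : HasDerivAt (fun δ : ℝ => x / δ) (-x / δ ^ 2) δ := by
    simpa [div_eq_mul_inv, mul_comm] using hi.const_mul x
  have hf := (hK.hasDerivAt_scaleDeriv_one (x / δ)).comp δ hx
  refine ((hi.pow 2).mul hf).congr_deriv ?_
  simp only [scaleDeriv, Function.comp_apply, Pi.pow_apply]
  norm_num
  field_simp
  ring

/-- Localisation with the constant function `1` identifies the limit in `IsKernel.mass` as the
integral over `locDomain`, a half-line when the dose is an endpoint. -/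
theorem IsKernel.integral_locDomain_eq_one (ha₀ : a₀ ∈ Set.Icc (0 : ℝ) 1) :
    ∫ u in locDomain a₀, K u = 1 := by
  have h1 := tendsto_integral_rescaled ha₀ (hK.scaleDeriv_integrable 0)
    (measurable_const (a := (1 : ℝ))) (C := 1) (by simp) continuousWithinAt_const
  have h2 := hK.mass
  refine (one_mul (∫ u in locDomain a₀, K u)).symm.trans (tendsto_nhds_unique h1 ?_)
  refine h2.congr fun δ => ?_
  rw [intervalIntegral.integral_of_le zero_le_one, integral_Icc_eq_integral_Ioc]
  simp [scaleDeriv]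

/-- If the integral of an even power vanished, `K` would be zero almost everywhere on `locDomain`,
where its integral is one. -/
theorem IsKernel.integral_pow_pos (ha₀ : a₀ ∈ Set.Icc (0 : ℝ) 1) {j : ℕ} (hj : Even (j + 1)) :
    0 < ∫ u in locDomain a₀, K u ^ (j + 1) := by
  have hnn : 0 ≤ ∫ u in locDomain a₀, K u ^ (j + 1) := integral_nonneg fun u => hj.pow_nonneg _
  refine lt_of_le_of_ne hnn fun h0 => ?_
  have h1 := (integral_eq_zero_iff_of_nonneg (fun u => hj.pow_nonneg (K u))
    (hK.pow_integrable j).integrableOn).1 h0.symm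
  have h2 : ∫ u in locDomain a₀, K u = 0 := by
    apply integral_eq_zero_of_ae
    filter_upwards [h1] with u hu
    simpa using hu
  rw [hK.integral_locDomain_eq_one ha₀] at h2
  exact one_ne_zero h2

end KernelDerivatives


/-- Measurable regression functions with values in `[0, 1]`. -/
structure IsRegression {𝒲 : Type*} [MeasurableSpace 𝒲] (Q : 𝒲 → ℝ → ℝ) : Prop where
  meas : Measurable (Function.uncurry Q)
  mem : ∀ w a, Q w a ∈ Set.Icc (0 : ℝ) 1

namespace Setting

variable {𝒲 : Type*} [MeasurableSpace 𝒲] (S : Setting 𝒲)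

theorem isRegression_Q₀ : IsRegression S.Q₀ := ⟨S.Q₀_meas, S.Q₀_mem⟩

theorem isRegression_Qinf : IsRegression S.Qinf := ⟨S.Qinf_meas, S.Qinf_mem⟩

theorem isRegression_fitQ (m : ℕ) (o : ℕ → Obs 𝒲) : IsRegression (S.fitQ m o) :=
  ⟨(S.Qhat_meas m).comp (measurable_const.prodMk measurable_id), fun _ _ => S.Qhat_mem _ _ _ _⟩

/-! ### The data-generating law -/

/-- The law of `(W, a)` for a dose `a` drawn uniformly from `[0, 1]`, independently of `W`. -/
noncomputable def base : Measure (𝒲 × ℝ) := S.covLaw.prod (volume.restrict (Set.Icc (0 : ℝ) 1))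

instance isProbabilityMeasure_unitInterval :
    IsProbabilityMeasure (volume.restrict (Set.Icc (0 : ℝ) 1)) := ⟨by simp⟩

instance isProbabilityMeasure_base : IsProbabilityMeasure S.base := by
  unfold base; infer_instance

theorem integrable_bdd {α : Type*} [MeasurableSpace α] {μ : Measure α} [IsFiniteMeasure μ]
    {f : α → ℝ} (hf : Measurable f) {C : ℝ} (hC : ∀ x, |f x| ≤ C) : Integrable f μ :=
  Integrable.of_bound hf.aestronglyMeasurable C (ae_of_all _ hC)

/-- Summing out the binary outcome reduces integrals under `P₀` to integrals over `(W, a)` with the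
reference law `base`. -/
theorem lintegral_P₀ {f : Obs 𝒲 → ℝ≥0∞} (hf : Measurable f) :
    ∫⁻ o, f o ∂S.P₀ = ∫⁻ p, ENNReal.ofReal (S.g p.1 p.2) *
      (ENNReal.ofReal (S.Q₀ p.1 p.2) * f (p.1, p.2, true) +
        ENNReal.ofReal (1 - S.Q₀ p.1 p.2) * f (p.1, p.2, false)) ∂S.base := by
  have hg : Measurable fun o : Obs 𝒲 => S.g o.1 o.2.1 :=
    S.g_meas.comp (measurable_fst.prodMk (measurable_fst.comp measurable_snd))
  have hQ : Measurable fun o : Obs 𝒲 => S.Q₀ o.1 o.2.1 :=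
    S.Q₀_meas.comp (measurable_fst.prodMk (measurable_fst.comp measurable_snd))
  have hg' : Measurable fun o : 𝒲 × ℝ => S.g o.1 o.2 := S.g_meas
  have hQ' : Measurable fun o : 𝒲 × ℝ => S.Q₀ o.1 o.2 := S.Q₀_meas
  have hs : MeasurableSet {o : Obs 𝒲 | o.2.2 = true} :=
    (measurable_snd.comp measurable_snd) (measurableSet_singleton true)
  have hd : Measurable fun o : Obs 𝒲 => ENNReal.ofReal (S.g o.1 o.2.1) *
      ENNReal.ofReal (if o.2.2 then S.Q₀ o.1 o.2.1 else 1 - S.Q₀ o.1 o.2.1) :=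
    hg.ennreal_ofReal.mul (Measurable.ite hs hQ (measurable_const.sub hQ)).ennreal_ofReal
  have hF : Measurable fun o : Obs 𝒲 => (ENNReal.ofReal (S.g o.1 o.2.1) *
      ENNReal.ofReal (if o.2.2 then S.Q₀ o.1 o.2.1 else 1 - S.Q₀ o.1 o.2.1)) * f o := hd.mul hf
  rw [P₀, lintegral_withDensity_eq_lintegral_mul _ hd hf]
  simp only [Pi.mul_apply]
  rw [lintegral_prod _ hF.aemeasurable, base, lintegral_prod]
  · refine lintegral_congr fun w => ?_
    rw [lintegral_prod _ (by exact (hF.comp measurable_prodMk_left).aemeasurable)]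
    refine lintegral_congr fun a => ?_
    rw [lintegral_count, tsum_fintype]
    simp only [Fintype.sum_bool, if_true, Bool.false_eq_true, if_false]
    ring
  · have h1 : Measurable fun p : 𝒲 × ℝ => f (p.1, p.2, true) := by fun_prop
    have h2 : Measurable fun p : 𝒲 × ℝ => f (p.1, p.2, false) := by fun_prop
    fun_prop

theorem g_nonneg_ae : ∀ᵐ p ∂S.base, 0 < S.g p.1 p.2 := S.g_pos

theorem lintegral_g_ae :
    ∀ᵐ w ∂S.covLaw, ∫⁻ a in Set.Icc (0 : ℝ) 1, ENNReal.ofReal (S.g w a) = 1 := by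
  filter_upwards [S.g_int, Measure.ae_ae_of_ae_prod S.g_pos] with w hw hpos
  rw [intervalIntegral.integral_of_le zero_le_one, ← integral_Icc_eq_integral_Ioc] at hw
  have hi : Integrable (S.g w) (volume.restrict (Set.Icc (0 : ℝ) 1)) := by
    -- Integrability comes for free: a non-integrable density would have Bochner integral `0`
    -- instead of `1`.
    by_contra hc
    rw [integral_undef hc] at hw
    exact zero_ne_one hw
  rw [← ofReal_integral_eq_lintegral_ofReal hi (hpos.mono fun a ha => ha.le), hw,
    ENNReal.ofReal_one]

theorem lintegral_mul_g {s : 𝒲 → ℝ≥0∞} (hs : Measurable s) :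
    ∫⁻ p, s p.1 * ENNReal.ofReal (S.g p.1 p.2) ∂S.base = ∫⁻ w, s w ∂S.covLaw := by
  have hg' : Measurable fun o : 𝒲 × ℝ => S.g o.1 o.2 := S.g_meas
  rw [base, lintegral_prod _ (by fun_prop)]
  refine lintegral_congr_ae ?_
  filter_upwards [S.lintegral_g_ae] with w hw
  have hgw : Measurable (S.g w) := hg'.comp measurable_prodMk_left
  rw [lintegral_const_mul _ hgw.ennreal_ofReal, hw, mul_one]

theorem integrable_g : Integrable (fun p : 𝒲 × ℝ => S.g p.1 p.2) S.base := by
  have hg' : Measurable fun o : 𝒲 × ℝ => S.g o.1 o.2 := S.g_meas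
  refine ⟨hg'.aestronglyMeasurable, ?_⟩
  have h := S.lintegral_mul_g (measurable_const (a := (1 : ℝ≥0∞)))
  rw [hasFiniteIntegral_iff_norm]
  have h2 : ∫⁻ p, ENNReal.ofReal ‖S.g p.1 p.2‖ ∂S.base =
      ∫⁻ p, 1 * ENNReal.ofReal (S.g p.1 p.2) ∂S.base := by
    refine lintegral_congr_ae ?_
    filter_upwards [S.g_nonneg_ae] with p hp
    rw [one_mul, Real.norm_of_nonneg hp.le]
  rw [h2, h]
  simp

theorem integral_mul_g {s : 𝒲 → ℝ} (hs : Measurable s) {C : ℝ} (hC : ∀ w, |s w| ≤ C) :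
    ∫ p, s p.1 * S.g p.1 p.2 ∂S.base = ∫ w, s w ∂S.covLaw := by
  have hi : Integrable (fun p : 𝒲 × ℝ => s p.1 * S.g p.1 p.2) S.base :=
    S.integrable_g.bdd_mul (c := C) (hs.comp measurable_fst).aestronglyMeasurable
      (ae_of_all _ fun p => hC p.1)
  rw [base] at hi ⊢
  rw [integral_prod _ hi]
  refine integral_congr_ae ?_
  filter_upwards [S.g_int] with w hw
  rw [intervalIntegral.integral_of_le zero_le_one, ← integral_Icc_eq_integral_Ioc] at hw
  rw [integral_const_mul, hw, mul_one]

/-- Splitting by the value of the outcome expresses the law through push-forwards of densities on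
`base`; Bochner integrals can then be computed on each piece. -/
theorem P₀_eq : S.P₀ =
    (S.base.withDensity fun p => ENNReal.ofReal (S.g p.1 p.2) * ENNReal.ofReal (S.Q₀ p.1 p.2)).map
      (fun p => (p.1, p.2, true)) +
    (S.base.withDensity fun p =>
      ENNReal.ofReal (S.g p.1 p.2) * ENNReal.ofReal (1 - S.Q₀ p.1 p.2)).map
      (fun p => (p.1, p.2, false)) := by
  have hg' : Measurable fun o : 𝒲 × ℝ => S.g o.1 o.2 := S.g_meas
  have hQ' : Measurable fun o : 𝒲 × ℝ => S.Q₀ o.1 o.2 := S.Q₀_meas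
  refine Measure.ext_of_lintegral _ fun f hf => ?_
  have h1 : Measurable fun p : 𝒲 × ℝ => f (p.1, p.2, true) := by fun_prop
  have h2 : Measurable fun p : 𝒲 × ℝ => f (p.1, p.2, false) := by fun_prop
  rw [S.lintegral_P₀ hf, lintegral_add_measure, lintegral_map hf (by fun_prop),
    lintegral_map hf (by fun_prop), lintegral_withDensity_eq_lintegral_mul _ (by fun_prop) h1,
    lintegral_withDensity_eq_lintegral_mul _ (by fun_prop) h2, ← lintegral_add_left (by fun_prop)]
  refine lintegral_congr fun p => ?_
  simp only [Pi.mul_apply]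
  ring

instance isProbabilityMeasure_P₀ : IsProbabilityMeasure S.P₀ := by
  constructor
  rw [← lintegral_one, S.lintegral_P₀ measurable_const]
  have h := S.lintegral_mul_g (measurable_const (a := (1 : ℝ≥0∞)))
  rw [lintegral_one, measure_univ] at h
  refine Eq.trans ?_ h
  refine lintegral_congr fun p => ?_
  have hm := S.Q₀_mem p.1 p.2
  rw [mul_one, mul_one, ← ENNReal.ofReal_add hm.1 (by linarith [hm.2])]
  simp

theorem integrable_P₀_and_integral {f : Obs 𝒲 → ℝ} (hf : Measurable f)
    (h1 : Integrable (fun p : 𝒲 × ℝ => S.g p.1 p.2 * f (p.1, p.2, true)) S.base)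
    (h0 : Integrable (fun p : 𝒲 × ℝ => S.g p.1 p.2 * f (p.1, p.2, false)) S.base) :
    Integrable f S.P₀ ∧ ∫ o, f o ∂S.P₀ = ∫ p, S.g p.1 p.2 *
      (S.Q₀ p.1 p.2 * f (p.1, p.2, true) + (1 - S.Q₀ p.1 p.2) * f (p.1, p.2, false)) ∂S.base := by
  have hg' : Measurable fun o : 𝒲 × ℝ => S.g o.1 o.2 := S.g_meas
  have hQ' : Measurable fun o : 𝒲 × ℝ => S.Q₀ o.1 o.2 := S.Q₀_meas
  have hQ1 : ∀ p : 𝒲 × ℝ, ‖S.Q₀ p.1 p.2‖ ≤ 1 := fun p => by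
    have := S.Q₀_mem p.1 p.2
    rw [Real.norm_eq_abs, abs_le]; constructor <;> linarith [this.1, this.2]
  have hQ0 : ∀ p : 𝒲 × ℝ, ‖1 - S.Q₀ p.1 p.2‖ ≤ 1 := fun p => by
    have := S.Q₀_mem p.1 p.2
    rw [Real.norm_eq_abs, abs_le]; constructor <;> linarith [this.1, this.2]
  have i1 := h1.bdd_mul (c := 1) hQ'.aestronglyMeasurable (ae_of_all _ hQ1)
  have i0 := h0.bdd_mul (c := 1) (f := fun p : 𝒲 × ℝ => 1 - S.Q₀ p.1 p.2)
    (measurable_const.sub hQ').aestronglyMeasurable (ae_of_all _ hQ0)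
  have e1 : ∀ᵐ p ∂S.base, S.Q₀ p.1 p.2 * (S.g p.1 p.2 * f (p.1, p.2, true)) =
      (ENNReal.ofReal (S.g p.1 p.2) * ENNReal.ofReal (S.Q₀ p.1 p.2)).toReal •
        f (p.1, p.2, true) := by
    filter_upwards [S.g_nonneg_ae] with p hp
    rw [ENNReal.toReal_mul, ENNReal.toReal_ofReal hp.le, ENNReal.toReal_ofReal (S.Q₀_mem _ _).1,
      smul_eq_mul]
    ring
  have e0 : ∀ᵐ p ∂S.base, (1 - S.Q₀ p.1 p.2) * (S.g p.1 p.2 * f (p.1, p.2, false)) =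
      (ENNReal.ofReal (S.g p.1 p.2) * ENNReal.ofReal (1 - S.Q₀ p.1 p.2)).toReal •
        f (p.1, p.2, false) := by
    filter_upwards [S.g_nonneg_ae] with p hp
    rw [ENNReal.toReal_mul, ENNReal.toReal_ofReal hp.le,
      ENNReal.toReal_ofReal (by linarith [(S.Q₀_mem p.1 p.2).2]), smul_eq_mul]
    ring
  have t1 : ∀ᵐ p ∂S.base, ENNReal.ofReal (S.g p.1 p.2) * ENNReal.ofReal (S.Q₀ p.1 p.2) < ∞ :=
    ae_of_all _ fun p => ENNReal.mul_lt_top ENNReal.ofReal_lt_top ENNReal.ofReal_lt_top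
  have t0 : ∀ᵐ p ∂S.base, ENNReal.ofReal (S.g p.1 p.2) * ENNReal.ofReal (1 - S.Q₀ p.1 p.2) < ∞ :=
    ae_of_all _ fun p => ENNReal.mul_lt_top ENNReal.ofReal_lt_top ENNReal.ofReal_lt_top
  have m1 : Measurable fun p : 𝒲 × ℝ =>
    ENNReal.ofReal (S.g p.1 p.2) * ENNReal.ofReal (S.Q₀ p.1 p.2) := by fun_prop
  have m0 : Measurable fun p : 𝒲 × ℝ =>
    ENNReal.ofReal (S.g p.1 p.2) * ENNReal.ofReal (1 - S.Q₀ p.1 p.2) := by fun_prop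
  have k1 := (integrable_withDensity_iff_integrable_smul' m1 t1).2 (i1.congr e1)
  have k0 := (integrable_withDensity_iff_integrable_smul' m0 t0).2 (i0.congr e0)
  have n1 : Measurable fun p : 𝒲 × ℝ => ((p.1, p.2, true) : Obs 𝒲) := by fun_prop
  have n0 : Measurable fun p : 𝒲 × ℝ => ((p.1, p.2, false) : Obs 𝒲) := by fun_prop
  have l1 := (integrable_map_measure hf.aestronglyMeasurable n1.aemeasurable).2 k1
  have l0 := (integrable_map_measure hf.aestronglyMeasurable n0.aemeasurable).2 k0
  refine ⟨by rw [P₀_eq]; exact l1.add_measure l0, ?_⟩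
  rw [P₀_eq, integral_add_measure l1 l0, integral_map n1.aemeasurable hf.aestronglyMeasurable,
    integral_map n0.aemeasurable hf.aestronglyMeasurable,
    integral_withDensity_eq_integral_toReal_smul m1 t1,
    integral_withDensity_eq_integral_toReal_smul m0 t0, ← integral_congr_ae e1,
    ← integral_congr_ae e0, ← integral_add i1 i0]
  refine integral_congr_ae (ae_of_all _ fun p => ?_)
  ring

theorem map_P₀ : S.P₀.map (fun o => (o.1, o.2.1)) =
    S.base.withDensity fun p => ENNReal.ofReal (S.g p.1 p.2) := by
  have hg' : Measurable fun o : 𝒲 × ℝ => S.g o.1 o.2 := S.g_meas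
  refine Measure.ext_of_lintegral _ fun f hf => ?_
  rw [lintegral_map hf (by fun_prop), S.lintegral_P₀ (by fun_prop),
    lintegral_withDensity_eq_lintegral_mul _ (by fun_prop) hf]
  refine lintegral_congr fun p => ?_
  have hm := S.Q₀_mem p.1 p.2
  rw [← add_mul, ← ENNReal.ofReal_add hm.1 (by linarith [hm.2])]
  simp

theorem ae_P₀_of_ae_base {p : 𝒲 × ℝ → Prop} (h : ∀ᵐ x ∂S.base, p x) :
    ∀ᵐ o ∂S.P₀, p (o.1, o.2.1) := by
  have hm : Measurable fun o : Obs 𝒲 => (o.1, o.2.1) := by fun_prop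
  refine ae_of_ae_map hm.aemeasurable ?_
  rw [map_P₀]
  exact (withDensity_absolutelyContinuous _ _).ae_le h

/-- Positivity of `g₀` almost everywhere makes `base` absolutely continuous with respect to the law
of `(W, A)`. It carries `L_∞(P₀)` bounds over to `base`, where the integrals are computed. -/
theorem ae_base_of_ae_P₀ {p : 𝒲 × ℝ → Prop} (hp : MeasurableSet {x | p x})
    (h : ∀ᵐ o ∂S.P₀, p (o.1, o.2.1)) : ∀ᵐ x ∂S.base, p x := by
  have hg' : Measurable fun o : 𝒲 × ℝ => S.g o.1 o.2 := S.g_meas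
  have hm : Measurable fun o : Obs 𝒲 => (o.1, o.2.1) := by fun_prop
  rw [← ae_map_iff hm.aemeasurable hp, map_P₀, ae_withDensity_iff (by fun_prop)] at h
  filter_upwards [h, S.g_nonneg_ae] with x hx hpos
  exact hx (ENNReal.ofReal_pos.2 hpos).ne'

/-! ### Smoothing -/

theorem smooth_eq (Q : 𝒲 → ℝ → ℝ) (δ : ℝ) (w : 𝒲) :
    S.smooth Q δ w = ∫ a in Set.Icc (0 : ℝ) 1, S.kern δ a * Q w a := by
  rw [smooth, intervalIntegral.integral_of_le zero_le_one, integral_Icc_eq_integral_Ioc]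

theorem measurable_kern : Measurable (fun p : ℝ × ℝ => S.kern p.1 p.2) := by
  have hK := S.K_kernel.contDiff.continuous.measurable
  unfold kern
  fun_prop

/-- The parameter will be the data sequence, on which both the regression estimate and the bandwidth
depend. -/
theorem measurable_smooth_param {τ : Type*} [MeasurableSpace τ] {q : τ → 𝒲 → ℝ → ℝ}
    (hq : Measurable fun x : τ × 𝒲 × ℝ => q x.1 x.2.1 x.2.2) {d : τ → ℝ} (hd : Measurable d) :
    Measurable fun x : τ × 𝒲 => S.smooth (q x.1) (d x.1) x.2 := by
  simp only [smooth_eq]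
  have hk : Measurable fun y : (τ × 𝒲) × ℝ => S.kern (d y.1.1) y.2 :=
    S.measurable_kern.comp (f := fun y : (τ × 𝒲) × ℝ => (d y.1.1, y.2)) (by fun_prop)
  have hq' : Measurable fun y : (τ × 𝒲) × ℝ => q y.1.1 y.1.2 y.2 :=
    hq.comp (f := fun y : (τ × 𝒲) × ℝ => (y.1.1, y.1.2, y.2)) (by fun_prop)
  exact (StronglyMeasurable.integral_prod_right' (hk.mul hq').stronglyMeasurable).measurable

theorem _root_.DoseResponse.IsRegression.measurable_smooth {Q : 𝒲 → ℝ → ℝ} (hQ : IsRegression Q)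
    (δ : ℝ) : Measurable (S.smooth Q δ) := by
  have h := S.measurable_smooth_param (τ := Unit) (q := fun _ => Q) (d := fun _ => δ)
    (hQ.meas.comp measurable_snd) measurable_const
  exact h.comp (measurable_const.prodMk measurable_id : Measurable fun w : 𝒲 => ((), w))

theorem exists_kern_le (δ : ℝ) : ∃ C : ℝ, 0 ≤ C ∧ ∀ a, |S.kern δ a| ≤ C := by
  obtain ⟨C, hC0, hC⟩ := S.K_kernel.scaleDeriv_bounded 0
  refine ⟨|δ⁻¹| * C, by positivity, fun a => ?_⟩
  rw [kern, abs_mul]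
  gcongr
  exact hC _

theorem _root_.DoseResponse.IsRegression.abs_le {Q : 𝒲 → ℝ → ℝ} (hQ : IsRegression Q) (w : 𝒲)
    (a : ℝ) : |Q w a| ≤ 1 := by
  rw [abs_of_nonneg (hQ.mem w a).1]
  exact (hQ.mem w a).2

theorem exists_smooth_le (δ : ℝ) : ∃ C : ℝ, 0 ≤ C ∧
    ∀ {Q : 𝒲 → ℝ → ℝ}, IsRegression Q → ∀ w, |S.smooth Q δ w| ≤ C := by
  obtain ⟨C, hC0, hC⟩ := S.exists_kern_le δ
  refine ⟨C, hC0, fun {Q} hQ w => ?_⟩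
  rw [smooth_eq, ← Real.norm_eq_abs]
  refine (norm_integral_le_of_norm_le_const (C := C) (ae_of_all _ fun a => ?_)).trans ?_
  · rw [Real.norm_eq_abs, abs_mul]
    exact (mul_le_of_le_one_right (abs_nonneg _) (hQ.abs_le w a)).trans (hC a)
  · simp

theorem integral_kern_mul {Q : 𝒲 → ℝ → ℝ} (hQ : IsRegression Q) (δ : ℝ) :
    Integrable (fun p : 𝒲 × ℝ => S.kern δ p.2 * Q p.1 p.2) S.base ∧
    ∫ p, S.kern δ p.2 * Q p.1 p.2 ∂S.base = S.Psi S.covLaw Q δ := by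
  obtain ⟨C, hC0, hC⟩ := S.exists_kern_le δ
  have hi : Integrable (fun p : 𝒲 × ℝ => S.kern δ p.2 * Q p.1 p.2) S.base := by
    have hQ' : Measurable fun p : 𝒲 × ℝ => Q p.1 p.2 := hQ.meas
    refine integrable_bdd ((S.measurable_kern.comp
      (measurable_const.prodMk measurable_snd)).mul hQ') (C := C) fun p => ?_
    rw [abs_mul]
    exact (mul_le_of_le_one_right (abs_nonneg _) (hQ.abs_le _ _)).trans (hC _)
  refine ⟨hi, ?_⟩
  rw [base] at hi ⊢
  rw [integral_prod _ hi, Psi]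
  refine integral_congr_ae (ae_of_all _ fun w => ?_)
  rw [smooth_eq]

/-! ### The uncentred gradient and the remainder -/

/-- The canonical gradient without its centring constant. -/
noncomputable def score (Q : 𝒲 → ℝ → ℝ) (δ : ℝ) (o : Obs 𝒲) : ℝ :=
  S.kern δ o.2.1 / S.g o.1 o.2.1 * (yval o.2.2 - Q o.1 o.2.1) + S.smooth Q δ o.1

theorem grad_eq (ν : Measure 𝒲) (Q : 𝒲 → ℝ → ℝ) (δ : ℝ) (o : Obs 𝒲) :
    S.grad ν Q δ o = S.score Q δ o - S.Psi ν Q δ := rfl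

theorem measurable_yval : Measurable yval := measurable_from_top

theorem measurable_score_param {τ : Type*} [MeasurableSpace τ] {q : τ → 𝒲 → ℝ → ℝ}
    (hq : Measurable fun x : τ × 𝒲 × ℝ => q x.1 x.2.1 x.2.2) {d : τ → ℝ} (hd : Measurable d) :
    Measurable fun x : τ × Obs 𝒲 => S.score (q x.1) (d x.1) x.2 := by
  unfold score
  have h1 : Measurable fun x : τ × Obs 𝒲 => S.kern (d x.1) x.2.2.1 :=
    S.measurable_kern.comp (f := fun x : τ × Obs 𝒲 => (d x.1, x.2.2.1)) (by fun_prop)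
  have h2 : Measurable fun x : τ × Obs 𝒲 => S.g x.2.1 x.2.2.1 :=
    S.g_meas.comp (f := fun x : τ × Obs 𝒲 => (x.2.1, x.2.2.1)) (by fun_prop)
  have h3 : Measurable fun x : τ × Obs 𝒲 => yval x.2.2.2 := measurable_yval.comp (by fun_prop)
  have h4 : Measurable fun x : τ × Obs 𝒲 => q x.1 x.2.1 x.2.2.1 :=
    hq.comp (f := fun x : τ × Obs 𝒲 => (x.1, x.2.1, x.2.2.1)) (by fun_prop)
  have h5 : Measurable fun x : τ × Obs 𝒲 => S.smooth (q x.1) (d x.1) x.2.1 :=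
    (S.measurable_smooth_param hq hd).comp (f := fun x : τ × Obs 𝒲 => (x.1, x.2.1)) (by fun_prop)
  exact ((h1.div h2).mul (h3.sub h4)).add h5

theorem _root_.DoseResponse.IsRegression.measurable_score {Q : 𝒲 → ℝ → ℝ} (hQ : IsRegression Q)
    (δ : ℝ) : Measurable (S.score Q δ) := by
  have hq : Measurable fun x : Unit × 𝒲 × ℝ => Q x.2.1 x.2.2 := hQ.meas.comp measurable_snd
  have h := S.measurable_score_param (q := fun _ => Q) (d := fun _ => δ) hq measurable_const
  have hi : Measurable fun o : Obs 𝒲 => ((), o) := measurable_prodMk_left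
  have e : S.score Q δ = (fun x : Unit × Obs 𝒲 => S.score Q δ x.2) ∘ fun o => ((), o) := rfl
  rw [e]
  exact Measurable.comp h hi

/-- Averaging the residual part over the outcome and the dose cancels `g₀` and leaves the smoothed
`Q̄₀ - Q̄`; the term `smooth Q` adds the smoothed `Q̄` back. With the mechanism known,
misspecification of `Q̄` causes no bias at all. -/
theorem integral_score {Q : 𝒲 → ℝ → ℝ} (hQ : IsRegression Q) (δ : ℝ) :
    Integrable (S.score Q δ) S.P₀ ∧ ∫ o, S.score Q δ o ∂S.P₀ = S.Psi S.covLaw S.Q₀ δ := by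
  obtain ⟨C, hC0, hC⟩ := S.exists_smooth_le δ
  obtain ⟨C', hC0', hC'⟩ := S.exists_kern_le δ
  have hsm := hQ.measurable_smooth S δ
  obtain ⟨i1, e1⟩ := S.integral_kern_mul hQ δ
  obtain ⟨i2, e2⟩ := S.integral_kern_mul S.isRegression_Q₀ δ
  have ik : Integrable (fun p : 𝒲 × ℝ => S.kern δ p.2) S.base :=
    integrable_bdd (S.measurable_kern.comp (measurable_const.prodMk measurable_snd))
      (fun p => hC' p.2)
  have ig : Integrable (fun p : 𝒲 × ℝ => S.smooth Q δ p.1 * S.g p.1 p.2) S.base :=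
    S.integrable_g.bdd_mul (c := C) (hsm.comp measurable_fst).aestronglyMeasurable
      (ae_of_all _ fun p => hC hQ p.1)
  have key : ∀ y : Bool, Integrable
      (fun p : 𝒲 × ℝ => S.g p.1 p.2 * S.score Q δ (p.1, p.2, y)) S.base := by
    intro y
    refine (((ik.const_mul (yval y)).sub i1).add ig).congr ?_
    filter_upwards [S.g_nonneg_ae] with p hp
    have := hp.ne'
    simp only [score, Pi.add_apply, Pi.sub_apply]
    field_simp
    try ring
  obtain ⟨hi, he⟩ := S.integrable_P₀_and_integral (hQ.measurable_score S δ) (key true) (key false)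
  refine ⟨hi, ?_⟩
  rw [he]
  have : ∀ᵐ p ∂S.base, S.g p.1 p.2 * (S.Q₀ p.1 p.2 * S.score Q δ (p.1, p.2, true) +
      (1 - S.Q₀ p.1 p.2) * S.score Q δ (p.1, p.2, false)) =
      S.kern δ p.2 * S.Q₀ p.1 p.2 - S.kern δ p.2 * Q p.1 p.2 + S.smooth Q δ p.1 * S.g p.1 p.2 := by
    filter_upwards [S.g_nonneg_ae] with p hp
    have := hp.ne'
    simp only [score, yval, if_true, Bool.false_eq_true, if_false]
    field_simp
    ring
  rw [integral_congr_ae this, integral_add (by exact i2.sub i1) ig, integral_sub i2 i1, e1, e2,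
    S.integral_mul_g hsm (hC hQ), Psi, Psi]
  ring

/-- The plug-in value `Psi ν Q` enters once by itself and once, with opposite sign, as the centring
constant of the gradient; the mean of the score does the rest. -/
theorem rem_eq_zero (ν : Measure 𝒲) {Q : 𝒲 → ℝ → ℝ} (hQ : IsRegression Q) (δ : ℝ) :
    S.rem ν Q δ = 0 := by
  obtain ⟨hi, he⟩ := S.integral_score hQ δ
  simp only [rem, grad_eq]
  rw [integral_sub hi (integrable_const _), he]
  simp

theorem fitRem_eq_zero (m : ℕ) (o : ℕ → Obs 𝒲) : S.fitRem m o = fun _ => 0 := by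
  ext δ
  exact S.rem_eq_zero _ (S.isRegression_fitQ m o) δ

theorem remainder_conditions {Ω : Type*} [MeasurableSpace Ω] (Pr : Measure Ω)
    (O : ℕ → Ω → Obs 𝒲) (p₁ p₂ : ℝ) :
    S.A3 Pr O p₁ ∧ S.A5 Pr O p₁ p₂ ∧ ∀ r₀ : ℝ, 0 < r₀ → S.A7 Pr O p₂ r₀ ∧ S.A8 Pr O p₂ r₀ := by
  have hz : ∀ a : ℕ → ℝ, LittleOP Pr (fun (_ : ℕ) (_ : Ω) => (0 : ℝ)) a := by
    intro a c hc
    simp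
  have hzB : ∀ a : ℕ → ℝ, BigOP Pr (fun (_ : ℕ) (_ : Ω) => (0 : ℝ)) a := by
    intro a c hc
    exact ⟨0, by simp⟩
  refine ⟨⟨1, one_pos, fun d _ => ?_⟩, ⟨1, 1, 1, one_pos, one_pos, one_pos, fun d _ => ?_⟩,
    fun r₀ _ => ⟨Eventually.of_forall fun r => ?_, Eventually.of_forall fun r => ?_⟩⟩
  · simpa only [fitRem_eq_zero] using hz _
  · simpa only [fitRem_eq_zero, deriv_const] using hzB _
  · simpa only [fitRem_eq_zero] using hz _
  · simpa only [fitRem_eq_zero, deriv_const] using hz _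

end Setting

/-- Differentiation under the integral sign for integrands whose derivatives blow up at most
polynomially at `0`. -/
theorem hasDerivAt_integral_of_polynomial_bound {X : Type*} [MeasurableSpace X] {μ : Measure X}
    [IsFiniteMeasure μ] {f f' : ℝ → X → ℝ} {C C' : ℝ} {k k' : ℕ} (hC' : 0 ≤ C')
    (hf : ∀ δ, Measurable (f δ)) (hf' : ∀ δ, Measurable (f' δ))
    (hfb : ∀ δ, 0 < δ → ∀ x, |f δ x| ≤ C * δ⁻¹ ^ k)
    (hfb' : ∀ δ, 0 < δ → ∀ x, |f' δ x| ≤ C' * δ⁻¹ ^ k')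
    (hd : ∀ δ, 0 < δ → ∀ x, HasDerivAt (fun δ => f δ x) (f' δ x) δ) {δ : ℝ} (hδ : 0 < δ) :
    HasDerivAt (fun δ => ∫ x, f δ x ∂μ) (∫ x, f' δ x ∂μ) δ := by
  -- Bandwidths above `δ / 2` stay away from the singularity at zero, so the polynomial bound on
  -- `f'` becomes a constant there.
  refine (hasDerivAt_integral_of_dominated_loc_of_deriv_le (s := Set.Ioi (δ / 2))
    (bound := fun _ => C' * (δ / 2)⁻¹ ^ k') (Ioi_mem_nhds (by linarith))
    (Eventually.of_forall fun δ => (hf δ).aestronglyMeasurable)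
    (Setting.integrable_bdd (hf δ) (hfb δ hδ)) (hf' δ).aestronglyMeasurable
    (ae_of_all _ fun x y hy => ?_) (integrable_const _) (ae_of_all _ fun x y hy => ?_)).2
  · have hy0 : 0 < y := lt_trans (by positivity) hy
    refine (hfb' y hy0 x).trans ?_
    have : δ / 2 ≤ y := le_of_lt hy
    gcongr
  · exact hd y (lt_trans (by positivity) hy) x

namespace Setting

variable {𝒲 : Type*} [MeasurableSpace 𝒲] (S : Setting 𝒲)

/-! ### Derivatives of the kernel in the bandwidth -/

/-- The `j`-th derivative in `δ` of `K_{δ, a₀}(a)`. -/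
noncomputable def kernD (j : ℕ) (δ a : ℝ) : ℝ := δ⁻¹ ^ (j + 1) * scaleDeriv S.K j ((a - S.a₀) / δ)

/-- The `j`-th derivative in `δ` of `K_{δ, a₀}(a) ^ 2`. -/
noncomputable def kernSqD (j : ℕ) (δ a : ℝ) : ℝ :=
  δ⁻¹ ^ (j + 2) * scaleDerivSq S.K j ((a - S.a₀) / δ)

theorem kernD_zero (δ a : ℝ) : S.kernD 0 δ a = S.kern δ a := by
  simp [kernD, kern, scaleDeriv]

theorem kernSqD_zero (δ a : ℝ) : S.kernSqD 0 δ a = S.kern δ a ^ 2 := by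
  simp only [kernSqD, kern, scaleDerivSq]; ring

theorem measurable_kernD (j : ℕ) : Measurable fun p : ℝ × ℝ => S.kernD j p.1 p.2 := by
  have h := (S.K_kernel.continuous_scaleDeriv j).measurable
  unfold kernD
  fun_prop

theorem measurable_kernSqD (j : ℕ) : Measurable fun p : ℝ × ℝ => S.kernSqD j p.1 p.2 := by
  have h := (S.K_kernel.continuous_scaleDerivSq j).measurable
  unfold kernSqD
  fun_prop

theorem measurable_kernD' (j : ℕ) (δ : ℝ) : Measurable (S.kernD j δ) :=
  (S.measurable_kernD j).comp measurable_prodMk_left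

theorem measurable_kernSqD' (j : ℕ) (δ : ℝ) : Measurable (S.kernSqD j δ) :=
  (S.measurable_kernSqD j).comp measurable_prodMk_left

/-- Both families are constant from `j = 2` on, so only three orders have to be summed to obtain a
common bound for all `j`. -/
theorem exists_kernel_const : ∃ C : ℝ, 1 ≤ C ∧ ∀ j : ℕ,
    (∀ u, |scaleDeriv S.K j u| ≤ C) ∧ (∀ u, |scaleDerivSq S.K j u| ≤ C) ∧
    ∫ u, |scaleDeriv S.K j u| ≤ C ∧ ∫ u, |scaleDerivSq S.K j u| ≤ C := by
  have hsq : ∀ j, ∃ C : ℝ, 0 ≤ C ∧ ∀ u, |scaleDerivSq S.K j u| ≤ C := by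
    obtain ⟨A, hA0, hA⟩ := S.K_kernel.scaleDeriv_bounded 0
    obtain ⟨B, hB0, hB⟩ := S.K_kernel.scaleDeriv_bounded 1
    obtain ⟨D, hD0, hD⟩ := S.K_kernel.scaleDeriv_bounded 2
    simp only [scaleDeriv] at hA
    intro j
    refine ⟨A ^ 2 + 2 * A * B + (2 * B ^ 2 + 2 * A * D), by positivity, fun u => ?_⟩
    have a1 := hA u
    have b1 := hB u
    have d1 := hD u
    rcases j with _ | _ | j
    · change |S.K u ^ 2| ≤ _
      rw [abs_pow]
      have : |S.K u| ^ 2 ≤ A ^ 2 := by gcongr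
      have : 0 ≤ 2 * A * B + (2 * B ^ 2 + 2 * A * D) := by positivity
      linarith
    · change |2 * S.K u * scaleDeriv S.K 1 u| ≤ _
      rw [abs_mul, abs_mul, abs_two]
      have : 2 * |S.K u| * |scaleDeriv S.K 1 u| ≤ 2 * A * B := by gcongr
      have : 0 ≤ A ^ 2 + (2 * B ^ 2 + 2 * A * D) := by positivity
      linarith
    · change |2 * scaleDeriv S.K 1 u ^ 2 + 2 * S.K u * scaleDeriv S.K 2 u| ≤ _
      have h1 : |2 * scaleDeriv S.K 1 u ^ 2| ≤ 2 * B ^ 2 := by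
        rw [abs_mul, abs_two, abs_pow]; gcongr
      have h2 : |2 * S.K u * scaleDeriv S.K 2 u| ≤ 2 * A * D := by
        rw [abs_mul, abs_mul, abs_two]; gcongr
      have : 0 ≤ A ^ 2 + 2 * A * B := by positivity
      linarith [abs_add_le (2 * scaleDeriv S.K 1 u ^ 2) (2 * S.K u * scaleDeriv S.K 2 u)]
  choose c1 hc1 hb1 using S.K_kernel.scaleDeriv_bounded
  choose c2 hc2 hb2 using hsq
  have i1 : ∀ j, 0 ≤ ∫ u, |scaleDeriv S.K j u| := fun j => integral_nonneg fun _ => abs_nonneg _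
  have i2 : ∀ j, 0 ≤ ∫ u, |scaleDerivSq S.K j u| := fun j => integral_nonneg fun _ => abs_nonneg _
  have key : ∀ f : ℕ → ℝ, (∀ j, 0 ≤ f j) → ∀ j ≤ 2, f j ≤ ∑ i ∈ Finset.range 3, f i := by
    intro f hf j hj
    exact Finset.single_le_sum (f := f) (fun i _ => hf i) (Finset.mem_range.2 (by omega))
  refine ⟨1 + ∑ i ∈ Finset.range 3, (c1 i + c2 i + ∫ u, |scaleDeriv S.K i u|) +
    ∑ i ∈ Finset.range 3, ∫ u, |scaleDerivSq S.K i u|, ?_, ?_⟩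
  · have h1 : 0 ≤ ∑ i ∈ Finset.range 3, (c1 i + c2 i + ∫ u, |scaleDeriv S.K i u|) :=
      Finset.sum_nonneg fun i _ => by have := hc1 i; have := hc2 i; have := i1 i; positivity
    have h2 : 0 ≤ ∑ i ∈ Finset.range 3, ∫ u, |scaleDerivSq S.K i u| :=
      Finset.sum_nonneg fun i _ => i2 i
    linarith
  · have main : ∀ j ≤ 2, (∀ u, |scaleDeriv S.K j u| ≤ 1 + ∑ i ∈ Finset.range 3,
        (c1 i + c2 i + ∫ u, |scaleDeriv S.K i u|) +
        ∑ i ∈ Finset.range 3, ∫ u, |scaleDerivSq S.K i u|) ∧ (∀ u, |scaleDerivSq S.K j u| ≤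
        1 + ∑ i ∈ Finset.range 3, (c1 i + c2 i + ∫ u, |scaleDeriv S.K i u|) +
        ∑ i ∈ Finset.range 3, ∫ u, |scaleDerivSq S.K i u|) ∧
        ∫ u, |scaleDeriv S.K j u| ≤ 1 + ∑ i ∈ Finset.range 3,
        (c1 i + c2 i + ∫ u, |scaleDeriv S.K i u|) +
        ∑ i ∈ Finset.range 3, ∫ u, |scaleDerivSq S.K i u| ∧
        ∫ u, |scaleDerivSq S.K j u| ≤ 1 + ∑ i ∈ Finset.range 3,
        (c1 i + c2 i + ∫ u, |scaleDeriv S.K i u|) +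
        ∑ i ∈ Finset.range 3, ∫ u, |scaleDerivSq S.K i u| := by
      intro j hj
      have k1 := key (fun i => c1 i + c2 i + ∫ u, |scaleDeriv S.K i u|)
        (fun i => by have := hc1 i; have := hc2 i; have := i1 i; positivity) j hj
      have k2 := key (fun i => ∫ u, |scaleDerivSq S.K i u|) i2 j hj
      have := i1 j
      have := i2 j
      have := hc1 j
      have := hc2 j
      refine ⟨fun u => ?_, fun u => ?_, ?_, ?_⟩
      · linarith [hb1 j u]
      · linarith [hb2 j u]
      · linarith
      · linarith
    intro j
    rcases j with _ | _ | j
    · exact main 0 (by norm_num)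
    · exact main 1 (by norm_num)
    · exact main 2 le_rfl

/-- A common bound for the kernel, its scaled derivatives and their integrals. -/
noncomputable def kernelConst : ℝ := S.exists_kernel_const.choose

theorem one_le_kernelConst : 1 ≤ S.kernelConst := S.exists_kernel_const.choose_spec.1

theorem kernelConst_pos : 0 < S.kernelConst := one_pos.trans_le S.one_le_kernelConst

theorem abs_kernD_le (j : ℕ) {δ : ℝ} (hδ : 0 < δ) (a : ℝ) :
    |S.kernD j δ a| ≤ S.kernelConst * δ⁻¹ ^ (j + 1) := by
  rw [kernD, abs_mul, abs_of_pos (by positivity : 0 < δ⁻¹ ^ (j + 1)), mul_comm]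
  gcongr
  exact (S.exists_kernel_const.choose_spec.2 j).1 _

theorem abs_kernSqD_le (j : ℕ) {δ : ℝ} (hδ : 0 < δ) (a : ℝ) :
    |S.kernSqD j δ a| ≤ S.kernelConst * δ⁻¹ ^ (j + 2) := by
  rw [kernSqD, abs_mul, abs_of_pos (by positivity : 0 < δ⁻¹ ^ (j + 2)), mul_comm]
  gcongr
  exact (S.exists_kernel_const.choose_spec.2 j).2.1 _

/-- Each derivative in the bandwidth costs one factor `δ⁻¹`, but the `L¹` norm of the kernel itself
is scale-free. This saves one power compared with the supremum bound and makes the smoothing terms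
of lower order than the main variance term. -/
theorem integral_abs_kernD_le (j : ℕ) {δ : ℝ} (hδ : 0 < δ) :
    ∫ a in Set.Icc (0 : ℝ) 1, |S.kernD j δ a| ≤ S.kernelConst * δ⁻¹ ^ j := by
  have h := integral_rescaled_abs_le (a₀ := S.a₀) hδ (S.K_kernel.scaleDeriv_integrable j)
  have h2 := (S.exists_kernel_const.choose_spec.2 j).2.2.1
  have h3 : ∀ a, |S.kernD j δ a| = δ⁻¹ ^ j * |δ⁻¹ * scaleDeriv S.K j ((a - S.a₀) / δ)| := by
    intro a
    rw [kernD, pow_succ, mul_assoc, abs_mul, abs_of_pos (by positivity : 0 < δ⁻¹ ^ j)]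
  simp only [h3]
  rw [integral_const_mul, mul_comm]
  gcongr
  exact h.trans h2

theorem integral_abs_kernSqD_le (j : ℕ) {δ : ℝ} (hδ : 0 < δ) :
    ∫ a in Set.Icc (0 : ℝ) 1, |S.kernSqD j δ a| ≤ S.kernelConst * δ⁻¹ ^ (j + 1) := by
  have h := integral_rescaled_abs_le (a₀ := S.a₀) hδ (S.K_kernel.scaleDerivSq_integrable j)
  have h2 := (S.exists_kernel_const.choose_spec.2 j).2.2.2
  have h3 : ∀ a, |S.kernSqD j δ a| =
      δ⁻¹ ^ (j + 1) * |δ⁻¹ * scaleDerivSq S.K j ((a - S.a₀) / δ)| := by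
    intro a
    rw [kernSqD, pow_succ, mul_assoc, abs_mul, abs_of_pos (by positivity : 0 < δ⁻¹ ^ (j + 1))]
  simp only [h3]
  rw [integral_const_mul, mul_comm]
  gcongr
  exact h.trans h2

theorem hasDerivAt_kernD {j : ℕ} (hj : j ≤ 1) {δ : ℝ} (hδ : 0 < δ) (a : ℝ) :
    HasDerivAt (fun δ => S.kernD j δ a) (S.kernD (j + 1) δ a) δ := by
  interval_cases j
  · exact S.K_kernel.hasDerivAt_rescaled_zero hδ
  · exact S.K_kernel.hasDerivAt_rescaled_one hδ

theorem hasDerivAt_kernSqD {j : ℕ} (hj : j ≤ 1) {δ : ℝ} (hδ : 0 < δ) (a : ℝ) :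
    HasDerivAt (fun δ => S.kernSqD j δ a) (S.kernSqD (j + 1) δ a) δ := by
  -- `kernSqD` is the square of `kernD 0`, and its higher orders are exactly what the product rule
  -- produces.
  have e0 : ∀ δ, S.kernSqD 0 δ a = S.kernD 0 δ a ^ 2 := fun δ => by
    simp only [kernSqD, kernD, scaleDeriv, scaleDerivSq]; ring
  have e1 : ∀ δ, S.kernSqD 1 δ a = 2 * S.kernD 0 δ a * S.kernD 1 δ a := fun δ => by
    simp only [kernSqD, kernD, scaleDerivSq]; simp only [scaleDeriv]; ring
  have e2 : ∀ δ, S.kernSqD 2 δ a = 2 * S.kernD 1 δ a ^ 2 + 2 * S.kernD 0 δ a * S.kernD 2 δ a :=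
    fun δ => by simp only [kernSqD, kernD, scaleDerivSq]; simp only [scaleDeriv]; ring
  have d0 := S.hasDerivAt_kernD zero_le_one hδ a
  have d1 := S.hasDerivAt_kernD le_rfl hδ a
  interval_cases j
  · simp only [e0, zero_add, e1]
    refine (d0.pow 2).congr_deriv ?_
    simp
  · simp only [e1, one_add_one_eq_two, e2]
    refine ((d0.const_mul 2).mul d1).congr_deriv ?_
    ring

/-! ### Derivatives of the smoothed regression functions -/

/-- The `j`-th derivative in `δ` of `∫ K_{δ, a₀}(a) Q̄(a, w) da`. -/
noncomputable def smoothD (Q : 𝒲 → ℝ → ℝ) (j : ℕ) (δ : ℝ) (w : 𝒲) : ℝ :=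
  ∫ a in Set.Icc (0 : ℝ) 1, S.kernD j δ a * Q w a

theorem smoothD_zero (Q : 𝒲 → ℝ → ℝ) (δ : ℝ) (w : 𝒲) : S.smoothD Q 0 δ w = S.smooth Q δ w := by
  simp only [smoothD, smooth_eq, kernD_zero]

variable {Q Q' : 𝒲 → ℝ → ℝ}

theorem measurable_smoothD (hQ : IsRegression Q) (j : ℕ) (δ : ℝ) : Measurable (S.smoothD Q j δ) := by
  have h1 : Measurable fun p : 𝒲 × ℝ => S.kernD j δ p.2 :=
    (S.measurable_kernD' j δ).comp measurable_snd
  have h2 : Measurable fun p : 𝒲 × ℝ => Q p.1 p.2 := hQ.meas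
  exact (StronglyMeasurable.integral_prod_right' (h1.mul h2).stronglyMeasurable).measurable

/-- The almost everywhere form is needed because differences of regression functions are only
controlled in `L_∞`. -/
theorem abs_integral_kernD_mul_le (j : ℕ) {δ : ℝ} (hδ : 0 < δ) {f : ℝ → ℝ} {η : ℝ} (hη : 0 ≤ η)
    (hf : ∀ᵐ a ∂(volume.restrict (Set.Icc (0 : ℝ) 1)), |f a| ≤ η) :
    |∫ a in Set.Icc (0 : ℝ) 1, S.kernD j δ a * f a| ≤ η * (S.kernelConst * δ⁻¹ ^ j) := by
  rw [← Real.norm_eq_abs]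
  have hi : Integrable (fun a => |S.kernD j δ a|) (volume.restrict (Set.Icc (0 : ℝ) 1)) :=
    (integrable_bdd (S.measurable_kernD' j δ) (S.abs_kernD_le j hδ)).abs
  refine (norm_integral_le_of_norm_le (hi.const_mul η) ?_).trans ?_
  · filter_upwards [hf] with a ha
    rw [norm_mul, Real.norm_eq_abs, Real.norm_eq_abs, mul_comm]
    gcongr
  · rw [integral_const_mul]
    exact mul_le_mul_of_nonneg_left (S.integral_abs_kernD_le j hδ) hη

theorem abs_smoothD_le (hQ : IsRegression Q) (j : ℕ) {δ : ℝ} (hδ : 0 < δ) (w : 𝒲) :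
    |S.smoothD Q j δ w| ≤ S.kernelConst * δ⁻¹ ^ j := by
  have := S.abs_integral_kernD_mul_le j hδ zero_le_one (ae_of_all _ (hQ.abs_le w))
  rwa [one_mul] at this

theorem integrable_kernD_mul (hQ : IsRegression Q) (j : ℕ) {δ : ℝ} (hδ : 0 < δ) (w : 𝒲) :
    Integrable (fun a => S.kernD j δ a * Q w a) (volume.restrict (Set.Icc (0 : ℝ) 1)) := by
  refine integrable_bdd ((S.measurable_kernD' j δ).mul (hQ.meas.comp measurable_prodMk_left))
    (C := S.kernelConst * δ⁻¹ ^ (j + 1)) fun a => ?_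
  rw [abs_mul]
  exact (mul_le_of_le_one_right (abs_nonneg _) (hQ.abs_le w a)).trans (S.abs_kernD_le j hδ a)

theorem abs_smoothD_sub_le (hQ : IsRegression Q) (hQ' : IsRegression Q') {η : ℝ} (hη : 0 ≤ η)
    (h : ∀ᵐ p ∂S.base, |Q p.1 p.2 - Q' p.1 p.2| ≤ η) (j : ℕ) {δ : ℝ} (hδ : 0 < δ) :
    ∀ᵐ w ∂S.covLaw, |S.smoothD Q j δ w - S.smoothD Q' j δ w| ≤ η * (S.kernelConst * δ⁻¹ ^ j) := by
  filter_upwards [Measure.ae_ae_of_ae_prod h] with w hw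
  rw [smoothD, smoothD, ← integral_sub (S.integrable_kernD_mul hQ j hδ w)
    (S.integrable_kernD_mul hQ' j hδ w)]
  simp only [← mul_sub]
  exact S.abs_integral_kernD_mul_le j hδ hη hw

theorem hasDerivAt_smoothD (hQ : IsRegression Q) {j : ℕ} (hj : j ≤ 1) {δ : ℝ} (hδ : 0 < δ)
    (w : 𝒲) : HasDerivAt (fun δ => S.smoothD Q j δ w) (S.smoothD Q (j + 1) δ w) δ := by
  have hQw : Measurable (Q w) := hQ.meas.comp measurable_prodMk_left
  have hb : ∀ i δ, 0 < δ → ∀ a, |S.kernD i δ a * Q w a| ≤ S.kernelConst * δ⁻¹ ^ (i + 1) := by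
    intro i δ hδ a
    rw [abs_mul]
    exact (mul_le_of_le_one_right (abs_nonneg _) (hQ.abs_le w a)).trans (S.abs_kernD_le i hδ a)
  exact hasDerivAt_integral_of_polynomial_bound S.kernelConst_pos.le
    (fun δ => (S.measurable_kernD' j δ).mul hQw) (fun δ => (S.measurable_kernD' (j + 1) δ).mul hQw)
    (hb j) (hb (j + 1)) (fun δ hδ a => (S.hasDerivAt_kernD hj hδ a).mul_const _) hδ

/-- The `j`-th derivative of `∫ (2 Q̄_δ Q̄_{0, δ} - Q̄_δ²)`, before integration. -/
noncomputable def crossD (Q : 𝒲 → ℝ → ℝ) : ℕ → ℝ → 𝒲 → ℝ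
  | 0, δ, w => S.smoothD Q 0 δ w * (2 * S.smoothD S.Q₀ 0 δ w - S.smoothD Q 0 δ w)
  | 1, δ, w => S.smoothD Q 1 δ w * (2 * S.smoothD S.Q₀ 0 δ w - S.smoothD Q 0 δ w) +
      S.smoothD Q 0 δ w * (2 * S.smoothD S.Q₀ 1 δ w - S.smoothD Q 1 δ w)
  | _, δ, w => S.smoothD Q 2 δ w * (2 * S.smoothD S.Q₀ 0 δ w - S.smoothD Q 0 δ w) +
      2 * (S.smoothD Q 1 δ w * (2 * S.smoothD S.Q₀ 1 δ w - S.smoothD Q 1 δ w)) +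
      S.smoothD Q 0 δ w * (2 * S.smoothD S.Q₀ 2 δ w - S.smoothD Q 2 δ w)

theorem measurable_crossD (hQ : IsRegression Q) (j : ℕ) (δ : ℝ) :
    Measurable (S.crossD Q j δ) := by
  have h := fun j => S.measurable_smoothD hQ j δ
  have h' := fun j => S.measurable_smoothD S.isRegression_Q₀ j δ
  rcases j with _ | _ | j
  · exact (h 0).mul (((h' 0).const_mul 2).sub (h 0))
  · exact ((h 1).mul (((h' 0).const_mul 2).sub (h 0))).add
      ((h 0).mul (((h' 1).const_mul 2).sub (h 1)))
  · exact (((h 2).mul (((h' 0).const_mul 2).sub (h 0))).add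
      (((h 1).mul (((h' 1).const_mul 2).sub (h 1))).const_mul 2)).add
      ((h 0).mul (((h' 2).const_mul 2).sub (h 2)))

theorem abs_mul_two_mul_sub_le {x y z A B : ℝ} (hx : |x| ≤ A) (hy : |y| ≤ B) (hz : |z| ≤ B) :
    |x * (2 * y - z)| ≤ 3 * (A * B) := by
  rw [abs_mul]
  have h1 : |2 * y - z| ≤ 3 * B := by
    rw [abs_le] at *; constructor <;> linarith
  have hA : 0 ≤ A := (abs_nonneg x).trans hx
  calc |x| * |2 * y - z| ≤ A * (3 * B) := by gcongr
    _ = 3 * (A * B) := by ring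

theorem abs_crossD_le (hQ : IsRegression Q) {j : ℕ} (hj : j ≤ 2) {δ : ℝ} (hδ : 0 < δ) (w : 𝒲) :
    |S.crossD Q j δ w| ≤ 12 * S.kernelConst ^ 2 * δ⁻¹ ^ j := by
  have h := fun i => S.abs_smoothD_le hQ i hδ w
  have h' := fun i => S.abs_smoothD_le S.isRegression_Q₀ i hδ w
  have key := fun i k => abs_mul_two_mul_sub_le (h i) (h' k) (h k)
  have hp : 0 < S.kernelConst ^ 2 * δ⁻¹ ^ j := by
    have := S.kernelConst_pos; positivity
  interval_cases j
  · refine (key 0 0).trans ?_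
    simp only [pow_zero] at hp ⊢
    nlinarith
  · refine (abs_add_le _ _).trans ((add_le_add (key 1 0) (key 0 1)).trans ?_)
    simp only [pow_zero, pow_one] at hp ⊢
    nlinarith
  -- This is the worst case for the constant: the three products contribute `3 + 2 * 3 + 3 = 12`.
  · refine (abs_add_three _ _ _).trans ?_
    have h11 := key 1 1
    have h20 := key 2 0
    have h02 := key 0 2
    rw [abs_mul 2, abs_two]
    simp only [pow_zero, pow_one] at hp h11 h20 h02 ⊢
    nlinarith

theorem hasDerivAt_crossD (hQ : IsRegression Q) {j : ℕ} (hj : j ≤ 1) {δ : ℝ} (hδ : 0 < δ)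
    (w : 𝒲) : HasDerivAt (fun δ => S.crossD Q j δ w) (S.crossD Q (j + 1) δ w) δ := by
  have d0 := S.hasDerivAt_smoothD hQ zero_le_one hδ w
  have d1 := S.hasDerivAt_smoothD hQ le_rfl hδ w
  have e0 := S.hasDerivAt_smoothD S.isRegression_Q₀ zero_le_one hδ w
  have e1 := S.hasDerivAt_smoothD S.isRegression_Q₀ le_rfl hδ w
  interval_cases j
  · exact (d0.mul ((e0.const_mul 2).sub d0)).congr_deriv rfl
  · refine ((d1.mul ((e0.const_mul 2).sub d0)).add
      (d0.mul ((e1.const_mul 2).sub d1))).congr_deriv ?_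
    change _ = S.smoothD Q 2 δ w * (2 * S.smoothD S.Q₀ 0 δ w - S.smoothD Q 0 δ w) +
      2 * (S.smoothD Q 1 δ w * (2 * S.smoothD S.Q₀ 1 δ w - S.smoothD Q 1 δ w)) +
      S.smoothD Q 0 δ w * (2 * S.smoothD S.Q₀ 2 δ w - S.smoothD Q 2 δ w)
    simp only [zero_add, one_add_one_eq_two, Pi.sub_apply]
    ring

theorem hasDerivAt_integral_crossD (hQ : IsRegression Q) {j : ℕ} (hj : j ≤ 1) {δ : ℝ}
    (hδ : 0 < δ) : HasDerivAt (fun δ => ∫ w, S.crossD Q j δ w ∂S.covLaw)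
      (∫ w, S.crossD Q (j + 1) δ w ∂S.covLaw) δ :=
  hasDerivAt_integral_of_polynomial_bound (by positivity) (S.measurable_crossD hQ j)
    (S.measurable_crossD hQ (j + 1)) (fun _ hδ w => S.abs_crossD_le hQ (by omega) hδ w)
    (fun _ hδ w => S.abs_crossD_le hQ (by omega) hδ w)
    (fun _ hδ w => S.hasDerivAt_crossD hQ hj hδ w) hδ

theorem integrable_crossD (hQ : IsRegression Q) {j : ℕ} (hj : j ≤ 2) {δ : ℝ} (hδ : 0 < δ) :
    Integrable (S.crossD Q j δ) S.covLaw :=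
  integrable_bdd (S.measurable_crossD hQ j δ) (S.abs_crossD_le hQ hj hδ)

theorem abs_integral_le {α : Type*} [MeasurableSpace α] {μ : Measure α} [IsProbabilityMeasure μ]
    {f : α → ℝ} {C : ℝ} (h : ∀ᵐ x ∂μ, |f x| ≤ C) : |∫ x, f x ∂μ| ≤ C := by
  have := norm_integral_le_of_norm_le_const (f := f) (C := C) (μ := μ) h
  simpa using this

/-- Changing one factor at a time costs `3 η A B` for the first and `η A B` for the second. -/
theorem abs_cross_sub_le {x x' y y' z A B η : ℝ} (hx : |x| ≤ A) (hz : |z| ≤ B) (hy' : |y'| ≤ B)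
    (hxx : |x - x'| ≤ η * A) (hyy : |y - y'| ≤ η * B) :
    |x * (2 * z - y) - x' * (2 * z - y')| ≤ 4 * η * (A * B) := by
  have e : x * (2 * z - y) - x' * (2 * z - y') = (x - x') * (2 * z - y') - x * (y - y') := by ring
  have hA : 0 ≤ A := (abs_nonneg x).trans hx
  have hηA : 0 ≤ η * A := (abs_nonneg _).trans hxx
  have h1 := abs_mul_two_mul_sub_le hxx hz hy'
  have h2 : |x * (y - y')| ≤ A * (η * B) := by rw [abs_mul]; gcongr
  rw [e]
  refine (abs_sub _ _).trans ?_
  linarith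

theorem abs_integral_crossD_sub_le (hQ : IsRegression Q) (hQ' : IsRegression Q') {η : ℝ}
    (hη : 0 ≤ η) (h : ∀ᵐ p ∂S.base, |Q p.1 p.2 - Q' p.1 p.2| ≤ η) {j : ℕ} (hj : j ≤ 1) {δ : ℝ}
    (hδ : 0 < δ) :
    |∫ w, S.crossD Q j δ w ∂S.covLaw - ∫ w, S.crossD Q' j δ w ∂S.covLaw| ≤
      8 * η * (S.kernelConst ^ 2 * δ⁻¹ ^ j) := by
  rw [← integral_sub (S.integrable_crossD hQ (by omega) hδ)
    (S.integrable_crossD hQ' (by omega) hδ)]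
  refine abs_integral_le ?_
  filter_upwards [S.abs_smoothD_sub_le hQ hQ' hη h 0 hδ, S.abs_smoothD_sub_le hQ hQ' hη h 1 hδ]
    with w h0 h1
  have b := fun i => S.abs_smoothD_le hQ i hδ w
  have b' := fun i => S.abs_smoothD_le hQ' i hδ w
  have c := fun i => S.abs_smoothD_le S.isRegression_Q₀ i hδ w
  have hp : 0 < S.kernelConst ^ 2 * δ⁻¹ ^ j := by
    have := S.kernelConst_pos; positivity
  interval_cases j
  · refine (abs_cross_sub_le (b 0) (c 0) (b' 0) h0 h0).trans ?_
    simp only [pow_zero, mul_one] at hp ⊢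
    nlinarith
  · have k1 := abs_cross_sub_le (b 1) (c 0) (b' 0) h1 h0
    have k2 := abs_cross_sub_le (b 0) (c 1) (b' 1) h0 h1
    simp only [crossD]
    rw [add_sub_add_comm]
    refine (abs_add_le _ _).trans ((add_le_add k1 k2).trans (le_of_eq ?_))
    ring

end Setting

namespace Setting

variable {𝒲 : Type*} [MeasurableSpace 𝒲] (S : Setting 𝒲) {Q Q' : 𝒲 → ℝ → ℝ}

/-! ### Conditional moments of the residual -/

/-- The conditional moment of order `n + 1` of `|Y - Q̄(A, W)| / g₀(A | W)`, times `g₀` (with `g₀`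
bounded below by `c`). -/
noncomputable def momW (c : ℝ) (n : ℕ) (Q : 𝒲 → ℝ → ℝ) (p : 𝒲 × ℝ) : ℝ :=
  (S.Q₀ p.1 p.2 * (1 - Q p.1 p.2) ^ (n + 1) + (1 - S.Q₀ p.1 p.2) * Q p.1 p.2 ^ (n + 1)) /
    max c (S.g p.1 p.2) ^ n

theorem measurable_momW (hQ : IsRegression Q) (c : ℝ) (n : ℕ) : Measurable (S.momW c n Q) := by
  have h1 : Measurable fun o : 𝒲 × ℝ => S.g o.1 o.2 := S.g_meas
  have h2 : Measurable fun o : 𝒲 × ℝ => S.Q₀ o.1 o.2 := S.Q₀_meas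
  have h3 : Measurable fun o : 𝒲 × ℝ => Q o.1 o.2 := hQ.meas
  unfold momW
  fun_prop

theorem momW_nonneg (hQ : IsRegression Q) {c : ℝ} (hc : 0 < c) (n : ℕ) (p : 𝒲 × ℝ) :
    0 ≤ S.momW c n Q p := by
  have h1 := S.Q₀_mem p.1 p.2
  have h2 := hQ.mem p.1 p.2
  have h3 : 0 < max c (S.g p.1 p.2) := hc.trans_le (le_max_left _ _)
  have h4 : 0 ≤ 1 - S.Q₀ p.1 p.2 := by linarith [h1.2]
  have h5 : 0 ≤ 1 - Q p.1 p.2 := by linarith [h2.2]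
  have h6 := h1.1
  have h7 := h2.1
  unfold momW
  positivity

theorem momW_le (hQ : IsRegression Q) {c : ℝ} (hc : 0 < c) (n : ℕ) (p : 𝒲 × ℝ) :
    S.momW c n Q p ≤ (c ^ n)⁻¹ := by
  have h1 := S.Q₀_mem p.1 p.2
  have h2 := hQ.mem p.1 p.2
  have h4 : 0 ≤ 1 - S.Q₀ p.1 p.2 := by linarith [h1.2]
  have h8 : (1 - Q p.1 p.2) ^ (n + 1) ≤ 1 := pow_le_one₀ (by linarith [h2.2]) (by linarith [h2.1])
  have h9 : Q p.1 p.2 ^ (n + 1) ≤ 1 := pow_le_one₀ h2.1 h2.2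
  rw [momW, inv_eq_one_div]
  have : c ≤ max c (S.g p.1 p.2) := le_max_left _ _
  gcongr
  nlinarith [h1.1]

theorem abs_momW_le (hQ : IsRegression Q) {c : ℝ} (hc : 0 < c) (n : ℕ) (p : 𝒲 × ℝ) :
    |S.momW c n Q p| ≤ (c ^ n)⁻¹ := by
  rw [abs_of_nonneg (S.momW_nonneg hQ hc n p)]
  exact S.momW_le hQ hc n p

theorem abs_pow_sub_pow_le_of_unit {x y : ℝ} (hx : x ∈ Set.Icc (0 : ℝ) 1)
    (hy : y ∈ Set.Icc (0 : ℝ) 1) (n : ℕ) : |x ^ (n + 1) - y ^ (n + 1)| ≤ (n + 1) * |x - y| := by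
  refine (abs_pow_sub_pow_le x y (n + 1)).trans ?_
  have h1 : max |x| |y| ^ (n + 1 - 1) ≤ 1 := by
    refine pow_le_one₀ (le_max_of_le_left (abs_nonneg _)) (max_le ?_ ?_)
    · rw [abs_of_nonneg hx.1]; exact hx.2
    · rw [abs_of_nonneg hy.1]; exact hy.2
  push_cast
  calc |x - y| * ((n : ℝ) + 1) * max |x| |y| ^ (n + 1 - 1) ≤ |x - y| * ((n : ℝ) + 1) * 1 := by gcongr
    _ = (n + 1) * |x - y| := by ring

theorem abs_momW_sub_le (hQ : IsRegression Q) (hQ' : IsRegression Q') {c : ℝ} (hc : 0 < c) (n : ℕ)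
    (p : 𝒲 × ℝ) :
    |S.momW c n Q p - S.momW c n Q' p| ≤ (n + 1) * |Q p.1 p.2 - Q' p.1 p.2| * (c ^ n)⁻¹ := by
  have h1 := S.Q₀_mem p.1 p.2
  have h2 := hQ.mem p.1 p.2
  have h3 := hQ'.mem p.1 p.2
  have h4 : 0 ≤ 1 - S.Q₀ p.1 p.2 := by linarith [h1.2]
  have k1 := abs_pow_sub_pow_le_of_unit h2 h3 n
  have k2 := abs_pow_sub_pow_le_of_unit (x := 1 - Q p.1 p.2) (y := 1 - Q' p.1 p.2)
    ⟨by linarith [h2.2], by linarith [h2.1]⟩ ⟨by linarith [h3.2], by linarith [h3.1]⟩ n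
  rw [show 1 - Q p.1 p.2 - (1 - Q' p.1 p.2) = -(Q p.1 p.2 - Q' p.1 p.2) by ring, abs_neg] at k2
  have hg : 0 < max c (S.g p.1 p.2) := hc.trans_le (le_max_left _ _)
  rw [momW, momW, ← sub_div, abs_div, abs_of_pos (by positivity : 0 < max c (S.g p.1 p.2) ^ n),
    div_eq_mul_inv]
  have hcg : c ≤ max c (S.g p.1 p.2) := le_max_left _ _
  gcongr
  rw [show S.Q₀ p.1 p.2 * (1 - Q p.1 p.2) ^ (n + 1) + (1 - S.Q₀ p.1 p.2) * Q p.1 p.2 ^ (n + 1) -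
    (S.Q₀ p.1 p.2 * (1 - Q' p.1 p.2) ^ (n + 1) + (1 - S.Q₀ p.1 p.2) * Q' p.1 p.2 ^ (n + 1)) =
    S.Q₀ p.1 p.2 * ((1 - Q p.1 p.2) ^ (n + 1) - (1 - Q' p.1 p.2) ^ (n + 1)) +
    (1 - S.Q₀ p.1 p.2) * (Q p.1 p.2 ^ (n + 1) - Q' p.1 p.2 ^ (n + 1)) by ring]
  refine (abs_add_le _ _).trans ?_
  rw [abs_mul, abs_mul, abs_of_nonneg h1.1, abs_of_nonneg h4]
  have m1 := mul_le_mul_of_nonneg_left k2 h1.1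
  have m2 := mul_le_mul_of_nonneg_left k1 h4
  linarith

theorem abs_integral_base_mul_le {k : ℝ → ℝ} (hk : Integrable k (volume.restrict (Set.Icc (0 : ℝ) 1)))
    {f : 𝒲 × ℝ → ℝ} {η : ℝ} (hf : ∀ᵐ p ∂S.base, |f p| ≤ η) :
    |∫ p, k p.2 * f p ∂S.base| ≤ η * ∫ a in Set.Icc (0 : ℝ) 1, |k a| := by
  rw [← Real.norm_eq_abs]
  have hi : Integrable (fun p : 𝒲 × ℝ => |k p.2|) S.base := hk.abs.comp_snd S.covLaw
  refine (norm_integral_le_of_norm_le (hi.const_mul η) ?_).trans (le_of_eq ?_)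
  · filter_upwards [hf] with p hp
    rw [norm_mul, Real.norm_eq_abs, Real.norm_eq_abs, mul_comm]
    gcongr
  · rw [integral_const_mul, base, integral_fun_snd (fun a => |k a|)]
    simp

theorem integrable_rescaled {M : ℝ → ℝ} (hM : Integrable M) (δ : ℝ) (hδ : 0 < δ) :
    Integrable (fun a => δ⁻¹ * M ((a - S.a₀) / δ)) (volume.restrict (Set.Icc (0 : ℝ) 1)) :=
  (((hM.comp_div hδ.ne').comp_sub_right S.a₀).const_mul _).integrableOn

/-- The value at `a₀` of the conditional moments at `Q̄_∞`. -/
noncomputable def momInf (c : ℝ) (n : ℕ) : ℝ := ∫ w, S.momW c n S.Qinf (w, S.a₀) ∂S.covLaw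

/-- Averaging over the covariates first gives a bounded function of the dose, continuous at `a₀` by
dominated convergence, to which localisation applies. The truncation `max c g₀` keeps denominators
bounded away from zero for every `w`, not only almost everywhere. -/
theorem tendsto_integral_momW (hcont : S.ContinuousAtDose) {c : ℝ} (hc : 0 < c) (n : ℕ) {M : ℝ → ℝ}
    (hM : Integrable M) :
    Tendsto (fun δ : ℝ => ∫ p, δ⁻¹ * M ((p.2 - S.a₀) / δ) * S.momW c n S.Qinf p ∂S.base) (𝓝[>] 0)
      (𝓝 (S.momInf c n * ∫ u in locDomain S.a₀, M u)) := by
  have hm := S.measurable_momW S.isRegression_Qinf c n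
  set h : ℝ → ℝ := fun a => ∫ w, S.momW c n S.Qinf (w, a) ∂S.covLaw with hh
  have hh1 : Measurable h :=
    (StronglyMeasurable.integral_prod_left' hm.stronglyMeasurable).measurable
  have hh2 : ∀ a, |h a| ≤ (c ^ n)⁻¹ := fun a =>
    abs_integral_le (ae_of_all _ fun w => S.abs_momW_le S.isRegression_Qinf hc n _)
  have hh3 : ContinuousWithinAt h (Set.Icc 0 1) S.a₀ := by
    refine continuousWithinAt_of_dominated (bound := fun _ => (c ^ n)⁻¹)
      (Eventually.of_forall fun a => (hm.comp measurable_prodMk_right).aestronglyMeasurable)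
      (Eventually.of_forall fun a => ae_of_all _ fun w => S.abs_momW_le S.isRegression_Qinf hc n _)
      (integrable_const _) ?_
    filter_upwards [hcont] with w hw
    unfold momW
    have hg : max c (S.g w S.a₀) ^ n ≠ 0 := by
      have : 0 < max c (S.g w S.a₀) := hc.trans_le (le_max_left _ _)
      positivity
    refine ContinuousWithinAt.div ?_ ?_ hg
    · exact (hw.2.1.mul ((continuousWithinAt_const.sub hw.2.2).pow _)).add
        ((continuousWithinAt_const.sub hw.2.1).mul (hw.2.2.pow _))
    · exact (ContinuousWithinAt.sup continuousWithinAt_const hw.1).pow _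
  refine (tendsto_integral_rescaled S.a₀_mem hM hh1 hh2 hh3).congr' ?_
  filter_upwards [self_mem_nhdsWithin] with δ hδ
  have hi : Integrable (fun p : 𝒲 × ℝ => δ⁻¹ * M ((p.2 - S.a₀) / δ) * S.momW c n S.Qinf p)
      S.base := by
    refine Integrable.mul_bdd (c := (c ^ n)⁻¹) ?_ hm.aestronglyMeasurable
      (ae_of_all _ fun p => S.abs_momW_le S.isRegression_Qinf hc n _)
    exact (S.integrable_rescaled hM δ hδ).comp_snd S.covLaw
  rw [base] at hi ⊢
  rw [integral_prod_symm _ hi]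
  refine integral_congr_ae (ae_of_all _ fun a => ?_)
  simp only [hh]
  rw [← integral_const_mul]

theorem residVar_eq (w : 𝒲) (a : ℝ) : S.residVar w a =
    S.Q₀ w a * (1 - S.Qinf w a) ^ 2 + (1 - S.Q₀ w a) * S.Qinf w a ^ 2 := by
  rw [residVar]; ring

/-- A vanishing moment forces both non-negative summands of `momW` to vanish almost surely. The
order of the power is irrelevant for this, so the second moment `residVar` would vanish too. -/
theorem momInf_pos (hnd : S.NonDegenerate) {c : ℝ} (hc : 0 < c) (n : ℕ) : 0 < S.momInf c n := by
  have hm : Measurable fun w => S.momW c n S.Qinf (w, S.a₀) :=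
    (S.measurable_momW S.isRegression_Qinf c n).comp measurable_prodMk_right
  have hi : Integrable (fun w => S.momW c n S.Qinf (w, S.a₀)) S.covLaw :=
    integrable_bdd hm fun w => S.abs_momW_le S.isRegression_Qinf hc n _
  have hnn : 0 ≤ fun w => S.momW c n S.Qinf (w, S.a₀) := fun w =>
    S.momW_nonneg S.isRegression_Qinf hc n _
  refine lt_of_le_of_ne (integral_nonneg hnn) fun h0 => ?_
  have h1 := (integral_eq_zero_iff_of_nonneg hnn hi).1 h0.symm
  have h2 : ∫ w, S.residVar w S.a₀ ∂S.covLaw = 0 := by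
    refine integral_eq_zero_of_ae ?_
    filter_upwards [h1] with w hw
    have hg : max c (S.g w S.a₀) ^ n ≠ 0 := by
      have : 0 < max c (S.g w S.a₀) := hc.trans_le (le_max_left _ _)
      positivity
    simp only [momW, Pi.zero_apply, div_eq_zero_iff, hg, or_false] at hw
    have q0 := S.Q₀_mem w S.a₀
    have q1 := S.Qinf_mem w S.a₀
    have k1 : 0 ≤ S.Q₀ w S.a₀ * (1 - S.Qinf w S.a₀) ^ (n + 1) :=
      mul_nonneg q0.1 (pow_nonneg (by linarith [q1.2]) _)
    have k2 : 0 ≤ (1 - S.Q₀ w S.a₀) * S.Qinf w S.a₀ ^ (n + 1) :=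
      mul_nonneg (by linarith [q0.2]) (pow_nonneg q1.1 _)
    have z1 : S.Q₀ w S.a₀ * (1 - S.Qinf w S.a₀) ^ (n + 1) = 0 := by linarith
    have z2 : (1 - S.Q₀ w S.a₀) * S.Qinf w S.a₀ ^ (n + 1) = 0 := by linarith
    rw [residVar_eq, Pi.zero_apply]
    have y1 : S.Q₀ w S.a₀ * (1 - S.Qinf w S.a₀) ^ 2 = 0 := by
      rcases mul_eq_zero.1 z1 with h | h
      · rw [h, zero_mul]
      · rw [eq_zero_of_pow_eq_zero h]; ring
    have y2 : (1 - S.Q₀ w S.a₀) * S.Qinf w S.a₀ ^ 2 = 0 := by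
      rcases mul_eq_zero.1 z2 with h | h
      · rw [h, zero_mul]
      · rw [eq_zero_of_pow_eq_zero h]; ring
    rw [y1, y2, add_zero]
  have : 0 < ∫ w, S.residVar w S.a₀ ∂S.covLaw := hnd
  linarith

/-! ### The residual part of the gradient -/

/-- The residual part `K_δ / g₀ * (Y - Q̄)` of the gradient. -/
noncomputable def resid (Q : 𝒲 → ℝ → ℝ) (δ : ℝ) (o : Obs 𝒲) : ℝ :=
  S.kern δ o.2.1 / S.g o.1 o.2.1 * (yval o.2.2 - Q o.1 o.2.1)

theorem score_eq (Q : 𝒲 → ℝ → ℝ) (δ : ℝ) (o : Obs 𝒲) :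
    S.score Q δ o = S.resid Q δ o + S.smooth Q δ o.1 := rfl

theorem measurable_resid (hQ : IsRegression Q) (δ : ℝ) : Measurable (S.resid Q δ) := by
  have h : S.resid Q δ = fun o => S.score Q δ o - S.smooth Q δ o.1 := by
    ext o; rw [score_eq]; ring
  rw [h]
  exact (hQ.measurable_score S δ).sub ((hQ.measurable_smooth S δ).comp measurable_fst)

theorem abs_yval_sub_le (hQ : IsRegression Q) (y : Bool) (w : 𝒲) (a : ℝ) :
    |yval y - Q w a| ≤ 1 := by
  have := hQ.mem w a
  rw [abs_le]
  cases y <;> simp only [yval, if_true, Bool.false_eq_true, if_false] <;> constructor <;>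
    linarith [this.1, this.2]

theorem abs_kern_le {δ : ℝ} (hδ : 0 < δ) (a : ℝ) : |S.kern δ a| ≤ S.kernelConst * δ⁻¹ := by
  have := S.abs_kernD_le 0 hδ a
  rwa [kernD_zero, zero_add, pow_one] at this

/-- Positivity with an explicit constant. -/
def PositivityAt (c : ℝ) : Prop := 0 < c ∧ ∀ᵐ p ∂S.base, c ≤ S.g p.1 p.2

variable {S} {c : ℝ}

theorem PositivityAt.resid_le (hc : S.PositivityAt c) (hQ : IsRegression Q) {δ : ℝ} (hδ : 0 < δ) :
    ∀ᵐ o ∂S.P₀, |S.resid Q δ o| ≤ S.kernelConst * c⁻¹ * δ⁻¹ := by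
  have h0 := hc.1
  have hk := S.kernelConst_pos
  filter_upwards [S.ae_P₀_of_ae_base hc.2] with o ho
  rw [resid, abs_mul, abs_div]
  have h1 : |S.kern δ o.2.1| / |S.g o.1 o.2.1| ≤ S.kernelConst * δ⁻¹ / c := by
    rw [abs_of_pos (h0.trans_le ho)]
    have := S.abs_kern_le hδ o.2.1
    gcongr
  calc |S.kern δ o.2.1| / |S.g o.1 o.2.1| * |yval o.2.2 - Q o.1 o.2.1|
      ≤ (S.kernelConst * δ⁻¹ / c) * 1 := by
        have := abs_yval_sub_le hQ o.2.2 o.1 o.2.1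
        gcongr
    _ = S.kernelConst * c⁻¹ * δ⁻¹ := by rw [div_eq_mul_inv]; ring

/-- Given `(W, A)`, the absolute residual equals `1 - Q̄` or `Q̄`, and one of the `n + 1` factors
`g₀⁻¹` is cancelled by the density of the dose. Absolute values are kept since the third moment is
needed as well. -/
theorem PositivityAt.integral_resid_pow (hc : S.PositivityAt c) (hQ : IsRegression Q) {δ : ℝ}
    (hδ : 0 < δ) (n : ℕ) :
    ∫ o, |S.resid Q δ o| ^ (n + 1) ∂S.P₀ = ∫ p, |S.kern δ p.2| ^ (n + 1) * S.momW c n Q p ∂S.base := by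
  have h0 := hc.1
  have hk := S.kernelConst_pos
  have hm : Measurable fun o => |S.resid Q δ o| ^ (n + 1) :=
    ((S.measurable_resid hQ δ).norm).pow_const _
  have hg' : Measurable fun o : 𝒲 × ℝ => S.g o.1 o.2 := S.g_meas
  have key : ∀ y : Bool, Integrable
      (fun p : 𝒲 × ℝ => S.g p.1 p.2 * |S.resid Q δ (p.1, p.2, y)| ^ (n + 1)) S.base := by
    intro y
    refine Integrable.of_bound (C := (S.kernelConst * δ⁻¹) ^ (n + 1) * (c ^ n)⁻¹) ?_ ?_
    · exact (hg'.mul (hm.comp (by fun_prop : Measurable fun p : 𝒲 × ℝ => (p.1, p.2, y)))).aestronglyMeasurable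
    · filter_upwards [hc.2] with p hp
      have hgp : 0 < S.g p.1 p.2 := h0.trans_le hp
      rw [norm_mul, norm_pow, Real.norm_eq_abs, Real.norm_eq_abs, abs_abs, resid, abs_mul, abs_div,
        abs_of_pos hgp, mul_pow, div_pow]
      have h1 : |yval y - Q p.1 p.2| ^ (n + 1) ≤ 1 :=
        pow_le_one₀ (abs_nonneg _) (abs_yval_sub_le hQ _ _ _)
      have h2 := S.abs_kern_le hδ p.2
      calc S.g p.1 p.2 * (|S.kern δ p.2| ^ (n + 1) / S.g p.1 p.2 ^ (n + 1) *
            |yval y - Q p.1 p.2| ^ (n + 1))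
          = |S.kern δ p.2| ^ (n + 1) * (S.g p.1 p.2 ^ n)⁻¹ * |yval y - Q p.1 p.2| ^ (n + 1) := by
            field_simp
            ring
        _ ≤ (S.kernelConst * δ⁻¹) ^ (n + 1) * (c ^ n)⁻¹ * 1 := by gcongr
        _ = _ := mul_one _
  rw [(S.integrable_P₀_and_integral hm (key true) (key false)).2]
  refine integral_congr_ae ?_
  filter_upwards [hc.2] with p hp
  have hgp : 0 < S.g p.1 p.2 := h0.trans_le hp
  have hq := hQ.mem p.1 p.2
  simp only [resid, momW, max_eq_right hp, yval, if_true, Bool.false_eq_true, if_false, abs_mul,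
    abs_div, abs_of_pos hgp, mul_pow, div_pow, zero_sub, abs_neg, abs_of_nonneg hq.1,
    abs_of_nonneg (by linarith [hq.2] : 0 ≤ 1 - Q p.1 p.2)]
  field_simp
  ring

theorem integral_P₀_fst {s : 𝒲 → ℝ} (hs : Measurable s) {C : ℝ} (hC : ∀ w, |s w| ≤ C) :
    ∫ o, s o.1 ∂S.P₀ = ∫ w, s w ∂S.covLaw := by
  have h : Integrable (fun p : 𝒲 × ℝ => S.g p.1 p.2 * s p.1) S.base :=
    S.integrable_g.mul_bdd (c := C) (hs.comp measurable_fst).aestronglyMeasurable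
      (ae_of_all _ fun p => hC p.1)
  refine (S.integrable_P₀_and_integral (f := fun o => s o.1) (hs.comp measurable_fst) h h).2.trans ?_
  rw [← S.integral_mul_g hs hC]
  refine integral_congr_ae (ae_of_all _ fun p => ?_)
  ring

/-- Given `W` alone, the residual has mean `smooth Q₀ - smooth Q`. This is the cross term when the
variance is expanded. -/
theorem integral_resid_mul (hQ : IsRegression Q) {s : 𝒲 → ℝ} (hs : Measurable s) {C : ℝ}
    (hC : ∀ w, |s w| ≤ C) {δ : ℝ} :
    ∫ o, S.resid Q δ o * s o.1 ∂S.P₀ =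
      ∫ w, s w * (S.smooth S.Q₀ δ w - S.smooth Q δ w) ∂S.covLaw := by
  obtain ⟨i1, -⟩ := S.integral_kern_mul hQ δ
  obtain ⟨i2, -⟩ := S.integral_kern_mul S.isRegression_Q₀ δ
  obtain ⟨C', hC0', hC'⟩ := S.exists_kern_le δ
  have ik : Integrable (fun p : 𝒲 × ℝ => S.kern δ p.2) S.base :=
    integrable_bdd (S.measurable_kern.comp (measurable_const.prodMk measurable_snd))
      (fun p => hC' p.2)
  have key : ∀ y : Bool, Integrable
      (fun p : 𝒲 × ℝ => S.g p.1 p.2 * (S.resid Q δ (p.1, p.2, y) * s p.1)) S.base := by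
    intro y
    refine (((ik.const_mul (yval y)).sub i1).mul_bdd (c := C)
      (hs.comp measurable_fst).aestronglyMeasurable (ae_of_all _ fun p => hC p.1)).congr ?_
    filter_upwards [S.g_nonneg_ae] with p hp
    have := hp.ne'
    simp only [resid, Pi.sub_apply, Function.comp_apply]
    field_simp
  refine (S.integrable_P₀_and_integral (f := fun o => S.resid Q δ o * s o.1)
    ((S.measurable_resid hQ δ).mul (hs.comp measurable_fst)) (key true) (key false)).2.trans ?_
  have hi := (i2.sub i1).mul_bdd (c := C)
      (hs.comp measurable_fst).aestronglyMeasurable (ae_of_all _ fun p => hC p.1)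
  have : ∀ᵐ p ∂S.base, S.g p.1 p.2 * (S.Q₀ p.1 p.2 * (S.resid Q δ (p.1, p.2, true) * s p.1) +
      (1 - S.Q₀ p.1 p.2) * (S.resid Q δ (p.1, p.2, false) * s p.1)) =
      (S.kern δ p.2 * S.Q₀ p.1 p.2 - S.kern δ p.2 * Q p.1 p.2) * s p.1 := by
    filter_upwards [S.g_nonneg_ae] with p hp
    have := hp.ne'
    simp only [resid, yval, if_true, Bool.false_eq_true, if_false]
    field_simp
    ring
  rw [integral_congr_ae this]
  simp only [Pi.sub_apply, Function.comp_apply] at hi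
  rw [base] at hi i1 i2 ⊢
  rw [integral_prod _ hi]
  refine integral_congr_ae ?_
  filter_upwards [i1.prod_right_ae, i2.prod_right_ae] with w h1 h2
  rw [integral_mul_const, integral_sub h2 h1, smooth_eq, smooth_eq, mul_comm]

end Setting

namespace Setting

variable {𝒲 : Type*} [MeasurableSpace 𝒲] (S : Setting 𝒲) {Q Q' : 𝒲 → ℝ → ℝ}

/-! ### The variance of the gradient and its derivatives in the bandwidth -/

/-- The gradient, centred at its mean under the data-generating law. -/
noncomputable def center (Q : 𝒲 → ℝ → ℝ) (δ : ℝ) (o : Obs 𝒲) : ℝ :=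
  S.score Q δ o - S.Psi S.covLaw S.Q₀ δ

/-- The variance of the gradient. -/
noncomputable def varGrad (Q : 𝒲 → ℝ → ℝ) (δ : ℝ) : ℝ := ∫ o, S.center Q δ o ^ 2 ∂S.P₀

/-- The standard deviation of the gradient. -/
noncomputable def sdGrad (Q : 𝒲 → ℝ → ℝ) (δ : ℝ) : ℝ := √(S.varGrad Q δ)

/-- The variance of the squared centred gradient. -/
noncomputable def varSq (Q : 𝒲 → ℝ → ℝ) (δ : ℝ) : ℝ := S.var fun o => S.center Q δ o ^ 2

theorem varGrad_nonneg (Q : 𝒲 → ℝ → ℝ) (δ : ℝ) : 0 ≤ S.varGrad Q δ :=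
  integral_nonneg fun _ => sq_nonneg _

theorem measurable_center (hQ : IsRegression Q) (δ : ℝ) : Measurable (S.center Q δ) :=
  (hQ.measurable_score S δ).sub measurable_const

theorem integral_center (hQ : IsRegression Q) (δ : ℝ) :
    Integrable (S.center Q δ) S.P₀ ∧ ∫ o, S.center Q δ o ∂S.P₀ = 0 := by
  obtain ⟨hi, he⟩ := S.integral_score hQ δ
  refine ⟨hi.sub (integrable_const _), ?_⟩
  simp only [center]
  rw [integral_sub hi (integrable_const _), he]
  simp

/-- The constant `Psi ν Q` cancels and the score has the same mean for every regression. Variances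
and higher moments at `P̂` thus depend on the regression estimate only, never on the empirical law
of `W`. -/
theorem grad_sub_integral (ν : Measure 𝒲) (hQ : IsRegression Q) (δ : ℝ) (o : Obs 𝒲) :
    S.grad ν Q δ o - ∫ o', S.grad ν Q δ o' ∂S.P₀ = S.center Q δ o := by
  obtain ⟨hi, he⟩ := S.integral_score hQ δ
  simp only [grad_eq, center]
  rw [integral_sub hi (integrable_const _), he]
  simp

theorem sd_eq (ν : Measure 𝒲) (hQ : IsRegression Q) : S.sd ν Q = S.sdGrad Q := by
  ext δ
  simp only [sd, var, S.grad_sub_integral ν hQ]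
  rfl

theorem var_H_eq (ν : Measure 𝒲) (hQ : IsRegression Q) (δ : ℝ) :
    S.var (S.H ν Q δ) = S.varSq Q δ := by
  have : S.H ν Q δ = fun o => S.center Q δ o ^ 2 := by
    ext o
    rw [H, S.grad_sub_integral ν hQ]
  rw [this, varSq]

theorem sdInf_eq : S.sdInf = S.sdGrad S.Qinf := S.sd_eq _ S.isRegression_Qinf

theorem fitSd_eq (m : ℕ) (o : ℕ → Obs 𝒲) : S.fitSd m o = S.sdGrad (S.fitQ m o) :=
  S.sd_eq _ (S.isRegression_fitQ m o)

theorem varHInf_eq (δ : ℝ) : S.varHInf δ = S.varSq S.Qinf δ := S.var_H_eq _ S.isRegression_Qinf δ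

theorem fitVarH_eq (m : ℕ) (o : ℕ → Obs 𝒲) (δ : ℝ) :
    S.fitVarH m o δ = S.varSq (S.fitQ m o) δ := S.var_H_eq _ (S.isRegression_fitQ m o) δ

/-- The `j`-th derivative of `Ψ_δ(P₀)`. -/
noncomputable def psiD (j : ℕ) (δ : ℝ) : ℝ := ∫ w, S.smoothD S.Q₀ j δ w ∂S.covLaw

theorem psiD_zero (δ : ℝ) : S.psiD 0 δ = S.Psi S.covLaw S.Q₀ δ := by
  simp only [psiD, smoothD_zero, Psi]

theorem abs_psiD_le (j : ℕ) {δ : ℝ} (hδ : 0 < δ) : |S.psiD j δ| ≤ S.kernelConst * δ⁻¹ ^ j :=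
  abs_integral_le (ae_of_all _ fun w => S.abs_smoothD_le S.isRegression_Q₀ j hδ w)

theorem hasDerivAt_psiD {j : ℕ} (hj : j ≤ 1) {δ : ℝ} (hδ : 0 < δ) :
    HasDerivAt (S.psiD j) (S.psiD (j + 1) δ) δ :=
  hasDerivAt_integral_of_polynomial_bound S.kernelConst_pos.le
    (S.measurable_smoothD S.isRegression_Q₀ j) (S.measurable_smoothD S.isRegression_Q₀ (j + 1))
    (fun _ hδ w => S.abs_smoothD_le S.isRegression_Q₀ j hδ w)
    (fun _ hδ w => S.abs_smoothD_le S.isRegression_Q₀ (j + 1) hδ w)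
    (fun _ hδ w => S.hasDerivAt_smoothD S.isRegression_Q₀ hj hδ w) hδ

/-- The `j`-th derivative of `Ψ_δ(P₀) ^ 2`. -/
noncomputable def psiSqD : ℕ → ℝ → ℝ
  | 0, δ => S.psiD 0 δ ^ 2
  | 1, δ => 2 * (S.psiD 0 δ * S.psiD 1 δ)
  | _, δ => 2 * S.psiD 1 δ ^ 2 + 2 * (S.psiD 0 δ * S.psiD 2 δ)

theorem abs_psiSqD_le {j : ℕ} (hj : j ≤ 2) {δ : ℝ} (hδ : 0 < δ) :
    |S.psiSqD j δ| ≤ 4 * S.kernelConst ^ 2 * δ⁻¹ ^ j := by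
  have h := fun j => S.abs_psiD_le j hδ
  have key : ∀ i k, |S.psiD i δ * S.psiD k δ| ≤ S.kernelConst ^ 2 * δ⁻¹ ^ (i + k) := by
    intro i k
    rw [abs_mul]
    calc |S.psiD i δ| * |S.psiD k δ| ≤
        (S.kernelConst * δ⁻¹ ^ i) * (S.kernelConst * δ⁻¹ ^ k) :=
          mul_le_mul (h i) (h k) (abs_nonneg _) ((abs_nonneg _).trans (h i))
      _ = _ := by ring
  have hp : 0 < S.kernelConst ^ 2 * δ⁻¹ ^ j := by
    have := S.kernelConst_pos; positivity
  interval_cases j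
  · have := key 0 0
    simp only [psiSqD, sq (S.psiD 0 δ)]
    linarith
  · have := key 0 1
    simp only [psiSqD, abs_mul (2 : ℝ), abs_two]
    linarith
  · have h1 := key 1 1
    have h2 := key 0 2
    simp only [psiSqD, sq (S.psiD 1 δ)]
    refine (abs_add_le _ _).trans ?_
    rw [abs_mul (2 : ℝ), abs_mul (2 : ℝ), abs_two]
    linarith

theorem hasDerivAt_psiSqD {j : ℕ} (hj : j ≤ 1) {δ : ℝ} (hδ : 0 < δ) :
    HasDerivAt (S.psiSqD j) (S.psiSqD (j + 1) δ) δ := by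
  have d0 := S.hasDerivAt_psiD zero_le_one hδ
  have d1 := S.hasDerivAt_psiD le_rfl hδ
  interval_cases j
  · refine (d0.pow 2).congr_deriv ?_
    simp only [psiSqD, zero_add]
    norm_num
    ring
  · refine ((d0.mul d1).const_mul 2).congr_deriv ?_
    change _ = 2 * S.psiD 1 δ ^ 2 + 2 * (S.psiD 0 δ * S.psiD 2 δ)
    simp only [zero_add, one_add_one_eq_two]
    ring

/-- The `j`-th derivative of the main part of the variance. -/
noncomputable def mainD (c : ℝ) (Q : 𝒲 → ℝ → ℝ) (j : ℕ) (δ : ℝ) : ℝ :=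
  ∫ p, S.kernSqD j δ p.2 * S.momW c 1 Q p ∂S.base

/-- The `j`-th derivative of the variance of the gradient. -/
noncomputable def varD (c : ℝ) (Q : 𝒲 → ℝ → ℝ) (j : ℕ) (δ : ℝ) : ℝ :=
  S.mainD c Q j δ + ∫ w, S.crossD Q j δ w ∂S.covLaw - S.psiSqD j δ

theorem integrable_kernSqD (j : ℕ) {δ : ℝ} (hδ : 0 < δ) :
    Integrable (S.kernSqD j δ) (volume.restrict (Set.Icc (0 : ℝ) 1)) :=
  integrable_bdd (S.measurable_kernSqD' j δ) (S.abs_kernSqD_le j hδ)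

theorem integrable_kernSqD_mul (hQ : IsRegression Q) {c : ℝ} (hc : 0 < c) (j : ℕ) {δ : ℝ}
    (hδ : 0 < δ) : Integrable (fun p : 𝒲 × ℝ => S.kernSqD j δ p.2 * S.momW c 1 Q p) S.base :=
  ((S.integrable_kernSqD j hδ).comp_snd S.covLaw).mul_bdd (c := (c ^ 1)⁻¹)
    (S.measurable_momW hQ c 1).aestronglyMeasurable (ae_of_all _ fun p => S.abs_momW_le hQ hc 1 p)

theorem abs_mainD_le (hQ : IsRegression Q) {c : ℝ} (hc : 0 < c) (j : ℕ) {δ : ℝ} (hδ : 0 < δ) :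
    |S.mainD c Q j δ| ≤ c⁻¹ * S.kernelConst * δ⁻¹ ^ (j + 1) := by
  have h := S.abs_integral_base_mul_le (S.integrable_kernSqD j hδ)
    (ae_of_all _ fun p => S.abs_momW_le hQ hc 1 p)
  refine h.trans ?_
  rw [pow_one, mul_assoc]
  exact mul_le_mul_of_nonneg_left (S.integral_abs_kernSqD_le j hδ) (inv_nonneg.2 hc.le)

theorem abs_mainD_sub_le (hQ : IsRegression Q) (hQ' : IsRegression Q') {η : ℝ} (hη : 0 ≤ η)
    (h : ∀ᵐ p ∂S.base, |Q p.1 p.2 - Q' p.1 p.2| ≤ η) {c : ℝ} (hc : 0 < c) (j : ℕ) {δ : ℝ}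
    (hδ : 0 < δ) :
    |S.mainD c Q j δ - S.mainD c Q' j δ| ≤ 2 * η * c⁻¹ * S.kernelConst * δ⁻¹ ^ (j + 1) := by
  rw [mainD, mainD, ← integral_sub (S.integrable_kernSqD_mul hQ hc j hδ)
    (S.integrable_kernSqD_mul hQ' hc j hδ)]
  simp only [← mul_sub]
  refine (S.abs_integral_base_mul_le (η := 2 * η * c⁻¹) (S.integrable_kernSqD j hδ) ?_).trans ?_
  · filter_upwards [h] with p hp
    refine (S.abs_momW_sub_le hQ hQ' hc 1 p).trans ?_
    rw [pow_one]
    norm_num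
    gcongr
  · rw [mul_assoc (2 * η * c⁻¹)]
    exact mul_le_mul_of_nonneg_left (S.integral_abs_kernSqD_le j hδ) (by positivity)

theorem hasDerivAt_mainD (hQ : IsRegression Q) {c : ℝ} (hc : 0 < c) {j : ℕ} (hj : j ≤ 1) {δ : ℝ}
    (hδ : 0 < δ) : HasDerivAt (S.mainD c Q j) (S.mainD c Q (j + 1) δ) δ := by
  have hm := S.measurable_momW hQ c 1
  have hb : ∀ i δ, 0 < δ → ∀ p : 𝒲 × ℝ, |S.kernSqD i δ p.2 * S.momW c 1 Q p| ≤
      (S.kernelConst * (c ^ 1)⁻¹) * δ⁻¹ ^ (i + 2) := by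
    intro i δ hδ p
    rw [abs_mul, mul_right_comm]
    exact mul_le_mul (S.abs_kernSqD_le i hδ _) (S.abs_momW_le hQ hc 1 p) (abs_nonneg _)
      (by have := S.kernelConst_pos; positivity)
  exact hasDerivAt_integral_of_polynomial_bound
    (by have := S.kernelConst_pos; positivity)
    (fun δ => ((S.measurable_kernSqD' j δ).comp measurable_snd).mul hm)
    (fun δ => ((S.measurable_kernSqD' (j + 1) δ).comp measurable_snd).mul hm)
    (hb j) (hb (j + 1)) (fun δ hδ p => (S.hasDerivAt_kernSqD hj hδ p.2).mul_const _) hδ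

theorem hasDerivAt_varD (hQ : IsRegression Q) {c : ℝ} (hc : 0 < c) {j : ℕ} (hj : j ≤ 1) {δ : ℝ}
    (hδ : 0 < δ) : HasDerivAt (S.varD c Q j) (S.varD c Q (j + 1) δ) δ :=
  ((S.hasDerivAt_mainD hQ hc hj hδ).add (S.hasDerivAt_integral_crossD hQ hj hδ)).sub
    (S.hasDerivAt_psiSqD hj hδ)

/-- The terms in smoothed regression functions are one power of `δ` smaller than the main term. The
constant is `12` from `crossD` plus `4` from `psiSqD`. -/
theorem abs_varD_sub_mainD_le (hQ : IsRegression Q) (c : ℝ) {j : ℕ} (hj : j ≤ 2) {δ : ℝ}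
    (hδ : 0 < δ) : |S.varD c Q j δ - S.mainD c Q j δ| ≤ 16 * S.kernelConst ^ 2 * δ⁻¹ ^ j := by
  have h1 : |∫ w, S.crossD Q j δ w ∂S.covLaw| ≤ 12 * S.kernelConst ^ 2 * δ⁻¹ ^ j :=
    abs_integral_le (ae_of_all _ fun w => S.abs_crossD_le hQ hj hδ w)
  have h2 := S.abs_psiSqD_le hj hδ
  rw [varD, add_sub_assoc, add_sub_cancel_left]
  refine (abs_sub _ _).trans ?_
  linarith

/-- A constant in bounds for the derivatives of the variance. -/
noncomputable def varConst (c : ℝ) : ℝ := 2 * c⁻¹ * S.kernelConst + 16 * S.kernelConst ^ 2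

theorem varConst_pos {c : ℝ} (hc : 0 < c) : 0 < S.varConst c := by
  have := S.kernelConst_pos
  unfold varConst
  positivity

theorem inv_pow_le_succ {δ : ℝ} (hδ : 0 < δ) (hδ1 : δ ≤ 1) (j : ℕ) : δ⁻¹ ^ j ≤ δ⁻¹ ^ (j + 1) :=
  pow_le_pow_right₀ ((one_le_inv₀ hδ).2 hδ1) (Nat.le_succ j)

theorem abs_varD_le (hQ : IsRegression Q) {c : ℝ} (hc : 0 < c) {j : ℕ} (hj : j ≤ 2) {δ : ℝ}
    (hδ : 0 < δ) (hδ1 : δ ≤ 1) : |S.varD c Q j δ| ≤ S.varConst c * δ⁻¹ ^ (j + 1) := by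
  have h1 := S.abs_varD_sub_mainD_le hQ c hj hδ
  have h2 := S.abs_mainD_le hQ hc j hδ
  have h3 := inv_pow_le_succ hδ hδ1 j
  have h4 : |S.varD c Q j δ| ≤ |S.varD c Q j δ - S.mainD c Q j δ| + |S.mainD c Q j δ| := by
    simpa using abs_add_le (S.varD c Q j δ - S.mainD c Q j δ) (S.mainD c Q j δ)
  have hk := S.kernelConst_pos
  have h5 : 16 * S.kernelConst ^ 2 * δ⁻¹ ^ j ≤ 16 * S.kernelConst ^ 2 * δ⁻¹ ^ (j + 1) := by gcongr
  have h6 : 0 ≤ c⁻¹ * S.kernelConst * δ⁻¹ ^ (j + 1) := by positivity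
  rw [varConst]
  linarith

theorem abs_varD_sub_le (hQ : IsRegression Q) (hQ' : IsRegression Q') {η : ℝ} (hη : 0 ≤ η)
    (h : ∀ᵐ p ∂S.base, |Q p.1 p.2 - Q' p.1 p.2| ≤ η) {c : ℝ} (hc : 0 < c) {j : ℕ} (hj : j ≤ 1)
    {δ : ℝ} (hδ : 0 < δ) (hδ1 : δ ≤ 1) :
    |S.varD c Q j δ - S.varD c Q' j δ| ≤ S.varConst c * η * δ⁻¹ ^ (j + 1) := by
  have h1 := S.abs_mainD_sub_le hQ hQ' hη h hc j hδ
  have h2 := S.abs_integral_crossD_sub_le hQ hQ' hη h hj hδ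
  have h3 := inv_pow_le_succ hδ hδ1 j
  have hk := S.kernelConst_pos
  have h5 : 8 * η * (S.kernelConst ^ 2 * δ⁻¹ ^ j) ≤ 8 * η * (S.kernelConst ^ 2 * δ⁻¹ ^ (j + 1)) := by
    gcongr
  have h6 : 0 ≤ η * (S.kernelConst ^ 2 * δ⁻¹ ^ (j + 1)) := by positivity
  have e : S.varD c Q j δ - S.varD c Q' j δ = (S.mainD c Q j δ - S.mainD c Q' j δ) +
      (∫ w, S.crossD Q j δ w ∂S.covLaw - ∫ w, S.crossD Q' j δ w ∂S.covLaw) := by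
    simp only [varD]; ring
  rw [e, varConst]
  refine (abs_add_le _ _).trans ?_
  linarith

/-! ### Moments of the centred gradient -/

theorem abs_smooth_le (hQ : IsRegression Q) {δ : ℝ} (hδ : 0 < δ) (w : 𝒲) :
    |S.smooth Q δ w| ≤ S.kernelConst := by
  have := S.abs_smoothD_le hQ 0 hδ w
  rwa [smoothD_zero, pow_zero, mul_one] at this

theorem abs_Psi_le {δ : ℝ} (hδ : 0 < δ) : |S.Psi S.covLaw S.Q₀ δ| ≤ S.kernelConst := by
  have := S.abs_psiD_le 0 hδ
  rwa [psiD_zero, pow_zero, mul_one] at this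

theorem abs_smooth_sub_le (hQ : IsRegression Q) {δ : ℝ} (hδ : 0 < δ) (w : 𝒲) :
    |S.smooth Q δ w - S.Psi S.covLaw S.Q₀ δ| ≤ 2 * S.kernelConst := by
  refine (abs_sub _ _).trans ?_
  linarith [S.abs_smooth_le hQ hδ w, S.abs_Psi_le hδ]

theorem center_eq (Q : 𝒲 → ℝ → ℝ) (δ : ℝ) (o : Obs 𝒲) : S.center Q δ o =
    S.resid Q δ o + (S.smooth Q δ o.1 - S.Psi S.covLaw S.Q₀ δ) := by
  rw [center, score_eq]; ring

/-- A constant in bounds for the gradient. -/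
noncomputable def gradConst (c : ℝ) : ℝ := S.kernelConst * (c⁻¹ + 2)

variable {S} {c : ℝ}

theorem PositivityAt.center_le (hc : S.PositivityAt c) (hQ : IsRegression Q) {δ : ℝ} (hδ : 0 < δ)
    (hδ1 : δ ≤ 1) : ∀ᵐ o ∂S.P₀, |S.center Q δ o| ≤ S.gradConst c * δ⁻¹ := by
  have hk := S.kernelConst_pos
  filter_upwards [hc.resid_le hQ hδ] with o ho
  rw [center_eq, gradConst]
  refine (abs_add_le _ _).trans ?_
  have h1 := S.abs_smooth_sub_le hQ hδ o.1
  have h2 : 1 ≤ δ⁻¹ := (one_le_inv₀ hδ).2 hδ1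
  nlinarith

theorem PositivityAt.memLp_center (hc : S.PositivityAt c) (hQ : IsRegression Q) {δ : ℝ}
    (hδ : 0 < δ) (p : ℝ≥0∞) : MemLp (S.center Q δ) p S.P₀ := by
  refine MemLp.of_bound (S.measurable_center hQ δ).aestronglyMeasurable
    (S.kernelConst * c⁻¹ * δ⁻¹ + 2 * S.kernelConst) ?_
  filter_upwards [hc.resid_le hQ hδ] with o ho
  rw [center_eq]
  refine (abs_add_le _ _).trans ?_
  have h1 := S.abs_smooth_sub_le hQ hδ o.1
  linarith

theorem PositivityAt.integrable_center_pow (hc : S.PositivityAt c) (hQ : IsRegression Q) {δ : ℝ}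
    (hδ : 0 < δ) (n : ℕ) : Integrable (fun o => S.center Q δ o ^ n) S.P₀ := by
  refine Integrable.of_bound ((S.measurable_center hQ δ).pow_const n).aestronglyMeasurable
    ((S.kernelConst * c⁻¹ * δ⁻¹ + 2 * S.kernelConst) ^ n) ?_
  filter_upwards [hc.resid_le hQ hδ] with o ho
  rw [norm_pow, Real.norm_eq_abs, center_eq]
  refine pow_le_pow_left₀ (abs_nonneg _) ((abs_add_le _ _).trans ?_) n
  have h1 := S.abs_smooth_sub_le hQ hδ o.1
  linarith

theorem PositivityAt.integrable_resid_pow (hc : S.PositivityAt c) (hQ : IsRegression Q) {δ : ℝ}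
    (hδ : 0 < δ) (n : ℕ) : Integrable (fun o => |S.resid Q δ o| ^ n) S.P₀ := by
  refine Integrable.of_bound (((S.measurable_resid hQ δ).norm).pow_const n).aestronglyMeasurable
    ((S.kernelConst * c⁻¹ * δ⁻¹) ^ n) ?_
  filter_upwards [hc.resid_le hQ hδ] with o ho
  rw [norm_pow, Real.norm_eq_abs, abs_abs]
  exact pow_le_pow_left₀ (abs_nonneg _) ho n

/-- Expand the square of residual plus `smooth Q - L`, where `L = Ψ_δ(P₀)`. The squared residual
gives `mainD`. The cross term and the last square combine pointwise to `crossD - 2 L smooth Q₀ + L ^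
2`, and `smooth Q₀` has mean `L`. -/
theorem PositivityAt.varGrad_eq (hc : S.PositivityAt c) (hQ : IsRegression Q) {δ : ℝ}
    (hδ : 0 < δ) : S.varGrad Q δ = S.varD c Q 0 δ := by
  set L := S.Psi S.covLaw S.Q₀ δ with hL
  have hs := hQ.measurable_smooth S δ
  have hs0 := S.isRegression_Q₀.measurable_smooth S δ
  have hb := S.abs_smooth_le hQ hδ
  have hb0 := S.abs_smooth_le S.isRegression_Q₀ hδ
  have hsL : Measurable fun w => S.smooth Q δ w - L := hs.sub measurable_const
  have hbL := S.abs_smooth_sub_le hQ hδ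
  have hsL2 : Measurable fun w => (S.smooth Q δ w - L) ^ 2 := hsL.pow_const 2
  have hbL2 : ∀ w, |(S.smooth Q δ w - L) ^ 2| ≤ (2 * S.kernelConst) ^ 2 := fun w => by
    rw [abs_pow]; exact pow_le_pow_left₀ (abs_nonneg _) (hbL w) 2
  have i1 : Integrable (fun o => |S.resid Q δ o| ^ 2) S.P₀ := hc.integrable_resid_pow hQ hδ 2
  have hr : Integrable (S.resid Q δ) S.P₀ := by
    have := hc.integrable_resid_pow hQ hδ 1
    simp only [pow_one] at this
    exact (integrable_norm_iff (S.measurable_resid hQ δ).aestronglyMeasurable).1 this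
  have i2 : Integrable (fun o => S.resid Q δ o * (S.smooth Q δ o.1 - L)) S.P₀ :=
    hr.mul_bdd (c := 2 * S.kernelConst) (hsL.comp measurable_fst).aestronglyMeasurable
      (ae_of_all _ fun o => hbL o.1)
  have i3 : Integrable (fun o : Obs 𝒲 => (S.smooth Q δ o.1 - L) ^ 2) S.P₀ :=
    integrable_bdd (hsL2.comp measurable_fst) fun o => hbL2 o.1
  have e : ∀ o, S.center Q δ o ^ 2 = |S.resid Q δ o| ^ 2 +
      2 * (S.resid Q δ o * (S.smooth Q δ o.1 - L)) + (S.smooth Q δ o.1 - L) ^ 2 := fun o => by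
    rw [center_eq, sq_abs]; ring
  simp only [varGrad, e]
  rw [integral_add (by exact i1.add (i2.const_mul 2)) i3, integral_add i1 (i2.const_mul 2),
    integral_const_mul, hc.integral_resid_pow hQ hδ 1, integral_resid_mul hQ hsL hbL,
    integral_P₀_fst hsL2 hbL2, varD, add_assoc, add_sub_assoc]
  congr 1
  · rw [mainD]
    refine integral_congr_ae (ae_of_all _ fun p => ?_)
    simp only [kernSqD_zero]
    norm_num
  · have j0 : Integrable (fun w => S.smooth S.Q₀ δ w) S.covLaw := integrable_bdd hs0 hb0
    have j1 : Integrable (fun w => (S.smooth Q δ w - L) * (S.smooth S.Q₀ δ w - S.smooth Q δ w))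
        S.covLaw := by
      refine integrable_bdd (hsL.mul (hs0.sub hs))
        (C := 2 * S.kernelConst * (2 * S.kernelConst)) fun w => ?_
      rw [abs_mul]
      have hk := S.kernelConst_pos
      have : |S.smooth S.Q₀ δ w - S.smooth Q δ w| ≤ 2 * S.kernelConst :=
        (abs_sub _ _).trans (by linarith [hb w, hb0 w])
      exact mul_le_mul (hbL w) this (abs_nonneg _) (by positivity)
    have j2 : Integrable (fun w => (S.smooth Q δ w - L) ^ 2) S.covLaw := integrable_bdd hsL2 hbL2
    have j3 := S.integrable_crossD hQ (j := 0) (by norm_num) hδ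
    have hψ : ∫ w, S.smooth S.Q₀ δ w ∂S.covLaw = L := rfl
    have e2 : ∀ w, 2 * ((S.smooth Q δ w - L) * (S.smooth S.Q₀ δ w - S.smooth Q δ w)) +
        (S.smooth Q δ w - L) ^ 2 = S.crossD Q 0 δ w - 2 * L * S.smooth S.Q₀ δ w + L ^ 2 := by
      intro w
      simp only [crossD, smoothD_zero]
      ring
    rw [← integral_const_mul, ← integral_add (j1.const_mul 2) j2]
    simp only [e2]
    rw [integral_add (by exact j3.sub (j0.const_mul _)) (integrable_const _),
      integral_sub j3 (j0.const_mul _), integral_const_mul, hψ, psiSqD, psiD_zero]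
    simp
    ring

theorem PositivityAt.varGrad_le (hc : S.PositivityAt c) (hQ : IsRegression Q) {δ : ℝ} (hδ : 0 < δ)
    (hδ1 : δ ≤ 1) : S.varGrad Q δ ≤ S.varConst c * δ⁻¹ := by
  rw [hc.varGrad_eq hQ hδ]
  have := S.abs_varD_le hQ hc.1 (j := 0) (by norm_num) hδ hδ1
  rw [zero_add, pow_one] at this
  exact (le_abs_self _).trans this

theorem PositivityAt.varSq_eq (hc : S.PositivityAt c) (hQ : IsRegression Q) {δ : ℝ} (hδ : 0 < δ) :
    S.varSq Q δ = ∫ o, S.center Q δ o ^ 4 ∂S.P₀ - S.varGrad Q δ ^ 2 := by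
  have hm := (S.measurable_center hQ δ).pow_const 2
  have h2 : MemLp (fun o => S.center Q δ o ^ 2) 2 S.P₀ := by
    rw [memLp_two_iff_integrable_sq hm.aestronglyMeasurable]
    refine (hc.integrable_center_pow hQ hδ 4).congr (ae_of_all _ fun o => ?_)
    simp only []; ring
  rw [varSq, var, ← variance_eq_integral hm.aemeasurable, variance_eq_sub h2]
  congr 1
  refine integral_congr_ae (ae_of_all _ fun o => ?_)
  simp only [Pi.pow_apply]; ring

/-- Two factors are bounded in supremum norm and two are integrated: `δ⁻¹ ^ 2` times a variance of
order `δ⁻¹` gives the correct order `δ⁻¹ ^ 3`. -/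
theorem PositivityAt.integral_center_four_le (hc : S.PositivityAt c) (hQ : IsRegression Q) {δ : ℝ}
    (hδ : 0 < δ) (hδ1 : δ ≤ 1) :
    ∫ o, S.center Q δ o ^ 4 ∂S.P₀ ≤ S.gradConst c ^ 2 * S.varConst c * δ⁻¹ ^ 3 := by
  have h1 : ∫ o, S.center Q δ o ^ 4 ∂S.P₀ ≤
      ∫ o, (S.gradConst c * δ⁻¹) ^ 2 * S.center Q δ o ^ 2 ∂S.P₀ := by
    refine integral_mono_ae (hc.integrable_center_pow hQ hδ 4)
      ((hc.integrable_center_pow hQ hδ 2).const_mul _) ?_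
    filter_upwards [hc.center_le hQ hδ hδ1] with o ho
    have : S.center Q δ o ^ 2 ≤ (S.gradConst c * δ⁻¹) ^ 2 := by
      rw [← sq_abs]; gcongr
    calc S.center Q δ o ^ 4 = S.center Q δ o ^ 2 * S.center Q δ o ^ 2 := by ring
      _ ≤ _ := by gcongr
  refine h1.trans ?_
  rw [integral_const_mul]
  have h2 := hc.varGrad_le hQ hδ hδ1
  calc (S.gradConst c * δ⁻¹) ^ 2 * S.varGrad Q δ
      ≤ (S.gradConst c * δ⁻¹) ^ 2 * (S.varConst c * δ⁻¹) := by gcongr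
    _ = _ := by ring

theorem PositivityAt.varSq_le (hc : S.PositivityAt c) (hQ : IsRegression Q) {δ : ℝ}
    (hδ : 0 < δ) (hδ1 : δ ≤ 1) :
    S.varSq Q δ ≤ S.gradConst c ^ 2 * S.varConst c * δ⁻¹ ^ 3 := by
  rw [hc.varSq_eq hQ hδ]
  linarith [hc.integral_center_four_le hQ hδ hδ1, sq_nonneg (S.varGrad Q δ)]

/-- The smoothed part of the gradient plays the role of `s`. Being bounded, it changes fourth
moments only by a third moment, which is of order `δ⁻¹ ^ 2` and negligible against `δ⁻¹ ^ 3`. -/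
theorem abs_add_pow_four_sub_le {x s b : ℝ} (hs : |s| ≤ b) :
    |(x + s) ^ 4 - x ^ 4| ≤ b * (4 + 6 * b + 4 * b ^ 2 + b ^ 3) * (|x| ^ 3 + 1) := by
  have hb : 0 ≤ b := (abs_nonneg s).trans hs
  have hx := abs_nonneg x
  have h1 : |x| ≤ |x| ^ 3 + 1 := by nlinarith [mul_nonneg hx (sq_nonneg (|x| - 1))]
  have h2 : |x| ^ 2 ≤ |x| ^ 3 + 1 := by nlinarith [mul_nonneg hx (sq_nonneg (|x| - 1)), sq_nonneg (|x| - 1)]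
  have h3 : 0 ≤ |x| ^ 3 := by positivity
  have e : (x + s) ^ 4 - x ^ 4 = s * (4 * x ^ 3 + 6 * (x ^ 2 * s) + 4 * (x * s ^ 2) + s ^ 3) := by
    ring
  have a1 : |4 * x ^ 3| ≤ 4 * (|x| ^ 3 + 1) := by
    rw [abs_mul, abs_pow, abs_of_pos (by norm_num : (0 : ℝ) < 4)]; linarith
  have a2 : |6 * (x ^ 2 * s)| ≤ 6 * ((|x| ^ 3 + 1) * b) := by
    rw [abs_mul, abs_mul, abs_pow, abs_of_pos (by norm_num : (0 : ℝ) < 6)]; gcongr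
  have a3 : |4 * (x * s ^ 2)| ≤ 4 * ((|x| ^ 3 + 1) * b ^ 2) := by
    rw [abs_mul, abs_mul, abs_pow, abs_of_pos (by norm_num : (0 : ℝ) < 4)]; gcongr
  have a4 : |s ^ 3| ≤ (|x| ^ 3 + 1) * b ^ 3 := by
    rw [abs_pow]
    calc |s| ^ 3 ≤ b ^ 3 := by gcongr
      _ ≤ (|x| ^ 3 + 1) * b ^ 3 := le_mul_of_one_le_left (by positivity) (by linarith)
  rw [e, abs_mul, mul_assoc]
  refine mul_le_mul hs ?_ (abs_nonneg _) hb
  refine (abs_add_le _ _).trans ((add_le_add ((abs_add_three _ _ _).trans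
    (add_le_add (add_le_add a1 a2) a3)) a4).trans (le_of_eq ?_))
  ring

/-- A polynomial in bounds for fourth powers. -/
noncomputable def fourPoly (b : ℝ) : ℝ := b * (4 + 6 * b + 4 * b ^ 2 + b ^ 3)

theorem fourPoly_nonneg {b : ℝ} (hb : 0 ≤ b) : 0 ≤ fourPoly b := by
  unfold fourPoly; positivity

/-- A constant for the lower-order terms of the fourth moment. -/
noncomputable def fourConst (S : Setting 𝒲) (c : ℝ) : ℝ :=
  fourPoly (2 * S.kernelConst) * ((c ^ 2)⁻¹ * S.kernelConst ^ 3 + 1)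

theorem integrable_kern_pow (n : ℕ) {δ : ℝ} (hδ : 0 < δ) :
    Integrable (fun a => |S.kern δ a| ^ n) (volume.restrict (Set.Icc (0 : ℝ) 1)) := by
  refine integrable_bdd (((S.measurable_kern.comp measurable_prodMk_left).norm).pow_const n)
    (C := (S.kernelConst * δ⁻¹) ^ n) fun a => ?_
  rw [abs_pow, abs_abs]
  exact pow_le_pow_left₀ (abs_nonneg _) (S.abs_kern_le hδ a) n

theorem integral_kern_pow_le (n : ℕ) {δ : ℝ} (hδ : 0 < δ) :
    ∫ a in Set.Icc (0 : ℝ) 1, |S.kern δ a| ^ (n + 1) ≤ S.kernelConst ^ (n + 1) * δ⁻¹ ^ n := by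
  have hk := S.kernelConst_pos
  have h1 : ∫ a in Set.Icc (0 : ℝ) 1, |S.kern δ a| ^ (n + 1) ≤
      ∫ a in Set.Icc (0 : ℝ) 1, (S.kernelConst * δ⁻¹) ^ n * |S.kern δ a| := by
    refine integral_mono (integrable_kern_pow (n + 1) hδ)
      (Integrable.const_mul (by simpa using integrable_kern_pow (S := S) 1 hδ) _) fun a => ?_
    simp only [pow_succ]
    have := S.abs_kern_le hδ a
    gcongr
  refine h1.trans ?_
  rw [integral_const_mul]
  have h2 := S.integral_abs_kernD_le 0 hδ
  simp only [kernD_zero, pow_zero, mul_one] at h2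
  calc (S.kernelConst * δ⁻¹) ^ n * ∫ a in Set.Icc (0 : ℝ) 1, |S.kern δ a|
      ≤ (S.kernelConst * δ⁻¹) ^ n * S.kernelConst := by gcongr
    _ = _ := by rw [mul_pow, pow_succ]; ring

/-- Only the residual part contributes to the fourth moment at the leading order `δ⁻¹ ^ 3`;
everything else is absorbed by the third absolute moment of the residual. -/
theorem PositivityAt.abs_center_four_sub_le (hc : S.PositivityAt c) (hQ : IsRegression Q) {δ : ℝ}
    (hδ : 0 < δ) (hδ1 : δ ≤ 1) :
    |∫ o, S.center Q δ o ^ 4 ∂S.P₀ - ∫ p, |S.kern δ p.2| ^ 4 * S.momW c 3 Q p ∂S.base| ≤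
      S.fourConst c * δ⁻¹ ^ 2 := by
  have hk := S.kernelConst_pos
  have h0 := hc.1
  have hD0 : 0 ≤ fourPoly (2 * S.kernelConst) := fourPoly_nonneg (by positivity)
  have h1 := S.abs_integral_base_mul_le (integrable_kern_pow (S := S) 3 hδ)
    (ae_of_all _ fun p => S.abs_momW_le hQ h0 2 p)
  simp only [abs_pow, abs_abs] at h1
  have h2 := integral_kern_pow_le (S := S) 2 hδ
  have h3 : 1 ≤ δ⁻¹ ^ 2 := one_le_pow₀ ((one_le_inv₀ hδ).2 hδ1)
  have h4 : (c ^ 2)⁻¹ * ∫ a in Set.Icc (0 : ℝ) 1, |S.kern δ a| ^ (2 + 1) ≤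
      (c ^ 2)⁻¹ * (S.kernelConst ^ (2 + 1) * δ⁻¹ ^ 2) :=
    mul_le_mul_of_nonneg_left h2 (by positivity)
  have h5 : ∫ o, |S.resid Q δ o| ^ 3 ∂S.P₀ ≤ (c ^ 2)⁻¹ * (S.kernelConst ^ 3 * δ⁻¹ ^ 2) := by
    rw [hc.integral_resid_pow hQ hδ 2]
    exact ((le_abs_self _).trans h1).trans h4
  have i3 := hc.integrable_resid_pow hQ hδ 3
  have h6 : ∫ o, fourPoly (2 * S.kernelConst) * (|S.resid Q δ o| ^ 3 + 1) ∂S.P₀ ≤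
      S.fourConst c * δ⁻¹ ^ 2 := by
    rw [integral_const_mul, integral_add i3 (integrable_const _), fourConst, mul_assoc]
    refine mul_le_mul_of_nonneg_left ?_ hD0
    rw [integral_const, probReal_univ, smul_eq_mul, mul_one]
    linarith
  rw [← hc.integral_resid_pow hQ hδ 3, ← integral_sub (hc.integrable_center_pow hQ hδ 4)
    (hc.integrable_resid_pow hQ hδ 4), ← Real.norm_eq_abs]
  refine (norm_integral_le_of_norm_le ((i3.add (integrable_const _)).const_mul _)
    (ae_of_all _ fun o => ?_)).trans h6
  rw [center_eq, Real.norm_eq_abs, show |S.resid Q δ o| ^ 4 = S.resid Q δ o ^ 4 from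
    Even.pow_abs (by decide) _]
  exact abs_add_pow_four_sub_le (S.abs_smooth_sub_le hQ hδ o.1)

end Setting

namespace Setting

variable {𝒲 : Type*} [MeasurableSpace 𝒲] (S : Setting 𝒲) {Q Q' : 𝒲 → ℝ → ℝ}

/-! ### Neighbourhoods of the limit of the regression estimates -/

/-- The distance of `Q̄` to `Q̄_∞` in `L_∞(P₀)`. -/
noncomputable def distInf (Q : 𝒲 → ℝ → ℝ) : ℝ≥0∞ :=
  essSup (fun x : Obs 𝒲 => ‖Q x.1 x.2.1 - S.Qinf x.1 x.2.1‖ₑ) S.P₀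

/-- The distance of `Q̄` to `Q̄_∞` in `L_∞(P₀)`, as a real number. -/
noncomputable def devInf (Q : 𝒲 → ℝ → ℝ) : ℝ := (S.distInf Q).toReal

/-- Regression functions converging to `Q̄_∞` in `L_∞(P₀)`. -/
noncomputable def nearInf : Filter (𝒲 → ℝ → ℝ) :=
  𝓟 {Q | IsRegression Q} ⊓ comap S.devInf (𝓝 0)

theorem devInf_nonneg (Q : 𝒲 → ℝ → ℝ) : 0 ≤ S.devInf Q := ENNReal.toReal_nonneg

theorem distInf_lt_top (hQ : IsRegression Q) : S.distInf Q < ∞ := by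
  refine lt_of_le_of_lt (essSup_le_of_ae_le (1 : ℝ≥0∞) (ae_of_all _ fun x => ?_)) ENNReal.one_lt_top
  change ‖Q x.1 x.2.1 - S.Qinf x.1 x.2.1‖ₑ ≤ 1
  rw [← ofReal_norm, ← ENNReal.ofReal_one]
  refine ENNReal.ofReal_le_ofReal ?_
  have h1 := hQ.mem x.1 x.2.1
  have h2 := S.Qinf_mem x.1 x.2.1
  rw [Real.norm_eq_abs, abs_le]
  constructor <;> linarith [h1.1, h1.2, h2.1, h2.2]

/-- An essential supremum under the law of the data becomes a pointwise bound almost everywhere for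
`base`, the form in which the perturbation lemmas take it. -/
theorem ae_abs_sub_le_devInf (hQ : IsRegression Q) :
    ∀ᵐ p ∂S.base, |Q p.1 p.2 - S.Qinf p.1 p.2| ≤ S.devInf Q := by
  have h1 : Measurable fun p : 𝒲 × ℝ => Q p.1 p.2 := hQ.meas
  have h2 : Measurable fun p : 𝒲 × ℝ => S.Qinf p.1 p.2 := S.Qinf_meas
  refine S.ae_base_of_ae_P₀ (measurableSet_le (by fun_prop) measurable_const) ?_
  have h3 := ENNReal.ae_le_essSup (μ := S.P₀)
    (fun x : Obs 𝒲 => ‖Q x.1 x.2.1 - S.Qinf x.1 x.2.1‖ₑ)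
  filter_upwards [h3] with o ho
  have := ENNReal.toReal_mono (S.distInf_lt_top hQ).ne ho
  simpa [devInf] using this

theorem eventually_isRegression : ∀ᶠ Q in S.nearInf, IsRegression Q :=
  mem_inf_of_left (mem_principal_self _)

theorem tendsto_devInf : Tendsto S.devInf S.nearInf (𝓝 0) := tendsto_comap.mono_left inf_le_right

theorem devInf_Qinf : S.devInf S.Qinf = 0 := by
  have : (fun x : Obs 𝒲 => ‖S.Qinf x.1 x.2.1 - S.Qinf x.1 x.2.1‖ₑ) = fun _ => 0 := by
    ext x; simp
  rw [devInf, distInf, this]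
  have : essSup (fun _ : Obs 𝒲 => (0 : ℝ≥0∞)) S.P₀ = 0 :=
    le_antisymm (essSup_le_of_ae_le _ (ae_of_all _ fun _ => le_rfl)) zero_le
  rw [this]
  rfl

theorem tendsto_nearInf {α : Type*} {l : Filter α} {q : α → 𝒲 → ℝ → ℝ}
    (hq : ∀ x, IsRegression (q x)) (h : Tendsto (fun x => S.devInf (q x)) l (𝓝 0)) :
    Tendsto q l S.nearInf :=
  tendsto_inf.2 ⟨tendsto_principal.2 (Eventually.of_forall hq), tendsto_comap_iff.2 h⟩

theorem tendsto_const_Qinf {α : Type*} (l : Filter α) :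
    Tendsto (fun _ : α => S.Qinf) l S.nearInf :=
  S.tendsto_nearInf (fun _ => S.isRegression_Qinf) (by simpa [devInf_Qinf] using tendsto_const_nhds)

/-- Pairs of a regression function close to `Q̄_∞` and a small bandwidth. -/
noncomputable def nearLim : Filter ((𝒲 → ℝ → ℝ) × ℝ) := S.nearInf ×ˢ 𝓝[>] 0

theorem tendsto_snd_nearLim : Tendsto Prod.snd S.nearLim (𝓝[>] 0) := tendsto_snd

theorem tendsto_Qinf_nearLim :
    Tendsto (fun x : (𝒲 → ℝ → ℝ) × ℝ => (S.Qinf, x.2)) S.nearLim S.nearLim :=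
  (S.tendsto_const_Qinf _).prodMk tendsto_snd

theorem eventually_nearLim : ∀ᶠ x in S.nearLim, IsRegression x.1 ∧ 0 < x.2 ∧ x.2 ≤ 1 := by
  have h1 : ∀ᶠ δ : ℝ in 𝓝[>] 0, 0 < δ ∧ δ ≤ 1 := by
    filter_upwards [self_mem_nhdsWithin, nhdsWithin_le_nhds (Iic_mem_nhds one_pos)] with δ h1 h2
    exact ⟨h1, h2⟩
  exact (S.eventually_isRegression.prod_mk h1)

/-- The limit of `δ * σ_∞(δ) ^ 2`. -/
noncomputable def varLim (c : ℝ) : ℝ := S.momInf c 1 * ∫ u in locDomain S.a₀, S.K u ^ 2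

theorem varLim_pos (hnd : S.NonDegenerate) {c : ℝ} (hc : 0 < c) : 0 < S.varLim c :=
  mul_pos (S.momInf_pos hnd hc 1) (S.K_kernel.integral_pow_pos S.a₀_mem (j := 1) (by decide))

variable {S} {c : ℝ}

/-- After scaling, the smoothing terms are `O(δ)` and replacing `Q̄` by `Q̄_∞` costs `O(devInf)`;
what remains is the localised main term at `Q̄_∞`. The limit is joint in the regression and the
bandwidth, so both may be random and may depend on each other. -/
theorem tendsto_varD_aux (hcont : S.ContinuousAtDose) (hc : 0 < c) {j : ℕ} (hj : j ≤ 2) :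
    Tendsto (fun x : (𝒲 → ℝ → ℝ) × ℝ => x.2 ^ (j + 1) * S.varD c x.1 j x.2) S.nearLim
      (𝓝 (S.momInf c 1 * ∫ u in locDomain S.a₀, scaleDerivSq S.K j u)) := by
  have hsnd : Tendsto (fun x : (𝒲 → ℝ → ℝ) × ℝ => x.2) S.nearLim (𝓝 0) :=
    S.tendsto_snd_nearLim.mono_right nhdsWithin_le_nhds
  have hdev : Tendsto (fun x : (𝒲 → ℝ → ℝ) × ℝ => S.devInf x.1) S.nearLim (𝓝 0) :=
    S.tendsto_devInf.comp tendsto_fst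
  have h1 := (tendsto_integral_momW S hcont hc 1
    (S.K_kernel.scaleDerivSq_integrable j)).comp S.tendsto_snd_nearLim
  have h2 : Tendsto (fun x : (𝒲 → ℝ → ℝ) × ℝ => 16 * S.kernelConst ^ 2 * x.2 +
      2 * c⁻¹ * S.kernelConst * S.devInf x.1) S.nearLim (𝓝 0) := by
    have := (hsnd.const_mul (16 * S.kernelConst ^ 2)).add
      (hdev.const_mul (2 * c⁻¹ * S.kernelConst))
    simpa using this
  refine tendsto_of_tendsto_of_dist h1 (squeeze_zero' (Eventually.of_forall fun x => dist_nonneg)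
    ?_ h2)
  filter_upwards [S.eventually_nearLim] with x hx
  obtain ⟨hQ, hδ, hδ1⟩ := hx
  set δ := x.2
  have hp : (0 : ℝ) < δ ^ (j + 1) := by positivity
  have e1 : ((fun δ : ℝ => ∫ p, δ⁻¹ * scaleDerivSq S.K j ((p.2 - S.a₀) / δ) *
      S.momW c 1 S.Qinf p ∂S.base) ∘ Prod.snd) x = δ ^ (j + 1) * S.mainD c S.Qinf j δ := by
    rw [mainD, ← integral_const_mul]
    refine integral_congr_ae (ae_of_all _ fun p => ?_)
    simp only [kernSqD]
    have : δ ^ (j + 1) * δ⁻¹ ^ (j + 2) = δ⁻¹ := by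
      rw [pow_succ' δ⁻¹ (j + 1), mul_left_comm, ← mul_pow, mul_inv_cancel₀ hδ.ne', one_pow,
        mul_one]
    rw [← mul_assoc, ← mul_assoc, this]
  rw [e1, dist_comm, Real.dist_eq, ← mul_sub, abs_mul, abs_of_pos hp]
  have b1 := S.abs_varD_sub_mainD_le hQ c hj hδ
  have b2 := S.abs_mainD_sub_le hQ S.isRegression_Qinf (S.devInf_nonneg x.1)
    (S.ae_abs_sub_le_devInf hQ) hc j hδ
  have b3 : |S.varD c x.1 j δ - S.mainD c S.Qinf j δ| ≤ 16 * S.kernelConst ^ 2 * δ⁻¹ ^ j +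
      2 * S.devInf x.1 * c⁻¹ * S.kernelConst * δ⁻¹ ^ (j + 1) := by
    refine le_trans ?_ (add_le_add b1 b2)
    refine le_trans (le_of_eq ?_) (abs_add_le _ _)
    congr 1; ring
  refine (mul_le_mul_of_nonneg_left b3 hp.le).trans (le_of_eq ?_)
  rw [inv_pow, inv_pow]
  field_simp
  ring

theorem tendsto_varD_zero (hcont : S.ContinuousAtDose) (hc : 0 < c) :
    Tendsto (fun x : (𝒲 → ℝ → ℝ) × ℝ => x.2 * S.varD c x.1 0 x.2) S.nearLim (𝓝 (S.varLim c)) := by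
  simpa [scaleDerivSq, varLim] using tendsto_varD_aux hcont hc (j := 0) (by norm_num)

theorem tendsto_varD_one (hcont : S.ContinuousAtDose) (hc : 0 < c) :
    Tendsto (fun x : (𝒲 → ℝ → ℝ) × ℝ => x.2 ^ 2 * S.varD c x.1 1 x.2) S.nearLim
      (𝓝 (-S.varLim c)) := by
  have h := tendsto_varD_aux hcont hc (j := 1) (by norm_num)
  rw [S.K_kernel.integral_scaleDerivSq_one S.a₀_mem, mul_neg] at h
  exact h

theorem tendsto_varD_two (hcont : S.ContinuousAtDose) (hc : 0 < c) :
    Tendsto (fun x : (𝒲 → ℝ → ℝ) × ℝ => x.2 ^ 3 * S.varD c x.1 2 x.2) S.nearLim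
      (𝓝 (2 * S.varLim c)) := by
  have h := tendsto_varD_aux hcont hc (j := 2) (by norm_num)
  rw [S.K_kernel.integral_scaleDerivSq_two S.a₀_mem, mul_left_comm] at h
  exact h

theorem PositivityAt.tendsto_varGrad (hc : S.PositivityAt c) (hcont : S.ContinuousAtDose) :
    Tendsto (fun x : (𝒲 → ℝ → ℝ) × ℝ => x.2 * S.varGrad x.1 x.2) S.nearLim (𝓝 (S.varLim c)) := by
  refine (tendsto_varD_zero hcont hc.1).congr' ?_
  filter_upwards [S.eventually_nearLim] with x hx
  rw [hc.varGrad_eq hx.1 hx.2.1]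

theorem PositivityAt.tendsto_sdGrad (hc : S.PositivityAt c) (hcont : S.ContinuousAtDose) :
    Tendsto (fun x : (𝒲 → ℝ → ℝ) × ℝ => √x.2 * S.sdGrad x.1 x.2) S.nearLim
      (𝓝 √(S.varLim c)) := by
  refine ((hc.tendsto_varGrad hcont).sqrt).congr' ?_
  filter_upwards [S.eventually_nearLim] with x hx
  rw [sdGrad, Real.sqrt_mul hx.2.1.le]

theorem PositivityAt.eventually_varGrad_pos (hc : S.PositivityAt c) (hcont : S.ContinuousAtDose)
    (hnd : S.NonDegenerate) : ∀ᶠ x in S.nearLim, 0 < S.varGrad x.1 x.2 := by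
  filter_upwards [S.eventually_nearLim, (hc.tendsto_varGrad hcont).eventually
    (lt_mem_nhds (S.varLim_pos hnd hc.1))] with x hx h
  exact pos_of_mul_pos_right h hx.2.1.le

theorem PositivityAt.hasDerivAt_sdGrad (hc : S.PositivityAt c) (hQ : IsRegression Q) {δ : ℝ}
    (hδ : 0 < δ) (hV : 0 < S.varGrad Q δ) :
    HasDerivAt (S.sdGrad Q) (S.varD c Q 1 δ / (2 * S.sdGrad Q δ)) δ := by
  have h1 := S.hasDerivAt_varD hQ hc.1 zero_le_one hδ
  have h2 : S.varGrad Q =ᶠ[𝓝 δ] S.varD c Q 0 := by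
    filter_upwards [Ioi_mem_nhds hδ] with x hx using hc.varGrad_eq hQ hx
  exact (h1.congr_of_eventuallyEq h2).sqrt hV.ne'

theorem PositivityAt.hasDerivAt_deriv_sdGrad (hc : S.PositivityAt c) (hQ : IsRegression Q) {δ : ℝ}
    (hδ : 0 < δ) (hV : 0 < S.varGrad Q δ) :
    HasDerivAt (deriv (S.sdGrad Q)) (S.varD c Q 2 δ / (2 * S.sdGrad Q δ) -
      S.varD c Q 1 δ ^ 2 / (4 * S.sdGrad Q δ ^ 3)) δ := by
  have hs := hc.hasDerivAt_sdGrad hQ hδ hV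
  have hcontV : ContinuousAt (S.varGrad Q) δ := by
    have h1 := S.hasDerivAt_varD hQ hc.1 zero_le_one hδ
    have h2 : S.varGrad Q =ᶠ[𝓝 δ] S.varD c Q 0 := by
      filter_upwards [Ioi_mem_nhds hδ] with x hx using hc.varGrad_eq hQ hx
    exact (h1.congr_of_eventuallyEq h2).continuousAt
  have hev : deriv (S.sdGrad Q) =ᶠ[𝓝 δ] fun x => S.varD c Q 1 x / (2 * S.sdGrad Q x) := by
    filter_upwards [Ioi_mem_nhds hδ, hcontV.eventually (lt_mem_nhds hV)] with x hx hx2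
    exact (hc.hasDerivAt_sdGrad hQ hx hx2).deriv
  have hpos : 0 < S.sdGrad Q δ := Real.sqrt_pos.2 hV
  refine ((((S.hasDerivAt_varD hQ hc.1 le_rfl hδ).div (hs.const_mul 2)
    (by positivity)).congr_of_eventuallyEq hev)).congr_deriv ?_
  simp only [one_add_one_eq_two]
  field_simp
  ring

/-- From `σ' = V' / (2 σ)` with `V' ~ -B / δ ^ 2` and `σ ~ √(B / δ)`: the exponent of `σ'` is `-3/2`
and its constant is `-√B / 2`. -/
theorem PositivityAt.tendsto_deriv_sdGrad (hc : S.PositivityAt c) (hcont : S.ContinuousAtDose)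
    (hnd : S.NonDegenerate) :
    Tendsto (fun x : (𝒲 → ℝ → ℝ) × ℝ => x.2 * √x.2 * deriv (S.sdGrad x.1) x.2) S.nearLim
      (𝓝 (-(√(S.varLim c) / 2))) := by
  have hB := S.varLim_pos hnd hc.1
  have hsB : 0 < √(S.varLim c) := Real.sqrt_pos.2 hB
  have h := (tendsto_varD_one hcont hc.1).div ((hc.tendsto_sdGrad hcont).const_mul 2)
    (by positivity)
  have e : -S.varLim c / (2 * √(S.varLim c)) = -(√(S.varLim c) / 2) := by
    nth_rw 1 [← Real.mul_self_sqrt hB.le]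
    field_simp
  rw [e] at h
  refine h.congr' ?_
  filter_upwards [S.eventually_nearLim, hc.eventually_varGrad_pos hcont hnd] with x hx hV
  rw [(hc.hasDerivAt_sdGrad hx.1 hx.2.1 hV).deriv]
  have h1 : 0 < √x.2 := Real.sqrt_pos.2 hx.2.1
  have h2 : 0 < S.sdGrad x.1 x.2 := Real.sqrt_pos.2 hV
  have h3 : √x.2 * √x.2 = x.2 := Real.mul_self_sqrt hx.2.1.le
  simp only [Pi.div_apply]
  rw [div_eq_iff (by positivity)]
  field_simp
  rw [pow_two √x.2, h3]
  ring

/-- The two terms of `σ''` contribute `√B` and `-√B / 4`. They do not cancel, so the ratio asked for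
in A2 makes sense. -/
theorem PositivityAt.tendsto_deriv2_sdGrad (hc : S.PositivityAt c) (hcont : S.ContinuousAtDose)
    (hnd : S.NonDegenerate) :
    Tendsto (fun x : (𝒲 → ℝ → ℝ) × ℝ => x.2 ^ 2 * √x.2 * iteratedDeriv 2 (S.sdGrad x.1) x.2)
      S.nearLim (𝓝 (3 / 4 * √(S.varLim c))) := by
  have hB := S.varLim_pos hnd hc.1
  have hsB : 0 < √(S.varLim c) := Real.sqrt_pos.2 hB
  have hs := hc.tendsto_sdGrad hcont
  have h := ((tendsto_varD_two hcont hc.1).div (hs.const_mul 2) (by positivity)).sub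
    (((tendsto_varD_one hcont hc.1).pow 2).div ((hs.pow 3).const_mul 4) (by positivity))
  have e : 2 * S.varLim c / (2 * √(S.varLim c)) - (-S.varLim c) ^ 2 / (4 * √(S.varLim c) ^ 3) =
      3 / 4 * √(S.varLim c) := by
    have : S.varLim c = √(S.varLim c) ^ 2 := (Real.sq_sqrt hB.le).symm
    generalize √(S.varLim c) = y at *
    rw [this]
    field_simp
    ring
  rw [e] at h
  refine h.congr' ?_
  filter_upwards [S.eventually_nearLim, hc.eventually_varGrad_pos hcont hnd] with x hx hV
  rw [iteratedDeriv_succ, iteratedDeriv_one, (hc.hasDerivAt_deriv_sdGrad hx.1 hx.2.1 hV).deriv]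
  have h1 : 0 < √x.2 := Real.sqrt_pos.2 hx.2.1
  have h2 : 0 < S.sdGrad x.1 x.2 := Real.sqrt_pos.2 hV
  have h3 : x.2 = √x.2 ^ 2 := (Real.sq_sqrt hx.2.1.le).symm
  simp only [Pi.div_apply]
  generalize S.varD c x.1 2 x.2 = v2 at *
  generalize S.varD c x.1 1 x.2 = v1 at *
  generalize S.sdGrad x.1 x.2 = s at *
  generalize √x.2 = y at *
  rw [h3]
  field_simp

/-- The fourth moment dominates at order `δ⁻¹ ^ 3`, while the squared variance is only `O(δ⁻¹ ^ 2)`.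
-/
theorem PositivityAt.tendsto_varSq (hc : S.PositivityAt c) (hcont : S.ContinuousAtDose) :
    Tendsto (fun x : (𝒲 → ℝ → ℝ) × ℝ => x.2 ^ 3 * S.varSq x.1 x.2) S.nearLim
      (𝓝 (S.momInf c 3 * ∫ u in locDomain S.a₀, S.K u ^ 4)) := by
  have hc0 := hc.1
  have hsnd : Tendsto (fun x : (𝒲 → ℝ → ℝ) × ℝ => x.2) S.nearLim (𝓝 0) :=
    S.tendsto_snd_nearLim.mono_right nhdsWithin_le_nhds
  have hdev : Tendsto (fun x : (𝒲 → ℝ → ℝ) × ℝ => S.devInf x.1) S.nearLim (𝓝 0) :=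
    S.tendsto_devInf.comp tendsto_fst
  have h1 := (tendsto_integral_momW S hcont hc.1 3
    (S.K_kernel.pow_integrable 3)).comp S.tendsto_snd_nearLim
  set D := S.fourConst c + S.varConst c ^ 2 with hD
  set E := 4 * (c ^ 3)⁻¹ * S.kernelConst ^ 4 with hE
  have h2 : Tendsto (fun x : (𝒲 → ℝ → ℝ) × ℝ => D * x.2 + E * S.devInf x.1) S.nearLim (𝓝 0) := by
    simpa using (hsnd.const_mul D).add (hdev.const_mul E)
  refine tendsto_of_tendsto_of_dist h1 (squeeze_zero' (Eventually.of_forall fun x => dist_nonneg)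
    ?_ h2)
  filter_upwards [S.eventually_nearLim] with x hx
  obtain ⟨hQ, hδ, hδ1⟩ := hx
  set δ := x.2
  have hp : (0 : ℝ) < δ ^ 3 := by positivity
  have e1 : ((fun δ : ℝ => ∫ p, δ⁻¹ * S.K ((p.2 - S.a₀) / δ) ^ (3 + 1) *
      S.momW c 3 S.Qinf p ∂S.base) ∘ Prod.snd) x =
      δ ^ 3 * ∫ p, |S.kern δ p.2| ^ 4 * S.momW c 3 S.Qinf p ∂S.base := by
    rw [← integral_const_mul]
    refine integral_congr_ae (ae_of_all _ fun p => ?_)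
    simp only [Even.pow_abs (by decide : Even 4), kern]
    change δ⁻¹ * S.K ((p.2 - S.a₀) / δ) ^ 4 * S.momW c 3 S.Qinf p = _
    field_simp
  rw [e1, dist_comm, Real.dist_eq, ← mul_sub, abs_mul, abs_of_pos hp, hc.varSq_eq hQ hδ]
  have b1 := hc.abs_center_four_sub_le hQ hδ hδ1
  have b2 : |∫ p, |S.kern δ p.2| ^ 4 * S.momW c 3 x.1 p ∂S.base -
      ∫ p, |S.kern δ p.2| ^ 4 * S.momW c 3 S.Qinf p ∂S.base| ≤ E * S.devInf x.1 * δ⁻¹ ^ 3 := by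
    have hi : ∀ {Q : 𝒲 → ℝ → ℝ}, IsRegression Q →
        Integrable (fun p => |S.kern δ p.2| ^ 4 * S.momW c 3 Q p) S.base := fun {Q} hQ =>
      ((integrable_kern_pow 4 hδ).comp_snd S.covLaw).mul_bdd (c := (c ^ 3)⁻¹)
        (S.measurable_momW hQ c 3).aestronglyMeasurable
        (ae_of_all _ fun p => S.abs_momW_le hQ hc.1 3 p)
    rw [← integral_sub (hi hQ) (hi S.isRegression_Qinf)]
    simp only [← mul_sub]
    have hdn := S.devInf_nonneg x.1
    refine (S.abs_integral_base_mul_le (η := 4 * S.devInf x.1 * (c ^ 3)⁻¹)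
      (integrable_kern_pow 4 hδ) ?_).trans ?_
    · filter_upwards [S.ae_abs_sub_le_devInf hQ] with p hp
      refine (S.abs_momW_sub_le hQ S.isRegression_Qinf hc.1 3 p).trans ?_
      norm_num
      gcongr
    · simp only [abs_pow, abs_abs]
      have := integral_kern_pow_le (S := S) 3 hδ
      calc 4 * S.devInf x.1 * (c ^ 3)⁻¹ * ∫ a in Set.Icc (0 : ℝ) 1, |S.kern δ a| ^ 4
          ≤ 4 * S.devInf x.1 * (c ^ 3)⁻¹ * (S.kernelConst ^ 4 * δ⁻¹ ^ 3) := by gcongr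
        _ = _ := by rw [hE]; ring
  have b3 : |S.varGrad x.1 δ ^ 2| ≤ S.varConst c ^ 2 * δ⁻¹ ^ 2 := by
    rw [abs_pow, abs_of_nonneg (S.varGrad_nonneg _ _), ← mul_pow]
    exact pow_le_pow_left₀ (S.varGrad_nonneg _ _) (hc.varGrad_le hQ hδ hδ1) 2
  have b4 : |∫ o, S.center x.1 δ o ^ 4 ∂S.P₀ - S.varGrad x.1 δ ^ 2 -
      ∫ p, |S.kern δ p.2| ^ 4 * S.momW c 3 S.Qinf p ∂S.base| ≤
      D * δ⁻¹ ^ 2 + E * S.devInf x.1 * δ⁻¹ ^ 3 := by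
    rw [abs_le] at b1 b2 b3 ⊢
    constructor <;> linarith [b1.1, b1.2, b2.1, b2.2, b3.1, b3.2]
  refine (mul_le_mul_of_nonneg_left b4 hp.le).trans (le_of_eq ?_)
  field_simp

theorem varSqLim_pos (hnd : S.NonDegenerate) (hc : 0 < c) :
    0 < S.momInf c 3 * ∫ u in locDomain S.a₀, S.K u ^ 4 :=
  mul_pos (S.momInf_pos hnd hc 3) (S.K_kernel.integral_pow_pos S.a₀_mem (j := 3) (by decide))

/-- Equivalence of a quantity at the estimate and at `Q̄_∞` follows since both have the same nonzero
limit under the same scaling. -/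
theorem tendsto_div_of_scaled {α : Type*} {l : Filter α} {s f g : α → ℝ} {L : ℝ} (hL : L ≠ 0)
    (hs : ∀ᶠ x in l, s x ≠ 0) (hf : Tendsto (fun x => s x * f x) l (𝓝 L))
    (hg : Tendsto (fun x => s x * g x) l (𝓝 L)) : Tendsto (fun x => f x / g x) l (𝓝 1) := by
  have h := hf.div hg hL
  rw [div_self hL] at h
  refine h.congr' ?_
  filter_upwards [hs] with x hx
  exact mul_div_mul_left _ _ hx

theorem eventually_sqrt_ne : ∀ᶠ x in S.nearLim, √x.2 ≠ 0 := by
  filter_upwards [S.eventually_nearLim] with x hx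
  exact (Real.sqrt_pos.2 hx.2.1).ne'

theorem PositivityAt.tendsto_sdGrad_div (hc : S.PositivityAt c) (hcont : S.ContinuousAtDose)
    (hnd : S.NonDegenerate) : Tendsto (fun x : (𝒲 → ℝ → ℝ) × ℝ =>
      S.sdGrad x.1 x.2 / S.sdGrad S.Qinf x.2) S.nearLim (𝓝 1) := by
  refine tendsto_div_of_scaled (Real.sqrt_pos.2 (S.varLim_pos hnd hc.1)).ne' eventually_sqrt_ne
    (hc.tendsto_sdGrad hcont) ((hc.tendsto_sdGrad hcont).comp S.tendsto_Qinf_nearLim)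

theorem PositivityAt.tendsto_deriv2_sdGrad_div (hc : S.PositivityAt c) (hcont : S.ContinuousAtDose)
    (hnd : S.NonDegenerate) : Tendsto (fun x : (𝒲 → ℝ → ℝ) × ℝ =>
      iteratedDeriv 2 (S.sdGrad x.1) x.2 / iteratedDeriv 2 (S.sdGrad S.Qinf) x.2)
      S.nearLim (𝓝 1) := by
  have hpos := Real.sqrt_pos.2 (S.varLim_pos hnd hc.1)
  refine tendsto_div_of_scaled (by positivity) ?_ (hc.tendsto_deriv2_sdGrad hcont hnd)
    ((hc.tendsto_deriv2_sdGrad hcont hnd).comp S.tendsto_Qinf_nearLim)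
  filter_upwards [S.eventually_nearLim] with x hx
  have := Real.sqrt_pos.2 hx.2.1
  have := hx.2.1
  positivity

theorem PositivityAt.tendsto_varSq_div (hc : S.PositivityAt c) (hcont : S.ContinuousAtDose)
    (hnd : S.NonDegenerate) : Tendsto (fun x : (𝒲 → ℝ → ℝ) × ℝ =>
      S.varSq x.1 x.2 / S.varSq S.Qinf x.2) S.nearLim (𝓝 1) := by
  refine tendsto_div_of_scaled (varSqLim_pos hnd hc.1).ne' ?_
    (hc.tendsto_varSq hcont) ((hc.tendsto_varSq hcont).comp S.tendsto_Qinf_nearLim)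
  filter_upwards [S.eventually_nearLim] with x hx
  have := hx.2.1
  positivity

/-- The variance diverges as `B / δ`. The lower bound `1` makes square roots Lipschitz wherever
variances are compared. -/
theorem PositivityAt.eventually_one_le_sdGrad (hc : S.PositivityAt c) (hcont : S.ContinuousAtDose)
    (hnd : S.NonDegenerate) : ∀ᶠ x in S.nearLim, 1 ≤ S.sdGrad x.1 x.2 := by
  have hsnd : Tendsto (fun x : (𝒲 → ℝ → ℝ) × ℝ => x.2) S.nearLim (𝓝 0) :=
    S.tendsto_snd_nearLim.mono_right nhdsWithin_le_nhds
  have hB := S.varLim_pos hnd hc.1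
  filter_upwards [S.eventually_nearLim, (hc.tendsto_varGrad hcont).eventually
    (lt_mem_nhds (half_lt_self hB)), hsnd.eventually (gt_mem_nhds (half_pos hB))] with x hx h1 h2
  rw [sdGrad, Real.one_le_sqrt]
  by_contra hlt
  push Not at hlt
  have := mul_lt_mul_of_pos_left hlt hx.2.1
  linarith

/-- A difference of squares is the difference times the sum, and the sum of the two standard
deviations is at least one. -/
theorem PositivityAt.eventually_abs_sdGrad_sub_le (hc : S.PositivityAt c)
    (hcont : S.ContinuousAtDose) (hnd : S.NonDegenerate) : ∀ᶠ x in S.nearLim,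
      |S.sdGrad x.1 x.2 - S.sdGrad S.Qinf x.2| ≤ S.varConst c * S.devInf x.1 * x.2⁻¹ := by
  filter_upwards [S.eventually_nearLim, hc.eventually_one_le_sdGrad hcont hnd,
    S.tendsto_Qinf_nearLim.eventually (hc.eventually_one_le_sdGrad hcont hnd)] with x hx h1 h2
  have h := S.abs_varD_sub_le hx.1 S.isRegression_Qinf (S.devInf_nonneg x.1)
    (S.ae_abs_sub_le_devInf hx.1) hc.1 zero_le_one hx.2.1 hx.2.2
  rw [← hc.varGrad_eq hx.1 hx.2.1, ← hc.varGrad_eq S.isRegression_Qinf hx.2.1, zero_add, pow_one]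
    at h
  refine le_trans ?_ h
  have e : S.varGrad x.1 x.2 - S.varGrad S.Qinf x.2 =
      (S.sdGrad x.1 x.2 - S.sdGrad S.Qinf x.2) * (S.sdGrad x.1 x.2 + S.sdGrad S.Qinf x.2) := by
    rw [← Real.sq_sqrt (S.varGrad_nonneg x.1 x.2), ← Real.sq_sqrt (S.varGrad_nonneg S.Qinf x.2)]
    simp only [sdGrad]
    ring
  rw [e, abs_mul]
  refine le_mul_of_one_le_right (abs_nonneg _) ?_
  rw [abs_of_pos (by linarith)]
  linarith

/-- In `V' / (2 σ)` the change of `V'` costs `δ⁻¹ ^ 2`, and the change of `σ`, of order `δ⁻¹`, is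
multiplied by `V' = O(δ⁻¹ ^ 2)`; hence the cubic factor. -/
theorem PositivityAt.eventually_abs_deriv_sdGrad_sub_le (hc : S.PositivityAt c)
    (hcont : S.ContinuousAtDose) (hnd : S.NonDegenerate) : ∀ᶠ x in S.nearLim,
      |deriv (S.sdGrad x.1) x.2 - deriv (S.sdGrad S.Qinf) x.2| ≤
        (S.varConst c + S.varConst c ^ 2) * S.devInf x.1 * x.2⁻¹ ^ 3 := by
  filter_upwards [S.eventually_nearLim, hc.eventually_one_le_sdGrad hcont hnd,
    S.tendsto_Qinf_nearLim.eventually (hc.eventually_one_le_sdGrad hcont hnd),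
    hc.eventually_abs_sdGrad_sub_le hcont hnd, hc.eventually_varGrad_pos hcont hnd,
    S.tendsto_Qinf_nearLim.eventually (hc.eventually_varGrad_pos hcont hnd)]
    with x hx h1 h2 h3 h4 h5
  have hC := S.varConst_pos hc.1
  have hη := S.devInf_nonneg x.1
  have k1 := S.abs_varD_sub_le hx.1 S.isRegression_Qinf (S.devInf_nonneg x.1)
    (S.ae_abs_sub_le_devInf hx.1) hc.1 le_rfl hx.2.1 hx.2.2
  have k2 := S.abs_varD_le S.isRegression_Qinf hc.1 (j := 1) (by norm_num) hx.2.1 hx.2.2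
  rw [(hc.hasDerivAt_sdGrad hx.1 hx.2.1 h4).deriv,
    (hc.hasDerivAt_sdGrad S.isRegression_Qinf hx.2.1 h5).deriv]
  have hpos : 0 < x.2⁻¹ := inv_pos.2 hx.2.1
  have k3 := inv_pow_le_succ hx.2.1 hx.2.2 2
  simp only [one_add_one_eq_two] at k1 k2
  generalize S.varD c x.1 1 x.2 = v at *
  generalize S.varD c S.Qinf 1 x.2 = v' at *
  generalize S.sdGrad x.1 x.2 = s at *
  generalize S.sdGrad S.Qinf x.2 = s' at *
  have e : v / (2 * s) - v' / (2 * s') = (v - v') / (2 * s) - v' * (s - s') / (2 * s * s') := by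
    field_simp
    ring
  rw [e]
  refine (abs_sub _ _).trans ?_
  rw [abs_div, abs_div, abs_mul v', abs_of_pos (by positivity : 0 < 2 * s),
    abs_of_pos (by positivity : 0 < 2 * s * s')]
  have m1 : |v - v'| / (2 * s) ≤ |v - v'| := div_le_self (abs_nonneg _) (by linarith)
  have m2 : |v'| * |s - s'| / (2 * s * s') ≤ |v'| * |s - s'| :=
    div_le_self (by positivity) (by nlinarith)
  have m3 : |v'| * |s - s'| ≤ (S.varConst c * x.2⁻¹ ^ 2) * (S.varConst c * S.devInf x.1 * x.2⁻¹) := by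
    gcongr
  have m4 : S.varConst c * S.devInf x.1 * x.2⁻¹ ^ 2 ≤ S.varConst c * S.devInf x.1 * x.2⁻¹ ^ 3 := by
    gcongr
  calc _ ≤ S.varConst c * S.devInf x.1 * x.2⁻¹ ^ 3 +
        (S.varConst c * x.2⁻¹ ^ 2) * (S.varConst c * S.devInf x.1 * x.2⁻¹) := by linarith
    _ = _ := by ring

end Setting

/-! ### Sizes of the parts of the sample -/

section Sizes

theorem tendsto_cut_div {p : ℝ} (hp : 0 ≤ p) :
    Tendsto (fun n : ℕ => (cut p n : ℝ) / n) atTop (𝓝 p) :=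
  (tendsto_nat_floor_mul_div_atTop hp).comp tendsto_natCast_atTop_atTop

theorem tendsto_midSize_div {p₁ p₂ : ℝ} (h1 : 0 ≤ p₁) (h2 : 0 ≤ p₂) :
    Tendsto (fun n : ℕ => midSize p₁ p₂ n / n) atTop (𝓝 (p₂ - p₁)) := by
  simpa only [midSize, sub_div] using (tendsto_cut_div h2).sub (tendsto_cut_div h1)

theorem tendsto_lastSize_div {p : ℝ} (hp : 0 ≤ p) :
    Tendsto (fun n : ℕ => lastSize p n / n) atTop (𝓝 (1 - p)) := by
  refine (tendsto_const_nhds.sub (tendsto_cut_div hp)).congr' ?_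
  filter_upwards [eventually_gt_atTop 0] with n hn
  have : (n : ℝ) ≠ 0 := by positivity
  rw [lastSize, sub_div, div_self this]

theorem tendsto_atTop_of_div {f : ℕ → ℝ} {q : ℝ} (hq : 0 < q)
    (h : Tendsto (fun n : ℕ => f n / n) atTop (𝓝 q)) : Tendsto f atTop atTop := by
  refine (h.pos_mul_atTop hq tendsto_natCast_atTop_atTop).congr' ?_
  filter_upwards [eventually_gt_atTop 0] with n hn
  have : (n : ℝ) ≠ 0 := by positivity
  exact div_mul_cancel₀ _ this

theorem tendsto_cut {p : ℝ} (hp : 0 < p) : Tendsto (cut p) atTop atTop :=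
  tendsto_natCast_atTop_iff.1 (tendsto_atTop_of_div hp (tendsto_cut_div hp.le))

theorem tendsto_midSize {p₁ p₂ : ℝ} (h1 : 0 < p₁) (h2 : p₁ < p₂) :
    Tendsto (midSize p₁ p₂) atTop atTop :=
  tendsto_atTop_of_div (by linarith) (tendsto_midSize_div h1.le (by linarith))

theorem tendsto_lastSize {p : ℝ} (hp : 0 < p) (hp1 : p < 1) :
    Tendsto (lastSize p) atTop atTop :=
  tendsto_atTop_of_div (by linarith) (tendsto_lastSize_div hp.le)

theorem midSize_le {p₁ p₂ : ℝ} (h2 : p₂ ≤ 1) (n : ℕ) : midSize p₁ p₂ n ≤ n := by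
  have h : cut p₂ n ≤ n := by
    refine Nat.floor_le_of_le ?_
    have : (0 : ℝ) ≤ n := by positivity
    nlinarith
  have h' : ((cut p₂ n : ℕ) : ℝ) ≤ n := by exact_mod_cast h
  have : (0 : ℝ) ≤ cut p₁ n := by positivity
  rw [midSize]
  linarith

theorem tendsto_rpow_neg_nhdsGT {f : ℕ → ℝ} (hf : Tendsto f atTop atTop) {r : ℝ} (hr : 0 < r) :
    Tendsto (fun n => f n ^ (-r)) atTop (𝓝[>] 0) := by
  refine tendsto_nhdsWithin_iff.2 ⟨(tendsto_rpow_neg_atTop hr).comp hf, ?_⟩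
  filter_upwards [hf.eventually_gt_atTop 0] with n hn
  exact Real.rpow_pos_of_pos hn _

theorem SlowerThan.tendsto_nhdsGT {r : ℝ} {d : ℕ → ℝ} (h : SlowerThan r d) :
    Tendsto d atTop (𝓝[>] 0) :=
  tendsto_nhdsWithin_iff.2 ⟨h.2.1, Eventually.of_forall h.1⟩

end Sizes

/-! ### Conditions A2, A4 and A6 -/

namespace Setting

variable {𝒲 : Type*} [MeasurableSpace 𝒲] (S : Setting 𝒲)
  {Ω : Type*} [MeasurableSpace Ω] {Pr : Measure Ω} {O : ℕ → Ω → Obs 𝒲}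

variable {S}

/-- Giving up half of the rate absorbs the unknown constant of the `O_P` statement and the fraction
`p` of the sample, and yields a clean bound with high probability. -/
theorem UniformRate.eventually_le (h : S.UniformRate Pr O) : ∃ r : ℝ, 0 < r ∧
    ∀ p : ℝ, 0 < p → ∀ᶠ x : ℕ × Ω in whp Pr,
      S.devInf (S.fitQ (cut p x.1) (O · x.2)) ≤ (x.1 : ℝ) ^ (-r) := by
  obtain ⟨r, hr, h⟩ := h
  refine ⟨r / 2, by positivity, fun p hp => ?_⟩
  have hab : (fun n : ℕ => ((cut p n : ℕ) : ℝ) ^ (-r)) =o[atTop] fun n : ℕ => (n : ℝ) ^ (-(r / 2)) := by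
    have h1 : Tendsto (fun n : ℕ => ((cut p n : ℝ) / n) ^ (-r) * (n : ℝ) ^ (-(r / 2))) atTop
        (𝓝 0) := by
      have := ((tendsto_cut_div hp.le).rpow_const (p := -r) (Or.inl hp.ne')).mul
        ((tendsto_rpow_neg_atTop (half_pos hr)).comp tendsto_natCast_atTop_atTop)
      simpa using this
    refine isLittleO_of_tendsto' ?_ (h1.congr' ?_)
    · filter_upwards [eventually_gt_atTop 0] with n hn h0
      have : (0 : ℝ) < (n : ℝ) ^ (-(r / 2)) := Real.rpow_pos_of_pos (by positivity) _
      exact absurd h0 this.ne'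
    · filter_upwards [eventually_gt_atTop 0] with n hn
      have hn' : (0 : ℝ) < n := by positivity
      rw [Real.div_rpow (by positivity) hn'.le, div_mul_eq_mul_div, div_eq_div_iff
        (Real.rpow_pos_of_pos hn' _).ne' (Real.rpow_pos_of_pos hn' _).ne', mul_assoc,
        ← Real.rpow_add hn']
      ring_nf
  have hev := tendsto_whp_of_bigOPE h (tendsto_cut hp) hab 1 one_pos
  filter_upwards [hev] with x hx
  rw [one_mul, abs_of_nonneg (Real.rpow_nonneg (by positivity) _)] at hx
  exact ENNReal.toReal_le_of_le_ofReal (Real.rpow_nonneg (by positivity) _) hx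

theorem UniformRate.tendsto_nearInf (h : S.UniformRate Pr O) {p : ℝ} (hp : 0 < p) :
    Tendsto (fun x : ℕ × Ω => S.fitQ (cut p x.1) (O · x.2)) (whp Pr) S.nearInf := by
  obtain ⟨r, hr, hev⟩ := h.eventually_le
  refine S.tendsto_nearInf (fun x => S.isRegression_fitQ _ _) ?_
  refine squeeze_zero' (Eventually.of_forall fun x => S.devInf_nonneg _) (hev p hp) ?_
  have h0 : Tendsto (fun n : ℕ => (n : ℝ) ^ (-r)) atTop (𝓝 0) :=
    (tendsto_rpow_neg_atTop hr).comp tendsto_natCast_atTop_atTop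
  exact h0.comp tendsto_fst_whp

theorem UniformRate.tendsto_nearLim (h : S.UniformRate Pr O) {p : ℝ} (hp : 0 < p)
    {D : ℕ × Ω → ℝ} (hD : Tendsto D (whp Pr) (𝓝[>] 0)) :
    Tendsto (fun x : ℕ × Ω => (S.fitQ (cut p x.1) (O · x.2), D x)) (whp Pr) S.nearLim :=
  (h.tendsto_nearInf hp).prodMk hD

theorem Positivity.exists (h : S.Positivity) : ∃ c, S.PositivityAt c := h

variable {c p₁ p₂ : ℝ}

theorem PositivityAt.condition_A2 (hc : S.PositivityAt c) (hcont : S.ContinuousAtDose)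
    (hnd : S.NonDegenerate) (hu : S.UniformRate Pr O) (h1 : 0 < p₁) (h2 : p₁ < p₂) (h3 : p₂ ≤ 1) :
    S.A2 Pr O p₁ p₂ := by
  obtain ⟨κ, hκ, hev⟩ := hu.eventually_le
  have hmid : ∀ᶠ n : ℕ in atTop, (n : ℝ) ^ (-κ) ≤ midSize p₁ p₂ n ^ (-κ) := by
    filter_upwards [(tendsto_midSize h1 h2).eventually_gt_atTop 0] with n hn
    exact Real.rpow_le_rpow_of_nonpos hn (midSize_le h3 n) (by linarith)
  -- The exponents `1` and `3` of `δ⁻¹` are those of the perturbation bounds for `σ` and `σ'`. The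
  -- first `1` is an arbitrary choice: only `d n → 0` from the right is used.
  refine ⟨1, 1, 3, κ, κ, one_pos, one_pos, by norm_num, hκ, hκ, fun d hd => ?_⟩
  have hlim : Tendsto (fun x : ℕ × Ω => (S.fitQ (cut p₁ x.1) (O · x.2), d x.1)) (whp Pr)
      S.nearLim := hu.tendsto_nearLim h1 (D := fun x => d x.1) (hd.tendsto_nhdsGT.comp tendsto_fst_whp)
  have key := (hc.tendsto_deriv2_sdGrad_div hcont hnd).comp hlim
  have ev1 := hlim.eventually (hc.eventually_abs_sdGrad_sub_le hcont hnd)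
  have ev2 := hlim.eventually (hc.eventually_abs_deriv_sdGrad_sub_le hcont hnd)
  have ev3 := tendsto_fst_whp (Pr := Pr) |>.eventually hmid
  have hC := S.varConst_pos hc.1
  simp only [sdInf_eq, fitSd_eq]
  refine ⟨bigOP_of_isBigO (IsBigO.of_bound (S.varConst c) ?_),
    bigOP_of_isBigO (IsBigO.of_bound (S.varConst c + S.varConst c ^ 2) ?_),
    equivP_iff.2 key⟩
  · filter_upwards [ev1, hev p₁ h1, ev3] with x k1 k2 k3
    have hd0 := hd.1 x.1
    refine k1.trans ?_
    have hm0 : 0 ≤ midSize p₁ p₂ x.1 ^ (-κ) :=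
      (Real.rpow_nonneg (Nat.cast_nonneg _) _).trans k3
    rw [Real.norm_eq_abs, abs_of_nonneg (mul_nonneg (Real.rpow_nonneg hd0.le _) hm0),
      Real.rpow_neg_one, mul_assoc, mul_comm (d x.1)⁻¹]
    have := k2.trans k3
    have := inv_pos.2 hd0
    gcongr
  · filter_upwards [ev2, hev p₁ h1, ev3] with x k1 k2 k3
    have hd0 := hd.1 x.1
    refine k1.trans ?_
    have hm0 : 0 ≤ midSize p₁ p₂ x.1 ^ (-κ) :=
      (Real.rpow_nonneg (Nat.cast_nonneg _) _).trans k3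
    have e : d x.1 ^ (-3 : ℝ) = (d x.1)⁻¹ ^ 3 := by
      rw [Real.rpow_neg hd0.le, inv_pow]
      norm_cast
    rw [Real.norm_eq_abs, abs_of_nonneg (mul_nonneg (Real.rpow_nonneg hd0.le _) hm0), e,
      mul_assoc, mul_comm ((d x.1)⁻¹ ^ 3)]
    have := k2.trans k3
    have := inv_pos.2 hd0
    gcongr

theorem PositivityAt.condition_A4 (hc : S.PositivityAt c) (hcont : S.ContinuousAtDose)
    (hnd : S.NonDegenerate) (hu : S.UniformRate Pr O) (h1 : 0 < p₁) : S.A4 Pr O p₁ := by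
  refine ⟨1, one_pos, fun d hd => equivP_iff.2 ?_⟩
  simp only [varHInf_eq, fitVarH_eq]
  have hlim : Tendsto (fun x : ℕ × Ω => (S.fitQ (cut p₁ x.1) (O · x.2), d x.1)) (whp Pr)
      S.nearLim := hu.tendsto_nearLim h1 (D := fun x => d x.1) (hd.tendsto_nhdsGT.comp tendsto_fst_whp)
  have key := (hc.tendsto_varSq_div hcont hnd).comp hlim
  exact key

theorem PositivityAt.condition_A6 (hc : S.PositivityAt c) (hcont : S.ContinuousAtDose)
    (hnd : S.NonDegenerate) (hu : S.UniformRate Pr O) (h2 : 0 < p₂) (h3 : p₂ < 1) {r₀ : ℝ}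
    (hr₀ : 0 < r₀) : S.A6 Pr O p₂ r₀ := by
  filter_upwards [Ioi_mem_nhds hr₀] with r hr
  refine equivP_iff.2 ?_
  simp only [sdInf_eq, fitSd_eq]
  have hlim : Tendsto (fun x : ℕ × Ω => (S.fitQ (cut p₂ x.1) (O · x.2), lastSize p₂ x.1 ^ (-r)))
      (whp Pr) S.nearLim := hu.tendsto_nearLim h2 (D := fun x => lastSize p₂ x.1 ^ (-r))
        ((tendsto_rpow_neg_nhdsGT (tendsto_lastSize h2 h3) hr).comp tendsto_fst_whp)
  have key := (hc.tendsto_sdGrad_div hcont hnd).comp hlim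
  exact key

end Setting

/-! ### Conditioning on the first observations -/

section Freezing

variable {Ω : Type*} [MeasurableSpace Ω] {Pr : Measure Ω} [IsProbabilityMeasure Pr]
  {α : Type*} [MeasurableSpace α] {O : ℕ → Ω → α}

/-- The sequence `o` with the entries outside `s` replaced by `o₀`. -/
def mask (s : Finset ℕ) (o₀ : α) (o : ℕ → α) : ℕ → α := fun i => if i ∈ s then o i else o₀

theorem measurable_mask (s : Finset ℕ) (o₀ : α) : Measurable (mask s o₀) := by
  refine measurable_pi_lambda _ fun i => ?_
  unfold mask
  split_ifs
  · exact measurable_pi_apply i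
  · exact measurable_const

/-- Independence of two disjoint finite blocks, rewritten for whole sequences. Filling the other
entries with a constant lets estimators defined on sequences be used without change. -/
theorem map_mask_eq_prod (hO : ∀ i, Measurable (O i)) (hI : iIndepFun O Pr) {s t : Finset ℕ}
    (hst : Disjoint s t) (o₀ : α) :
    Pr.map (fun ω => (mask s o₀ (O · ω), mask t o₀ (O · ω))) =
      (Pr.map fun ω => mask s o₀ (O · ω)).prod (Pr.map fun ω => mask t o₀ (O · ω)) := by
  have h := hI.indepFun_finset s t hst hO
  have hext : ∀ u : Finset ℕ, Measurable
      (fun (z : u → α) (i : ℕ) => if hi : i ∈ u then z ⟨i, hi⟩ else o₀) := by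
    intro u
    refine measurable_pi_lambda _ fun i => ?_
    by_cases hi : i ∈ u
    · simp only [hi, dite_true]; exact measurable_pi_apply _
    · simp only [hi, dite_false]; exact measurable_const
  have h2 := h.comp (hext s) (hext t)
  have e : ∀ u : Finset ℕ, (fun (z : u → α) (i : ℕ) => if hi : i ∈ u then z ⟨i, hi⟩ else o₀) ∘
      (fun ω (i : u) => O i ω) = fun ω => mask u o₀ (O · ω) := by
    intro u
    ext ω i
    simp only [Function.comp_apply, mask]
    split_ifs <;> rfl
  rw [e s, e t] at h2
  have hm : ∀ u : Finset ℕ, Measurable fun ω => mask u o₀ (O · ω) := fun u =>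
    (measurable_mask u o₀).comp (measurable_pi_lambda _ hO)
  exact (indepFun_iff_map_prod_eq_prod_map_map (hm s).aemeasurable (hm t).aemeasurable).1 h2

/-- Functions of two sequences which depend on the first `l` entries of the first one, and on the
entries with index in `[l, n)` of the second one. -/
def SplitsAt {E : Type*} (l n : ℕ) (G : (ℕ → α) → (ℕ → α) → E) : Prop :=
  ∀ a a' b b', (∀ i < l, a i = a' i) → (∀ i, l ≤ i → i < n → b i = b' i) → G a b = G a' b'

omit [MeasurableSpace α] in
theorem SplitsAt.mask_eq {E : Type*} {l n : ℕ} {G : (ℕ → α) → (ℕ → α) → E} (h : SplitsAt l n G)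
    (o₀ : α) (a b : ℕ → α) : G (mask (Finset.range l) o₀ a) (mask (Finset.Ico l n) o₀ b) = G a b := by
  refine h _ _ _ _ (fun i hi => ?_) (fun i h1 h2 => ?_)
  · simp [mask, hi]
  · simp [mask, h1, h2]

theorem disjoint_range_Ico (l n : ℕ) : Disjoint (Finset.range l) (Finset.Ico l n) := by
  rw [Finset.disjoint_left]
  intro i h1 h2
  simp only [Finset.mem_range, Finset.mem_Ico] at h1 h2
  omega

/-- Conditioning on the first `l` observations. -/
theorem lintegral_splitsAt (hO : ∀ i, Measurable (O i)) (hI : iIndepFun O Pr) {l n : ℕ}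
    {G : (ℕ → α) → (ℕ → α) → ℝ≥0∞} (hG : Measurable (Function.uncurry G)) (h : SplitsAt l n G) :
    ∫⁻ ω, G (O · ω) (O · ω) ∂Pr = ∫⁻ ω, ∫⁻ ω', G (O · ω) (O · ω') ∂Pr ∂Pr := by
  obtain ⟨ω₀⟩ : Nonempty Ω := Pr.nonempty_of_neZero
  set o₀ := O 0 ω₀
  have hm : ∀ u : Finset ℕ, Measurable fun ω => mask u o₀ (O · ω) := fun u =>
    (measurable_mask u o₀).comp (measurable_pi_lambda _ hO)
  have e := map_mask_eq_prod hO hI (disjoint_range_Ico l n) o₀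
  calc ∫⁻ ω, G (O · ω) (O · ω) ∂Pr
      = ∫⁻ ω, Function.uncurry G (mask (Finset.range l) o₀ (O · ω),
          mask (Finset.Ico l n) o₀ (O · ω)) ∂Pr := by
        refine lintegral_congr fun ω => ?_
        exact (h.mask_eq o₀ _ _).symm
    _ = _ := by
        rw [← lintegral_map (f := Function.uncurry G) hG ((hm _).prodMk (hm _)), e,
          lintegral_prod _ hG.aemeasurable, lintegral_map hG.lintegral_prod_right' (hm _)]
        refine lintegral_congr fun ω => ?_
        refine (lintegral_map (hG.comp measurable_prodMk_left) (hm _)).trans ?_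
        exact lintegral_congr fun ω' => h.mask_eq o₀ _ _

/-- The bounded complex-valued counterpart, used for characteristic functions. -/
theorem integral_splitsAt (hO : ∀ i, Measurable (O i)) (hI : iIndepFun O Pr) {l n : ℕ}
    {G : (ℕ → α) → (ℕ → α) → ℂ} (hG : Measurable (Function.uncurry G)) (h : SplitsAt l n G)
    {C : ℝ} (hC : ∀ a b, ‖G a b‖ ≤ C) :
    ∫ ω, G (O · ω) (O · ω) ∂Pr = ∫ ω, ∫ ω', G (O · ω) (O · ω') ∂Pr ∂Pr := by
  obtain ⟨ω₀⟩ : Nonempty Ω := Pr.nonempty_of_neZero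
  set o₀ := O 0 ω₀
  have hm : ∀ u : Finset ℕ, Measurable fun ω => mask u o₀ (O · ω) := fun u =>
    (measurable_mask u o₀).comp (measurable_pi_lambda _ hO)
  have e := map_mask_eq_prod hO hI (disjoint_range_Ico l n) o₀
  have hp : ∀ u : Finset ℕ, IsProbabilityMeasure (Pr.map fun ω => mask u o₀ (O · ω)) := fun u =>
    Measure.isProbabilityMeasure_map (hm u).aemeasurable
  have h1 := hp (Finset.range l)
  have h2 := hp (Finset.Ico l n)
  calc ∫ ω, G (O · ω) (O · ω) ∂Pr
      = ∫ ω, Function.uncurry G (mask (Finset.range l) o₀ (O · ω),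
          mask (Finset.Ico l n) o₀ (O · ω)) ∂Pr :=
        integral_congr_ae (ae_of_all _ fun ω => (h.mask_eq o₀ _ _).symm)
    _ = ∫ x, Function.uncurry G x ∂((Pr.map fun ω => mask (Finset.range l) o₀ (O · ω)).prod
          (Pr.map fun ω => mask (Finset.Ico l n) o₀ (O · ω))) := by
        rw [← e, integral_map ((hm _).prodMk (hm _)).aemeasurable hG.aestronglyMeasurable]
    _ = _ := by
        rw [integral_prod _ (Integrable.of_bound hG.aestronglyMeasurable C
          (ae_of_all _ fun x => hC x.1 x.2))]
        rw [integral_map (hm _).aemeasurable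
          hG.stronglyMeasurable.integral_prod_right'.aestronglyMeasurable]
        refine integral_congr_ae (ae_of_all _ fun ω => ?_)
        refine (integral_map (hm _).aemeasurable
          (hG.comp measurable_prodMk_left).aestronglyMeasurable).trans ?_
        exact integral_congr_ae (ae_of_all _ fun ω' => h.mask_eq o₀ _ _)

end Freezing

namespace Setting

/-- `O` is an i.i.d. sample from the data-generating law. -/
structure IsSample {𝒲 : Type*} [MeasurableSpace 𝒲] (S : Setting 𝒲) {Ω : Type*} [MeasurableSpace Ω]
    (Pr : Measure Ω) (O : ℕ → Ω → Obs 𝒲) : Prop where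
  meas : ∀ i, Measurable (O i)
  indep : iIndepFun O Pr
  law : ∀ i, Pr.map (O i) = S.P₀

/-! ### Second moments of sample averages -/

section Moments

variable {𝒲 : Type*} [MeasurableSpace 𝒲] {S : Setting 𝒲} {Ω : Type*} [MeasurableSpace Ω]
  {Pr : Measure Ω} {O : ℕ → Ω → Obs 𝒲}

theorem measurable_empMean_param {τ : Type*} [MeasurableSpace τ] (l n : ℕ) {f : τ → Obs 𝒲 → ℝ}
    (hf : Measurable (Function.uncurry f)) :
    Measurable fun x : τ × (ℕ → Obs 𝒲) => empMean l n x.2 (f x.1) := by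
  unfold empMean
  refine Measurable.div_const (Finset.measurable_fun_sum _ fun i _ => ?_) _
  exact hf.comp (f := fun x : τ × (ℕ → Obs 𝒲) => (x.1, x.2 i))
    (measurable_fst.prodMk ((measurable_pi_apply i).comp measurable_snd))

omit [MeasurableSpace 𝒲] in
theorem empMean_congr {l n : ℕ} {o o' : ℕ → Obs 𝒲} (h : ∀ i, l ≤ i → i < n → o i = o' i)
    (f : Obs 𝒲 → ℝ) : empMean l n o f = empMean l n o' f := by
  unfold empMean
  congr 1
  refine Finset.sum_congr rfl fun i hi => ?_
  rw [Finset.mem_Ico] at hi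
  rw [h i hi.1 hi.2]

omit [MeasurableSpace 𝒲] in
theorem empMean_sub_const {l n : ℕ} (hln : l < n) (o : ℕ → Obs 𝒲) (f : Obs 𝒲 → ℝ) (b : ℝ) :
    empMean l n o (fun x => f x - b) = empMean l n o f - b := by
  have h : (0 : ℝ) < (n : ℝ) - l := by
    have : (l : ℝ) < n := by exact_mod_cast hln
    linarith
  have hc : (((n - l : ℕ) : ℕ) : ℝ) = n - l := Nat.cast_sub hln.le
  rw [empMean, empMean, Finset.sum_sub_distrib, Finset.sum_const, Nat.card_Ico, nsmul_eq_mul, hc]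
  field_simp

theorem IsSample.memLp (hS : S.IsSample Pr O) {f : Obs 𝒲 → ℝ} {p : ℝ≥0∞} (hf : MemLp f p S.P₀)
    (i : ℕ) : MemLp (fun ω => f (O i ω)) p Pr := by
  rw [← hS.law i] at hf
  exact hf.comp_of_map (hS.meas i).aemeasurable

theorem IsSample.integral_comp (hS : S.IsSample Pr O) {f : Obs 𝒲 → ℝ} (hf : Measurable f) (i : ℕ) :
    ∫ ω, f (O i ω) ∂Pr = ∫ o, f o ∂S.P₀ := by
  rw [← hS.law i, integral_map (hS.meas i).aemeasurable hf.aestronglyMeasurable]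

/-- The second moment of a shifted average of centred observations. -/
theorem IsSample.lintegral_empMean_add_sq [IsProbabilityMeasure Pr] (hS : S.IsSample Pr O) {f : Obs 𝒲 → ℝ}
    (hfm : Measurable f) (hf : MemLp f 2 S.P₀) (h0 : ∫ o, f o ∂S.P₀ = 0) {l n : ℕ} (hln : l < n)
    (b : ℝ) : ∫⁻ ω, ENNReal.ofReal ((empMean l n (O · ω) f + b) ^ 2) ∂Pr =
      ENNReal.ofReal ((∫ o, f o ^ 2 ∂S.P₀) / ((n : ℝ) - l) + b ^ 2) := by
  have hpos : (0 : ℝ) < (n : ℝ) - l := by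
    have : (l : ℝ) < n := by exact_mod_cast hln
    linarith
  have hc : (((n - l : ℕ) : ℕ) : ℝ) = n - l := Nat.cast_sub hln.le
  set X : ℕ → Ω → ℝ := fun i ω => f (O i ω)
  have hX : ∀ i, MemLp (X i) 2 Pr := fun i => hS.memLp hf i
  have hX0 : ∀ i, ∫ ω, X i ω ∂Pr = 0 := fun i => (hS.integral_comp hfm i).trans h0
  have hXv : ∀ i, variance (X i) Pr = ∫ o, f o ^ 2 ∂S.P₀ := by
    intro i
    rw [variance_of_integral_eq_zero (hX i).aemeasurable (hX0 i)]
    exact hS.integral_comp (hfm.pow_const 2) i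
  have hind : iIndepFun X Pr := hS.indep.comp (fun _ => f) fun _ => hfm
  set s := Finset.Ico l n
  have hsum : MemLp (∑ i ∈ s, X i) 2 Pr := memLp_finsetSum' _ fun i _ => hX i
  have hsum0 : ∫ ω, (∑ i ∈ s, X i) ω ∂Pr = 0 := by
    simp only [Finset.sum_apply]
    rw [integral_finsetSum _ fun i _ => (hX i).integrable one_le_two]
    simp [hX0]
  have hvar : ∫ ω, (∑ i ∈ s, X i) ω ^ 2 ∂Pr = ((n : ℝ) - l) * ∫ o, f o ^ 2 ∂S.P₀ := by
    have h1 := IndepFun.variance_sum (μ := Pr) (s := s) (fun i _ => hX i)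
      (fun i _ j _ hij => hind.indepFun hij)
    rw [variance_of_integral_eq_zero hsum.aemeasurable hsum0] at h1
    refine h1.trans ?_
    simp only [hXv, Finset.sum_const, s, Nat.card_Ico, nsmul_eq_mul, hc]
  have e : ∀ ω, (empMean l n (O · ω) f + b) ^ 2 =
      ((n : ℝ) - l)⁻¹ ^ 2 * (∑ i ∈ s, X i) ω ^ 2 + 2 * b * ((n : ℝ) - l)⁻¹ * (∑ i ∈ s, X i) ω +
        b ^ 2 := by
    intro ω
    simp only [empMean, Finset.sum_apply, X, s]
    field_simp
    ring
  have i1 : Integrable (fun ω => (∑ i ∈ s, X i) ω ^ 2) Pr := hsum.integrable_sq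
  have i2 : Integrable (fun ω => (∑ i ∈ s, X i) ω) Pr := hsum.integrable one_le_two
  have hi : Integrable (fun ω => ((n : ℝ) - l)⁻¹ ^ 2 * (∑ i ∈ s, X i) ω ^ 2 +
      2 * b * ((n : ℝ) - l)⁻¹ * (∑ i ∈ s, X i) ω) Pr := (i1.const_mul _).add (i2.const_mul _)
  have hi' : Integrable (fun ω => (empMean l n (O · ω) f + b) ^ 2) Pr := by
    simp only [e]
    exact hi.add (integrable_const _)
  rw [← ofReal_integral_eq_lintegral_ofReal hi' (ae_of_all _ fun ω => sq_nonneg _)]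
  congr 1
  simp only [e]
  rw [integral_add hi (integrable_const _), integral_add (i1.const_mul _) (i2.const_mul _),
    integral_const_mul, integral_const_mul, hvar, hsum0]
  simp
  field_simp

end Moments

end Setting


namespace Setting

section FreezeFit

variable {𝒲 : Type*} [MeasurableSpace 𝒲] {S : Setting 𝒲} {Ω : Type*} [MeasurableSpace Ω]
  {Pr : Measure Ω} [IsProbabilityMeasure Pr] {O : ℕ → Ω → Obs 𝒲}

/-- `f` depends on the first `l` entries of a sequence only. -/
def _root_.DoseResponse.DependsOnFirst {α E : Type*} (l : ℕ) (f : (ℕ → α) → E) : Prop :=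
  ∀ a a', (∀ i < l, a i = a' i) → f a = f a'

/-- The second moment of an average over the observations in `[l, n)` of a function that is
centred given the first `l` observations. -/
theorem IsSample.lintegral_empMean_fit (hS : S.IsSample Pr O) {f : (ℕ → Obs 𝒲) → Obs 𝒲 → ℝ}
    (hfm : Measurable (Function.uncurry f)) {l n : ℕ} (hfd : DependsOnFirst l f)
    (hf : ∀ a, MemLp (f a) 2 S.P₀) (h0 : ∀ a, ∫ o, f a o ∂S.P₀ = 0) (hln : l < n)
    {b : (ℕ → Obs 𝒲) → ℝ} (hb : Measurable b) (hbd : DependsOnFirst l b) :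
    ∫⁻ ω, ENNReal.ofReal ((empMean l n (O · ω) (f (O · ω)) + b (O · ω)) ^ 2) ∂Pr =
      ∫⁻ ω, ENNReal.ofReal ((∫ o, f (O · ω) o ^ 2 ∂S.P₀) / ((n : ℝ) - l) + b (O · ω) ^ 2) ∂Pr := by
  set G : (ℕ → Obs 𝒲) → (ℕ → Obs 𝒲) → ℝ≥0∞ := fun a a' =>
    ENNReal.ofReal ((empMean l n a' (f a) + b a) ^ 2)
  have hG : Measurable (Function.uncurry G) :=
    (((measurable_empMean_param l n hfm).add (hb.comp measurable_fst)).pow_const 2).ennreal_ofReal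
  have hsplit : SplitsAt l n G := by
    intro a a' c c' h1 h2
    simp only [G]
    rw [hfd a a' h1, hbd a a' h1, empMean_congr h2]
  refine (lintegral_splitsAt hS.meas hS.indep hG hsplit).trans (lintegral_congr fun ω => ?_)
  exact hS.lintegral_empMean_add_sq (hfm.comp measurable_prodMk_left) (hf _) (h0 _) hln _

end FreezeFit

variable {𝒲 : Type*} [MeasurableSpace 𝒲] (S : Setting 𝒲)

/-! ### Measurability and locality of the estimators -/

theorem measurable_fitQ (l : ℕ) :
    Measurable fun x : (ℕ → Obs 𝒲) × 𝒲 × ℝ => S.fitQ l x.1 x.2.1 x.2.2 := by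
  have h : Measurable fun x : (ℕ → Obs 𝒲) × 𝒲 × ℝ => ((fun i : Fin l => x.1 i), x.2.1, x.2.2) :=
    (measurable_pi_lambda _ fun i => (measurable_pi_apply _).comp measurable_fst).prodMk
      measurable_snd
  exact (S.Qhat_meas l).comp h

theorem measurable_Psi : Measurable (S.Psi S.covLaw S.Q₀) := by
  have hq : Measurable fun x : ℝ × 𝒲 × ℝ => S.Q₀ x.2.1 x.2.2 := S.Q₀_meas.comp measurable_snd
  have h := S.measurable_smooth_param (q := fun _ => S.Q₀) (d := fun δ : ℝ => δ) hq measurable_id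
  exact h.stronglyMeasurable.integral_prod_right'.measurable

theorem measurable_center_fit (l : ℕ) {D : (ℕ → Obs 𝒲) → ℝ} (hD : Measurable D) :
    Measurable (Function.uncurry fun a => S.center (S.fitQ l a) (D a)) := by
  have h := S.measurable_score_param (q := S.fitQ l) (S.measurable_fitQ l) hD
  exact h.sub ((S.measurable_Psi.comp hD).comp measurable_fst)

theorem measurable_varGrad_fit (l : ℕ) {D : (ℕ → Obs 𝒲) → ℝ} (hD : Measurable D) :
    Measurable fun a => S.varGrad (S.fitQ l a) (D a) :=
  ((S.measurable_center_fit l hD).pow_const 2).stronglyMeasurable.integral_prod_right'.measurable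

/-- An explicit finite sum, from which measurability in the data and dependence on the first `l`
entries can be read off. For `l = 0` the factor is `∞.toReal = 0`, in agreement with the zero
empirical measure. -/
theorem fitPsi_eq (l : ℕ) (o : ℕ → Obs 𝒲) (δ : ℝ) :
    S.fitPsi l o δ = ((l : ℝ≥0∞)⁻¹).toReal * ∑ i ∈ Finset.range l, S.smooth (S.fitQ l o) δ (o i).1 := by
  have hm := (S.isRegression_fitQ l o).measurable_smooth S δ
  obtain ⟨C, -, hC⟩ := S.exists_smooth_le δ
  rw [fitPsi, Psi, empW, integral_smul_measure, smul_eq_mul, integral_finsetSum_measure]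
  · congr 1
    refine Finset.sum_congr rfl fun i _ => ?_
    exact integral_dirac' _ _ hm.stronglyMeasurable
  · exact fun i _ => integrable_bdd hm (hC (S.isRegression_fitQ l o))

theorem measurable_fitPsi (l : ℕ) {D : (ℕ → Obs 𝒲) → ℝ} (hD : Measurable D) :
    Measurable fun o => S.fitPsi l o (D o) := by
  simp only [fitPsi_eq]
  refine (Finset.measurable_fun_sum _ fun i _ => ?_).const_mul _
  exact (S.measurable_smooth_param (q := S.fitQ l) (S.measurable_fitQ l) hD).comp
    (f := fun o : ℕ → Obs 𝒲 => (o, (o i).1))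
    (measurable_id.prodMk (measurable_fst.comp (measurable_pi_apply i)))

theorem measurable_fitGrad (l : ℕ) {D : (ℕ → Obs 𝒲) → ℝ} (hD : Measurable D) :
    Measurable (Function.uncurry fun a => S.fitGrad l a (D a)) := by
  have h := S.measurable_score_param (q := S.fitQ l) (S.measurable_fitQ l) hD
  exact h.sub ((S.measurable_fitPsi l hD).comp measurable_fst)

theorem measurable_empMean_fit (l n : ℕ) {f : (ℕ → Obs 𝒲) → Obs 𝒲 → ℝ}
    (hf : Measurable (Function.uncurry f)) : Measurable fun o => empMean l n o (f o) :=
  (measurable_empMean_param l n hf).comp (measurable_id.prodMk measurable_id)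

theorem fitQ_dependsOnFirst (l : ℕ) : DependsOnFirst l (S.fitQ l) := by
  intro a a' h
  unfold fitQ
  congr 1
  exact funext fun i => h i i.2

theorem fitPsi_dependsOnFirst (l : ℕ) : DependsOnFirst l (S.fitPsi l) := by
  intro a a' h
  ext δ
  rw [fitPsi_eq, fitPsi_eq, S.fitQ_dependsOnFirst l a a' h]
  congr 1
  refine Finset.sum_congr rfl fun i hi => ?_
  rw [h i (Finset.mem_range.1 hi)]

theorem fitGrad_dependsOnFirst (l : ℕ) : DependsOnFirst l (S.fitGrad l) := by
  intro a a' h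
  ext δ o
  have h1 := S.fitPsi_dependsOnFirst l a a' h
  have h2 := S.fitQ_dependsOnFirst l a a' h
  have h3 := congrFun h1 δ
  change S.score (S.fitQ l a) δ o - S.fitPsi l a δ = S.score (S.fitQ l a') δ o - S.fitPsi l a' δ
  rw [h3, h2]

variable (p₁ p₂ : ℝ)

theorem measurable_oneStep₂ (n : ℕ) {D : (ℕ → Obs 𝒲) → ℝ} (hD : Measurable D) :
    Measurable fun o => S.oneStep₂ p₁ p₂ n o (D o) :=
  (S.measurable_fitPsi _ hD).add (measurable_empMean_fit _ _ (S.measurable_fitGrad _ hD))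

theorem measurable_estimator (n : ℕ) {D : (ℕ → Obs 𝒲) → ℝ} (hD : Measurable D) :
    Measurable fun o => S.estimator p₂ n o (D o) :=
  (S.measurable_fitPsi _ hD).add (measurable_empMean_fit _ _ (S.measurable_fitGrad _ hD))

theorem measurable_sdHat (n : ℕ) {D : (ℕ → Obs 𝒲) → ℝ} (hD : Measurable D) :
    Measurable fun o => S.sdHat p₁ p₂ n o (D o) := by
  have h := measurable_empMean_fit (cut p₁ n) (cut p₂ n) (S.measurable_fitGrad (cut p₁ n) hD)
  exact (measurable_empMean_fit (cut p₁ n) (cut p₂ n)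
    (((S.measurable_fitGrad (cut p₁ n) hD).sub (h.comp measurable_fst)).pow_const 2)).sqrt

variable {p₁ p₂}

theorem cut_le_cut (h : p₁ ≤ p₂) (n : ℕ) : cut p₁ n ≤ cut p₂ n :=
  Nat.floor_le_floor (mul_le_mul_of_nonneg_right h (Nat.cast_nonneg n))

theorem oneStep₂_dependsOnFirst (h12 : p₁ ≤ p₂) (n : ℕ) :
    DependsOnFirst (cut p₂ n) (S.oneStep₂ p₁ p₂ n) := by
  intro a a' h
  have h' : ∀ i < cut p₁ n, a i = a' i := fun i hi => h i (hi.trans_le (cut_le_cut h12 n))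
  ext δ
  rw [oneStep₂, oneStep₂, S.fitPsi_dependsOnFirst _ a a' h', S.fitGrad_dependsOnFirst _ a a' h',
    empMean_congr fun i _ h2 => h i h2]

theorem sdHat_dependsOnFirst (h12 : p₁ ≤ p₂) (n : ℕ) :
    DependsOnFirst (cut p₂ n) (S.sdHat p₁ p₂ n) := by
  intro a a' h
  have h' : ∀ i < cut p₁ n, a i = a' i := fun i hi => h i (hi.trans_le (cut_le_cut h12 n))
  ext δ
  have e : ∀ f, empMean (cut p₁ n) (cut p₂ n) a f = empMean (cut p₁ n) (cut p₂ n) a' f :=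
    fun f => empMean_congr (fun i _ h2 => h i h2) f
  simp only [sdHat, S.fitGrad_dependsOnFirst _ a a' h', e]

variable (d₁ d₂ d₃ : ℕ → ℝ)

/-- The tuning uses no observation of the last part, so the bandwidth can be frozen together with
the regression estimate when conditioning. -/
theorem deltaHat_dependsOnFirst (h12 : p₁ ≤ p₂) (ε : ℝ) (n : ℕ) :
    DependsOnFirst (cut p₂ n) (S.deltaHat p₁ p₂ d₁ d₂ d₃ ε n) := by
  intro a a' h
  simp only [deltaHat, CHat, CsdHat, CsdSlopeHat, CbHat, rHat, betaHat, gammaHat, nuHat, biasSlope,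
    sdSlope, S.oneStep₂_dependsOnFirst h12 n a a' h, S.sdHat_dependsOnFirst h12 n a a' h]

variable (p₁ p₂)

theorem measurable_biasSlope (n : ℕ) (δ Δ : ℝ) :
    Measurable fun o => S.biasSlope p₁ p₂ n o δ Δ :=
  ((S.measurable_oneStep₂ p₁ p₂ n measurable_const).sub
    (S.measurable_oneStep₂ p₁ p₂ n measurable_const)).div_const _

theorem measurable_sdSlope (n : ℕ) (δ Δ : ℝ) :
    Measurable fun o => S.sdSlope p₁ p₂ n o δ Δ :=
  ((S.measurable_sdHat p₁ p₂ n measurable_const).sub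
    (S.measurable_sdHat p₁ p₂ n measurable_const)).div_const _

theorem measurable_betaHat (n : ℕ) : Measurable (S.betaHat p₁ p₂ d₁ d₂ n) := by
  have h := S.measurable_biasSlope p₁ p₂ n
  exact ((((h _ _).abs.log).sub ((h _ _).abs.log)).div_const _).const_add _

theorem measurable_gammaHat (n : ℕ) : Measurable (S.gammaHat p₁ p₂ d₁ d₂ n) := by
  have h := fun δ : ℝ => S.measurable_sdHat p₁ p₂ n (measurable_const (a := δ))
  exact (((h _).log.sub (h _).log).div_const _).neg

theorem measurable_nuHat (n : ℕ) : Measurable (S.nuHat p₁ p₂ d₁ d₂ n) := by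
  have h := S.measurable_sdSlope p₁ p₂ n
  exact ((((h _ _).abs.log).sub ((h _ _).abs.log)).div_const _)

theorem measurable_CsdHat (n : ℕ) : Measurable (S.CsdHat p₁ p₂ d₁ d₂ d₃ n) :=
  (S.measurable_sdHat p₁ p₂ n measurable_const).mul
    (measurable_const.pow (S.measurable_gammaHat p₁ p₂ d₁ d₂ n))

theorem measurable_rHat (n : ℕ) : Measurable (S.rHat p₁ p₂ d₁ d₂ n) :=
  (((((S.measurable_betaHat p₁ p₂ d₁ d₂ n).const_mul 2).sub_const 1).add
    (S.measurable_gammaHat p₁ p₂ d₁ d₂ n)).sub (S.measurable_nuHat p₁ p₂ d₁ d₂ n)).const_div 1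

theorem measurable_CHat (n : ℕ) : Measurable (S.CHat p₁ p₂ d₁ d₂ d₃ n) := by
  have h1 : Measurable (S.CsdSlopeHat p₁ p₂ d₁ d₂ d₃ n) :=
    (S.measurable_sdSlope p₁ p₂ n _ _).mul
      (measurable_const.pow (S.measurable_nuHat p₁ p₂ d₁ d₂ n).neg)
  have h2 : Measurable (S.CbHat p₁ p₂ d₁ d₂ d₃ n) :=
    (S.measurable_biasSlope p₁ p₂ n _ _).mul
      (measurable_const.pow ((S.measurable_betaHat p₁ p₂ d₁ d₂ n).sub_const 1).neg)
  exact ((((S.measurable_CsdHat p₁ p₂ d₁ d₂ d₃ n).mul h1).abs.mul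
    (S.measurable_betaHat p₁ p₂ d₁ d₂ n)).div (h2.pow_const 2)).pow
      (S.measurable_rHat p₁ p₂ d₁ d₂ n)

theorem measurable_deltaHat (ε : ℝ) (n : ℕ) : Measurable (S.deltaHat p₁ p₂ d₁ d₂ d₃ ε n) :=
  (S.measurable_CHat p₁ p₂ d₁ d₂ d₃ n).mul
    (measurable_const.pow ((S.measurable_rHat p₁ p₂ d₁ d₂ n).neg.sub_const ε))

theorem measurable_studentized (ε : ℝ) (n : ℕ) :
    Measurable (S.studentized p₁ p₂ d₁ d₂ d₃ ε n) :=
  ((((S.measurable_CsdHat p₁ p₂ d₁ d₂ d₃ n).inv).mul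
    ((S.measurable_deltaHat p₁ p₂ d₁ d₂ d₃ ε n).pow (S.measurable_gammaHat p₁ p₂ d₁ d₂ n))).mul_const
      _).mul ((S.measurable_estimator p₂ n (S.measurable_deltaHat p₁ p₂ d₁ d₂ d₃ ε n)).sub_const _)

/-! ### Representations of the estimators -/

variable {p₁ p₂}

/-- The plug-in value `fitPsi` cancels the centring of the gradient. What remains has conditional
mean `Ψ_δ(P₀)` given the fit, so the deterministic bias is exactly `b₀(δ)`. -/
theorem oneStep_eq {l n : ℕ} (hln : l < n) (o : ℕ → Obs 𝒲) (δ : ℝ) :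
    S.fitPsi l o δ + empMean l n o (S.fitGrad l o δ) =
      empMean l n o (S.center (S.fitQ l o) δ) + S.Psi S.covLaw S.Q₀ δ := by
  have h1 : S.fitGrad l o δ = fun x => S.score (S.fitQ l o) δ x - S.fitPsi l o δ := rfl
  have h2 : S.center (S.fitQ l o) δ =
    fun x => S.score (S.fitQ l o) δ x - S.Psi S.covLaw S.Q₀ δ := rfl
  rw [h1, h2, empMean_sub_const hln, empMean_sub_const hln]
  ring

omit [MeasurableSpace 𝒲] in
theorem empMean_sub_sq {l n : ℕ} (hln : l < n) (o : ℕ → Obs 𝒲) (f : Obs 𝒲 → ℝ) :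
    empMean l n o (fun x => (f x - empMean l n o f) ^ 2) =
      empMean l n o (fun x => f x ^ 2) - empMean l n o f ^ 2 := by
  have h : (0 : ℝ) < (n : ℝ) - l := by
    have : (l : ℝ) < n := by exact_mod_cast hln
    linarith
  have hc : (((n - l : ℕ) : ℕ) : ℝ) = n - l := Nat.cast_sub hln.le
  set μ := empMean l n o f with hμ
  have h1 : ∑ i ∈ Finset.Ico l n, f (o i) = ((n : ℝ) - l) * μ := by
    rw [hμ, empMean]; field_simp
  have h2 : ∑ i ∈ Finset.Ico l n, (f (o i) - μ) ^ 2 =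
      ∑ i ∈ Finset.Ico l n, f (o i) ^ 2 - ((n : ℝ) - l) * μ ^ 2 := by
    have : ∀ i, (f (o i) - μ) ^ 2 = f (o i) ^ 2 - 2 * μ * f (o i) + μ ^ 2 := fun i => by ring
    simp only [this]
    rw [Finset.sum_add_distrib, Finset.sum_sub_distrib, ← Finset.mul_sum, h1, Finset.sum_const,
      Nat.card_Ico, nsmul_eq_mul, hc]
    ring
  rw [empMean, empMean, h2]
  field_simp

theorem sdHat_eq {n : ℕ} (hln : cut p₁ n < cut p₂ n) (o : ℕ → Obs 𝒲) (δ : ℝ) :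
    S.sdHat p₁ p₂ n o δ =
      √(empMean (cut p₁ n) (cut p₂ n) o (fun x => S.center (S.fitQ (cut p₁ n) o) δ x ^ 2) -
        empMean (cut p₁ n) (cut p₂ n) o (S.center (S.fitQ (cut p₁ n) o) δ) ^ 2) := by
  have h1 : S.fitGrad (cut p₁ n) o δ =
      fun x => S.score (S.fitQ (cut p₁ n) o) δ x - S.fitPsi (cut p₁ n) o δ := rfl
  have h2 : S.center (S.fitQ (cut p₁ n) o) δ =
    fun x => S.score (S.fitQ (cut p₁ n) o) δ x - S.Psi S.covLaw S.Q₀ δ := rfl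
  rw [← empMean_sub_sq hln, sdHat, h1, h2, empMean_sub_const hln, empMean_sub_const hln]
  congr 2
  ext x
  ring

end Setting


/-! ### Power laws along filters -/

section PowerLaws

variable {α : Type*} {l : Filter α}

theorem tendsto_div_of_mem_Icc {d Δ ξ : α → ℝ} (hd : ∀ᶠ x in l, 0 < d x)
    (hr : Tendsto (fun x => Δ x / d x) l (𝓝 0))
    (hξ : ∀ᶠ x in l, ξ x ∈ Set.Icc (d x) (d x + Δ x)) : Tendsto (fun x => ξ x / d x) l (𝓝 1) := by
  have h1 : Tendsto (fun x => 1 + Δ x / d x) l (𝓝 1) := by simpa using hr.const_add 1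
  refine tendsto_of_tendsto_of_tendsto_of_le_of_le' tendsto_const_nhds h1 ?_ ?_
  · filter_upwards [hd, hξ] with x hx h
    exact (one_le_div hx).2 h.1
  · filter_upwards [hd, hξ] with x hx h
    rw [div_le_iff₀ hx, add_mul, one_mul, div_mul_cancel₀ _ hx.ne']
    exact h.2

theorem tendsto_nhdsGT_of_div {d ξ : α → ℝ} (hd : Tendsto d l (𝓝[>] 0)) {L : ℝ} (hL : 0 < L)
    (h : Tendsto (fun x => ξ x / d x) l (𝓝 L)) : Tendsto ξ l (𝓝[>] 0) := by
  have hd0 : ∀ᶠ x in l, 0 < d x := hd.eventually self_mem_nhdsWithin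
  have hd1 : Tendsto d l (𝓝 0) := hd.mono_right nhdsWithin_le_nhds
  refine tendsto_nhdsWithin_iff.2 ⟨?_, ?_⟩
  · have := h.mul hd1
    rw [mul_zero] at this
    refine this.congr' ?_
    filter_upwards [hd0] with x hx using div_mul_cancel₀ _ hx.ne'
  · filter_upwards [hd0, h.eventually (lt_mem_nhds hL)] with x hx h
    exact (div_pos_iff_of_pos_right hx).1 h

/-- Difference quotients over steps that are small compared with the base point follow the same
power law as the derivative. -/
theorem tendsto_slope_mul_rpow {F F' : α → ℝ → ℝ} {d Δ : α → ℝ} {C a : ℝ}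
    (hd : Tendsto d l (𝓝[>] 0)) (hΔ : ∀ᶠ x in l, 0 < Δ x)
    (hr : Tendsto (fun x => Δ x / d x) l (𝓝 0))
    (hderiv : ∀ ξ : α → ℝ, Tendsto ξ l (𝓝[>] 0) →
      ∀ᶠ x in l, HasDerivAt (F x) (F' x (ξ x)) (ξ x))
    (hlim : ∀ ξ : α → ℝ, Tendsto ξ l (𝓝[>] 0) →
      Tendsto (fun x => F' x (ξ x) * ξ x ^ (-a)) l (𝓝 C)) :
    Tendsto (fun x => (F x (d x + Δ x) - F x (d x)) / Δ x * d x ^ (-a)) l (𝓝 C) := by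
  classical
  have hd0 : ∀ᶠ x in l, 0 < d x := hd.eventually self_mem_nhdsWithin
  have hξ0 : ∀ ξ : α → ℝ, (∀ᶠ x in l, ξ x ∈ Set.Icc (d x) (d x + Δ x)) →
      Tendsto ξ l (𝓝[>] 0) := fun ξ hξ =>
    tendsto_nhdsGT_of_div hd one_pos (tendsto_div_of_mem_Icc hd0 hr hξ)
  have hall : ∀ᶠ x in l, ∀ δ ∈ Set.Icc (d x) (d x + Δ x), HasDerivAt (F x) (F' x δ) δ := by
    -- The hypothesis concerns one selection of points at a time. Selecting a point where
    -- differentiability fails, whenever there is one, upgrades it to all points of the interval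
    -- simultaneously.
    set ξ : α → ℝ := fun x =>
      if h : ∃ δ ∈ Set.Icc (d x) (d x + Δ x), ¬ HasDerivAt (F x) (F' x δ) δ then h.choose else d x
    have h1 : ∀ᶠ x in l, ξ x ∈ Set.Icc (d x) (d x + Δ x) := by
      filter_upwards [hΔ] with x hx
      by_cases h : ∃ δ ∈ Set.Icc (d x) (d x + Δ x), ¬ HasDerivAt (F x) (F' x δ) δ
      · simp only [ξ, h, dite_true]; exact h.choose_spec.1
      · simp only [ξ, h, dite_false]; exact ⟨le_rfl, by linarith⟩
    filter_upwards [hderiv ξ (hξ0 ξ h1)] with x hx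
    by_contra hcon
    push Not at hcon
    have h : ∃ δ ∈ Set.Icc (d x) (d x + Δ x), ¬ HasDerivAt (F x) (F' x δ) δ := hcon
    simp only [ξ, h, dite_true] at hx
    exact h.choose_spec.2 hx
  have hmv : ∀ᶠ x in l, ∃ ξ ∈ Set.Icc (d x) (d x + Δ x),
      (F x (d x + Δ x) - F x (d x)) / Δ x = F' x ξ := by
    filter_upwards [hall, hΔ] with x hx hΔx
    obtain ⟨ξ, hξ, h⟩ := exists_hasDerivAt_eq_slope (F x) (F' x) (by linarith : d x < d x + Δ x)
      (fun δ hδ => (hx δ hδ).continuousAt.continuousWithinAt)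
      (fun δ hδ => hx δ (Set.Ioo_subset_Icc_self hδ))
    exact ⟨ξ, Set.Ioo_subset_Icc_self hξ, by rw [h]; congr 1; ring⟩
  have hmv' : ∃ ξ : α → ℝ, ∀ᶠ x in l, ξ x ∈ Set.Icc (d x) (d x + Δ x) ∧
      (F x (d x + Δ x) - F x (d x)) / Δ x = F' x (ξ x) := by
    rcases l.eq_or_neBot with rfl | _
    · exact ⟨d, eventually_bot⟩
    · exact hmv.choice
  obtain ⟨ξ, hξ⟩ := hmv'
  have hξ1 : ∀ᶠ x in l, ξ x ∈ Set.Icc (d x) (d x + Δ x) := hξ.mono fun x h => h.1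
  have hq := tendsto_div_of_mem_Icc hd0 hr hξ1
  have h := (hlim ξ (hξ0 ξ hξ1)).mul (hq.rpow_const (p := a) (Or.inl one_ne_zero))
  rw [Real.one_rpow, mul_one] at h
  refine h.congr' ?_
  filter_upwards [hξ, hd0] with x hx hdx
  have hξx : 0 < ξ x := hdx.trans_le hx.1.1
  rw [hx.2, Real.div_rpow hξx.le hdx.le, Real.rpow_neg hξx.le, Real.rpow_neg hdx.le]
  have := (Real.rpow_pos_of_pos hξx a).ne'
  field_simp

/-- Consistency of the log-log slope, faster than `N`. -/
theorem tendsto_logSlope_sub_mul {X₁ X₂ d₁ d₂ N : α → ℝ} {C a c : ℝ} (hC : C ≠ 0) (hc : 0 < c)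
    (h₁ : Tendsto (fun x => X₁ x * d₁ x ^ (-a)) l (𝓝 C))
    (h₂ : Tendsto (fun x => X₂ x * d₂ x ^ (-a)) l (𝓝 C))
    (hd₁ : ∀ᶠ x in l, 0 < d₁ x) (hd₂ : ∀ᶠ x in l, 0 < d₂ x) (hN : ∀ᶠ x in l, 0 < N x)
    (hsep : ∀ᶠ x in l, c * N x ≤ |Real.log (d₂ x) - Real.log (d₁ x)|) :
    Tendsto (fun x => ((Real.log |X₂ x| - Real.log |X₁ x|) /
      (Real.log (d₂ x) - Real.log (d₁ x)) - a) * N x) l (𝓝 0) := by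
  -- In logarithms the power law reads `log |X| = a log d + log |C| + o(1)`. The constant cancels
  -- between the two levels, and the remaining `o(1)` is divided by a log distance of at least `c
  -- N`.
  have hlog : ∀ {X d : α → ℝ}, Tendsto (fun x => X x * d x ^ (-a)) l (𝓝 C) →
      (∀ᶠ x in l, 0 < d x) →
      Tendsto (fun x => Real.log |X x| - a * Real.log (d x)) l (𝓝 (Real.log |C|)) := by
    intro X d h hd
    have h1 := h.abs.log (abs_pos.2 hC).ne'
    refine h1.congr' ?_
    filter_upwards [hd, h.eventually_ne hC] with x hx h0
    have hX : X x ≠ 0 := left_ne_zero_of_mul h0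
    have hp := Real.rpow_pos_of_pos hx (-a)
    rw [abs_mul, abs_of_pos hp, Real.log_mul (abs_pos.2 hX).ne' hp.ne', Real.log_rpow hx]
    ring
  have hη := (hlog h₂ hd₂).sub (hlog h₁ hd₁)
  rw [sub_self] at hη
  have hη' := (hη.abs).div_const c
  rw [abs_zero, zero_div] at hη'
  refine squeeze_zero_norm' ?_ hη'
  filter_upwards [hN, hsep] with x hNx hx
  have hD : 0 < |Real.log (d₂ x) - Real.log (d₁ x)| := (mul_pos hc hNx).trans_le hx
  have hD0 : Real.log (d₂ x) - Real.log (d₁ x) ≠ 0 := abs_pos.1 hD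
  have e : (Real.log |X₂ x| - Real.log |X₁ x|) / (Real.log (d₂ x) - Real.log (d₁ x)) - a =
      (Real.log |X₂ x| - a * Real.log (d₂ x) - (Real.log |X₁ x| - a * Real.log (d₁ x))) /
        (Real.log (d₂ x) - Real.log (d₁ x)) := by
    field_simp
    ring
  rw [e, Real.norm_eq_abs, abs_mul, abs_div, abs_of_pos hNx, div_mul_eq_mul_div,
    div_le_div_iff₀ hD hc, mul_assoc]
  gcongr
  linarith

/-- Write the power as `exp (e log d)`. This is why mere consistency of the exponents is not enough:
with `N = log n`, errors `o(1 / log n)` are required. -/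
theorem tendsto_rpow_one_of_log {d e N : α → ℝ} {k : ℝ} (hd : ∀ᶠ x in l, 0 < d x)
    (hlog : ∀ᶠ x in l, |Real.log (d x)| ≤ k * N x) (he : Tendsto (fun x => e x * N x) l (𝓝 0)) :
    Tendsto (fun x => d x ^ e x) l (𝓝 1) := by
  have h0 : Tendsto (fun x => Real.log (d x) * e x) l (𝓝 0) := by
    have h1 := (he.abs).const_mul |k|
    rw [abs_zero, mul_zero] at h1
    refine squeeze_zero_norm' ?_ h1
    filter_upwards [hlog] with x hx
    rw [Real.norm_eq_abs, abs_mul]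
    calc |Real.log (d x)| * |e x| ≤ |k * N x| * |e x| := by
          exact mul_le_mul_of_nonneg_right (hx.trans (le_abs_self _)) (abs_nonneg _)
      _ = |k| * |e x * N x| := by rw [abs_mul, abs_mul]; ring
  have h2 := (Real.continuous_exp.tendsto 0).comp h0
  rw [Real.exp_zero] at h2
  refine h2.congr' ?_
  filter_upwards [hd] with x hx
  exact (Real.rpow_def_of_pos hx _).symm

/-- In a power law, the exponent may be replaced by a consistent estimate. -/
theorem tendsto_mul_rpow_estimate {X d e N : α → ℝ} {C a k : ℝ}
    (h : Tendsto (fun x => X x * d x ^ (-a)) l (𝓝 C)) (hd : ∀ᶠ x in l, 0 < d x)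
    (hlog : ∀ᶠ x in l, |Real.log (d x)| ≤ k * N x)
    (he : Tendsto (fun x => (e x - a) * N x) l (𝓝 0)) :
    Tendsto (fun x => X x * d x ^ (-e x)) l (𝓝 C) := by
  have h0 : Tendsto (fun x => -(e x - a) * N x) l (𝓝 0) := by
    have := he.neg
    rw [neg_zero] at this
    refine this.congr fun x => ?_
    ring
  have h1 := h.mul (tendsto_rpow_one_of_log hd hlog h0)
  rw [mul_one] at h1
  refine h1.congr' ?_
  filter_upwards [hd] with x hx
  rw [mul_assoc, ← Real.rpow_add hx]
  congr 2
  ring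

end PowerLaws

namespace Setting

variable {𝒲 : Type*} [MeasurableSpace 𝒲] (S : Setting 𝒲)

/-! ### The bias -/

theorem hasDerivAt_bias {δ : ℝ} (hδ : 0 < δ) : HasDerivAt S.bias (S.psiD 1 δ) δ := by
  have h := S.hasDerivAt_psiD zero_le_one hδ
  have e : S.psiD 0 = S.Psi S.covLaw S.Q₀ := funext S.psiD_zero
  rw [e] at h
  exact h.sub_const _

variable {S}

/-- For almost every `w`, localisation applies at a point of continuity with total kernel mass one;
the smoothed values are bounded by `kernelConst`, which dominates. -/
theorem tendsto_bias (hcont : S.ContinuousAtDose) : Tendsto S.bias (𝓝[>] 0) (𝓝 0) := by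
  have hsm : ∀ᵐ w ∂S.covLaw, Tendsto (fun δ => S.smooth S.Q₀ δ w) (𝓝[>] 0) (𝓝 (S.Q₀ w S.a₀)) := by
    filter_upwards [hcont] with w hw
    have h := tendsto_integral_rescaled S.a₀_mem (M := S.K) (h := S.Q₀ w) (C := 1)
      ((S.K_kernel.scaleDeriv_integrable 0)) (S.Q₀_meas.comp measurable_prodMk_left)
      (S.isRegression_Q₀.abs_le w) hw.2.1
    rw [S.K_kernel.integral_locDomain_eq_one S.a₀_mem, mul_one] at h
    refine h.congr fun δ => ?_
    rw [smooth_eq]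
    rfl
  have h : Tendsto (fun δ => S.Psi S.covLaw S.Q₀ δ) (𝓝[>] 0) (𝓝 S.target) := by
    refine tendsto_integral_filter_of_dominated_convergence (fun _ => S.kernelConst) ?_ ?_
      (integrable_const _) hsm
    · exact Eventually.of_forall fun δ =>
        (S.isRegression_Q₀.measurable_smooth S δ).aestronglyMeasurable
    · filter_upwards [self_mem_nhdsWithin] with δ hδ
      exact ae_of_all _ fun w => S.abs_smooth_le S.isRegression_Q₀ hδ w
  have := h.sub_const S.target
  rwa [sub_self] at this

variable (S) in
/-- The bias and its derivative follow power laws at zero. -/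
structure BiasRate (C β : ℝ) : Prop where
  ne_zero : C ≠ 0
  pos : 0 < β
  deriv : Tendsto (fun δ => S.psiD 1 δ * δ ^ (-(β - 1))) (𝓝[>] 0) (𝓝 C)
  bias : Tendsto (fun δ => S.bias δ * δ ^ (-β)) (𝓝[>] 0) (𝓝 (C / β))

/-- The value `β = 0` is impossible: if `b₀'(δ) ~ C / δ`, the increment of the bias over `[δ, 2 δ]`
would exceed `|C| / 4` for small `δ`, although the bias tends to zero. For `β > 0`, L'Hôpital's rule
integrates the power law of `b₀'` to one for `b₀`. -/
theorem A1.exists_biasRate (h : S.A1) (hcont : S.ContinuousAtDose) : ∃ C β, S.BiasRate C β := by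
  obtain ⟨C, -, -, -, β, -, -, -, -, -, hC, -, -, -, hβ, -, -, -, -, -, -, hb, -, -, -⟩ := h
  have hmem : ∀ᶠ δ : ℝ in 𝓝[>] 0, 0 < δ := self_mem_nhdsWithin
  have hderiv : Tendsto (fun δ => S.psiD 1 δ * δ ^ (-(β - 1))) (𝓝[>] 0) (𝓝 C) := by
    have hne : ∀ᶠ δ : ℝ in 𝓝[>] 0, C * δ ^ (β - 1) ≠ 0 := by
      filter_upwards [hmem] with δ hδ
      exact mul_ne_zero hC (Real.rpow_pos_of_pos hδ _).ne'
    have h1 := ((isEquivalent_iff_tendsto_one hne).1 hb).const_mul C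
    rw [mul_one] at h1
    refine h1.congr' ?_
    filter_upwards [hmem] with δ hδ
    have := (Real.rpow_pos_of_pos hδ (β - 1)).ne'
    rw [Pi.div_apply, (S.hasDerivAt_bias hδ).deriv, Real.rpow_neg hδ.le]
    field_simp
  have hβ' : 0 < β := by
    refine hβ.lt_of_ne fun h0 => ?_
    subst h0
    have h2 : ∀ᶠ δ : ℝ in 𝓝[>] 0, |C| / 2 < |S.psiD 1 δ * δ| := by
      have h3 := hderiv.abs
      have h4 : |C| / 2 < |C| := half_lt_self (abs_pos.2 hC)
      filter_upwards [h3.eventually (lt_mem_nhds h4)] with δ hδ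
      simpa using hδ
    obtain ⟨η, hη, hη2⟩ := mem_nhdsGT_iff_exists_Ioo_subset.1 h2
    have h5 : Tendsto (fun δ : ℝ => 2 * δ) (𝓝[>] 0) (𝓝[>] 0) := by
      refine tendsto_nhdsWithin_iff.2 ⟨?_, ?_⟩
      · have : Tendsto (fun δ : ℝ => 2 * δ) (𝓝 0) (𝓝 (2 * 0)) := tendsto_id.const_mul 2
        rw [mul_zero] at this
        exact this.mono_left nhdsWithin_le_nhds
      · filter_upwards [hmem] with δ hδ
        exact mul_pos two_pos hδ
    have h6 := ((tendsto_bias hcont).comp h5).sub (tendsto_bias hcont)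
    rw [sub_self] at h6
    have h7 := h6.abs
    rw [abs_zero] at h7
    have hC4 : 0 < |C| / 4 := by have := abs_pos.2 hC; positivity
    have hη' : ∀ᶠ δ : ℝ in 𝓝[>] 0, δ < η / 2 :=
      nhdsWithin_le_nhds (gt_mem_nhds (half_pos hη))
    obtain ⟨δ, hδ0, hδ1, hδ2⟩ := (hmem.and (hη'.and (h7.eventually (gt_mem_nhds hC4)))).exists
    obtain ⟨ξ, hξ, e⟩ := exists_hasDerivAt_eq_slope S.bias (S.psiD 1) (by linarith : δ < 2 * δ)
      (fun y hy => (S.hasDerivAt_bias (hδ0.trans_le hy.1)).continuousAt.continuousWithinAt)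
      (fun y hy => S.hasDerivAt_bias (hδ0.trans hy.1))
    have hξ0 : 0 < ξ := hδ0.trans hξ.1
    have h8 : |C| / 2 < |S.psiD 1 ξ * ξ| := hη2 ⟨hξ0, by linarith [hξ.2]⟩
    have h9 : S.bias (2 * δ) - S.bias δ = S.psiD 1 ξ * δ := by
      rw [e]
      field_simp
      ring
    simp only [Function.comp_apply] at hδ2
    rw [h9, abs_mul, abs_of_pos hδ0] at hδ2
    rw [abs_mul, abs_of_pos hξ0] at h8
    nlinarith [hξ.2, abs_nonneg (S.psiD 1 ξ)]
  refine ⟨C, β, hC, hβ', hderiv, ?_⟩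
  have hpow : Tendsto (fun δ : ℝ => δ ^ β) (𝓝[>] 0) (𝓝 0) := by
    have := (Real.continuousAt_rpow_const 0 β (Or.inr hβ'.le)).tendsto
    rw [Real.zero_rpow hβ'.ne'] at this
    exact this.mono_left nhdsWithin_le_nhds
  have h := HasDerivAt.lhopital_zero_nhdsGT (f := S.bias) (g := fun δ : ℝ => δ ^ β)
    (f' := S.psiD 1) (g' := fun δ => β * δ ^ (β - 1)) (a := 0) (l := 𝓝 (C / β))
    (by filter_upwards [hmem] with δ hδ using S.hasDerivAt_bias hδ)
    (by filter_upwards [hmem] with δ hδ using Real.hasDerivAt_rpow_const (Or.inl hδ.ne'))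
    (by filter_upwards [hmem] with δ hδ using
          (mul_pos hβ' (Real.rpow_pos_of_pos hδ _)).ne')
    (tendsto_bias hcont) hpow
    (by
      refine (hderiv.div_const β).congr' ?_
      filter_upwards [hmem] with δ hδ
      have := (Real.rpow_pos_of_pos hδ (β - 1)).ne'
      rw [Real.rpow_neg hδ.le]
      field_simp)
  refine h.congr' ?_
  filter_upwards [hmem] with δ hδ
  rw [Real.rpow_neg (le_of_lt hδ), div_eq_mul_inv]

end Setting


/-! ### Fluctuations of averages over the middle part of the sample -/

theorem tendsto_midSize_rpow {p₁ p₂ : ℝ} (h1 : 0 < p₁) (h2 : p₁ < p₂) {t : ℝ} (ht : 0 < t) :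
    Tendsto (fun n => midSize p₁ p₂ n ^ (-t)) atTop (𝓝 0) :=
  (tendsto_rpow_neg_atTop ht).comp (tendsto_midSize h1 h2)

theorem SlowerThan.eventually_le {r : ℝ} {d : ℕ → ℝ} (h : SlowerThan r d) :
    ∀ᶠ n : ℕ in atTop, (n : ℝ) ^ (-r) ≤ d n := by
  filter_upwards [h.2.2.bound one_pos] with n hn
  rw [one_mul, Real.norm_of_nonneg (Real.rpow_nonneg (Nat.cast_nonneg n) _),
    Real.norm_of_nonneg (h.1 n).le] at hn
  exact hn

/-- Eventually `d n ≥ n ^ (-r)`, so `d n ^ (-s)` costs at most `n ^ (r s)`, while the middle part is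
of size proportional to `n`. -/
theorem SlowerThan.tendsto_rpow_mul {r : ℝ} {d : ℕ → ℝ} (h : SlowerThan r d) {p₁ p₂ : ℝ}
    (h1 : 0 < p₁) (h2 : p₁ < p₂) {s t : ℝ} (hs : 0 ≤ s) (ht : r * s < t) :
    Tendsto (fun n => d n ^ (-s) * midSize p₁ p₂ n ^ (-t)) atTop (𝓝 0) := by
  have hdiv := tendsto_midSize_div h1.le (h1.trans h2).le
  have h3 : Tendsto (fun n : ℕ => (midSize p₁ p₂ n / n) ^ (-t) * (n : ℝ) ^ (-(t - r * s))) atTop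
      (𝓝 0) := by
    have h4 : Tendsto (fun n : ℕ => (n : ℝ) ^ (-(t - r * s))) atTop (𝓝 0) :=
      (tendsto_rpow_neg_atTop (by linarith)).comp tendsto_natCast_atTop_atTop
    have := (hdiv.rpow_const (p := -t) (Or.inl (by linarith))).mul h4
    rwa [mul_zero] at this
  refine squeeze_zero' ?_ ?_ h3
  · filter_upwards [(tendsto_midSize h1 h2).eventually_gt_atTop 0] with n hn
    exact mul_nonneg (Real.rpow_nonneg (h.1 n).le _) (Real.rpow_nonneg hn.le _)
  · filter_upwards [h.eventually_le, eventually_gt_atTop 0,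
      (tendsto_midSize h1 h2).eventually_gt_atTop 0] with n hn hn0 hm
    have hn' : (0 : ℝ) < n := by exact_mod_cast hn0
    have e1 : d n ^ (-s) ≤ ((n : ℝ) ^ (-r)) ^ (-s) :=
      Real.rpow_le_rpow_of_nonpos (Real.rpow_pos_of_pos hn' _) hn (by linarith)
    have e2 : ((n : ℝ) ^ (-r)) ^ (-s) = (n : ℝ) ^ (-(t - r * s)) * (n : ℝ) ^ t := by
      rw [← Real.rpow_mul hn'.le, ← Real.rpow_add hn']
      congr 1; ring
    have e3 : (midSize p₁ p₂ n / n) ^ (-t) = midSize p₁ p₂ n ^ (-t) * (n : ℝ) ^ t := by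
      rw [Real.div_rpow hm.le hn'.le, Real.rpow_neg hn'.le, div_inv_eq_mul]
    rw [e3]
    refine (mul_le_mul_of_nonneg_right e1 (Real.rpow_nonneg hm.le _)).trans (le_of_eq ?_)
    rw [e2]; ring

theorem eventually_cut_lt_cut {p₁ p₂ : ℝ} (h1 : 0 < p₁) (h2 : p₁ < p₂) :
    ∀ᶠ n in atTop, cut p₁ n < cut p₂ n := by
  filter_upwards [(tendsto_midSize h1 h2).eventually_gt_atTop 0] with n hn
  rw [midSize, sub_pos] at hn
  exact_mod_cast hn

theorem eventually_cut_lt {p : ℝ} (h1 : 0 < p) (h2 : p < 1) : ∀ᶠ n in atTop, cut p n < n := by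
  filter_upwards [(tendsto_lastSize h1 h2).eventually_gt_atTop 0] with n hn
  rw [lastSize, sub_pos] at hn
  exact_mod_cast hn

/-- No sign is imposed on `u`: for negative `u` the root is zero and `√v ≤ v ≤ v - u`. Otherwise the
sum of the roots is at least one. -/
theorem abs_sqrt_sub_sqrt_le {u v : ℝ} (hv : 1 ≤ √v) : |√u - √v| ≤ |u - v| := by
  have hv0 : 0 ≤ v := by
    by_contra h
    rw [Real.sqrt_eq_zero_of_nonpos (by linarith)] at hv
    linarith
  have hsv := Real.sq_sqrt hv0
  rcases le_total 0 u with hu | hu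
  · have hsu := Real.sq_sqrt hu
    have h : u - v = (√u - √v) * (√u + √v) := by nlinarith
    rw [h, abs_mul]
    have h1 : 1 ≤ |√u + √v| := by
      rw [abs_of_nonneg (by positivity)]
      linarith [Real.sqrt_nonneg u]
    nlinarith [abs_nonneg (√u - √v)]
  · rw [Real.sqrt_eq_zero_of_nonpos hu, zero_sub, abs_neg, abs_of_nonneg (Real.sqrt_nonneg v),
      abs_sub_comm]
    refine le_trans ?_ (le_abs_self _)
    nlinarith

namespace Setting

variable {𝒲 : Type*} [MeasurableSpace 𝒲] {S : Setting 𝒲} {Ω : Type*} [MeasurableSpace Ω]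
  {Pr : Measure Ω} {O : ℕ → Ω → Obs 𝒲}

omit [MeasurableSpace 𝒲] in
theorem empMean_const_mul (l n : ℕ) (o : ℕ → Obs 𝒲) (f : Obs 𝒲 → ℝ) (b : ℝ) :
    empMean l n o (fun x => b * f x) = b * empMean l n o f := by
  rw [empMean, empMean, ← Finset.mul_sum, mul_div_assoc]

/-- Averages of functions that are centred given the fit vanish in probability, if their
conditional variances do. -/
theorem IsSample.tendsto_empMean_fit [IsProbabilityMeasure Pr] (hS : S.IsSample Pr O)
    {f : ℕ → (ℕ → Obs 𝒲) → Obs 𝒲 → ℝ} {l k : ℕ → ℕ} {v : ℕ → ℝ}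
    (hfm : ∀ n, Measurable (Function.uncurry (f n))) (hfd : ∀ n, DependsOnFirst (l n) (f n))
    (hlk : ∀ᶠ n in atTop, l n < k n)
    (hf : ∀ᶠ n in atTop, ∀ a, MemLp (f n a) 2 S.P₀ ∧ ∫ o, f n a o ∂S.P₀ = 0 ∧
      (∫ o, f n a o ^ 2 ∂S.P₀) / ((k n : ℝ) - l n) ≤ v n)
    (hv : Tendsto v atTop (𝓝 0)) :
    Tendsto (fun x : ℕ × Ω => empMean (l x.1) (k x.1) (O · x.2) (f x.1 (O · x.2))) (whp Pr)
      (𝓝 0) := by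
  have hO : Measurable fun ω => (O · ω) := measurable_pi_lambda _ hS.meas
  refine tendsto_whp_of_lintegral_sq
    (X := fun n ω => empMean (l n) (k n) (O · ω) (f n (O · ω)))
    (fun n => ((measurable_empMean_fit (l n) (k n) (hfm n)).comp hO).aemeasurable) ?_
  have hv' : Tendsto (fun n => ENNReal.ofReal (v n)) atTop (𝓝 0) := by
    simpa using ENNReal.tendsto_ofReal hv
  refine tendsto_of_tendsto_of_tendsto_of_le_of_le' tendsto_const_nhds hv'
    (Eventually.of_forall fun n => zero_le) ?_
  filter_upwards [hlk, hf] with n h1 h2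
  have h := hS.lintegral_empMean_fit (hfm n) (hfd n) (fun a => (h2 a).1) (fun a => (h2 a).2.1) h1
    (b := fun _ => 0) measurable_const (fun _ _ _ => rfl)
  simp only [add_zero] at h
  rw [h]
  calc ∫⁻ ω, ENNReal.ofReal ((∫ o, f n (O · ω) o ^ 2 ∂S.P₀) / ((k n : ℝ) - l n) + 0 ^ 2) ∂Pr
      ≤ ∫⁻ _, ENNReal.ofReal (v n) ∂Pr := by
        refine lintegral_mono fun ω => ENNReal.ofReal_le_ofReal ?_
        simpa using (h2 (O · ω)).2.2
    _ = ENNReal.ofReal (v n) := by simp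

variable (S Pr O) in
/-- The standing assumptions on the sample, the regression algorithm and the data-generating law. -/
structure Regular (p₁ p₂ c C β : ℝ) : Prop where
  sample : S.IsSample Pr O
  pos : S.PositivityAt c
  cont : S.ContinuousAtDose
  nondeg : S.NonDegenerate
  rate : S.UniformRate Pr O
  bias : S.BiasRate C β
  p₁_pos : 0 < p₁
  p₁_lt : p₁ < p₂
  p₂_lt : p₂ < 1

variable {p₁ p₂ c C β : ℝ}

theorem Regular.p₂_pos (H : S.Regular Pr O p₁ p₂ c C β) : 0 < p₂ := H.p₁_pos.trans H.p₁_lt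

theorem Regular.eventually_mid (H : S.Regular Pr O p₁ p₂ c C β) :
    ∀ᶠ n in atTop, cut p₁ n < cut p₂ n := eventually_cut_lt_cut H.p₁_pos H.p₁_lt

theorem Regular.tendsto_nearLim (H : S.Regular Pr O p₁ p₂ c C β) {p : ℝ} (hp : 0 < p)
    {D : ℕ × Ω → ℝ} (hD : Tendsto D (whp Pr) (𝓝[>] 0)) :
    Tendsto (fun x : ℕ × Ω => (S.fitQ (cut p x.1) (O · x.2), D x)) (whp Pr) S.nearLim :=
  H.rate.tendsto_nearLim hp hD

variable [IsProbabilityMeasure Pr]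

/-- Chebyshev given the fit, with conditional variance at most `a ^ 2 * varConst / (d m)`. The level
`d` is only a lower bound for the evaluation point `e`, so one hypothesis serves both `d` and `d +
Δ_n` in difference quotients. -/
theorem Regular.tendsto_center (H : S.Regular Pr O p₁ p₂ c C β) {d e a : ℕ → ℝ}
    (hd : ∀ n, 0 < d n) (hde : ∀ᶠ n in atTop, d n ≤ e n) (he : Tendsto e atTop (𝓝 0))
    (ha : Tendsto (fun n => a n ^ 2 * (d n)⁻¹ * (midSize p₁ p₂ n)⁻¹) atTop (𝓝 0)) :
    Tendsto (fun x : ℕ × Ω => a x.1 * empMean (cut p₁ x.1) (cut p₂ x.1) (O · x.2)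
      (S.center (S.fitQ (cut p₁ x.1) (O · x.2)) (e x.1))) (whp Pr) (𝓝 0) := by
  have hm : ∀ n, Measurable (Function.uncurry fun (o : ℕ → Obs 𝒲) (x : Obs 𝒲) =>
      a n * S.center (S.fitQ (cut p₁ n) o) (e n) x) := fun n =>
    (S.measurable_center_fit (cut p₁ n) measurable_const).const_mul (a n)
  have hv : Tendsto (fun n => S.varConst c * (a n ^ 2 * (d n)⁻¹ * (midSize p₁ p₂ n)⁻¹)) atTop
      (𝓝 0) := by simpa using ha.const_mul (S.varConst c)
  have key := H.sample.tendsto_empMean_fit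
    (f := fun n o x => a n * S.center (S.fitQ (cut p₁ n) o) (e n) x) (l := cut p₁) (k := cut p₂)
    hm (fun n o o' h => by simp only [S.fitQ_dependsOnFirst _ o o' h]) H.eventually_mid ?_ hv
  · refine key.congr fun x => ?_
    exact empMean_const_mul _ _ _ _ _
  · filter_upwards [hde, he.eventually (Iic_mem_nhds one_pos),
      (tendsto_midSize H.p₁_pos H.p₁_lt).eventually_gt_atTop 0] with n h1 h2 h3 o
    have he0 : 0 < e n := (hd n).trans_le h1
    have hQ := S.isRegression_fitQ (cut p₁ n) o
    refine ⟨(H.pos.memLp_center hQ he0 2).const_mul (a n), ?_, ?_⟩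
    · rw [integral_const_mul, (S.integral_center hQ _).2, mul_zero]
    · simp only [mul_pow]
      rw [integral_const_mul]
      have hV := H.pos.varGrad_le hQ he0 h2
      have hi : (e n)⁻¹ ≤ (d n)⁻¹ := inv_anti₀ (hd n) h1
      have hC := (S.varConst_pos H.pos.1).le
      have hV' : S.varGrad (S.fitQ (cut p₁ n) o) (e n) ≤ S.varConst c * (d n)⁻¹ :=
        hV.trans (mul_le_mul_of_nonneg_left hi hC)
      change a n ^ 2 * S.varGrad (S.fitQ (cut p₁ n) o) (e n) / midSize p₁ p₂ n ≤ _
      rw [div_eq_mul_inv]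
      have := mul_le_mul_of_nonneg_left hV' (sq_nonneg (a n))
      have := mul_le_mul_of_nonneg_right this (inv_nonneg.2 h3.le)
      refine this.trans (le_of_eq ?_)
      ring

/-- As for the centred gradient itself, but the square of the gradient has variance of order `δ⁻¹ ^
3`. -/
theorem Regular.tendsto_centerSq (H : S.Regular Pr O p₁ p₂ c C β) {d e a : ℕ → ℝ}
    (hd : ∀ n, 0 < d n) (hde : ∀ᶠ n in atTop, d n ≤ e n) (he : Tendsto e atTop (𝓝 0))
    (ha : Tendsto (fun n => a n ^ 2 * (d n)⁻¹ ^ 3 * (midSize p₁ p₂ n)⁻¹) atTop (𝓝 0)) :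
    Tendsto (fun x : ℕ × Ω => a x.1 * (empMean (cut p₁ x.1) (cut p₂ x.1) (O · x.2)
      (fun y => S.center (S.fitQ (cut p₁ x.1) (O · x.2)) (e x.1) y ^ 2) -
        S.varGrad (S.fitQ (cut p₁ x.1) (O · x.2)) (e x.1))) (whp Pr) (𝓝 0) := by
  have hm : ∀ n, Measurable (Function.uncurry fun (o : ℕ → Obs 𝒲) (x : Obs 𝒲) =>
      a n * (S.center (S.fitQ (cut p₁ n) o) (e n) x ^ 2 -
        S.varGrad (S.fitQ (cut p₁ n) o) (e n))) := fun n =>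
    (((S.measurable_center_fit (cut p₁ n) measurable_const).pow_const 2).sub
      ((S.measurable_varGrad_fit (cut p₁ n) measurable_const).comp measurable_fst)).const_mul (a n)
  set K := S.gradConst c ^ 2 * S.varConst c
  have hK : 0 ≤ K := mul_nonneg (sq_nonneg _) (S.varConst_pos H.pos.1).le
  have hv : Tendsto (fun n => K * (a n ^ 2 * (d n)⁻¹ ^ 3 * (midSize p₁ p₂ n)⁻¹)) atTop
      (𝓝 0) := by simpa using ha.const_mul K
  have key := H.sample.tendsto_empMean_fit
    (f := fun n o x => a n * (S.center (S.fitQ (cut p₁ n) o) (e n) x ^ 2 -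
        S.varGrad (S.fitQ (cut p₁ n) o) (e n))) (l := cut p₁) (k := cut p₂)
    hm (fun n o o' h => by simp only [S.fitQ_dependsOnFirst _ o o' h]) H.eventually_mid ?_ hv
  · refine key.congr' ?_
    filter_upwards [tendsto_fst_whp.eventually H.eventually_mid] with x hx
    rw [empMean_const_mul, empMean_sub_const hx]
  · filter_upwards [hde, he.eventually (Iic_mem_nhds one_pos),
      (tendsto_midSize H.p₁_pos H.p₁_lt).eventually_gt_atTop 0] with n h1 h2 h3 o
    have he0 : 0 < e n := (hd n).trans_le h1
    have hQ := S.isRegression_fitQ (cut p₁ n) o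
    have hi2 := H.pos.integrable_center_pow hQ he0 2
    have hmc := (S.measurable_center hQ (e n)).pow_const 2
    have hL2 : MemLp (fun x => S.center (S.fitQ (cut p₁ n) o) (e n) x ^ 2) 2 S.P₀ := by
      rw [memLp_two_iff_integrable_sq hmc.aestronglyMeasurable]
      refine (H.pos.integrable_center_pow hQ he0 4).congr (ae_of_all _ fun x => ?_)
      ring
    refine ⟨(hL2.sub (memLp_const _)).const_mul (a n), ?_, ?_⟩
    · rw [integral_const_mul, integral_sub hi2 (integrable_const _)]
      simp [varGrad]
    · simp only [mul_pow]
      rw [integral_const_mul]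
      have hV := H.pos.varSq_le hQ he0 h2
      have hi : (e n)⁻¹ ^ 3 ≤ (d n)⁻¹ ^ 3 :=
        pow_le_pow_left₀ (inv_nonneg.2 he0.le) (inv_anti₀ (hd n) h1) 3
      have hV' : S.varSq (S.fitQ (cut p₁ n) o) (e n) ≤ K * (d n)⁻¹ ^ 3 :=
        hV.trans (mul_le_mul_of_nonneg_left hi hK)
      change a n ^ 2 * S.varSq (S.fitQ (cut p₁ n) o) (e n) / midSize p₁ p₂ n ≤ _
      rw [div_eq_mul_inv]
      have := mul_le_mul_of_nonneg_left hV' (sq_nonneg (a n))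
      have := mul_le_mul_of_nonneg_right this (inv_nonneg.2 h3.le)
      refine this.trans (le_of_eq ?_)
      ring

theorem Regular.tendsto_oneStep₂_sub (H : S.Regular Pr O p₁ p₂ c C β) {d e a : ℕ → ℝ}
    (hd : ∀ n, 0 < d n) (hde : ∀ᶠ n in atTop, d n ≤ e n) (he : Tendsto e atTop (𝓝 0))
    (ha : Tendsto (fun n => a n ^ 2 * (d n)⁻¹ * (midSize p₁ p₂ n)⁻¹) atTop (𝓝 0)) :
    Tendsto (fun x : ℕ × Ω => a x.1 * (S.oneStep₂ p₁ p₂ x.1 (O · x.2) (e x.1) -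
      S.Psi S.covLaw S.Q₀ (e x.1))) (whp Pr) (𝓝 0) := by
  refine (H.tendsto_center hd hde he ha).congr' ?_
  filter_upwards [tendsto_fst_whp.eventually H.eventually_mid] with x hx
  rw [oneStep₂, S.oneStep_eq hx, add_sub_cancel_right]

/-- The empirical variance differs from the true one by the fluctuation of the average of squares
(`ha`) and by the squared empirical mean, which enters with weight `√a` before squaring (`ha'`). The
square root is Lipschitz because the standard deviation is eventually at least one. -/
theorem Regular.tendsto_sdHat_sub (H : S.Regular Pr O p₁ p₂ c C β) {d e a : ℕ → ℝ}
    (hd : ∀ n, 0 < d n) (hde : ∀ᶠ n in atTop, d n ≤ e n) (he : Tendsto e atTop (𝓝 0))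
    (ha0 : ∀ᶠ n in atTop, 0 ≤ a n)
    (ha : Tendsto (fun n => a n ^ 2 * (d n)⁻¹ ^ 3 * (midSize p₁ p₂ n)⁻¹) atTop (𝓝 0))
    (ha' : Tendsto (fun n => a n * (d n)⁻¹ * (midSize p₁ p₂ n)⁻¹) atTop (𝓝 0)) :
    Tendsto (fun x : ℕ × Ω => a x.1 * (S.sdHat p₁ p₂ x.1 (O · x.2) (e x.1) -
      S.sdGrad (S.fitQ (cut p₁ x.1) (O · x.2)) (e x.1))) (whp Pr) (𝓝 0) := by
  have he' : Tendsto e atTop (𝓝[>] 0) := by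
    refine tendsto_nhdsWithin_iff.2 ⟨he, ?_⟩
    filter_upwards [hde] with n hn using (hd n).trans_le hn
  have h1 := H.tendsto_centerSq hd hde he ha
  have h2 : Tendsto (fun n => √(a n) ^ 2 * (d n)⁻¹ * (midSize p₁ p₂ n)⁻¹) atTop (𝓝 0) := by
    refine ha'.congr' ?_
    filter_upwards [ha0] with n hn
    rw [Real.sq_sqrt hn]
  have h3 := (H.tendsto_center hd hde he h2).pow 2
  have h4 := h1.abs.add h3
  simp only [abs_zero, ne_eq, OfNat.ofNat_ne_zero, not_false_eq_true, zero_pow, add_zero] at h4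
  have hev := (H.tendsto_nearLim H.p₁_pos (D := fun x => e x.1)
    (he'.comp tendsto_fst_whp)).eventually (H.pos.eventually_one_le_sdGrad H.cont H.nondeg)
  refine squeeze_zero_norm' ?_ h4
  filter_upwards [hev, tendsto_fst_whp.eventually H.eventually_mid,
    tendsto_fst_whp.eventually ha0] with x k1 k2 k3
  rw [S.sdHat_eq k2, sdGrad, Real.norm_eq_abs, abs_mul, abs_of_nonneg k3]
  have k4 := abs_sqrt_sub_sqrt_le (u := empMean (cut p₁ x.1) (cut p₂ x.1) (O · x.2)
      (fun y => S.center (S.fitQ (cut p₁ x.1) (O · x.2)) (e x.1) y ^ 2) -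
      empMean (cut p₁ x.1) (cut p₂ x.1) (O · x.2)
        (S.center (S.fitQ (cut p₁ x.1) (O · x.2)) (e x.1)) ^ 2) k1
  refine (mul_le_mul_of_nonneg_left k4 k3).trans ?_
  rw [mul_pow, Real.sq_sqrt k3, abs_mul, abs_of_nonneg k3, ← mul_add]
  refine mul_le_mul_of_nonneg_left ?_ k3
  rw [sub_right_comm]
  refine (abs_sub _ _).trans (le_of_eq ?_)
  rw [abs_sq]

end Setting


namespace Setting

theorem tendsto_stepSize_div {r : ℝ} {d : ℕ → ℝ} (h : SlowerThan r d) {p₁ p₂ : ℝ} (h1 : 0 < p₁)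
    (h2 : p₁ < p₂) (hr : r < 1 / 4) :
    Tendsto (fun n => stepSize p₁ p₂ n / d n) atTop (𝓝 0) := by
  refine (h.tendsto_rpow_mul h1 h2 zero_le_one (t := 1 / 4) (by linarith)).congr fun n => ?_
  rw [Real.rpow_neg_one, stepSize]
  ring

theorem eventually_stepSize_pos {p₁ p₂ : ℝ} (h1 : 0 < p₁) (h2 : p₁ < p₂) :
    ∀ᶠ n in atTop, 0 < stepSize p₁ p₂ n := by
  filter_upwards [(tendsto_midSize h1 h2).eventually_gt_atTop 0] with n hn
  exact Real.rpow_pos_of_pos hn _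

theorem tendsto_add_stepSize {d : ℕ → ℝ} (h : Tendsto d atTop (𝓝 0)) {p₁ p₂ : ℝ} (h1 : 0 < p₁)
    (h2 : p₁ < p₂) : Tendsto (fun n => d n + stepSize p₁ p₂ n) atTop (𝓝 0) := by
  have := h.add (tendsto_midSize_rpow h1 h2 (t := 1 / 4) (by norm_num))
  rwa [add_zero] at this

variable {𝒲 : Type*} [MeasurableSpace 𝒲] {S : Setting 𝒲} {Ω : Type*} [MeasurableSpace Ω]
  {Pr : Measure Ω} [IsProbabilityMeasure Pr] {O : ℕ → Ω → Obs 𝒲} {p₁ p₂ c C β r : ℝ} {d : ℕ → ℝ}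

/-! ### Consistency of the estimates of the bias and of the standard deviation -/

/-- The deterministic quotient follows `b₀'` since `Δ_n = o(d n)`. The noise is amplified by `1 /
Δ_n`; relative to `d ^ (β - 1)` its variance is of order `d ^ (1 - 2 β) m ^ (-1/2)`, and `hr'` makes
this vanish. -/
theorem Regular.tendsto_biasSlope (H : S.Regular Pr O p₁ p₂ c C β) (hd : SlowerThan r d)
    (hr : r < 1 / 4) (hr' : r * (2 * β) < 1 / 2) :
    Tendsto (fun x : ℕ × Ω => S.biasSlope p₁ p₂ x.1 (O · x.2) (d x.1) (stepSize p₁ p₂ x.1) *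
      d x.1 ^ (-(β - 1))) (whp Pr) (𝓝 C) := by
  have hpos := eventually_stepSize_pos H.p₁_pos H.p₁_lt
  set a : ℕ → ℝ := fun n => d n ^ (-(β - 1)) / stepSize p₁ p₂ n with ha
  have ha2 : Tendsto (fun n => a n ^ 2 * (d n)⁻¹ * (midSize p₁ p₂ n)⁻¹) atTop (𝓝 0) := by
    have h1 := hd.tendsto_rpow_mul H.p₁_pos H.p₁_lt (s := 2 * β) (t := 1 / 2)
      (by linarith [H.bias.pos]) hr'
    have h2 := h1.mul hd.2.1
    rw [zero_mul] at h2
    refine h2.congr' ?_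
    filter_upwards [(tendsto_midSize H.p₁_pos H.p₁_lt).eventually_gt_atTop 0] with n hm
    have hdn := hd.1 n
    have e1 : (stepSize p₁ p₂ n)⁻¹ ^ 2 * (midSize p₁ p₂ n)⁻¹ = midSize p₁ p₂ n ^ (-(1 / 2) : ℝ) := by
      rw [stepSize, Real.rpow_neg hm.le, inv_inv, ← Real.rpow_neg_one, ← Real.rpow_natCast,
        ← Real.rpow_mul hm.le, ← Real.rpow_add hm]
      norm_num
    have e2 : (d n ^ (-(β - 1))) ^ 2 * (d n)⁻¹ = d n ^ (-(2 * β)) * d n := by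
      rw [← Real.rpow_neg_one, ← Real.rpow_natCast, ← Real.rpow_mul hdn.le, ← Real.rpow_add hdn]
      conv_rhs => rw [← Real.rpow_one (d n), ← Real.rpow_mul hdn.le, ← Real.rpow_add hdn]
      congr 1
      push_cast
      ring
    rw [← e1]
    calc _ = (stepSize p₁ p₂ n)⁻¹ ^ 2 * (midSize p₁ p₂ n)⁻¹ * (d n ^ (-(2 * β)) * d n) := by ring
      _ = (stepSize p₁ p₂ n)⁻¹ ^ 2 * (midSize p₁ p₂ n)⁻¹ * ((d n ^ (-(β - 1))) ^ 2 * (d n)⁻¹) := by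
        rw [e2]
      _ = _ := by simp only [ha]; ring
  have h1 := H.tendsto_oneStep₂_sub hd.1 (Eventually.of_forall fun n => le_rfl) hd.2.1 ha2
  have h2 := H.tendsto_oneStep₂_sub (e := fun n => d n + stepSize p₁ p₂ n) hd.1
    (hpos.mono fun n hn => by linarith) (tendsto_add_stepSize hd.2.1 H.p₁_pos H.p₁_lt) ha2
  have h3 : Tendsto (fun n => (S.bias (d n + stepSize p₁ p₂ n) - S.bias (d n)) / stepSize p₁ p₂ n *
      d n ^ (-(β - 1))) atTop (𝓝 C) := by
    refine tendsto_slope_mul_rpow (F := fun _ => S.bias) (F' := fun _ => S.psiD 1)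
      hd.tendsto_nhdsGT hpos (tendsto_stepSize_div hd H.p₁_pos H.p₁_lt hr) ?_ ?_
    · intro ξ hξ
      filter_upwards [hξ.eventually self_mem_nhdsWithin] with n hn using S.hasDerivAt_bias hn
    · intro ξ hξ
      exact H.bias.deriv.comp hξ
  have h4 := ((h3.comp (tendsto_fst_whp (Pr := Pr))).add h2).sub h1
  rw [add_zero, sub_zero] at h4
  refine h4.congr fun x => ?_
  simp only [Function.comp_apply, biasSlope, ha, Setting.bias]
  ring

theorem Regular.tendsto_sdHat (H : S.Regular Pr O p₁ p₂ c C β) (hd : SlowerThan r d)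
    (hr : r < 1 / 4) :
    Tendsto (fun x : ℕ × Ω => S.sdHat p₁ p₂ x.1 (O · x.2) (d x.1) * d x.1 ^ (-(-(1 / 2) : ℝ)))
      (whp Pr) (𝓝 √(S.varLim c)) := by
  have h1 := H.tendsto_sdHat_sub (a := fun n => √(d n)) hd.1 (Eventually.of_forall fun n => le_rfl)
    hd.2.1 (Eventually.of_forall fun n => Real.sqrt_nonneg _) ?_ ?_
  · have h2 := (H.pos.tendsto_sdGrad H.cont).comp (H.tendsto_nearLim H.p₁_pos
      (D := fun x => d x.1) (hd.tendsto_nhdsGT.comp tendsto_fst_whp))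
    have h3 := h2.add h1
    rw [add_zero] at h3
    refine h3.congr fun x => ?_
    simp only [Function.comp_apply, neg_neg]
    rw [← Real.sqrt_eq_rpow]
    ring
  · have h := hd.tendsto_rpow_mul H.p₁_pos H.p₁_lt (s := 2) (t := 1) (by norm_num) (by linarith)
    refine h.congr fun n => ?_
    have hdn := hd.1 n
    rw [Real.sq_sqrt hdn.le, Real.rpow_neg_one, Real.rpow_neg hdn.le, Real.rpow_two]
    field_simp
  · have h := hd.tendsto_rpow_mul H.p₁_pos H.p₁_lt (s := 1 / 2) (t := 1) (by norm_num)
      (by linarith)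
    refine h.congr fun n => ?_
    have hdn := hd.1 n
    rw [Real.rpow_neg_one, Real.rpow_neg hdn.le, ← Real.sqrt_eq_rpow]
    congr 1
    rw [← Real.sqrt_div_self, div_eq_mul_inv]

/-- The mean value theorem is applied to the random function `σ` at the fitted regression, along
`whp`. With the scaling `d ^ (3/2) / Δ_n`, the powers of `d` cancel in the noise variance, which
becomes `m ^ (-1/2)`. -/
theorem Regular.tendsto_sdSlope (H : S.Regular Pr O p₁ p₂ c C β) (hd : SlowerThan r d)
    (hr : r < 1 / 4) :
    Tendsto (fun x : ℕ × Ω => S.sdSlope p₁ p₂ x.1 (O · x.2) (d x.1) (stepSize p₁ p₂ x.1) *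
      d x.1 ^ (-(-(3 / 2) : ℝ))) (whp Pr) (𝓝 (-(√(S.varLim c) / 2))) := by
  have hpos := eventually_stepSize_pos H.p₁_pos H.p₁_lt
  set a : ℕ → ℝ := fun n => d n ^ (-(-(3 / 2) : ℝ)) / stepSize p₁ p₂ n with ha
  have ha0 : ∀ᶠ n in atTop, 0 ≤ a n := by
    filter_upwards [hpos] with n hn
    exact div_nonneg (Real.rpow_nonneg (hd.1 n).le _) hn.le
  have ha1 : Tendsto (fun n => a n ^ 2 * (d n)⁻¹ ^ 3 * (midSize p₁ p₂ n)⁻¹) atTop (𝓝 0) := by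
    refine (tendsto_midSize_rpow H.p₁_pos H.p₁_lt (t := 1 / 2) (by norm_num)).congr' ?_
    filter_upwards [(tendsto_midSize H.p₁_pos H.p₁_lt).eventually_gt_atTop 0] with n hm
    have hdn := hd.1 n
    have e1 : (stepSize p₁ p₂ n)⁻¹ ^ 2 * (midSize p₁ p₂ n)⁻¹ = midSize p₁ p₂ n ^ (-(1 / 2) : ℝ) := by
      rw [stepSize, Real.rpow_neg hm.le, inv_inv, ← Real.rpow_neg_one, ← Real.rpow_natCast,
        ← Real.rpow_mul hm.le, ← Real.rpow_add hm]
      norm_num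
    have e2 : (d n ^ (-(-(3 / 2) : ℝ))) ^ 2 = d n ^ 3 := by
      rw [← Real.rpow_natCast, ← Real.rpow_mul hdn.le, ← Real.rpow_natCast]
      norm_num
    rw [← e1, ha]
    simp only [div_pow, e2]
    field_simp
  have ha2 : Tendsto (fun n => a n * (d n)⁻¹ * (midSize p₁ p₂ n)⁻¹) atTop (𝓝 0) := by
    have h1 := (tendsto_midSize_rpow H.p₁_pos H.p₁_lt (t := 3 / 4) (by norm_num)).mul
      (hd.2.1.sqrt)
    rw [Real.sqrt_zero, mul_zero] at h1
    refine h1.congr' ?_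
    filter_upwards [(tendsto_midSize H.p₁_pos H.p₁_lt).eventually_gt_atTop 0] with n hm
    have hdn := hd.1 n
    have e1 : (stepSize p₁ p₂ n)⁻¹ * (midSize p₁ p₂ n)⁻¹ = midSize p₁ p₂ n ^ (-(3 / 4) : ℝ) := by
      rw [stepSize, Real.rpow_neg hm.le, inv_inv, ← Real.rpow_neg_one, ← Real.rpow_add hm]
      norm_num
    have e2 : d n ^ (-(-(3 / 2) : ℝ)) * (d n)⁻¹ = √(d n) := by
      rw [← Real.rpow_neg_one, ← Real.rpow_add hdn, Real.sqrt_eq_rpow]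
      norm_num
    rw [← e1, ← e2, ha]
    ring
  have h1 := H.tendsto_sdHat_sub hd.1 (Eventually.of_forall fun n => le_rfl) hd.2.1 ha0 ha1 ha2
  have h2 := H.tendsto_sdHat_sub (e := fun n => d n + stepSize p₁ p₂ n) hd.1
    (hpos.mono fun n hn => by linarith) (tendsto_add_stepSize hd.2.1 H.p₁_pos H.p₁_lt) ha0 ha1 ha2
  have h3 : Tendsto (fun x : ℕ × Ω => (S.sdGrad (S.fitQ (cut p₁ x.1) (O · x.2))
        (d x.1 + stepSize p₁ p₂ x.1) -
      S.sdGrad (S.fitQ (cut p₁ x.1) (O · x.2)) (d x.1)) / stepSize p₁ p₂ x.1 *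
        d x.1 ^ (-(-(3 / 2) : ℝ))) (whp Pr) (𝓝 (-(√(S.varLim c) / 2))) := by
    have k1 : Tendsto (fun x : ℕ × Ω => d x.1) (whp Pr) (𝓝[>] 0) :=
      hd.tendsto_nhdsGT.comp tendsto_fst_whp
    have k2 : ∀ᶠ x : ℕ × Ω in whp Pr, 0 < stepSize p₁ p₂ x.1 := tendsto_fst_whp.eventually hpos
    have k3 : Tendsto (fun x : ℕ × Ω => stepSize p₁ p₂ x.1 / d x.1) (whp Pr) (𝓝 0) :=
      (tendsto_stepSize_div hd H.p₁_pos H.p₁_lt hr).comp tendsto_fst_whp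
    refine tendsto_slope_mul_rpow (F := fun x : ℕ × Ω => S.sdGrad (S.fitQ (cut p₁ x.1) (O · x.2)))
      (F' := fun x : ℕ × Ω => deriv (S.sdGrad (S.fitQ (cut p₁ x.1) (O · x.2))))
      (d := fun x => d x.1) (Δ := fun x => stepSize p₁ p₂ x.1) k1 k2 k3 ?_ ?_
    · intro ξ hξ
      have k4 := (H.tendsto_nearLim H.p₁_pos hξ).eventually
        (H.pos.eventually_varGrad_pos H.cont H.nondeg)
      filter_upwards [k4, hξ.eventually self_mem_nhdsWithin] with x k5 k6
      exact (H.pos.hasDerivAt_sdGrad (S.isRegression_fitQ _ _) k6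
        k5).differentiableAt.hasDerivAt
    · intro ξ hξ
      have k4 := (H.pos.tendsto_deriv_sdGrad H.cont H.nondeg).comp (H.tendsto_nearLim H.p₁_pos hξ)
      refine k4.congr' ?_
      filter_upwards [hξ.eventually self_mem_nhdsWithin] with x k6
      have k7 : 0 < ξ x := k6
      have e : ξ x ^ (-(-(3 / 2) : ℝ)) = ξ x * √(ξ x) := by
        rw [Real.sqrt_eq_rpow]
        conv_rhs => rw [← Real.rpow_one (ξ x), ← Real.rpow_mul k7.le, ← Real.rpow_add k7]
        norm_num
      simp only [Function.comp_apply]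
      rw [e, mul_comm]
  have h4 := (h3.add h2).sub h1
  rw [add_zero, sub_zero] at h4
  refine h4.congr fun x => ?_
  simp only [sdSlope, ha]
  ring

end Setting


theorem tendsto_of_sub_mul {α : Type*} {l : Filter α} {u N : α → ℝ} {a : ℝ}
    (hN : Tendsto N l atTop) (h : Tendsto (fun x => (u x - a) * N x) l (𝓝 0)) :
    Tendsto u l (𝓝 a) := by
  have h1 := (h.mul (tendsto_inv_atTop_zero.comp hN)).add_const a
  rw [mul_zero, zero_add] at h1
  refine h1.congr' ?_
  filter_upwards [hN.eventually_gt_atTop 0] with x hx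
  have := hx.ne'
  simp only [Function.comp_apply]
  field_simp
  ring

theorem tendsto_log_whp {Ω : Type*} [MeasurableSpace Ω] {Pr : Measure Ω} :
    Tendsto (fun x : ℕ × Ω => Real.log x.1) (whp Pr) atTop :=
  (Real.tendsto_log_atTop.comp tendsto_natCast_atTop_atTop).comp tendsto_fst_whp

theorem SlowerThan.abs_log_le {r : ℝ} {d : ℕ → ℝ} (h : SlowerThan r d) :
    ∀ᶠ n : ℕ in atTop, |Real.log (d n)| ≤ r * Real.log n := by
  filter_upwards [h.eventually_le, h.2.1.eventually (Iic_mem_nhds one_pos), eventually_gt_atTop 0]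
    with n h1 h2 h3
  have hn : (0 : ℝ) < n := by exact_mod_cast h3
  rw [abs_of_nonpos (Real.log_nonpos (h.1 n).le h2)]
  have := Real.log_le_log (Real.rpow_pos_of_pos hn _) h1
  rw [Real.log_rpow hn] at this
  linarith

namespace Setting

variable {𝒲 : Type*} [MeasurableSpace 𝒲] {S : Setting 𝒲} {Ω : Type*} [MeasurableSpace Ω]
  {Pr : Measure Ω} {O : ℕ → Ω → Obs 𝒲} {p₁ p₂ c C β r : ℝ}
  {d₁ d₂ d₃ : ℕ → ℝ}

/-! ### Consistency of the estimated rates and constants -/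

variable (S Pr O) in
/-- The standing assumptions, together with admissible preliminary levels. -/
structure Tuned (p₁ p₂ c C β r : ℝ) (d₁ d₂ d₃ : ℕ → ℝ) : Prop extends
    S.Regular Pr O p₁ p₂ c C β where
  r_lt : r < 1 / 4
  r_mul_lt : r * (2 * β) < 1 / 2
  levels : Admissible r d₁ d₂ d₃

/-- The exponent of the optimal bandwidth. -/
noncomputable def _root_.DoseResponse.optRate (β : ℝ) : ℝ := 1 / (2 * β + 1)

variable (S) in
/-- The constant of the optimal bandwidth. -/
noncomputable def optConst (c C β : ℝ) : ℝ := (S.varLim c / 2 * β / C ^ 2) ^ optRate β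

theorem Regular.optConst_pos (H : S.Regular Pr O p₁ p₂ c C β) : 0 < S.optConst c C β := by
  have h1 := S.varLim_pos H.nondeg H.pos.1
  have h2 := H.bias.pos
  have h3 := H.bias.ne_zero
  exact Real.rpow_pos_of_pos (by positivity) _

theorem Tuned.eventually_sep (H : S.Tuned Pr O p₁ p₂ c C β r d₁ d₂ d₃) : ∃ k : ℝ, 0 < k ∧
    ∀ᶠ x : ℕ × Ω in whp Pr, k * Real.log x.1 ≤ |Real.log (d₂ x.1) - Real.log (d₁ x.1)| := by
  obtain ⟨k, hk, h⟩ := H.levels.2.2.2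
  exact ⟨k, hk, tendsto_fst_whp.eventually h⟩

theorem Tuned.eventually_log_pos (_ : S.Tuned Pr O p₁ p₂ c C β r d₁ d₂ d₃) :
    ∀ᶠ x : ℕ × Ω in whp Pr, 0 < Real.log x.1 := tendsto_log_whp.eventually_gt_atTop 0

theorem Tuned.varLim_pos (H : S.Tuned Pr O p₁ p₂ c C β r d₁ d₂ d₃) : 0 < S.varLim c :=
  S.varLim_pos H.nondeg H.pos.1

theorem Tuned.eventually_log_d₃ (H : S.Tuned Pr O p₁ p₂ c C β r d₁ d₂ d₃) :
    ∀ᶠ x : ℕ × Ω in whp Pr, |Real.log (d₃ x.1)| ≤ r * Real.log x.1 :=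
  tendsto_fst_whp.eventually H.levels.2.2.1.abs_log_le

variable [IsProbabilityMeasure Pr]

theorem Tuned.tendsto_betaHat (H : S.Tuned Pr O p₁ p₂ c C β r d₁ d₂ d₃) :
    Tendsto (fun x : ℕ × Ω => (S.betaHat p₁ p₂ d₁ d₂ x.1 (O · x.2) - β) * Real.log x.1) (whp Pr)
      (𝓝 0) := by
  obtain ⟨k, hk, hsep⟩ := H.eventually_sep
  have h1 := H.tendsto_biasSlope H.levels.1 H.r_lt H.r_mul_lt
  have h2 := H.tendsto_biasSlope H.levels.2.1 H.r_lt H.r_mul_lt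
  have h := tendsto_logSlope_sub_mul (d₁ := fun x : ℕ × Ω => d₁ x.1) (d₂ := fun x => d₂ x.1)
    H.bias.ne_zero hk h1 h2 (Eventually.of_forall fun x => H.levels.1.1 _)
    (Eventually.of_forall fun x => H.levels.2.1.1 _) H.eventually_log_pos hsep
  refine h.congr fun x => ?_
  rw [betaHat]
  ring

theorem Tuned.tendsto_gammaHat (H : S.Tuned Pr O p₁ p₂ c C β r d₁ d₂ d₃) :
    Tendsto (fun x : ℕ × Ω => (S.gammaHat p₁ p₂ d₁ d₂ x.1 (O · x.2) - 1 / 2) * Real.log x.1)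
      (whp Pr) (𝓝 0) := by
  obtain ⟨k, hk, hsep⟩ := H.eventually_sep
  have h1 := H.tendsto_sdHat H.levels.1 H.r_lt
  have h2 := H.tendsto_sdHat H.levels.2.1 H.r_lt
  have h := tendsto_logSlope_sub_mul (d₁ := fun x : ℕ × Ω => d₁ x.1) (d₂ := fun x => d₂ x.1)
    (Real.sqrt_pos.2 H.varLim_pos).ne' hk h1 h2 (Eventually.of_forall fun x => H.levels.1.1 _)
    (Eventually.of_forall fun x => H.levels.2.1.1 _) H.eventually_log_pos hsep
  have h' := h.neg
  rw [neg_zero] at h'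
  refine h'.congr fun x => ?_
  rw [gammaHat]
  simp only [Real.log_abs]
  ring

theorem Tuned.tendsto_nuHat (H : S.Tuned Pr O p₁ p₂ c C β r d₁ d₂ d₃) :
    Tendsto (fun x : ℕ × Ω => (S.nuHat p₁ p₂ d₁ d₂ x.1 (O · x.2) - -(3 / 2)) * Real.log x.1)
      (whp Pr) (𝓝 0) := by
  obtain ⟨k, hk, hsep⟩ := H.eventually_sep
  have h1 := H.tendsto_sdSlope H.levels.1 H.r_lt
  have h2 := H.tendsto_sdSlope H.levels.2.1 H.r_lt
  have hne : -(√(S.varLim c) / 2) ≠ 0 := by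
    have := Real.sqrt_pos.2 H.varLim_pos
    exact (neg_neg_of_pos (by positivity)).ne
  exact tendsto_logSlope_sub_mul (d₁ := fun x : ℕ × Ω => d₁ x.1) (d₂ := fun x => d₂ x.1)
    hne hk h1 h2 (Eventually.of_forall fun x => H.levels.1.1 _)
    (Eventually.of_forall fun x => H.levels.2.1.1 _) H.eventually_log_pos hsep

theorem Tuned.tendsto_CbHat (H : S.Tuned Pr O p₁ p₂ c C β r d₁ d₂ d₃) :
    Tendsto (fun x : ℕ × Ω => S.CbHat p₁ p₂ d₁ d₂ d₃ x.1 (O · x.2)) (whp Pr) (𝓝 C) := by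
  have h := H.tendsto_biasSlope H.levels.2.2.1 H.r_lt H.r_mul_lt
  refine tendsto_mul_rpow_estimate (d := fun x : ℕ × Ω => d₃ x.1)
    (N := fun x : ℕ × Ω => Real.log x.1)
    (e := fun x : ℕ × Ω => S.betaHat p₁ p₂ d₁ d₂ x.1 (O · x.2) - 1) h
    (Eventually.of_forall fun x => H.levels.2.2.1.1 _) H.eventually_log_d₃ ?_
  refine H.tendsto_betaHat.congr fun x => ?_
  ring

theorem Tuned.tendsto_CsdHat (H : S.Tuned Pr O p₁ p₂ c C β r d₁ d₂ d₃) :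
    Tendsto (fun x : ℕ × Ω => S.CsdHat p₁ p₂ d₁ d₂ d₃ x.1 (O · x.2)) (whp Pr)
      (𝓝 √(S.varLim c)) := by
  have h := H.tendsto_sdHat H.levels.2.2.1 H.r_lt
  have h' := tendsto_mul_rpow_estimate (d := fun x : ℕ × Ω => d₃ x.1)
    (N := fun x : ℕ × Ω => Real.log x.1)
    (e := fun x : ℕ × Ω => -S.gammaHat p₁ p₂ d₁ d₂ x.1 (O · x.2)) h
    (Eventually.of_forall fun x => H.levels.2.2.1.1 _) H.eventually_log_d₃ (by
      have := H.tendsto_gammaHat.neg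
      rw [neg_zero] at this
      refine this.congr fun x => ?_
      ring)
  refine h'.congr fun x => ?_
  rw [CsdHat, neg_neg]

theorem Tuned.tendsto_CsdSlopeHat (H : S.Tuned Pr O p₁ p₂ c C β r d₁ d₂ d₃) :
    Tendsto (fun x : ℕ × Ω => S.CsdSlopeHat p₁ p₂ d₁ d₂ d₃ x.1 (O · x.2)) (whp Pr)
      (𝓝 (-(√(S.varLim c) / 2))) := by
  have h := H.tendsto_sdSlope H.levels.2.2.1 H.r_lt
  exact tendsto_mul_rpow_estimate (d := fun x : ℕ × Ω => d₃ x.1)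
    (N := fun x : ℕ × Ω => Real.log x.1)
    (e := fun x : ℕ × Ω => S.nuHat p₁ p₂ d₁ d₂ x.1 (O · x.2)) h
    (Eventually.of_forall fun x => H.levels.2.2.1.1 _) H.eventually_log_d₃ H.tendsto_nuHat

theorem _root_.DoseResponse.optRate_pos {β : ℝ} (hβ : 0 < β) : 0 < optRate β := by
  unfold optRate; positivity

/-- The denominator converges to `2 β - 1 + 1/2 + 3/2 = 2 β + 1`, and inversion preserves errors
`o(1 / log n)`. -/
theorem Tuned.tendsto_rHat (H : S.Tuned Pr O p₁ p₂ c C β r d₁ d₂ d₃) :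
    Tendsto (fun x : ℕ × Ω => (S.rHat p₁ p₂ d₁ d₂ x.1 (O · x.2) - optRate β) * Real.log x.1)
      (whp Pr) (𝓝 0) := by
  have hβ := H.bias.pos
  set D : ℕ × Ω → ℝ := fun x => 2 * S.betaHat p₁ p₂ d₁ d₂ x.1 (O · x.2) - 1 +
    S.gammaHat p₁ p₂ d₁ d₂ x.1 (O · x.2) - S.nuHat p₁ p₂ d₁ d₂ x.1 (O · x.2) with hD
  have h1 : Tendsto (fun x => (D x - (2 * β + 1)) * Real.log x.1) (whp Pr) (𝓝 0) := by
    have := ((H.tendsto_betaHat.const_mul 2).add H.tendsto_gammaHat).sub H.tendsto_nuHat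
    rw [mul_zero, add_zero, sub_zero] at this
    refine this.congr fun x => ?_
    simp only [hD]
    ring
  have h2 : Tendsto D (whp Pr) (𝓝 (2 * β + 1)) := tendsto_of_sub_mul tendsto_log_whp h1
  have hpos : (0 : ℝ) < 2 * β + 1 := by positivity
  have h3 := (h1.mul (h2.inv₀ hpos.ne')).mul_const (-optRate β)
  rw [zero_mul, zero_mul] at h3
  refine h3.congr' ?_
  filter_upwards [h2.eventually (lt_mem_nhds hpos)] with x hx
  have e : S.rHat p₁ p₂ d₁ d₂ x.1 (O · x.2) = 1 / D x := rfl
  rw [e, optRate]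
  field_simp
  ring

theorem Tuned.tendsto_CHat (H : S.Tuned Pr O p₁ p₂ c C β r d₁ d₂ d₃) :
    Tendsto (fun x : ℕ × Ω => S.CHat p₁ p₂ d₁ d₂ d₃ x.1 (O · x.2)) (whp Pr)
      (𝓝 (S.optConst c C β)) := by
  have hb := tendsto_of_sub_mul tendsto_log_whp H.tendsto_betaHat
  have hr := tendsto_of_sub_mul tendsto_log_whp H.tendsto_rHat
  have h := (((H.tendsto_CsdHat.mul H.tendsto_CsdSlopeHat).abs.mul hb).div
    (H.tendsto_CbHat.pow 2) (pow_ne_zero 2 H.bias.ne_zero)).rpow hr (Or.inl ?_)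
  -- The product of the constants of `σ` and `σ'` is `-B / 2`, half the derivative of the variance:
  -- the plug-in formula reproduces the constant of the optimal bandwidth.
  · have e : |√(S.varLim c) * -(√(S.varLim c) / 2)| * β / C ^ 2 = S.varLim c / 2 * β / C ^ 2 := by
      have : √(S.varLim c) * -(√(S.varLim c) / 2) = -(S.varLim c / 2) := by
        have := Real.mul_self_sqrt H.varLim_pos.le
        linarith
      rw [this, abs_neg, abs_of_pos (half_pos H.varLim_pos)]
    rw [e] at h
    exact h
  · have h1 := Real.sqrt_pos.2 H.varLim_pos
    have h2 := H.bias.pos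
    have h3 := H.bias.ne_zero
    have h4 : √(S.varLim c) * -(√(S.varLim c) / 2) ≠ 0 :=
      mul_ne_zero h1.ne' (neg_neg_of_pos (by positivity)).ne
    have := abs_pos.2 h4
    positivity

/-- The last part has at most `n` observations, so its size raised to `r̂_n - optRate β = o(1 / log
n)` tends to one. -/
theorem Tuned.tendsto_deltaHat (H : S.Tuned Pr O p₁ p₂ c C β r d₁ d₂ d₃) (ε : ℝ) :
    Tendsto (fun x : ℕ × Ω => S.deltaHat p₁ p₂ d₁ d₂ d₃ ε x.1 (O · x.2) /
      lastSize p₂ x.1 ^ (-(optRate β + ε))) (whp Pr) (𝓝 (S.optConst c C β)) := by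
  have hm := (tendsto_lastSize H.p₂_pos H.p₂_lt).comp (tendsto_fst_whp (Pr := Pr))
  have hm1 := hm.eventually_ge_atTop 1
  simp only [Function.comp_apply] at hm1
  have hlog : ∀ᶠ x : ℕ × Ω in whp Pr, |Real.log (lastSize p₂ x.1)| ≤ 1 * Real.log x.1 := by
    filter_upwards [hm1] with x hx
    rw [abs_of_nonneg (Real.log_nonneg hx), one_mul]
    refine Real.log_le_log (by linarith) ?_
    rw [lastSize]
    linarith [(Nat.cast_nonneg (cut p₂ x.1) : (0 : ℝ) ≤ _)]
  have hpos : ∀ᶠ x : ℕ × Ω in whp Pr, 0 < lastSize p₂ x.1 :=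
    hm1.mono fun x hx => one_pos.trans_le hx
  have h := H.tendsto_rHat.neg
  rw [neg_zero] at h
  have h1 := H.tendsto_CHat.mul (tendsto_rpow_one_of_log (d := fun x : ℕ × Ω => lastSize p₂ x.1)
    (N := fun x : ℕ × Ω => Real.log x.1)
    (e := fun x : ℕ × Ω => -(S.rHat p₁ p₂ d₁ d₂ x.1 (O · x.2) - optRate β)) hpos hlog
    (h.congr fun x => by ring))
  rw [mul_one] at h1
  refine h1.congr' ?_
  filter_upwards [hpos] with x hx
  rw [deltaHat, mul_div_assoc, ← Real.rpow_sub hx]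
  congr 2
  ring

end Setting


/-! ### A central limit theorem for averages of functions fitted on the first observations -/

/-- For `|x| ≤ 1` the Taylor remainder carries a factor at most `e < 4`. For larger `x` the crude
bound `2 + |x| + |x| ^ 2 / 2` is below `4 |x| ^ 3`. -/
theorem norm_cexp_mul_I_sub_le (x : ℝ) :
    ‖Complex.exp (x * Complex.I) - (1 + x * Complex.I - (x : ℂ) ^ 2 / 2)‖ ≤ 4 * |x| ^ 3 := by
  rcases le_total |x| 1 with hx | hx
  · have h := Complex.norm_exp_sub_sum_le_norm_mul_exp (x * Complex.I) 3
    have hn : ‖(x : ℂ) * Complex.I‖ = |x| := by simp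
    have e : ∑ m ∈ Finset.range 3, ((x : ℂ) * Complex.I) ^ m / m.factorial =
        1 + x * Complex.I - (x : ℂ) ^ 2 / 2 := by
      simp only [Finset.sum_range_succ, Finset.sum_range_zero, Nat.factorial, mul_pow,
        Complex.I_sq]
      push_cast
      ring
    rw [e, hn] at h
    refine h.trans ?_
    rw [mul_comm]
    refine mul_le_mul_of_nonneg_right ?_ (by positivity)
    exact (Real.exp_le_exp.2 hx).trans (Real.exp_one_lt_d9.le.trans (by norm_num))
  · have h1 : ‖Complex.exp (x * Complex.I)‖ = 1 := Complex.norm_exp_ofReal_mul_I x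
    have h2 : ‖(1 + x * Complex.I - (x : ℂ) ^ 2 / 2)‖ ≤ 1 + |x| + |x| ^ 2 / 2 := by
      refine (norm_sub_le _ _).trans (add_le_add ((norm_add_le _ _).trans ?_) ?_) <;> simp
    refine (norm_sub_le _ _).trans ?_
    rw [h1]
    have h3 : |x| ≤ |x| ^ 2 := by nlinarith
    have h4 : |x| ^ 2 ≤ |x| ^ 3 := by nlinarith
    linarith

theorem abs_exp_neg_sub_le {u : ℝ} (hu : 0 ≤ u) : |Real.exp (-u) - (1 - u)| ≤ u ^ 2 := by
  rcases le_total u 1 with h | h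
  · have := Real.abs_exp_sub_one_sub_id_le (x := -u) (by rwa [abs_neg, abs_of_nonneg hu])
    rw [neg_sq] at this
    convert! this using 2
    ring
  · have h1 := Real.add_one_le_exp (-u)
    have h2 : Real.exp (-u) ≤ 1 := Real.exp_le_one_iff.2 (by linarith)
    rw [abs_of_nonneg (by linarith)]
    nlinarith

/-- Replacing one factor at a time costs `‖a - b‖` each, since all other factors have norm at most
one. -/
theorem norm_pow_sub_pow_le {a b : ℂ} (ha : ‖a‖ ≤ 1) (hb : ‖b‖ ≤ 1) (n : ℕ) :
    ‖a ^ n - b ^ n‖ ≤ n * ‖a - b‖ := by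
  induction n with
  | zero => simp
  | succ k ih =>
    have e : a ^ (k + 1) - b ^ (k + 1) = (a ^ k - b ^ k) * a + b ^ k * (a - b) := by ring
    rw [e]
    refine (norm_add_le _ _).trans ?_
    rw [norm_mul, norm_mul, norm_pow]
    have h1 : ‖b‖ ^ k ≤ 1 := pow_le_one₀ (norm_nonneg _) hb
    have h2 := mul_le_mul ih ha (norm_nonneg _) (by positivity)
    have h3 := mul_le_mul_of_nonneg_right h1 (norm_nonneg (a - b))
    push_cast
    linarith

/-- A quantitative second order expansion of the characteristic function of a bounded variable. -/
theorem norm_integral_cexp_sub_le {α : Type*} [MeasurableSpace α] {μ : Measure α}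
    [IsProbabilityMeasure μ] {h : α → ℝ} {K : ℝ} (hm : Measurable h) (hK : ∀ᵐ x ∂μ, |h x| ≤ K)
    (h0 : ∫ x, h x ∂μ = 0) (h1 : ∫ x, h x ^ 2 ∂μ = 1) (s : ℝ) :
    ‖∫ x, Complex.exp (s * h x * Complex.I) ∂μ - Real.exp (-(s ^ 2 / 2))‖ ≤
      4 * |s| ^ 3 * K + s ^ 4 / 4 := by
  have hi1 : Integrable h μ := Integrable.of_bound hm.aestronglyMeasurable K hK
  have hi2 : Integrable (fun x => h x ^ 2) μ := by
    refine Integrable.of_bound (hm.pow_const 2).aestronglyMeasurable (K ^ 2) ?_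
    filter_upwards [hK] with x hx
    rw [norm_pow, Real.norm_eq_abs]
    exact pow_le_pow_left₀ (abs_nonneg _) hx 2
  have hi3 : Integrable (fun x => 4 * |s| ^ 3 * K * h x ^ 2) μ := hi2.const_mul _
  have hme : Measurable fun x => Complex.exp (s * h x * Complex.I) :=
    (((Complex.measurable_ofReal.comp hm).const_mul (s : ℂ)).mul_const _).cexp
  have hie : Integrable (fun x => Complex.exp (s * h x * Complex.I)) μ := by
    refine Integrable.of_bound hme.aestronglyMeasurable 1 (ae_of_all _ fun x => ?_)
    rw [← Complex.ofReal_mul, Complex.norm_exp_ofReal_mul_I]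
  have hc1 : Integrable (fun x => (s : ℂ) * h x * Complex.I) μ :=
    (hi1.ofReal.const_mul (s : ℂ)).mul_const _
  have hc2 : Integrable (fun x => ((s : ℂ) ^ 2 / 2) * ((h x ^ 2 : ℝ) : ℂ)) μ :=
    hi2.ofReal.const_mul _
  have hc0 : Integrable (fun x => 1 + (s : ℂ) * h x * Complex.I) μ := (integrable_const 1).add hc1
  have hq : Integrable (fun x => 1 + (s : ℂ) * h x * Complex.I -
      ((s : ℂ) ^ 2 / 2) * ((h x ^ 2 : ℝ) : ℂ)) μ := hc0.sub hc2
  have eq : ∫ x, (1 + (s : ℂ) * h x * Complex.I -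
      ((s : ℂ) ^ 2 / 2) * ((h x ^ 2 : ℝ) : ℂ)) ∂μ = ((1 - s ^ 2 / 2 : ℝ) : ℂ) := by
    rw [integral_sub hc0 hc2, integral_add (integrable_const 1) hc1,
      integral_mul_const, integral_const_mul, integral_const_mul]
    have e1 : ∫ x, (h x : ℂ) ∂μ = ((∫ x, h x ∂μ : ℝ) : ℂ) := integral_ofReal
    have e2 : ∫ x, ((h x ^ 2 : ℝ) : ℂ) ∂μ = ((∫ x, h x ^ 2 ∂μ : ℝ) : ℂ) := integral_ofReal
    rw [e1, e2, h0, h1]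
    simp
  have hA : ‖∫ x, Complex.exp (s * h x * Complex.I) ∂μ - ((1 - s ^ 2 / 2 : ℝ) : ℂ)‖ ≤
      4 * |s| ^ 3 * K := by
    rw [← eq, ← integral_sub hie hq]
    refine (norm_integral_le_of_norm_le hi3 ?_).trans (le_of_eq ?_)
    · filter_upwards [hK] with x hx
      have := norm_cexp_mul_I_sub_le (s * h x)
      push_cast at this ⊢
      rw [abs_mul, mul_pow, mul_pow] at this
      rw [mul_div_right_comm] at this
      refine this.trans ?_
      -- Boundedness trades the third absolute moment for `K` times the second one, which is
      -- normalised.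
      have h3 : |h x| ^ 3 ≤ K * h x ^ 2 := by
        rw [← sq_abs (h x), pow_succ, mul_comm]
        exact mul_le_mul_of_nonneg_right hx (sq_nonneg _)
      have := mul_le_mul_of_nonneg_left h3 (by positivity : 0 ≤ 4 * |s| ^ 3)
      linarith
    · rw [integral_const_mul, h1, mul_one]
  have hB : ‖((1 - s ^ 2 / 2 : ℝ) : ℂ) - Real.exp (-(s ^ 2 / 2))‖ ≤ s ^ 4 / 4 := by
    rw [← Complex.ofReal_sub, Complex.norm_real, Real.norm_eq_abs, abs_sub_comm]
    refine (abs_exp_neg_sub_le (by positivity)).trans (le_of_eq ?_)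
    ring
  exact (norm_sub_le_norm_sub_add_norm_sub _ _ _).trans (add_le_add hA hB)

namespace Setting

variable {𝒲 : Type*} [MeasurableSpace 𝒲] {S : Setting 𝒲} {Ω : Type*} [MeasurableSpace Ω]
  {Pr : Measure Ω} {O : ℕ → Ω → Obs 𝒲} [IsProbabilityMeasure Pr]

theorem IsSample.isProbabilityMeasure (hS : S.IsSample Pr O) : IsProbabilityMeasure S.P₀ := by
  rw [← hS.law 0]
  exact Measure.isProbabilityMeasure_map (hS.meas 0).aemeasurable

omit [IsProbabilityMeasure Pr] in
theorem IsSample.integral_cexp_sum (hS : S.IsSample Pr O) {h : Obs 𝒲 → ℝ} (hm : Measurable h)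
    (s : Finset ℕ) (t : ℝ) :
    ∫ ω, Complex.exp (t * (∑ i ∈ s, h (O i ω) : ℝ) * Complex.I) ∂Pr =
      (∫ o, Complex.exp (t * h o * Complex.I) ∂S.P₀) ^ s.card := by
  have hX : ∀ i, Measurable fun ω => h (O i ω) := fun i => hm.comp (hS.meas i)
  have hind : iIndepFun (fun i ω => h (O i ω)) Pr := hS.indep.comp (fun _ => h) fun _ => hm
  have key := congrFun ((hind.restrict s).charFun_map_fun_finsetSum_eq_prod
    (fun i _ => (hX i).aemeasurable)) t
  have hmc : StronglyMeasurable fun x : ℝ => Complex.exp (t * (x : ℂ) * Complex.I) :=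
    (((Complex.measurable_ofReal.const_mul (t : ℂ)).mul_const _).cexp).stronglyMeasurable
  have hsum : Measurable fun ω => ∑ i ∈ s, h (O i ω) := Finset.measurable_fun_sum _ fun i _ => hX i
  rw [charFun_apply_real, integral_map hsum.aemeasurable
    hmc.aestronglyMeasurable, Finset.prod_apply] at key
  refine key.trans ?_
  rw [← Finset.prod_const]
  refine Finset.prod_congr rfl fun i _ => ?_
  rw [charFun_apply_real, integral_map (hX i).aemeasurable
    hmc.aestronglyMeasurable, ← hS.law i,
    integral_map (hS.meas i).aemeasurable]
  exact ((((Complex.measurable_ofReal.comp hm).const_mul (t : ℂ)).mul_const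
    _).cexp).aestronglyMeasurable

/-- Apply the expansion at `s = t / √m` and multiply the error by the number `m` of factors. The
explicit bound makes the estimate uniform over frozen functions `h`. -/
theorem IsSample.norm_integral_cexp_empMean_sub_le (hS : S.IsSample Pr O) {h : Obs 𝒲 → ℝ} {K : ℝ}
    (hm : Measurable h) (hK : ∀ᵐ x ∂S.P₀, |h x| ≤ K) (h0 : ∫ x, h x ∂S.P₀ = 0)
    (h1 : ∫ x, h x ^ 2 ∂S.P₀ = 1) {l n : ℕ} (hln : l < n) (t : ℝ) :
    ‖∫ ω, Complex.exp (t * (√((n : ℝ) - l) * empMean l n (O · ω) h : ℝ) * Complex.I) ∂Pr -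
      Real.exp (-(t ^ 2 / 2))‖ ≤
      4 * |t| ^ 3 * (K / √((n : ℝ) - l)) + t ^ 4 / 4 * ((n : ℝ) - l)⁻¹ := by
  have := hS.isProbabilityMeasure
  have hpos : (0 : ℝ) < (n : ℝ) - l := by
    have : (l : ℝ) < n := by exact_mod_cast hln
    linarith
  have hc : (((n - l : ℕ) : ℕ) : ℝ) = n - l := Nat.cast_sub hln.le
  have hsq := Real.sqrt_pos.2 hpos
  set m : ℝ := (n : ℝ) - l with hmdef
  set s : ℝ := t / √m with hs
  have hss : √m * √m = m := Real.mul_self_sqrt hpos.le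
  have e1 : ∀ ω, (t : ℂ) * (√m * empMean l n (O · ω) h : ℝ) * Complex.I =
      s * (∑ i ∈ Finset.Ico l n, h (O i ω) : ℝ) * Complex.I := by
    intro ω
    congr 1
    rw [← Complex.ofReal_mul, ← Complex.ofReal_mul]
    congr 1
    rw [empMean, hs, ← hmdef]
    field_simp
    rw [pow_two, hss]
    field_simp
  simp only [e1]
  rw [hS.integral_cexp_sum hm, Nat.card_Ico]
  have e2 : ((Real.exp (-(t ^ 2 / 2)) : ℝ) : ℂ) =
      ((Real.exp (-(s ^ 2 / 2)) : ℝ) : ℂ) ^ (n - l) := by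
    rw [← Complex.ofReal_pow, ← Real.exp_nat_mul, hc]
    congr 2
    rw [hs, div_pow, pow_two √m, hss]
    field_simp
  rw [e2]
  refine (norm_pow_sub_pow_le ?_ ?_ _).trans ?_
  · refine (norm_integral_le_of_norm_le_const (C := 1) (ae_of_all _ fun x => ?_)).trans (by simp)
    rw [← Complex.ofReal_mul, Complex.norm_exp_ofReal_mul_I]
  · rw [Complex.norm_real, Real.norm_eq_abs, abs_of_pos (Real.exp_pos _)]
    exact Real.exp_le_one_iff.2 (by have := sq_nonneg s; linarith)
  · rw [hc]
    refine (mul_le_mul_of_nonneg_left (norm_integral_cexp_sub_le hm hK h0 h1 s) hpos.le).trans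
      (le_of_eq ?_)
    have e3 : |s| ^ 3 = |t| ^ 3 / (m * √m) := by
      rw [hs, abs_div, abs_of_pos hsq, div_pow, pow_succ (√m), pow_two, hss]
    have e4 : s ^ 4 = t ^ 4 / (m * m) := by
      rw [hs, div_pow]
      congr 1
      calc √m ^ 4 = (√m * √m) * (√m * √m) := by ring
        _ = m * m := by rw [hss]
    rw [e3, e4]
    field_simp

/-- The characteristic functions of standardized averages of functions fitted on the first
observations. -/
theorem IsSample.tendsto_integral_cexp_fit (hS : S.IsSample Pr O)
    {h : ℕ → (ℕ → Obs 𝒲) → Obs 𝒲 → ℝ} {l : ℕ → ℕ} {K : ℕ → (ℕ → Obs 𝒲) → ℝ}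
    (hm : ∀ n, Measurable (Function.uncurry (h n))) (hd : ∀ n, DependsOnFirst (l n) (h n))
    (hln : ∀ᶠ n in atTop, l n < n) (hlt : Tendsto (fun n : ℕ => (n : ℝ) - l n) atTop atTop)
    (hh : ∀ᶠ x : ℕ × Ω in whp Pr, (∀ᵐ y ∂S.P₀, |h x.1 (O · x.2) y| ≤ K x.1 (O · x.2)) ∧
      ∫ y, h x.1 (O · x.2) y ∂S.P₀ = 0 ∧ ∫ y, h x.1 (O · x.2) y ^ 2 ∂S.P₀ = 1)
    (hK : Tendsto (fun x : ℕ × Ω => K x.1 (O · x.2) / √((x.1 : ℝ) - l x.1)) (whp Pr) (𝓝 0))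
    (t : ℝ) :
    Tendsto (fun n : ℕ => ∫ ω, Complex.exp (t * (√((n : ℝ) - l n) *
      empMean (l n) n (O · ω) (h n (O · ω)) : ℝ) * Complex.I) ∂Pr) atTop
      (𝓝 ((Real.exp (-(t ^ 2 / 2)) : ℝ) : ℂ)) := by
  have hO : Measurable fun ω => (O · ω) := measurable_pi_lambda _ hS.meas
  set G : ℕ → (ℕ → Obs 𝒲) → (ℕ → Obs 𝒲) → ℂ := fun n a b =>
    Complex.exp (t * (√((n : ℝ) - l n) * empMean (l n) n b (h n a) : ℝ) * Complex.I) with hGdef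
  have hG : ∀ n, Measurable (Function.uncurry (G n)) := fun n =>
    (((Complex.measurable_ofReal.comp ((measurable_empMean_param (l n) n (hm n)).const_mul
      _)).const_mul (t : ℂ)).mul_const _).cexp
  have hGn : ∀ n a b, ‖G n a b‖ ≤ 1 := by
    intro n a b
    simp only [hGdef]
    rw [← Complex.ofReal_mul, Complex.norm_exp_ofReal_mul_I]
  have hGs : ∀ n, SplitsAt (l n) n (G n) := by
    intro n a a' b b' h1 h2
    simp only [hGdef]
    rw [hd n a a' h1, empMean_congr h2]
  set e : ℂ := ((Real.exp (-(t ^ 2 / 2)) : ℝ) : ℂ)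
  have he : ‖e‖ ≤ 1 := by
    rw [Complex.norm_real, Real.norm_eq_abs, abs_of_pos (Real.exp_pos _)]
    exact Real.exp_le_one_iff.2 (by have := sq_nonneg t; linarith)
  set φ : ℕ → Ω → ℂ := fun n ω => ∫ ω', G n (O · ω) (O · ω') ∂Pr
  have hφm : ∀ n, StronglyMeasurable (φ n) := fun n =>
    ((hG n).comp ((hO.comp measurable_fst).prodMk
      (hO.comp measurable_snd))).stronglyMeasurable.integral_prod_right'
  have hφn : ∀ n ω, ‖φ n ω‖ ≤ 1 := fun n ω =>
    (norm_integral_le_of_norm_le_const (ae_of_all _ fun _ => hGn _ _ _)).trans (by simp)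
  -- The conditional characteristic function converges in probability to a constant and is bounded,
  -- so its mean converges as well.
  have key : Tendsto (fun n => ∫ ω, (φ n ω - e) ∂Pr) atTop (𝓝 0) := by
    refine tendsto_integral_of_whp (C := 2)
      (fun n => ((hφm n).sub stronglyMeasurable_const).aestronglyMeasurable)
      (fun n ω => (norm_sub_le _ _).trans (by linarith [hφn n ω])) ?_
    have hlim := (hK.const_mul (4 * |t| ^ 3)).add ((tendsto_inv_atTop_zero.comp
      (hlt.comp (tendsto_fst_whp (Pr := Pr)))).const_mul (t ^ 4 / 4))
    rw [mul_zero, mul_zero, add_zero] at hlim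
    refine squeeze_zero_norm' ?_ hlim
    filter_upwards [hh, tendsto_fst_whp.eventually hln] with x h1 h2
    exact hS.norm_integral_cexp_empMean_sub_le ((hm x.1).comp measurable_prodMk_left) h1.1 h1.2.1
      h1.2.2 h2 t
  have key2 := key.add_const e
  rw [zero_add] at key2
  refine key2.congr fun n => ?_
  have hi : Integrable (φ n) Pr :=
    Integrable.of_bound (hφm n).aestronglyMeasurable 1 (ae_of_all _ (hφn n))
  rw [integral_sub hi (integrable_const e)]
  simp only [integral_const, probReal_univ, one_smul, sub_add_cancel]
  exact (integral_splitsAt hS.meas hS.indep (hG n) (hGs n) (hGn n)).symm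

/-- A central limit theorem for averages of functions fitted on the first observations. -/
theorem IsSample.tendstoInDistribution_fit (hS : S.IsSample Pr O)
    {h : ℕ → (ℕ → Obs 𝒲) → Obs 𝒲 → ℝ} {l : ℕ → ℕ} {K : ℕ → (ℕ → Obs 𝒲) → ℝ}
    (hm : ∀ n, Measurable (Function.uncurry (h n))) (hd : ∀ n, DependsOnFirst (l n) (h n))
    (hln : ∀ᶠ n in atTop, l n < n) (hlt : Tendsto (fun n : ℕ => (n : ℝ) - l n) atTop atTop)
    (hh : ∀ᶠ x : ℕ × Ω in whp Pr, (∀ᵐ y ∂S.P₀, |h x.1 (O · x.2) y| ≤ K x.1 (O · x.2)) ∧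
      ∫ y, h x.1 (O · x.2) y ∂S.P₀ = 0 ∧ ∫ y, h x.1 (O · x.2) y ^ 2 ∂S.P₀ = 1)
    (hK : Tendsto (fun x : ℕ × Ω => K x.1 (O · x.2) / √((x.1 : ℝ) - l x.1)) (whp Pr) (𝓝 0)) :
    TendstoInDistribution (fun (n : ℕ) ω => √((n : ℝ) - l n) *
      empMean (l n) n (O · ω) (h n (O · ω))) atTop (id : ℝ → ℝ) (fun _ => Pr)
      (gaussianReal 0 1) where
  forall_aemeasurable n := (((measurable_empMean_fit (l n) n (hm n)).comp
    (measurable_pi_lambda _ hS.meas)).const_mul _).aemeasurable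
  aemeasurable_limit := aemeasurable_id
  tendsto := by
    refine ProbabilityMeasure.tendsto_iff_tendsto_charFun.2 fun t => ?_
    have key := hS.tendsto_integral_cexp_fit hm hd hln hlt hh hK t
    have e : charFun ((gaussianReal 0 1).map id) t = ((Real.exp (-(t ^ 2 / 2)) : ℝ) : ℂ) := by
      rw [Measure.map_id, charFun_gaussianReal]
      push_cast
      congr 1
      simp
    simp only [ProbabilityMeasure.coe_mk]
    rw [e]
    refine key.congr fun n => ?_
    have hmn : Measurable fun ω => √((n : ℝ) - l n) * empMean (l n) n (O · ω) (h n (O · ω)) := ((measurable_empMean_fit (l n) n (hm n)).comp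
      (measurable_pi_lambda _ hS.meas)).const_mul √((n : ℝ) - l n)
    rw [charFun_apply_real, integral_map hmn.aemeasurable]
    exact (((Complex.measurable_ofReal.const_mul (t : ℂ)).mul_const
        _).cexp).aestronglyMeasurable

end Setting


namespace Setting

variable {𝒲 : Type*} [MeasurableSpace 𝒲] (S : Setting 𝒲) {Ω : Type*} [MeasurableSpace Ω]
  {Pr : Measure Ω} {O : ℕ → Ω → Obs 𝒲} {p₁ p₂ c C β r ε : ℝ} {d₁ d₂ d₃ : ℕ → ℝ}

/-! ### The standardized average behind the final estimator -/

/-- The standardized average of the centred gradient over the last part of the sample. -/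
noncomputable def stdMean (p₂ : ℝ) (n : ℕ) (o : ℕ → Obs 𝒲) (δ : ℝ) : ℝ :=
  √(lastSize p₂ n) * empMean (cut p₂ n) n o
    (fun y => (S.sdGrad (S.fitQ (cut p₂ n) o) δ)⁻¹ * S.center (S.fitQ (cut p₂ n) o) δ y)

/-- Writes the error as standard error times (standardized noise plus relative bias), the form used
both for asymptotic normality and for coverage. -/
theorem estimator_sub_target {n : ℕ} (hn : cut p₂ n < n) (o : ℕ → Obs 𝒲) {δ : ℝ}
    (hV : 0 < S.sdGrad (S.fitQ (cut p₂ n) o) δ) :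
    S.estimator p₂ n o δ - S.target = S.sdGrad (S.fitQ (cut p₂ n) o) δ / √(lastSize p₂ n) *
      (S.stdMean p₂ n o δ +
        √(lastSize p₂ n) * S.bias δ / S.sdGrad (S.fitQ (cut p₂ n) o) δ) := by
  have hm : 0 < √(lastSize p₂ n) := by
    rw [Real.sqrt_pos, lastSize, sub_pos]
    exact_mod_cast hn
  rw [estimator, S.oneStep_eq hn, stdMean, empMean_const_mul, Setting.bias]
  field_simp
  ring

variable {S}

theorem measurable_stdIntegrand (l : ℕ) {D : (ℕ → Obs 𝒲) → ℝ} (hD : Measurable D) :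
    Measurable (Function.uncurry fun (o : ℕ → Obs 𝒲) (y : Obs 𝒲) =>
      (S.sdGrad (S.fitQ l o) (D o))⁻¹ * S.center (S.fitQ l o) (D o) y) :=
  ((S.measurable_varGrad_fit l hD).sqrt.inv.comp measurable_fst).mul (S.measurable_center_fit l hD)

theorem integral_stdIntegrand_sq {Q : 𝒲 → ℝ → ℝ} {δ : ℝ} (hV : 0 < S.varGrad Q δ) :
    ∫ y, ((S.sdGrad Q δ)⁻¹ * S.center Q δ y) ^ 2 ∂S.P₀ = 1 := by
  simp only [mul_pow]
  rw [integral_const_mul, inv_pow, sdGrad, Real.sq_sqrt hV.le]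
  exact inv_mul_cancel₀ hV.ne'

theorem Regular.tendsto_lastSize (H : S.Regular Pr O p₁ p₂ c C β) :
    Tendsto (fun x : ℕ × Ω => lastSize p₂ x.1) (whp Pr) atTop :=
  (DoseResponse.tendsto_lastSize H.p₂_pos H.p₂_lt).comp tendsto_fst_whp

theorem Regular.eventually_last (H : S.Regular Pr O p₁ p₂ c C β) :
    ∀ᶠ n in atTop, cut p₂ n < n := eventually_cut_lt H.p₂_pos H.p₂_lt

variable {D : ℕ → (ℕ → Obs 𝒲) → ℝ}

theorem Regular.eventually_varGrad_pos (H : S.Regular Pr O p₁ p₂ c C β)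
    (hD : Tendsto (fun x : ℕ × Ω => D x.1 (O · x.2)) (whp Pr) (𝓝[>] 0)) :
    ∀ᶠ x : ℕ × Ω in whp Pr,
      0 < S.varGrad (S.fitQ (cut p₂ x.1) (O · x.2)) (D x.1 (O · x.2)) :=
  (H.tendsto_nearLim H.p₂_pos hD).eventually (H.pos.eventually_varGrad_pos H.cont H.nondeg)

theorem Regular.tendsto_mul_varGrad (H : S.Regular Pr O p₁ p₂ c C β)
    (hD : Tendsto (fun x : ℕ × Ω => D x.1 (O · x.2)) (whp Pr) (𝓝[>] 0)) :
    Tendsto (fun x : ℕ × Ω => √(D x.1 (O · x.2)) *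
      S.sdGrad (S.fitQ (cut p₂ x.1) (O · x.2)) (D x.1 (O · x.2))) (whp Pr) (𝓝 √(S.varLim c)) := by
  have key := (H.pos.tendsto_sdGrad H.cont).comp (H.tendsto_nearLim H.p₂_pos hD)
  exact key

variable [IsProbabilityMeasure Pr]

/-- The standardized gradient is bounded by a multiple of `1 / (σ δ)`, of order `δ ^ (-1/2)`.
Divided by `√m` this is `(δ m) ^ (-1/2)`, so `hDl` is the Lyapunov-type condition of the central
limit theorem. -/
theorem Regular.tendsto_stdMean (H : S.Regular Pr O p₁ p₂ c C β) (hDm : ∀ n, Measurable (D n))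
    (hDd : ∀ n, DependsOnFirst (cut p₂ n) (D n))
    (hD : Tendsto (fun x : ℕ × Ω => D x.1 (O · x.2)) (whp Pr) (𝓝[>] 0))
    (hDl : Tendsto (fun x : ℕ × Ω => D x.1 (O · x.2) * lastSize p₂ x.1) (whp Pr) atTop) :
    TendstoInDistribution (fun n ω => S.stdMean p₂ n (O · ω) (D n (O · ω))) atTop (id : ℝ → ℝ)
      (fun _ => Pr) (gaussianReal 0 1) := by
  have hsd := Real.sqrt_pos.2 (S.varLim_pos H.nondeg H.pos.1)
  set h : ℕ → (ℕ → Obs 𝒲) → Obs 𝒲 → ℝ := fun n o y =>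
    (S.sdGrad (S.fitQ (cut p₂ n) o) (D n o))⁻¹ * S.center (S.fitQ (cut p₂ n) o) (D n o) y with hh
  set K : ℕ → (ℕ → Obs 𝒲) → ℝ := fun n o =>
    (S.sdGrad (S.fitQ (cut p₂ n) o) (D n o))⁻¹ * (S.gradConst c * (D n o)⁻¹) with hKdef
  have hdep : ∀ n, DependsOnFirst (cut p₂ n) (h n) := by
    intro n o o' e
    simp only [hh, S.fitQ_dependsOnFirst _ o o' e, hDd n o o' e]
  have hpos : ∀ᶠ x : ℕ × Ω in whp Pr, 0 < D x.1 (O · x.2) ∧ D x.1 (O · x.2) ≤ 1 :=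
    (hD.eventually self_mem_nhdsWithin).and
      ((hD.mono_right nhdsWithin_le_nhds).eventually (Iic_mem_nhds one_pos))
  have hK : Tendsto (fun x : ℕ × Ω => K x.1 (O · x.2) / √((x.1 : ℝ) - cut p₂ x.1)) (whp Pr)
      (𝓝 0) := by
    have h1 := (((H.tendsto_mul_varGrad hD).inv₀ hsd.ne').mul
      (tendsto_inv_atTop_zero.comp (Real.tendsto_sqrt_atTop.comp hDl))).const_mul (S.gradConst c)
    rw [mul_zero, mul_zero] at h1
    refine h1.congr' ?_
    filter_upwards [hpos] with x hx
    simp only [Function.comp_apply, hKdef]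
    rw [Real.sqrt_mul hx.1.le, lastSize]
    have e : (D x.1 (O · x.2))⁻¹ = (√(D x.1 (O · x.2)))⁻¹ * (√(D x.1 (O · x.2)))⁻¹ := by
      rw [← mul_inv, Real.mul_self_sqrt hx.1.le]
    rw [e, div_eq_mul_inv, mul_inv, mul_inv]
    ring
  have key := H.sample.tendstoInDistribution_fit (h := h) (l := cut p₂) (K := K)
    (fun n => measurable_stdIntegrand (cut p₂ n) (hDm n)) hdep H.eventually_last
    (DoseResponse.tendsto_lastSize H.p₂_pos H.p₂_lt) ?_ hK
  · exact key
  · filter_upwards [hpos, H.eventually_varGrad_pos hD] with x hx hV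
    have hQ := S.isRegression_fitQ (cut p₂ x.1) (O · x.2)
    have hs : 0 < S.sdGrad (S.fitQ (cut p₂ x.1) (O · x.2)) (D x.1 (O · x.2)) := Real.sqrt_pos.2 hV
    refine ⟨?_, ?_, integral_stdIntegrand_sq hV⟩
    · filter_upwards [H.pos.center_le hQ hx.1 hx.2] with y hy
      rw [abs_mul, abs_of_pos (inv_pos.2 hs)]
      exact mul_le_mul_of_nonneg_left hy (inv_pos.2 hs).le
    · simp only [hh]
      rw [integral_const_mul, (S.integral_center hQ _).2, mul_zero]

theorem Regular.tendsto_mul_stdMean (H : S.Regular Pr O p₁ p₂ c C β) (hDm : ∀ n, Measurable (D n))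
    (hDd : ∀ n, DependsOnFirst (cut p₂ n) (D n))
    (hD : Tendsto (fun x : ℕ × Ω => D x.1 (O · x.2)) (whp Pr) (𝓝[>] 0)) {a : ℕ → ℝ}
    (ha : Tendsto a atTop (𝓝 0)) :
    Tendsto (fun x : ℕ × Ω => a x.1 * S.stdMean p₂ x.1 (O · x.2) (D x.1 (O · x.2))) (whp Pr)
      (𝓝 0) := by
  classical
  -- Cutting off degenerate samples gives a function that is centred with controlled second moment
  -- for every data sequence, as Chebyshev's inequality requires; the cut-off is inactive with high
  -- probability.
  set f : ℕ → (ℕ → Obs 𝒲) → Obs 𝒲 → ℝ := fun n o y =>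
    if 0 < D n o ∧ 0 < S.varGrad (S.fitQ (cut p₂ n) o) (D n o) then a n * (√(lastSize p₂ n) *
      ((S.sdGrad (S.fitQ (cut p₂ n) o) (D n o))⁻¹ * S.center (S.fitQ (cut p₂ n) o) (D n o) y))
    else 0 with hf
  have hfm : ∀ n, Measurable (Function.uncurry (f n)) := by
    intro n
    have hs : MeasurableSet {x : (ℕ → Obs 𝒲) × Obs 𝒲 |
        0 < D n x.1 ∧ 0 < S.varGrad (S.fitQ (cut p₂ n) x.1) (D n x.1)} :=
      (measurableSet_lt measurable_const ((hDm n).comp measurable_fst)).inter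
        (measurableSet_lt measurable_const
          ((S.measurable_varGrad_fit (cut p₂ n) (hDm n)).comp measurable_fst))
    exact Measurable.ite hs (((measurable_stdIntegrand (cut p₂ n) (hDm n)).const_mul _).const_mul _)
      measurable_const
  have hfd : ∀ n, DependsOnFirst (cut p₂ n) (f n) := by
    intro n o o' e
    simp only [hf, S.fitQ_dependsOnFirst _ o o' e, hDd n o o' e]
  have key := H.sample.tendsto_empMean_fit (f := f) (l := cut p₂) (k := fun n => n)
    (v := fun n => a n ^ 2) hfm hfd H.eventually_last ?_ (by simpa using ha.pow 2)
  · refine key.congr' ?_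
    filter_upwards [H.eventually_varGrad_pos hD, hD.eventually self_mem_nhdsWithin] with x h1 h2
    have h2' : 0 < D x.1 (O · x.2) := h2
    simp only [hf, h1, h2', and_self, if_true]
    rw [empMean_const_mul, empMean_const_mul, stdMean]
  · filter_upwards [H.eventually_last] with n hn o
    have hm : 0 < lastSize p₂ n := by
      rw [lastSize, sub_pos]
      exact_mod_cast hn
    have hQ := S.isRegression_fitQ (cut p₂ n) o
    by_cases h : 0 < D n o ∧ 0 < S.varGrad (S.fitQ (cut p₂ n) o) (D n o)
    · simp only [hf, h, and_self, if_true]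
      refine ⟨(((H.pos.memLp_center hQ h.1 2).const_mul _).const_mul _).const_mul _, ?_, ?_⟩
      · simp only [integral_const_mul, (S.integral_center hQ _).2, mul_zero]
      · have e : ∀ y, (a n * (√(lastSize p₂ n) * ((S.sdGrad (S.fitQ (cut p₂ n) o) (D n o))⁻¹ *
            S.center (S.fitQ (cut p₂ n) o) (D n o) y))) ^ 2 = a n ^ 2 * lastSize p₂ n *
            ((S.sdGrad (S.fitQ (cut p₂ n) o) (D n o))⁻¹ *
              S.center (S.fitQ (cut p₂ n) o) (D n o) y) ^ 2 := by
          intro y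
          rw [mul_pow, mul_pow (√_), Real.sq_sqrt hm.le, mul_assoc]
        simp only [e]
        rw [integral_const_mul, integral_stdIntegrand_sq h.2]
        change a n ^ 2 * lastSize p₂ n * 1 / lastSize p₂ n ≤ _
        rw [mul_one, mul_div_cancel_right₀ _ hm.ne']
    · simp only [hf, h, if_false]
      exact ⟨MemLp.zero, by simp, by simp [sq_nonneg]⟩

/-! ### The data-driven bandwidths -/

omit [IsProbabilityMeasure Pr] in
theorem Tuned.tendsto_rpow_lastSize (H : S.Tuned Pr O p₁ p₂ c C β r d₁ d₂ d₃)
    (hε : 0 < optRate β + ε) :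
    Tendsto (fun x : ℕ × Ω => lastSize p₂ x.1 ^ (-(optRate β + ε))) (whp Pr) (𝓝[>] 0) :=
  (tendsto_rpow_neg_nhdsGT (DoseResponse.tendsto_lastSize H.p₂_pos H.p₂_lt) hε).comp
    tendsto_fst_whp

theorem Tuned.tendsto_deltaHat_nhdsGT (H : S.Tuned Pr O p₁ p₂ c C β r d₁ d₂ d₃)
    (hε : 0 < optRate β + ε) :
    Tendsto (fun x : ℕ × Ω => S.deltaHat p₁ p₂ d₁ d₂ d₃ ε x.1 (O · x.2)) (whp Pr) (𝓝[>] 0) :=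
  tendsto_nhdsGT_of_div (H.tendsto_rpow_lastSize hε) H.optConst_pos (H.tendsto_deltaHat ε)

/-- The effective sample size grows as `m ^ (1 - optRate β - ε)`; this limits how much
undersmoothing the central limit theorem tolerates. -/
theorem Tuned.tendsto_deltaHat_mul_lastSize (H : S.Tuned Pr O p₁ p₂ c C β r d₁ d₂ d₃)
    (hε : optRate β + ε < 1) :
    Tendsto (fun x : ℕ × Ω => S.deltaHat p₁ p₂ d₁ d₂ d₃ ε x.1 (O · x.2) * lastSize p₂ x.1)
      (whp Pr) atTop := by
  have h1 := (tendsto_rpow_atTop (y := 1 - (optRate β + ε)) (by linarith)).comp H.tendsto_lastSize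
  refine ((H.tendsto_deltaHat ε).pos_mul_atTop H.optConst_pos h1).congr' ?_
  filter_upwards [H.tendsto_lastSize.eventually_gt_atTop 0] with x hx
  have e : lastSize p₂ x.1 ^ (1 - (optRate β + ε)) =
      lastSize p₂ x.1 ^ (-(optRate β + ε)) * lastSize p₂ x.1 := by
    rw [← Real.rpow_add_one hx.ne']
    congr 1
    ring
  have := (Real.rpow_pos_of_pos hx (-(optRate β + ε))).ne'
  simp only [Function.comp_apply]
  rw [e]
  field_simp

/-- Since `optRate β * (2 β + 1) = 1`, the bandwidth to the power `2 β + 1` is of order `m ^ (-1 - ε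
(2 β + 1))`. The quantity `m δ ^ (2 β + 1)` is the order of squared bias over variance. -/
theorem Tuned.tendsto_lastSize_mul_rpow (H : S.Tuned Pr O p₁ p₂ c C β r d₁ d₂ d₃)
    (hε : 0 < optRate β + ε) :
    Tendsto (fun x : ℕ × Ω => lastSize p₂ x.1 *
      S.deltaHat p₁ p₂ d₁ d₂ d₃ ε x.1 (O · x.2) ^ (2 * β + 1) *
        lastSize p₂ x.1 ^ (ε * (2 * β + 1))) (whp Pr) (𝓝 (S.optConst c C β ^ (2 * β + 1))) := by
  have hβ := H.bias.pos
  have h1 := (H.tendsto_deltaHat ε).rpow_const (p := 2 * β + 1) (Or.inl H.optConst_pos.ne')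
  refine h1.congr' ?_
  filter_upwards [H.tendsto_lastSize.eventually_gt_atTop 0,
    (H.tendsto_deltaHat_nhdsGT hε).eventually self_mem_nhdsWithin] with x hx hd
  have hd' : 0 < S.deltaHat p₁ p₂ d₁ d₂ d₃ ε x.1 (O · x.2) := hd
  have e : lastSize p₂ x.1 * lastSize p₂ x.1 ^ (ε * (2 * β + 1)) =
      ((lastSize p₂ x.1 ^ (-(optRate β + ε))) ^ (2 * β + 1))⁻¹ := by
    rw [← Real.rpow_mul hx.le, ← Real.rpow_neg hx.le, ← Real.rpow_one_add' hx.le]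
    · congr 1
      rw [optRate]
      field_simp
    -- The exponent law needs `1 + ε (2 β + 1) ≠ 0`; it equals `(optRate β + ε) (2 β + 1)`, which is
    -- positive by `hε`.
    · have h2 : optRate β * (2 * β + 1) = 1 := by
        rw [optRate]
        field_simp
      have h3 : 0 < (optRate β + ε) * (2 * β + 1) := by positivity
      nlinarith
  rw [Real.div_rpow hd'.le (Real.rpow_nonneg hx.le _), div_eq_mul_inv, ← e]
  ring

theorem Tuned.eventually_abs_log_deltaHat (H : S.Tuned Pr O p₁ p₂ c C β r d₁ d₂ d₃)
    (hε : 0 < optRate β + ε) :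
    ∀ᶠ x : ℕ × Ω in whp Pr, |Real.log (S.deltaHat p₁ p₂ d₁ d₂ d₃ ε x.1 (O · x.2))| ≤
      (optRate β + ε + 1) * Real.log x.1 := by
  have h1 := (((Real.continuousAt_log H.optConst_pos.ne').tendsto.comp
    (H.tendsto_deltaHat ε)).abs).eventually (Iio_mem_nhds (lt_add_one _))
  filter_upwards [H.tendsto_lastSize.eventually_ge_atTop 1, h1,
    (H.tendsto_deltaHat_nhdsGT hε).eventually self_mem_nhdsWithin,
    tendsto_log_whp.eventually_ge_atTop (|Real.log (S.optConst c C β)| + 1)] with x hx h2 hd h3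
  have hd' : 0 < S.deltaHat p₁ p₂ d₁ d₂ d₃ ε x.1 (O · x.2) := hd
  have hx0 : 0 < lastSize p₂ x.1 := by linarith
  have hm : Real.log (lastSize p₂ x.1) ≤ Real.log x.1 := by
    refine Real.log_le_log hx0 ?_
    rw [lastSize]
    linarith [(Nat.cast_nonneg (cut p₂ x.1) : (0 : ℝ) ≤ _)]
  have h4 := Real.log_nonneg hx
  simp only [Function.comp_apply] at h2
  rw [Real.log_div hd'.ne' (Real.rpow_pos_of_pos hx0 _).ne', Real.log_rpow hx0] at h2
  have h5 := abs_sub_abs_le_abs_sub (Real.log (S.deltaHat p₁ p₂ d₁ d₂ d₃ ε x.1 (O · x.2)))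
    (-(optRate β + ε) * Real.log (lastSize p₂ x.1))
  rw [abs_mul (-(optRate β + ε)), abs_neg, abs_of_pos hε, abs_of_nonneg h4] at h5
  have h6 := mul_le_mul_of_nonneg_left hm hε.le
  linarith

/-- The squared bias is of the order of the variance, up to `m ^ (-2 ε (2 β + 1))`. -/
theorem Tuned.tendsto_bias_div_sdGrad (H : S.Tuned Pr O p₁ p₂ c C β r d₁ d₂ d₃)
    (hε : 0 < optRate β + ε) :
    Tendsto (fun x : ℕ × Ω => √(lastSize p₂ x.1) *
      S.bias (S.deltaHat p₁ p₂ d₁ d₂ d₃ ε x.1 (O · x.2)) /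
        S.sdGrad (S.fitQ (cut p₂ x.1) (O · x.2)) (S.deltaHat p₁ p₂ d₁ d₂ d₃ ε x.1 (O · x.2)) *
          √(lastSize p₂ x.1 ^ (ε * (2 * β + 1)))) (whp Pr)
      (𝓝 (√(S.optConst c C β ^ (2 * β + 1)) * (C / β) * (√(S.varLim c))⁻¹)) := by
  have hD := H.tendsto_deltaHat_nhdsGT hε
  have hsd := Real.sqrt_pos.2 H.varLim_pos
  have h1 := (Real.continuous_sqrt.tendsto _).comp (H.tendsto_lastSize_mul_rpow hε)
  have h2 := H.bias.bias.comp hD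
  have h3 := (H.tendsto_mul_varGrad (D := S.deltaHat p₁ p₂ d₁ d₂ d₃ ε) hD).inv₀ hsd.ne'
  refine ((h1.mul h2).mul h3).congr' ?_
  filter_upwards [H.tendsto_lastSize.eventually_gt_atTop 0,
    hD.eventually self_mem_nhdsWithin] with x hx hd
  simp only [Function.comp_apply]
  set δ := S.deltaHat p₁ p₂ d₁ d₂ d₃ ε x.1 (O · x.2)
  have hd' : 0 < δ := hd
  have e : √(δ ^ (2 * β + 1)) = δ ^ β * √δ := by
    rw [Real.sqrt_eq_rpow, Real.sqrt_eq_rpow, ← Real.rpow_mul hd'.le, ← Real.rpow_add hd']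
    congr 1
    ring
  rw [Real.sqrt_mul (by positivity), Real.sqrt_mul hx.le, e, Real.rpow_neg hd'.le, mul_inv]
  have := (Real.rpow_pos_of_pos hd' β).ne'
  have := (Real.sqrt_pos.2 hd').ne'
  field_simp

end Setting


/-! ### Normal quantiles, asymptotic normality and coverage -/

theorem cdf_gaussianReal_zero : cdf (gaussianReal 0 1) 0 = 1 / 2 := by
  have hn : NullSingletonClass (gaussianReal 0 1) := nullSingletonClass_gaussianReal one_ne_zero
  have h1 : (gaussianReal 0 1).real (Set.Iic 0) = (gaussianReal 0 1).real (Set.Ici 0) := by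
    have h := gaussianReal_map_neg (μ := 0) (v := 1)
    rw [neg_zero] at h
    conv_lhs => rw [← h]
    rw [map_measureReal_apply measurable_neg measurableSet_Iic]
    congr 1
    ext x
    simp
  have h2 : (gaussianReal 0 1).real (Set.Ioi 0) = (gaussianReal 0 1).real (Set.Ici 0) :=
    measureReal_congr Ioi_ae_eq_Ici
  have h3 := probReal_compl_eq_one_sub (μ := gaussianReal 0 1) (measurableSet_Iic (a := (0 : ℝ)))
  rw [Set.compl_Iic, h2, ← h1] at h3
  rw [cdf_eq_real]
  linarith

/-- Right continuity at `0`, where the distribution function is `1/2 < p`, gives a point `x > 0`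
below which no candidate lies. The case `p < 1` makes the set of candidates non-empty. -/
theorem normalQuantile_pos {p : ℝ} (h1 : 1 / 2 < p) (h2 : p < 1) : 0 < normalQuantile p := by
  have hc := (cdf (gaussianReal 0 1)).right_continuous 0
  rw [← continuousWithinAt_Ioi_iff_Ici] at hc
  have hlt : cdf (gaussianReal 0 1) 0 < p := by rwa [cdf_gaussianReal_zero]
  obtain ⟨x, hx, hx0⟩ := ((hc.eventually (Iio_mem_nhds hlt)).and self_mem_nhdsWithin).exists
  obtain ⟨y, hy⟩ := ((tendsto_cdf_atTop (gaussianReal 0 1)).eventually (lt_mem_nhds h2)).exists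
  refine lt_of_lt_of_le hx0 (le_csInf ⟨y, hy.le⟩ fun z hz => ?_)
  by_contra hzx
  exact absurd ((monotone_cdf (gaussianReal 0 1)) (not_le.1 hzx).le) (not_le.2 (hx.trans_le hz))

namespace Setting

variable {𝒲 : Type*} [MeasurableSpace 𝒲] {S : Setting 𝒲} {Ω : Type*} [MeasurableSpace Ω]
  {Pr : Measure Ω} {O : ℕ → Ω → Obs 𝒲} {p₁ p₂ c C β r ε : ℝ} {d₁ d₂ d₃ : ℕ → ℝ}
  [IsProbabilityMeasure Pr]

/-- The true scale is `√B δ ^ (-1/2)`. Replacing `1/2` by `γ̂_n` is harmless because `|log δ̂|` is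
`O(log n)` while the error of `γ̂_n` is `o(1 / log n)`. -/
theorem Tuned.tendsto_normalization (H : S.Tuned Pr O p₁ p₂ c C β r d₁ d₂ d₃)
    (hε : 0 < optRate β + ε) :
    Tendsto (fun x : ℕ × Ω => (S.CsdHat p₁ p₂ d₁ d₂ d₃ x.1 (O · x.2))⁻¹ *
      S.deltaHat p₁ p₂ d₁ d₂ d₃ ε x.1 (O · x.2) ^ S.gammaHat p₁ p₂ d₁ d₂ x.1 (O · x.2) *
      S.sdGrad (S.fitQ (cut p₂ x.1) (O · x.2)) (S.deltaHat p₁ p₂ d₁ d₂ d₃ ε x.1 (O · x.2)))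
      (whp Pr) (𝓝 1) := by
  have hD := H.tendsto_deltaHat_nhdsGT hε
  have hsd := Real.sqrt_pos.2 H.varLim_pos
  have hpos : ∀ᶠ x : ℕ × Ω in whp Pr, 0 < S.deltaHat p₁ p₂ d₁ d₂ d₃ ε x.1 (O · x.2) :=
    hD.eventually self_mem_nhdsWithin
  have h1 := tendsto_rpow_one_of_log
    (d := fun x : ℕ × Ω => S.deltaHat p₁ p₂ d₁ d₂ d₃ ε x.1 (O · x.2))
    (N := fun x : ℕ × Ω => Real.log x.1)
    (e := fun x : ℕ × Ω => S.gammaHat p₁ p₂ d₁ d₂ x.1 (O · x.2) - 1 / 2)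
    hpos (H.eventually_abs_log_deltaHat hε) H.tendsto_gammaHat
  have h2 := ((H.tendsto_CsdHat.inv₀ hsd.ne').mul h1).mul
    (H.tendsto_mul_varGrad (D := S.deltaHat p₁ p₂ d₁ d₂ d₃ ε) hD)
  rw [mul_one, inv_mul_cancel₀ hsd.ne'] at h2
  refine h2.congr' ?_
  filter_upwards [hpos] with x hx
  rw [Real.rpow_sub hx, ← Real.sqrt_eq_rpow]
  have := (Real.sqrt_pos.2 hx).ne'
  field_simp

/-- The relative bias vanishes for undersmoothed bandwidths. -/
theorem Tuned.tendsto_bias_div_sdGrad_zero (H : S.Tuned Pr O p₁ p₂ c C β r d₁ d₂ d₃)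
    (hε : 0 < ε) :
    Tendsto (fun x : ℕ × Ω => √(lastSize p₂ x.1) *
      S.bias (S.deltaHat p₁ p₂ d₁ d₂ d₃ ε x.1 (O · x.2)) /
        S.sdGrad (S.fitQ (cut p₂ x.1) (O · x.2)) (S.deltaHat p₁ p₂ d₁ d₂ d₃ ε x.1 (O · x.2)))
      (whp Pr) (𝓝 0) := by
  have hβ := H.bias.pos
  have hρ := optRate_pos hβ
  have h1 := H.tendsto_bias_div_sdGrad (ε := ε) (by linarith)
  have h2 := tendsto_inv_atTop_zero.comp (Real.tendsto_sqrt_atTop.comp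
    ((tendsto_rpow_atTop (y := ε * (2 * β + 1)) (by positivity)).comp H.tendsto_lastSize))
  have h3 := h1.mul h2
  rw [mul_zero] at h3
  refine h3.congr' ?_
  filter_upwards [H.tendsto_lastSize.eventually_gt_atTop 0] with x hx
  have := (Real.sqrt_pos.2 (Real.rpow_pos_of_pos hx (ε * (2 * β + 1)))).ne'
  simp only [Function.comp_apply]
  field_simp

theorem Tuned.eventually_estimator (H : S.Tuned Pr O p₁ p₂ c C β r d₁ d₂ d₃)
    (hε : 0 < optRate β + ε) :
    ∀ᶠ x : ℕ × Ω in whp Pr,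
      0 < S.deltaHat p₁ p₂ d₁ d₂ d₃ ε x.1 (O · x.2) ∧ 0 < lastSize p₂ x.1 ∧
      S.estimator p₂ x.1 (O · x.2) (S.deltaHat p₁ p₂ d₁ d₂ d₃ ε x.1 (O · x.2)) - S.target =
        S.sdGrad (S.fitQ (cut p₂ x.1) (O · x.2)) (S.deltaHat p₁ p₂ d₁ d₂ d₃ ε x.1 (O · x.2)) /
          √(lastSize p₂ x.1) *
        (S.stdMean p₂ x.1 (O · x.2) (S.deltaHat p₁ p₂ d₁ d₂ d₃ ε x.1 (O · x.2)) +
          √(lastSize p₂ x.1) * S.bias (S.deltaHat p₁ p₂ d₁ d₂ d₃ ε x.1 (O · x.2)) /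
            S.sdGrad (S.fitQ (cut p₂ x.1) (O · x.2))
              (S.deltaHat p₁ p₂ d₁ d₂ d₃ ε x.1 (O · x.2))) := by
  have hD := H.tendsto_deltaHat_nhdsGT hε
  filter_upwards [H.tendsto_lastSize.eventually_gt_atTop 0, hD.eventually self_mem_nhdsWithin,
    H.eventually_varGrad_pos (D := S.deltaHat p₁ p₂ d₁ d₂ d₃ ε) hD,
    tendsto_fst_whp.eventually H.eventually_last] with x h1 h2 h3 h4
  exact ⟨h2, h1, S.estimator_sub_target h4 _ (Real.sqrt_pos.2 h3)⟩

/-- Asymptotic normality of the studentized estimator. -/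
theorem Tuned.tendstoInDistribution_studentized (H : S.Tuned Pr O p₁ p₂ c C β r d₁ d₂ d₃)
    (hε : 0 < ε) (hε1 : optRate β + ε < 1) :
    TendstoInDistribution (fun n ω => S.studentized p₁ p₂ d₁ d₂ d₃ ε n (O · ω)) atTop
      (id : ℝ → ℝ) (fun _ => Pr) (gaussianReal 0 1) := by
  have hρ := optRate_pos H.bias.pos
  have hε0 : 0 < optRate β + ε := by linarith
  have hO : Measurable fun ω => (O · ω) := measurable_pi_lambda _ H.sample.meas
  have hDm := S.measurable_deltaHat p₁ p₂ d₁ d₂ d₃ ε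
  have hZ := H.tendsto_stdMean (D := S.deltaHat p₁ p₂ d₁ d₂ d₃ ε) hDm
    (S.deltaHat_dependsOnFirst d₁ d₂ d₃ H.p₁_lt.le ε) (H.tendsto_deltaHat_nhdsGT hε0)
    (H.tendsto_deltaHat_mul_lastSize hε1)
  set Z : ℕ → Ω → ℝ := fun n ω =>
    S.stdMean p₂ n (O · ω) (S.deltaHat p₁ p₂ d₁ d₂ d₃ ε n (O · ω)) with hZdef
  set A : ℕ → Ω → ℝ := fun n ω => (S.CsdHat p₁ p₂ d₁ d₂ d₃ n (O · ω))⁻¹ *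
      S.deltaHat p₁ p₂ d₁ d₂ d₃ ε n (O · ω) ^ S.gammaHat p₁ p₂ d₁ d₂ n (O · ω) *
      S.sdGrad (S.fitQ (cut p₂ n) (O · ω)) (S.deltaHat p₁ p₂ d₁ d₂ d₃ ε n (O · ω)) with hAdef
  have hA : TendstoInMeasure Pr A atTop (fun _ => (1 : ℝ)) :=
    tendstoInMeasure_const_iff.2 (H.tendsto_normalization hε0)
  have hAm : ∀ n, AEMeasurable (A n) Pr := by
    intro n
    have h1 := (((S.measurable_CsdHat p₁ p₂ d₁ d₂ d₃ n).inv).mul ((hDm n).pow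
      (S.measurable_gammaHat p₁ p₂ d₁ d₂ n))).mul
        ((S.measurable_varGrad_fit (cut p₂ n) (hDm n)).sqrt)
    exact (h1.comp hO).aemeasurable
  have hX := hZ.continuous_comp_prodMk_of_tendstoInMeasure_const
    (g := fun x : ℝ × ℝ => x.2 * x.1) (by fun_prop) hA hAm
  have e : (fun x : ℝ => ((id x, (1 : ℝ)).2 * (id x, (1 : ℝ)).1)) = id := by
    ext x
    simp
  rw [e] at hX
  -- Slutsky's theorem has replaced the true scale by the estimated one; what is left is the
  -- relative bias times a factor tending to one.
  refine tendstoInDistribution_of_tendstoInMeasure_sub _ _ hX ?_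
    fun n => ((S.measurable_studentized p₁ p₂ d₁ d₂ d₃ ε n).comp hO).aemeasurable
  refine tendstoInMeasure_const_iff.2 ?_
  have h0 := (H.tendsto_normalization hε0).mul (H.tendsto_bias_div_sdGrad_zero hε)
  rw [mul_zero] at h0
  refine h0.congr' ?_
  filter_upwards [H.eventually_estimator hε0] with x hx
  have hm := (Real.sqrt_pos.2 hx.2.1).ne'
  simp only [Pi.sub_apply, studentized, hx.2.2, ← Real.sqrt_eq_rpow, hAdef, hZdef]
  generalize S.stdMean p₂ x.1 (O · x.2) (S.deltaHat p₁ p₂ d₁ d₂ d₃ ε x.1 (O · x.2)) = z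
  generalize √(lastSize p₂ x.1) * S.bias (S.deltaHat p₁ p₂ d₁ d₂ d₃ ε x.1 (O · x.2)) /
    S.sdGrad (S.fitQ (cut p₂ x.1) (O · x.2)) (S.deltaHat p₁ p₂ d₁ d₂ d₃ ε x.1 (O · x.2)) = b
  field_simp
  ring

/-- The estimation error is negligible with respect to the width of the interval. -/
theorem Tuned.tendsto_error_div_halfWidth (H : S.Tuned Pr O p₁ p₂ c C β r d₁ d₂ d₃)
    (hε : 0 < ε) (α : ℝ) :
    Tendsto (fun x : ℕ × Ω =>
      (S.estimator p₂ x.1 (O · x.2) (S.deltaHat p₁ p₂ d₁ d₂ d₃ 0 x.1 (O · x.2)) - S.target) /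
        S.halfWidth p₁ p₂ d₁ d₂ d₃ α ε x.1 (O · x.2)) (whp Pr) (𝓝 0) := by
  have hβ := H.bias.pos
  have hρ := optRate_pos hβ
  have hρ0 : 0 < optRate β + 0 := by linarith
  have hsd := Real.sqrt_pos.2 H.varLim_pos
  have hD := H.tendsto_deltaHat_nhdsGT hρ0
  have hγ := tendsto_of_sub_mul tendsto_log_whp H.tendsto_gammaHat
  -- With `γ = 1/2`, the `ε` in the exponent widens the interval by a factor of order `m ^ (ε / 2)`
  -- beyond the standard error at `δ̂_{0, n}`.
  have ha : Tendsto (fun n : ℕ => lastSize p₂ n ^ (-(ε / 2))) atTop (𝓝 0) :=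
    (tendsto_rpow_neg_nhdsGT (DoseResponse.tendsto_lastSize H.p₂_pos H.p₂_lt)
      (by positivity)).mono_right nhdsWithin_le_nhds
  have hz := H.tendsto_mul_stdMean (D := S.deltaHat p₁ p₂ d₁ d₂ d₃ 0)
    (S.measurable_deltaHat p₁ p₂ d₁ d₂ d₃ 0)
    (S.deltaHat_dependsOnFirst d₁ d₂ d₃ H.p₁_lt.le 0) hD ha
  have hb := (H.tendsto_bias_div_sdGrad hρ0).mul (ha.comp (tendsto_fst_whp (Pr := Pr)))
  rw [mul_zero] at hb
  have hzb := hz.add hb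
  rw [add_zero] at hzb
  have hlog : ∀ᶠ x : ℕ × Ω in whp Pr, |Real.log (lastSize p₂ x.1)| ≤ 1 * Real.log x.1 := by
    filter_upwards [H.tendsto_lastSize.eventually_ge_atTop 1] with x hx
    rw [abs_of_nonneg (Real.log_nonneg hx), one_mul]
    refine Real.log_le_log (by linarith) ?_
    rw [lastSize]
    linarith [(Nat.cast_nonneg (cut p₂ x.1) : (0 : ℝ) ≤ _)]
  -- The estimated exponent differs from `(optRate β + ε) / 2` by `(r̂_n - optRate β) γ̂_n +
  -- (optRate β + ε)(γ̂_n - 1/2)`, again `o(1 / log n)`.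
  have he := ((H.tendsto_rHat.mul hγ).add (H.tendsto_gammaHat.const_mul (optRate β + ε))).neg
  rw [zero_mul, mul_zero, add_zero, neg_zero] at he
  have hm := tendsto_rpow_one_of_log (d := fun x : ℕ × Ω => lastSize p₂ x.1)
    (N := fun x : ℕ × Ω => Real.log x.1)
    (e := fun x : ℕ × Ω => optRate β / 2 + ε / 2 - (S.rHat p₁ p₂ d₁ d₂ x.1 (O · x.2) + ε) *
      S.gammaHat p₁ p₂ d₁ d₂ x.1 (O · x.2))
    (H.tendsto_lastSize.eventually_gt_atTop 0) hlog (he.congr fun x => by ring)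
  have hk := ((Real.continuous_sqrt.tendsto _).comp (H.tendsto_deltaHat 0)).inv₀
    (Real.sqrt_pos.2 H.optConst_pos).ne'
  have h := (((((H.tendsto_CsdHat.inv₀ hsd.ne').mul
    (H.tendsto_mul_varGrad (D := S.deltaHat p₁ p₂ d₁ d₂ d₃ 0) hD)).mul hk).mul hm).mul
      hzb).const_mul (normalQuantile (1 - α / 2))⁻¹
  rw [mul_zero, mul_zero] at h
  refine h.congr' ?_
  filter_upwards [H.eventually_estimator hρ0] with x hx
  obtain ⟨h1, h2, h3⟩ := hx
  rw [h3, halfWidth]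
  simp only [Function.comp_apply, zero_mul, Real.rpow_zero, Real.sqrt_one, mul_one, add_zero]
  generalize √(lastSize p₂ x.1) * S.bias (S.deltaHat p₁ p₂ d₁ d₂ d₃ 0 x.1 (O · x.2)) /
    S.sdGrad (S.fitQ (cut p₂ x.1) (O · x.2)) (S.deltaHat p₁ p₂ d₁ d₂ d₃ 0 x.1 (O · x.2)) = b
  generalize S.stdMean p₂ x.1 (O · x.2) (S.deltaHat p₁ p₂ d₁ d₂ d₃ 0 x.1 (O · x.2)) = z
  generalize S.sdGrad (S.fitQ (cut p₂ x.1) (O · x.2))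
    (S.deltaHat p₁ p₂ d₁ d₂ d₃ 0 x.1 (O · x.2)) = s
  generalize S.deltaHat p₁ p₂ d₁ d₂ d₃ 0 x.1 (O · x.2) = δ at h1
  generalize S.rHat p₁ p₂ d₁ d₂ x.1 (O · x.2) = ρ'
  generalize S.gammaHat p₁ p₂ d₁ d₂ x.1 (O · x.2) = γ'
  generalize lastSize p₂ x.1 = m at h2
  have hδ := (Real.sqrt_pos.2 h1).ne'
  have hsm := (Real.sqrt_pos.2 h2).ne'
  have hr := (Real.rpow_pos_of_pos h2 ((ρ' + ε) * γ')).ne'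
  have hr2 := (Real.rpow_pos_of_pos h2 (optRate β / 2)).ne'
  have hr3 := (Real.rpow_pos_of_pos h2 (ε / 2)).ne'
  have e1 : √(δ / m ^ (-optRate β)) = √δ * m ^ (optRate β / 2) := by
    rw [Real.rpow_neg h2.le, div_inv_eq_mul, Real.sqrt_mul h1.le, Real.sqrt_eq_rpow (m ^ _),
      ← Real.rpow_mul h2.le]
    congr 2
    ring
  rw [e1, Real.rpow_sub h2, Real.rpow_add h2, Real.rpow_sub h2, ← Real.sqrt_eq_rpow,
    Real.rpow_neg h2.le]
  field_simp

theorem Tuned.tendsto_coverage (H : S.Tuned Pr O p₁ p₂ c C β r d₁ d₂ d₃) {α : ℝ}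
    (hα : α ∈ Set.Ioo (0 : ℝ) 1) (hε : 0 < ε) :
    Tendsto (fun n => Pr {ω | S.target ∈ S.CI' p₁ p₂ d₁ d₂ d₃ α ε n (O · ω)}) atTop (𝓝 1) := by
  have hq : 0 < normalQuantile (1 - α / 2) :=
    normalQuantile_pos (by linarith [hα.2]) (by linarith [hα.1])
  have hsd := Real.sqrt_pos.2 H.varLim_pos
  have hev : ∀ᶠ x : ℕ × Ω in whp Pr, S.target ∈ S.CI' p₁ p₂ d₁ d₂ d₃ α ε x.1 (O · x.2) := by
    filter_upwards [H.tendsto_CsdHat.eventually (lt_mem_nhds hsd),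
      H.tendsto_lastSize.eventually_gt_atTop 0,
      (H.tendsto_error_div_halfWidth hε α).abs.eventually
        (Iio_mem_nhds (abs_zero.trans_lt one_pos))] with x h1 h2 h3
    have hw : 0 < S.halfWidth p₁ p₂ d₁ d₂ d₃ α ε x.1 (O · x.2) :=
      mul_pos hq (div_pos h1 (Real.rpow_pos_of_pos h2 _))
    rw [abs_div, abs_of_pos hw, div_lt_one hw, abs_lt] at h3
    exact ⟨by linarith [h3.2], by linarith [h3.1]⟩
  have h1 := ENNReal.Tendsto.sub (tendsto_const_nhds (x := (1 : ℝ≥0∞))) (eventually_whp.1 hev)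
    (Or.inl ENNReal.one_ne_top)
  rw [tsub_zero] at h1
  refine tendsto_of_tendsto_of_tendsto_of_le_of_le h1 tendsto_const_nhds (fun n => ?_)
    fun n => prob_le_one
  rw [tsub_le_iff_right, ← measure_univ (μ := Pr)]
  refine (measure_mono ?_).trans (measure_union_le _ _)
  intro ω _
  exact em _

end Setting


/-! ### Minimization of risks of the form `A δ ^ (2 β) + B / (δ m)` -/

/-- The leading term of the risk. -/
noncomputable def riskApprox (A B β m δ : ℝ) : ℝ := A * δ ^ (2 * β) + B / (δ * m)

theorem riskApprox_pos {A B β m δ : ℝ} (hA : 0 < A) (hB : 0 < B) (hm : 0 < m) (hδ : 0 < δ) :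
    0 < riskApprox A B β m δ := by
  have := Real.rpow_pos_of_pos hδ (2 * β)
  rw [riskApprox]
  positivity

/-- The inequalities `s ^ b ≥ 1 + b log s` and `log s ≥ 1 - 1 / s` add up. Thus `s = 1` is a global
minimum, found without differentiating. -/
theorem one_add_le_rpow_add_div {b s : ℝ} (hb : 0 ≤ b) (hs : 0 < s) : 1 + b ≤ s ^ b + b / s := by
  have h1 : 1 + b * Real.log s ≤ s ^ b := by
    rw [Real.rpow_def_of_pos hs]
    linarith [Real.add_one_le_exp (Real.log s * b)]
  have h2 := mul_le_mul_of_nonneg_left (Real.one_sub_inv_le_log_of_pos hs) hb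
  rw [div_eq_mul_inv]
  linarith

/-- The first-order condition at `d` makes bias and variance terms multiples of the same scale `A d
^ (2 β)`, so only the ratio `δ / d` matters. -/
theorem riskApprox_eq {A B β m d δ : ℝ} (hm : 0 < m) (hd : 0 < d) (hδ : 0 < δ)
    (h : 2 * β * A * d ^ (2 * β + 1) * m = B) :
    riskApprox A B β m δ = A * d ^ (2 * β) * ((δ / d) ^ (2 * β) + 2 * β / (δ / d)) := by
  have h1 := (Real.rpow_pos_of_pos hd (2 * β)).ne'
  rw [riskApprox, ← h, Real.rpow_add_one hd.ne', Real.div_rpow hδ.le hd.le]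
  field_simp

/-- `F n` is a risk with leading term `A δ ^ (2 β) + B / (δ m_n)`, which is minimal at `d n`. -/
structure RiskExpansion (F : ℕ → ℝ → ℝ) (A B β : ℝ) (m d : ℕ → ℝ) : Prop where
  A_pos : 0 < A
  B_pos : 0 < B
  β_pos : 0 < β
  m_pos : ∀ᶠ n in atTop, 0 < m n
  tendsto_d : Tendsto d atTop (𝓝[>] 0)
  stationary : ∀ᶠ n in atTop, 2 * β * A * d n ^ (2 * β + 1) * m n = B
  ratio : Tendsto (fun p : ℕ × ℝ => F p.1 p.2 / riskApprox A B β (m p.1) p.2)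
    (atTop ×ˢ 𝓝[>] 0) (𝓝 1)
  cont : ∀ᶠ n in atTop, ContinuousOn (F n) (Set.Ioo 0 1)

namespace RiskExpansion

variable {F : ℕ → ℝ → ℝ} {A B β : ℝ} {m d : ℕ → ℝ}

theorem d_pos (h : RiskExpansion F A B β m d) : ∀ᶠ n in atTop, 0 < d n :=
  h.tendsto_d.eventually self_mem_nhdsWithin

theorem le_riskApprox (h : RiskExpansion F A B β m d) : ∀ᶠ n in atTop, ∀ δ, 0 < δ →
    riskApprox A B β (m n) (d n) ≤ riskApprox A B β (m n) δ := by
  filter_upwards [h.m_pos, h.d_pos, h.stationary] with n h1 h2 h3 δ hδ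
  rw [riskApprox_eq h1 h2 hδ h3, riskApprox_eq h1 h2 h2 h3, div_self h2.ne', Real.one_rpow, div_one]
  refine mul_le_mul_of_nonneg_left
    (one_add_le_rpow_add_div (by linarith [h.β_pos]) (by positivity)) ?_
  exact mul_nonneg h.A_pos.le (Real.rpow_nonneg h2.le _)

theorem tendsto_ratio_d (h : RiskExpansion F A B β m d) :
    Tendsto (fun n => F n (d n) / riskApprox A B β (m n) (d n)) atTop (𝓝 1) := by
  have key := h.ratio.comp (tendsto_id.prodMk h.tendsto_d)
  exact key

/-- Up to a factor, the risk is its leading term for small bandwidths. -/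
theorem exists_bounds (h : RiskExpansion F A B β m d) : ∃ δ₀ : ℝ, 0 < δ₀ ∧ δ₀ < 1 ∧
    ∀ᶠ n in atTop, ∀ δ, 0 < δ → δ ≤ δ₀ → riskApprox A B β (m n) δ / 2 ≤ F n δ := by
  have h1 := h.ratio.eventually (lt_mem_nhds (by norm_num : (1 / 2 : ℝ) < 1))
  obtain ⟨pa, ha, pb, hb, hp⟩ := eventually_prod_iff.1 h1
  obtain ⟨u, hu, hup⟩ := mem_nhdsGT_iff_exists_Ioc_subset.1 hb
  -- The cap `1 / 2` keeps the range inside `(0, 1)`, where continuity of the risk is available.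
  refine ⟨min u (1 / 2), lt_min hu (by norm_num), (min_le_right _ _).trans_lt (by norm_num), ?_⟩
  filter_upwards [ha, h.m_pos] with n h2 h3 δ hδ hδu
  have h4 := hp h2 (hup ⟨hδ, hδu.trans (min_le_left _ _)⟩)
  have h5 := riskApprox_pos (β := β) h.A_pos h.B_pos h3 hδ
  have h6 := (lt_div_iff₀ h5).1 h4
  linarith

/-- The domain is not compact at zero, but there the variance term exceeds the risk at `d n`. A
minimizer over a compact interval containing `d n` is therefore a global one. -/
theorem exists_isMinOn (h : RiskExpansion F A B β m d) {δ₀ δ₁ : ℝ} (h0 : δ₀ < 1)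
    (hb : ∀ᶠ n in atTop, ∀ δ, 0 < δ → δ ≤ δ₀ → riskApprox A B β (m n) δ / 2 ≤ F n δ)
    (h1 : 0 < δ₁) (h10 : δ₁ ≤ δ₀) :
    ∀ᶠ n in atTop, ∃ δ ∈ Set.Ioc 0 δ₁, IsMinOn (F n) (Set.Ioc 0 δ₁) δ := by
  filter_upwards [hb, h.m_pos, h.d_pos, h.cont,
    (h.tendsto_d.mono_right nhdsWithin_le_nhds).eventually (Iic_mem_nhds h1)] with n k1 k2 k3 k4 k5
  have k5' : d n ≤ δ₁ := k5
  -- Chosen so that half of the variance term at `τ` equals `|F n (d n)| + 1`.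
  set τ : ℝ := B / (2 * m n * (|F n (d n)| + 1)) with hτdef
  have hB := h.B_pos
  have hτ : 0 < τ := by positivity
  have hsmall : ∀ δ, 0 < δ → δ ≤ δ₁ → δ < τ → F n (d n) < F n δ := by
    intro δ hδ hδ1 hδτ
    have e1 := k1 δ hδ (hδ1.trans h10)
    have e2 : B / (δ * m n) ≤ riskApprox A B β (m n) δ := by
      rw [riskApprox]
      linarith [mul_nonneg h.A_pos.le (Real.rpow_nonneg hδ.le (2 * β))]
    have e3 : |F n (d n)| + 1 < B / (δ * m n) / 2 := by
      rw [hτdef, lt_div_iff₀ (by positivity)] at hδτ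
      rw [div_div, lt_div_iff₀ (by positivity)]
      linarith
    linarith [le_abs_self (F n (d n))]
  set τ' := min τ (d n)
  have hτ' : 0 < τ' := lt_min hτ k3
  obtain ⟨δ, hδ, hmin⟩ := (isCompact_Icc (a := τ') (b := δ₁)).exists_isMinOn
    ⟨d n, min_le_right _ _, k5'⟩ (k4.mono fun x hx =>
      ⟨hτ'.trans_le hx.1, (hx.2.trans h10).trans_lt h0⟩)
  refine ⟨δ, ⟨hτ'.trans_le hδ.1, hδ.2⟩, fun x hx => ?_⟩
  rcases le_or_gt τ' x with hx' | hx'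
  · exact hmin ⟨hx', hx.2⟩
  · have hd : F n δ ≤ F n (d n) := hmin ⟨min_le_right _ _, k5'⟩
    rcases lt_min_iff.1 hx' with ⟨hx1, -⟩
    exact hd.trans (hsmall x hx.1 hx.2 hx1).le

theorem tendsto_riskApprox_d (h : RiskExpansion F A B β m d) :
    Tendsto (fun n => riskApprox A B β (m n) (d n)) atTop (𝓝 0) := by
  have hβ := h.β_pos
  have h1 : Tendsto (fun n => d n ^ (2 * β)) atTop (𝓝 0) := by
    have := (h.tendsto_d.mono_right nhdsWithin_le_nhds).rpow_const (p := 2 * β)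
      (Or.inr (by positivity))
    rwa [Real.zero_rpow (by positivity)] at this
  have h2 := (h1.const_mul A).mul_const (1 + 2 * β)
  rw [mul_zero, zero_mul] at h2
  refine h2.congr' ?_
  filter_upwards [h.m_pos, h.d_pos, h.stationary] with n k1 k2 k3
  rw [riskApprox_eq k1 k2 k2 k3, div_self k2.ne', Real.one_rpow, div_one]

/-- The minimal risk is at most the risk at `d n`, which vanishes, while half of the bias term
bounds it from below. So minimizers tend to zero, where the expansion applies to them. -/
theorem tendsto_of_isMinOn (h : RiskExpansion F A B β m d) {δ₀ δ₁ : ℝ}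
    (hb : ∀ᶠ n in atTop, ∀ δ, 0 < δ → δ ≤ δ₀ → riskApprox A B β (m n) δ / 2 ≤ F n δ)
    (h1 : 0 < δ₁) (h10 : δ₁ ≤ δ₀) {δopt : ℕ → ℝ}
    (hopt : ∀ᶠ n in atTop, δopt n ∈ Set.Ioc 0 δ₁ ∧ IsMinOn (F n) (Set.Ioc 0 δ₁) (δopt n)) :
    Tendsto δopt atTop (𝓝[>] 0) := by
  have hβ := h.β_pos
  have hFd : Tendsto (fun n => F n (d n)) atTop (𝓝 0) := by
    have := h.tendsto_ratio_d.mul h.tendsto_riskApprox_d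
    rw [mul_zero] at this
    refine this.congr' ?_
    filter_upwards [h.m_pos, h.d_pos] with n k1 k2
    exact div_mul_cancel₀ _ (riskApprox_pos h.A_pos h.B_pos k1 k2).ne'
  refine tendsto_nhdsWithin_iff.2 ⟨?_, hopt.mono fun n hn => hn.1.1⟩
  rw [Metric.tendsto_nhds]
  intro ε hε
  have hA := h.A_pos
  have hpow := Real.rpow_pos_of_pos hε (2 * β)
  filter_upwards [hopt, hb, h.m_pos, h.d_pos,
    (h.tendsto_d.mono_right nhdsWithin_le_nhds).eventually (Iic_mem_nhds h1),
    hFd.eventually (Iio_mem_nhds (by positivity : 0 < A * ε ^ (2 * β) / 2))]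
    with n k1 k2 k3 k4 k5 k6
  have e1 : F n (δopt n) ≤ F n (d n) := k1.2 ⟨k4, k5⟩
  have e2 := k2 _ k1.1.1 (k1.1.2.trans h10)
  have e3 : A * δopt n ^ (2 * β) ≤ riskApprox A B β (m n) (δopt n) := by
    have := div_pos h.B_pos (mul_pos k1.1.1 k3)
    rw [riskApprox]
    linarith
  have k6' : F n (d n) < A * ε ^ (2 * β) / 2 := k6
  rw [Real.dist_eq, sub_zero, abs_of_pos k1.1.1]
  by_contra hc
  have e4 := Real.rpow_le_rpow hε.le (not_lt.1 hc) (by positivity : 0 ≤ 2 * β)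
  have e5 := mul_le_mul_of_nonneg_left e4 hA.le
  linarith

/-- Bandwidths equivalent to `d` have asymptotically minimal risk. -/
theorem tendsto_ratio (h : RiskExpansion F A B β m d) {δ₀ δ₁ : ℝ}
    (hb : ∀ᶠ n in atTop, ∀ δ, 0 < δ → δ ≤ δ₀ → riskApprox A B β (m n) δ / 2 ≤ F n δ)
    (h1 : 0 < δ₁) (h10 : δ₁ ≤ δ₀) {δopt : ℕ → ℝ}
    (hopt : ∀ᶠ n in atTop, δopt n ∈ Set.Ioc 0 δ₁ ∧ IsMinOn (F n) (Set.Ioc 0 δ₁) (δopt n))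
    {α : Type*} {l : Filter α} {N : α → ℕ} (hN : Tendsto N l atTop) {ξ : α → ℝ}
    (hξ : Tendsto (fun x => ξ x / d (N x)) l (𝓝 1)) :
    Tendsto (fun x => F (N x) (ξ x) / F (N x) (δopt (N x))) l (𝓝 1) := by
  have hβ := h.β_pos
  have hto := h.tendsto_of_isMinOn hb h1 h10 hopt
  have hR : Tendsto (fun n => F n (δopt n) / riskApprox A B β (m n) (δopt n)) atTop (𝓝 1) := by
    have key := h.ratio.comp (tendsto_id.prodMk hto)
    exact key
  -- Squeezed: from above by optimality against `d n`, from below because `d n` minimizes the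
  -- leading term and the expansion holds at the minimizer.
  have hO : Tendsto (fun n => F n (δopt n) / riskApprox A B β (m n) (d n)) atTop (𝓝 1) := by
    refine tendsto_of_tendsto_of_tendsto_of_le_of_le' hR h.tendsto_ratio_d ?_ ?_
    · filter_upwards [hopt, hb, h.m_pos, h.d_pos, h.le_riskApprox] with n k1 k2 k3 k4 k5
      have e1 := riskApprox_pos (β := β) h.A_pos h.B_pos k3 k1.1.1
      have e2 := k2 _ k1.1.1 (k1.1.2.trans h10)
      exact div_le_div_of_nonneg_left (by linarith) (riskApprox_pos h.A_pos h.B_pos k3 k4)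
        (k5 _ k1.1.1)
    · filter_upwards [hopt, h.m_pos, h.d_pos,
        (h.tendsto_d.mono_right nhdsWithin_le_nhds).eventually (Iic_mem_nhds h1)] with n k1 k3 k4 k5
      exact div_le_div_of_nonneg_right (k1.2 ⟨k4, k5⟩)
        (riskApprox_pos h.A_pos h.B_pos k3 k4).le
  have hξ0 : Tendsto ξ l (𝓝[>] 0) :=
    tendsto_nhdsGT_of_div (h.tendsto_d.comp hN) one_pos hξ
  have hξR : Tendsto (fun x => F (N x) (ξ x) / riskApprox A B β (m (N x)) (ξ x)) l (𝓝 1) := by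
    have key := h.ratio.comp (hN.prodMk hξ0)
    exact key
  have hφ : Tendsto (fun x => ((ξ x / d (N x)) ^ (2 * β) + 2 * β / (ξ x / d (N x))) / (1 + 2 * β))
      l (𝓝 1) := by
    have := ((hξ.rpow_const (p := 2 * β) (Or.inl one_ne_zero)).add
      ((hξ.inv₀ one_ne_zero).const_mul (2 * β))).div_const (1 + 2 * β)
    rw [Real.one_rpow, inv_one, mul_one, div_self (by positivity)] at this
    exact this
  have hfin := (hξR.mul hφ).div (hO.comp hN) one_ne_zero
  rw [mul_one, div_one] at hfin
  refine hfin.congr' ?_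
  filter_upwards [hN.eventually h.m_pos, hN.eventually h.d_pos, hN.eventually h.stationary,
    hξ0.eventually self_mem_nhdsWithin] with x k1 k2 k3 k4
  have k4' : 0 < ξ x := k4
  have hA := h.A_pos
  have p1 := riskApprox_pos (β := β) h.A_pos h.B_pos k1 k4'
  have p2 := Real.rpow_pos_of_pos k2 (2 * β)
  have p3 : 0 < (ξ x / d (N x)) ^ (2 * β) + 2 * β / (ξ x / d (N x)) := by positivity
  have e1 : riskApprox A B β (m (N x)) (d (N x)) = A * d (N x) ^ (2 * β) * (1 + 2 * β) := by
    rw [riskApprox_eq k1 k2 k2 k3, div_self k2.ne', Real.one_rpow, div_one]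
  simp only [Pi.div_apply, Function.comp_apply]
  rw [e1, riskApprox_eq k1 k2 k4' k3]
  generalize (ξ x / d (N x)) ^ (2 * β) + 2 * β / (ξ x / d (N x)) = φ at p3
  generalize d (N x) ^ (2 * β) = w at p2
  field_simp

end RiskExpansion


namespace Setting

variable {𝒲 : Type*} [MeasurableSpace 𝒲] {S : Setting 𝒲} {Ω : Type*} [MeasurableSpace Ω]
  {Pr : Measure Ω} {O : ℕ → Ω → Obs 𝒲} {p₁ p₂ c C β r : ℝ} {d₁ d₂ d₃ : ℕ → ℝ}

/-! ### The mean squared error -/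

variable (S Pr O) in
/-- The expected variance of the gradient at the regression estimate. -/
noncomputable def meanVar (l : ℕ) (δ : ℝ) : ℝ := ∫ ω, S.varGrad (S.fitQ l (O · ω)) δ ∂Pr

theorem IsSample.measurable_varGrad (hS : S.IsSample Pr O) (l : ℕ) (δ : ℝ) :
    Measurable fun ω => S.varGrad (S.fitQ l (O · ω)) δ :=
  (S.measurable_varGrad_fit l measurable_const).comp (measurable_pi_lambda _ hS.meas)

variable [IsProbabilityMeasure Pr]

theorem IsSample.integrable_varGrad (hS : S.IsSample Pr O) (hc : S.PositivityAt c) (l : ℕ) {δ : ℝ}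
    (hδ : 0 < δ) (hδ1 : δ ≤ 1) : Integrable (fun ω => S.varGrad (S.fitQ l (O · ω)) δ) Pr := by
  refine Integrable.of_bound (hS.measurable_varGrad l δ).aestronglyMeasurable
    (S.varConst c * δ⁻¹) (ae_of_all _ fun ω => ?_)
  rw [Real.norm_eq_abs, abs_of_nonneg (S.varGrad_nonneg _ _)]
  exact hc.varGrad_le (S.isRegression_fitQ l _) hδ hδ1

/-- Given the fit, the average of centred gradients has mean zero, so there is no cross term with
the bias and the identity is exact in finite samples. -/
theorem IsSample.MSE_eq (hS : S.IsSample Pr O) (hc : S.PositivityAt c) {n : ℕ} (hn : cut p₂ n < n)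
    {δ : ℝ} (hδ : 0 < δ) (hδ1 : δ ≤ 1) :
    S.MSE p₂ Pr O n δ = S.meanVar Pr O (cut p₂ n) δ / lastSize p₂ n + S.bias δ ^ 2 := by
  have hO : Measurable fun ω => (O · ω) := measurable_pi_lambda _ hS.meas
  have hm : 0 < lastSize p₂ n := by
    rw [lastSize, sub_pos]
    exact_mod_cast hn
  have hest : Measurable fun ω => S.estimator p₂ n (O · ω) δ - S.target :=
    ((S.measurable_estimator p₂ n (D := fun _ => δ) measurable_const).comp hO).sub_const S.target
  have e : ∀ ω, S.estimator p₂ n (O · ω) δ - S.target =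
      empMean (cut p₂ n) n (O · ω) (S.center (S.fitQ (cut p₂ n) (O · ω)) δ) + S.bias δ := by
    intro ω
    rw [estimator, S.oneStep_eq hn, Setting.bias]
    ring
  have key := hS.lintegral_empMean_fit (f := fun o => S.center (S.fitQ (cut p₂ n) o) δ)
    (l := cut p₂ n) (n := n) (b := fun _ => S.bias δ)
    (S.measurable_center_fit (cut p₂ n) measurable_const)
    (fun o o' h => by simp only [S.fitQ_dependsOnFirst _ o o' h])
    (fun a => hc.memLp_center (S.isRegression_fitQ _ a) hδ 2)
    (fun a => (S.integral_center (S.isRegression_fitQ _ a) δ).2) hn measurable_const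
    fun _ _ _ => rfl
  have hi := (hS.integrable_varGrad hc (cut p₂ n) hδ hδ1).div_const (lastSize p₂ n)
  have h1 : S.MSE p₂ Pr O n δ =
      ∫ ω, (S.varGrad (S.fitQ (cut p₂ n) (O · ω)) δ / lastSize p₂ n + S.bias δ ^ 2) ∂Pr := by
    rw [MSE, integral_eq_lintegral_of_nonneg_ae (ae_of_all _ fun ω => sq_nonneg _)
      (hest.pow_const 2).aestronglyMeasurable, integral_eq_lintegral_of_nonneg_ae
        (ae_of_all _ fun ω => add_nonneg (div_nonneg (S.varGrad_nonneg _ _) hm.le) (sq_nonneg _))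
        (hi.add (integrable_const _)).aestronglyMeasurable]
    congr 1
    simp only [e]
    exact key
  rw [h1, integral_add hi (integrable_const _), integral_div]
  simp [meanVar]

/-- The scaled variances `δ V` are bounded by `varConst`, and closeness of the regression estimate
to `Q̄_∞` is an event not involving `δ`. Bounded convergence is therefore uniform in small
bandwidths, so that a random bandwidth can be inserted into `MSE`. -/
theorem Regular.tendsto_meanVar (H : S.Regular Pr O p₁ p₂ c C β) :
    Tendsto (fun p : ℕ × ℝ => p.2 * S.meanVar Pr O (cut p₂ p.1) p.2) (atTop ×ˢ 𝓝[>] 0)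
      (𝓝 (S.varLim c)) := by
  rw [Metric.tendsto_nhds]
  intro ε hε
  have h1 := (H.pos.tendsto_varGrad H.cont).eventually
    (Metric.closedBall_mem_nhds _ (half_pos hε))
  obtain ⟨pa, ha, pb, hb, hp⟩ := eventually_prod_iff.1 h1
  have hL := S.varLim_pos H.nondeg H.pos.1
  have hV := S.varConst_pos H.pos.1
  set K := S.varConst c + S.varLim c with hK
  have hK0 : 0 < K := by positivity
  have hη : 0 < ε / (4 * K) := by positivity
  have ha' : ∀ᶠ x : ℕ × Ω in whp Pr, pa (S.fitQ (cut p₂ x.1) (O · x.2)) :=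
    (H.rate.tendsto_nearInf H.p₂_pos).eventually ha
  have ha'' := (eventually_whp.1 ha').eventually (Iio_mem_nhds (ENNReal.ofReal_pos.2 hη))
  have hδ : ∀ᶠ δ : ℝ in 𝓝[>] 0, 0 < δ ∧ δ ≤ 1 := by
    filter_upwards [self_mem_nhdsWithin, nhdsWithin_le_nhds (Iic_mem_nhds one_pos)] with δ k1 k2
    exact ⟨k1, k2⟩
  refine (ha''.prod_mk (hb.and hδ)).mono fun p hp' => ?_
  obtain ⟨k1, k2, k3, k4⟩ := hp'
  set V : Ω → ℝ := fun ω => S.varGrad (S.fitQ (cut p₂ p.1) (O · ω)) p.2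
  have hVi : Integrable V Pr := H.sample.integrable_varGrad H.pos _ k3 k4
  have hX : AEStronglyMeasurable (fun ω => p.2 * V ω - S.varLim c) Pr :=
    ((H.sample.measurable_varGrad _ _).const_mul _ |>.sub_const _).aestronglyMeasurable
  have hbd : ∀ ω, ‖p.2 * V ω - S.varLim c‖ ≤ K := by
    intro ω
    refine (norm_sub_le _ _).trans ?_
    rw [Real.norm_eq_abs, Real.norm_eq_abs, abs_of_pos hL,
      abs_of_nonneg (mul_nonneg k3.le (S.varGrad_nonneg _ _)), hK]
    have := mul_le_mul_of_nonneg_left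
      (H.pos.varGrad_le (S.isRegression_fitQ (cut p₂ p.1) (O · ω)) k3 k4) k3.le
    have e : p.2 * (S.varConst c * p.2⁻¹) = S.varConst c := by
      field_simp
    rw [e] at this
    linarith
  have hprob : Pr {ω | ¬ ‖p.2 * V ω - S.varLim c‖ ≤ ε / 2} ≤ ENNReal.ofReal (ε / (4 * K)) := by
    refine (measure_mono ?_).trans k1.le
    intro ω hω h
    exact hω (hp h k2)
  have hfin := norm_integral_le_of_bounded hX hbd hη.le (half_pos hε).le hprob
  rw [integral_sub (hVi.const_mul _) (integrable_const _), integral_const_mul] at hfin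
  simp only [integral_const, probReal_univ, one_smul] at hfin
  rw [Real.dist_eq]
  refine lt_of_le_of_lt hfin ?_
  have : K * (ε / (4 * K)) = ε / 4 := by
    field_simp
  linarith

theorem IsSample.continuousOn_meanVar (hS : S.IsSample Pr O) (hc : S.PositivityAt c) (l : ℕ) :
    ContinuousOn (S.meanVar Pr O l) (Set.Ioo 0 1) := by
  intro δ hδ
  refine ContinuousAt.continuousWithinAt ?_
  have hnhds : ∀ᶠ x in 𝓝 δ, δ / 2 < x ∧ x < 1 := Ioo_mem_nhds (by linarith [hδ.1]) hδ.2
  refine continuousAt_of_dominated (bound := fun _ => S.varConst c * (δ / 2)⁻¹)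
    (Eventually.of_forall fun x => (hS.measurable_varGrad l x).aestronglyMeasurable) ?_
    (integrable_const _) (ae_of_all _ fun ω => ?_)
  · filter_upwards [hnhds] with x hx
    refine ae_of_all _ fun ω => ?_
    have hδ2 : 0 < δ / 2 := half_pos hδ.1
    rw [Real.norm_eq_abs, abs_of_nonneg (S.varGrad_nonneg _ _)]
    refine (hc.varGrad_le (S.isRegression_fitQ l _) (hδ2.trans hx.1) hx.2.le).trans ?_
    exact mul_le_mul_of_nonneg_left (inv_anti₀ hδ2 hx.1.le) (S.varConst_pos hc.1).le
  · have hQ := S.isRegression_fitQ l (O · ω)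
    have h1 := (S.hasDerivAt_varD hQ hc.1 zero_le_one hδ.1).continuousAt
    refine h1.congr ?_
    filter_upwards [Ioi_mem_nhds hδ.1] with x hx
    rw [hc.varGrad_eq hQ hx]

theorem Regular.continuousOn_MSE (H : S.Regular Pr O p₁ p₂ c C β) :
    ∀ᶠ n in atTop, ContinuousOn (S.MSE p₂ Pr O n) (Set.Ioo 0 1) := by
  filter_upwards [H.eventually_last] with n hn
  have hb : ContinuousOn S.bias (Set.Ioo 0 1) := fun δ hδ =>
    (S.hasDerivAt_bias hδ.1).continuousAt.continuousWithinAt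
  have h1 := ((H.sample.continuousOn_meanVar H.pos (cut p₂ n)).div_const (lastSize p₂ n)).add
    (hb.pow 2)
  exact h1.congr fun δ hδ => H.sample.MSE_eq H.pos hn hδ.1 hδ.2.le

/-- Both terms of the leading part are positive, so the relative error of the sum is at most the sum
of the relative errors, whatever the balance between bias and variance. -/
theorem Regular.tendsto_MSE_div (H : S.Regular Pr O p₁ p₂ c C β) :
    Tendsto (fun p : ℕ × ℝ => S.MSE p₂ Pr O p.1 p.2 /
      riskApprox ((C / β) ^ 2) (S.varLim c) β (lastSize p₂ p.1) p.2) (atTop ×ˢ 𝓝[>] 0) (𝓝 1) := by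
  have hL := S.varLim_pos H.nondeg H.pos.1
  have hβ := H.bias.pos
  have hC := H.bias.ne_zero
  have hA : 0 < (C / β) ^ 2 := by positivity
  have h1 : Tendsto (fun p : ℕ × ℝ => (S.bias p.2 * p.2 ^ (-β)) ^ 2 / (C / β) ^ 2 - 1)
      (atTop ×ˢ 𝓝[>] 0) (𝓝 0) := by
    have := (((H.bias.bias.comp
      (tendsto_snd (f := (atTop : Filter ℕ)))).pow 2).div_const ((C / β) ^ 2)).sub_const 1
    rw [div_self hA.ne', sub_self] at this
    exact this
  have h2 : Tendsto (fun p : ℕ × ℝ => p.2 * S.meanVar Pr O (cut p₂ p.1) p.2 / S.varLim c - 1)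
      (atTop ×ˢ 𝓝[>] 0) (𝓝 0) := by
    have := (H.tendsto_meanVar.div_const (S.varLim c)).sub_const 1
    rw [div_self hL.ne', sub_self] at this
    exact this
  have h3 := h1.abs.add h2.abs
  rw [abs_zero, add_zero] at h3
  rw [tendsto_iff_norm_sub_tendsto_zero]
  refine squeeze_zero' (Eventually.of_forall fun _ => norm_nonneg _) ?_ h3
  have hδ : ∀ᶠ δ : ℝ in 𝓝[>] 0, 0 < δ ∧ δ ≤ 1 := by
    filter_upwards [self_mem_nhdsWithin, nhdsWithin_le_nhds (Iic_mem_nhds one_pos)] with δ k1 k2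
    exact ⟨k1, k2⟩
  refine (H.eventually_last.prod_mk hδ).mono fun p hp => ?_
  obtain ⟨k1, k2, k3⟩ := hp
  have hm : 0 < lastSize p₂ p.1 := by
    rw [lastSize, sub_pos]
    exact_mod_cast k1
  rw [H.sample.MSE_eq H.pos k1 k2 k3]
  have hw := Real.rpow_pos_of_pos k2 β
  have e1 : p.2 ^ (2 * β) = p.2 ^ β * p.2 ^ β := by
    rw [← Real.rpow_add k2]
    congr 1
    ring
  rw [riskApprox, e1, Real.rpow_neg k2.le]
  set w := p.2 ^ β
  set u := (C / β) ^ 2 * (w * w) with hu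
  set v := S.varLim c / (p.2 * lastSize p₂ p.1) with hv
  have hu0 : 0 < u := by positivity
  have hv0 : 0 < v := by positivity
  set a := (S.bias p.2 * w⁻¹) ^ 2 / (C / β) ^ 2 - 1 with ha
  set b := p.2 * S.meanVar Pr O (cut p₂ p.1) p.2 / S.varLim c - 1 with hb
  have e2 : S.bias p.2 ^ 2 = (a + 1) * u := by
    rw [ha, hu]
    field_simp
    ring
  have e3 : S.meanVar Pr O (cut p₂ p.1) p.2 / lastSize p₂ p.1 = (b + 1) * v := by
    rw [hb, hv]
    field_simp
    ring
  have e4 : ((b + 1) * v + (a + 1) * u) / (u + v) - 1 = (a * u + b * v) / (u + v) := by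
    field_simp
    ring
  rw [e2, e3, e4, Real.norm_eq_abs, abs_div, abs_of_pos (add_pos hu0 hv0),
    div_le_iff₀ (add_pos hu0 hv0)]
  refine (abs_add_le _ _).trans ?_
  rw [abs_mul a, abs_mul b, abs_of_pos hu0, abs_of_pos hv0]
  nlinarith [mul_nonneg (abs_nonneg a) hv0.le, mul_nonneg (abs_nonneg b) hu0.le]

variable (S) in
/-- The optimal bandwidth. -/
noncomputable def optBandwidth (p₂ c C β : ℝ) (n : ℕ) : ℝ :=
  S.optConst c C β * lastSize p₂ n ^ (-optRate β)

theorem Regular.riskExpansion (H : S.Regular Pr O p₁ p₂ c C β) :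
    RiskExpansion (S.MSE p₂ Pr O) ((C / β) ^ 2) (S.varLim c) β (lastSize p₂)
      (S.optBandwidth p₂ c C β) where
  A_pos := by
    have := H.bias.ne_zero
    have := H.bias.pos
    positivity
  B_pos := S.varLim_pos H.nondeg H.pos.1
  β_pos := H.bias.pos
  m_pos := (DoseResponse.tendsto_lastSize H.p₂_pos H.p₂_lt).eventually_gt_atTop 0
  tendsto_d := by
    refine tendsto_nhdsGT_of_div (tendsto_rpow_neg_nhdsGT
      (DoseResponse.tendsto_lastSize H.p₂_pos H.p₂_lt) (optRate_pos H.bias.pos)) H.optConst_pos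
      (tendsto_const_nhds.congr' ?_)
    filter_upwards [(DoseResponse.tendsto_lastSize H.p₂_pos H.p₂_lt).eventually_gt_atTop 0]
      with n hn
    exact (mul_div_cancel_right₀ _ (Real.rpow_pos_of_pos hn _).ne').symm
  stationary := by
    have hL := S.varLim_pos H.nondeg H.pos.1
    have hβ := H.bias.pos
    have hC := H.bias.ne_zero
    have hk : 0 < S.varLim c / 2 * β / C ^ 2 := by positivity
    filter_upwards [(DoseResponse.tendsto_lastSize H.p₂_pos H.p₂_lt).eventually_gt_atTop 0]
      with n hn
    -- Raising the bandwidth to the power `2 β + 1` undoes `optRate` and leaves `B β / (2 C ^ 2 m)`,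
    -- which solves the first-order condition with `A = (C / β) ^ 2`.
    have hρ : optRate β * (2 * β + 1) = 1 := by
      rw [optRate]
      field_simp
    rw [optBandwidth, Real.mul_rpow H.optConst_pos.le (Real.rpow_nonneg hn.le _), optConst,
      ← Real.rpow_mul hk.le, ← Real.rpow_mul hn.le, neg_mul, hρ, Real.rpow_one, Real.rpow_neg_one]
    field_simp
  ratio := H.tendsto_MSE_div
  cont := H.continuousOn_MSE

theorem Tuned.tendsto_deltaHat_div_optBandwidth (H : S.Tuned Pr O p₁ p₂ c C β r d₁ d₂ d₃) :
    Tendsto (fun x : ℕ × Ω => S.deltaHat p₁ p₂ d₁ d₂ d₃ 0 x.1 (O · x.2) /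
      S.optBandwidth p₂ c C β x.1) (whp Pr) (𝓝 1) := by
  have h := (H.tendsto_deltaHat 0).div_const (S.optConst c C β)
  rw [div_self H.optConst_pos.ne'] at h
  refine h.congr fun x => ?_
  rw [optBandwidth, add_zero, div_div, mul_comm (_ ^ _)]

end Setting

end DoseResponse

/-! ### The main theorem -/

theorem mainTheorem7 {𝒲 : Type*} [MeasurableSpace 𝒲] (S : DoseResponse.Setting 𝒲)
    {Ω : Type*} [MeasurableSpace Ω] (Pr : Measure Ω) [IsProbabilityMeasure Pr]
    (O : ℕ → Ω → DoseResponse.Obs 𝒲) (hO_meas : ∀ i, Measurable (O i))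
    (hO_indep : iIndepFun O Pr) (hO_law : ∀ i, Pr.map (O i) = S.P₀) :
    ∃ Kc : ℝ → ℝ, AntitoneOn Kc (Set.Ioo 0 1) ∧ (∀ p ∈ Set.Ioo (0 : ℝ) 1, 0 < Kc p) ∧
      ∀ p₁ p₂ : ℝ, 0 < p₁ → p₁ < p₂ → p₂ < 1 →
        (S.A3 Pr O p₁ ∧ S.A5 Pr O p₁ p₂ ∧ ∀ r₀ : ℝ, 0 < r₀ → S.A7 Pr O p₂ r₀ ∧ S.A8 Pr O p₂ r₀) ∧
        (S.Positivity → S.ContinuousAtDose → S.NonDegenerate →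
          S.UniformRate Pr O → S.RatioCondition Pr O →
          (S.A2 Pr O p₁ p₂ ∧ S.A4 Pr O p₁ ∧ ∀ r₀ : ℝ, 0 < r₀ → S.A6 Pr O p₂ r₀) ∧
          (S.A1 → ∃ r ε₀ δ₀ : ℝ, 0 < r ∧ 0 < ε₀ ∧ 0 < δ₀ ∧
            ∀ d₁ d₂ d₃ : ℕ → ℝ, DoseResponse.Admissible r d₁ d₂ d₃ →
              -- asymptotic normality
              (∀ ε : ℝ, 0 < ε → ε ≤ ε₀ →
                TendstoInDistribution
                  (fun n ω => S.studentized p₁ p₂ d₁ d₂ d₃ ε n (O · ω)) atTop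
                  (id : ℝ → ℝ) (fun _ => Pr) (gaussianReal 0 1)) ∧
              -- rate optimality in mean squared error
              (∀ δ₁ : ℝ, 0 < δ₁ → δ₁ ≤ δ₀ →
                (∀ᶠ n in atTop, ∃ δ ∈ Set.Ioc 0 δ₁,
                  IsMinOn (S.MSE p₂ Pr O n) (Set.Ioc 0 δ₁) δ) ∧
                ∀ δopt : ℕ → ℝ,
                  (∀ᶠ n in atTop, δopt n ∈ Set.Ioc 0 δ₁ ∧
                    IsMinOn (S.MSE p₂ Pr O n) (Set.Ioc 0 δ₁) (δopt n)) →
                  TendstoInMeasure Pr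
                    (fun n ω => S.MSE p₂ Pr O n (S.deltaHat p₁ p₂ d₁ d₂ d₃ 0 n (O · ω)) /
                      S.MSE p₂ Pr O n (δopt n))
                    atTop (fun _ => Kc p₂)) ∧
              -- coverage of the alternative confidence interval
              (∀ α ε : ℝ, α ∈ Set.Ioo (0 : ℝ) 1 → 0 < ε →
                Tendsto (fun n => Pr {ω | S.target ∈ S.CI' p₁ p₂ d₁ d₂ d₃ α ε n (O · ω)})
                  atTop (𝓝 1))))
    := by
  -- The data-driven bandwidth is equivalent to the minimizer of the leading term of the very risk
  -- it is compared with, so the limiting ratio is one for every split.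
  refine ⟨fun _ => 1, antitoneOn_const, fun _ _ => one_pos, fun p₁ p₂ h1 h12 h2 =>
    ⟨S.remainder_conditions Pr O p₁ p₂, fun hpos hcont hnd hu _ => ?_⟩⟩
  obtain ⟨c, hc⟩ := hpos.exists
  have h20 : 0 < p₂ := h1.trans h12
  refine ⟨⟨hc.condition_A2 hcont hnd hu h1 h12 h2.le, hc.condition_A4 hcont hnd hu h1,
    fun r₀ hr₀ => hc.condition_A6 hcont hnd hu h20 h2 hr₀⟩, fun hA1 => ?_⟩
  obtain ⟨C, β, hb⟩ := hA1.exists_biasRate hcont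
  have hβ := hb.pos
  have H : S.Regular Pr O p₁ p₂ c C β :=
    ⟨⟨hO_meas, hO_indep, hO_law⟩, hc, hcont, hnd, hu, hb, h1, h12, h2⟩
  obtain ⟨δ₀, hδ₀, hδ₀1, hbound⟩ := H.riskExpansion.exists_bounds
  -- This rate meets both demands on the preliminary levels: `r < 1/4` makes `Δ_n` small relative to
  -- them, and `2 β r < 1/2` keeps the noise in the slope of the bias negligible.
  have hr : 1 / (8 * (β + 1)) < (1 : ℝ) / 4 := by
    rw [div_lt_div_iff₀ (by positivity) (by norm_num)]
    linarith
  have hr2 : 1 / (8 * (β + 1)) * (2 * β) < (1 : ℝ) / 2 := by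
    rw [div_mul_eq_mul_div, div_lt_div_iff₀ (by positivity) (by norm_num)]
    linarith
  refine ⟨1 / (8 * (β + 1)), β / (2 * β + 1), δ₀, by positivity, by positivity, hδ₀,
    fun d₁ d₂ d₃ hd => ?_⟩
  have HT : S.Tuned Pr O p₁ p₂ c C β (1 / (8 * (β + 1))) d₁ d₂ d₃ :=
    { toRegular := H, r_lt := hr, r_mul_lt := hr2, levels := hd }
  refine ⟨fun ε hε hε1 => HT.tendstoInDistribution_studentized hε ?_, fun δ₁ h3 h4 =>
    ⟨H.riskExpansion.exists_isMinOn hδ₀1 hbound h3 h4, fun δopt hopt => ?_⟩,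
    fun α ε hα hε => HT.tendsto_coverage hα hε⟩
  -- With `ε₀ = β / (2 β + 1)`, the exponent is at most `(1 + β) / (2 β + 1) < 1`, so the effective
  -- sample size still diverges.
  · refine (add_le_add_right hε1 _).trans_lt ?_
    rw [DoseResponse.optRate, ← add_div, div_lt_one (by positivity)]
    linarith
  · exact DoseResponse.tendstoInMeasure_const_iff.2 (H.riskExpansion.tendsto_ratio hbound h3 h4 hopt
      DoseResponse.tendsto_fst_whp HT.tendsto_deltaHat_div_optBandwidth)
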